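/- **Notation.** $\hat{\mathbb Z}=\prod_p\mathbb Z_p$, $\mathbb Q\otimes\hat{\mathbb Z}$ is the ring of finite adeles of $\mathbb Q$, $X=(\mathbb Q\otimes\hat{\mathbb Z})^2$ (row vectors) and $G=\mathrm{GL}_2(\mathbb Q\otimes\hat{\mathbb Z})$ acts on $X$ on the right. For $x\in(\mathbb Q\otimes\hat{\mathbb Z})^*$, $|x|=\prod_p p^{v_p(x)}$ is the positive rational number with $x\in|x|\,\hat{\mathbb Z}^*$. $\mathbb Q^{\rm cycl}\subset\mathbb C$ is generated by all roots of unity, and $M_k^{\rm cong}(\mathbb Q^{\rm cycl})$ is the space of modular forms of weight $k$ for some congruence subgroup of $\mathrm{SL}_2(\mathbb Z)$ whose $q$-expansion has coefficients in $\mathbb Q^{\rm cycl}$. The group $G$ acts on it on the right by $*$: $g=\left(\begin{smallmatrix}a&b\\c&d\end{smallmatrix}\right)\in\mathrm{GL}_2(\mathbb Q)$ with $\det g>0$ acts by $(f*g)(\tau)=(c\tau+d)^{-k}f\left(\frac{a\tau+b}{c\tau+d}\right)$; $\mathrm{SL}_2(\hat{\mathbb Z})$ acts by extending $|_k$ from $\mathrm{SL}_2(\mathbb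 Z)$ by continuity; $\left(\begin{smallmatrix}1&0\\0&d\end{smallmatrix}\right)$ with $d\in\hat{\mathbb Z}^*$ acts on the coefficients of $q$-expansions by the automorphism $\sigma_d$ with $\sigma_d(\zeta)=\zeta^d$ for all roots of unity $\zeta$. An algebraic distribution on $X$ with values in $V$ is a $\mathbb Z$-linear map $\mu:\mathrm{LC}_c(X,\mathbb Z)\to V$, $\phi\mapsto\int\phi\,\mu$, on locally constant functions with compact support; for $\gamma\in G$ put $(\phi*\gamma)(x)=\phi(x\gamma^{-1})$ and $\int\phi\,(\mu*\gamma)=\bigl(\int(\phi*\gamma^{-1})\,\mu\bigr)*\gamma$. For $k\ge1$, $\tau$ in the upper half plane and $z,u\in\mathbb C$, let $H_k(s,\tau,z,u)$ be the analytic continuation to $s\in\mathbb C$ of $$\frac{\Gamma(s)}{(-2i\pi)^k}\Bigl(\frac{\tau-\bar\tau}{2i\pi}\Bigr)^{s-k}\sum_{\omega\in\mathbb Z+\mathbb Z\tau,\ \omega\ne -z}\frac{\overline{\omega+z}^{\,k}}{|\omega+z|^{2s}}\,e^{2i\pi\frac{\omega\bar u-u\bar\omega}{\tau-\bar\tau}}\qquad(\mathrm{Re}(s)>1+k/2),$$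 and for $\alpha,\beta\in\mathbb Q$ (only their classes mod $\mathbb Z$ matter) put $E^{(k)}_{\alpha,\beta}(\tau)=H_k(k,\tau,\alpha\tau+\beta,0)$, $F^{(k)}_{\alpha,\beta}(\tau)=H_k(k,\tau,0,\alpha\tau+\beta)$ and $\tilde E^{(2)}_{\alpha,\beta}=E^{(2)}_{\alpha,\beta}-E^{(2)}_{0,0}$. **Theorem.** Let $k\ge1$. There are algebraic distributions $z_{\mathbf{Eis}}(k)$ and $z'_{\mathbf{Eis}}(k)$ on $X$ with values in $M_k^{\rm cong}(\mathbb Q^{\rm cycl})$ such that, for all $r\in\mathbb Q^*$ and $(a,b)\in\mathbb Q^2$, $$\int_{(a+r\hat{\mathbb Z})\times(b+r\hat{\mathbb Z})}z_{\mathbf{Eis}}(k)=r^{-k}E^{(k)}_{a/r,b/r}\ \text{ if } k\neq2,\qquad \int_{(a+r\hat{\mathbb Z})\times(b+r\hat{\mathbb Z})}z_{\mathbf{Eis}}(2)=r^{-2}\tilde E^{(2)}_{a/r,b/r},$$ $$\int_{(a+r\hat{\mathbb Z})\times(b+r\hat{\mathbb Z})}z'_{\mathbf{Eis}}(k)=r^{k-2}F^{(k)}_{a/r,b/r}\quad\text{if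 } k\ne2\text{ or }(a/r,b/r)\notin\mathbb Z^2 .$$ If $k\ne2$, then for every $\gamma\in\mathrm{GL}_2(\mathbb Q\otimes\hat{\mathbb Z})$ $$z_{\mathbf{Eis}}(k)*\gamma=z_{\mathbf{Eis}}(k)\quad\text{and}\quad z'_{\mathbf{Eis}}(k)*\gamma=|\det\gamma|^{1-k}z'_{\mathbf{Eis}}(k).$$ If $k=2$, these two identities hold for every $\gamma\in\mathbb Q^*\cdot\mathrm{GL}_2(\hat{\mathbb Z})$, and for an arbitrary $\gamma\in\mathrm{GL}_2(\mathbb Q\otimes\hat{\mathbb Z})$ the first one holds on all $\phi\in\mathrm{LC}_c(X,\mathbb Z)$ whose integral for a Haar measure of $X$ is $0$, and the second one on all $\phi$ with $\phi(0)=0$ (that is, on $X\setminus\{0\}$). -/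

import Mathlib

open UpperHalfPlane ModularForm
open scoped MatrixGroups RestrictedProduct

noncomputable section

namespace EisDist

/-! ### Adelic objects -/

instance factPrime (p : Nat.Primes) : Fact (p : ℕ).Prime := ⟨p.2⟩

/-- The ring `ℚ ⊗ Ẑ` of finite adeles of `ℚ`: the restricted product of the fields `ℚ_p`
with respect to the subrings `ℤ_p`, with the restricted product topology. -/
abbrev Adele : Type := Πʳ p : Nat.Primes, [ℚ_[p], PadicInt.subring (p : ℕ)]

theorem isOpen_padicInt (p : Nat.Primes) :
    IsOpen (PadicInt.subring (p : ℕ) : Set ℚ_[p]) := by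
  have h : (PadicInt.subring (p : ℕ) : Set ℚ_[p]) = Metric.closedBall 0 1 := by
    ext x; simp [PadicInt.subring]
  rw [h]
  exact IsUltrametricDist.isOpen_closedBall _ one_ne_zero

instance factIsOpen :
    Fact (∀ p : Nat.Primes, IsOpen (PadicInt.subring (p : ℕ) : Set ℚ_[p])) :=
  ⟨isOpen_padicInt⟩

instance compactPadicInt (p : Nat.Primes) : CompactSpace (PadicInt.subring (p : ℕ)) :=
  inferInstanceAs (CompactSpace ℤ_[p])

/-- `x ∈ Ẑ = ∏ ℤ_p`. -/
def InZhat (x : Adele) : Prop := ∀ p : Nat.Primes, ‖x p‖ ≤ 1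

/-- `x ∈ Ẑ^*`. -/
def IsUnitZhat (x : Adele) : Prop := ∀ p : Nat.Primes, ‖x p‖ = 1

theorem rat_eventually_integral (x : ℚ) :
    ∀ᶠ p : Nat.Primes in Filter.cofinite, (x : ℚ_[p]) ∈ PadicInt.subring (p : ℕ) := by
  have hfin : {p : Nat.Primes | (p : ℕ) ∈ x.den.primeFactors}.Finite :=
    (x.den.primeFactors.finite_toSet).preimage (Nat.Primes.coe_nat_injective.injOn)
  refine Filter.mem_of_superset hfin.compl_mem_cofinite ?_
  intro p hp
  have hp' : ¬ (p : ℕ) ∣ x.den := fun h => hp (by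
    simp only [Set.mem_ofPred_eq, Nat.mem_primeFactors]
    exact ⟨p.2, h, x.den_nz⟩)
  exact Padic.norm_rat_le_one hp'

/-- The diagonal embedding `ℚ → ℚ ⊗ Ẑ`. -/
def ratAdele : ℚ →+* Adele where
  toFun x := ⟨fun p => (x : ℚ_[p]), rat_eventually_integral x⟩
  map_one' := by ext p; exact Rat.cast_one
  map_zero' := by ext p; exact Rat.cast_zero
  map_add' x y := by ext p; exact Rat.cast_add x y
  map_mul' x y := by ext p; exact Rat.cast_mul x y

/-- For `x ∈ (ℚ ⊗ Ẑ)^*`, the positive rational number `|x| = ∏ p ^ v_p(x)`, characterised by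
`x ∈ |x| Ẑ^*`.  It is the usual absolute value on positive rationals, and `1` on `Ẑ^*`. -/
def absAdele (x : Adele) : ℚ := ∏ᶠ p : Nat.Primes, ((p : ℕ) : ℚ) ^ (x p).valuation

/-- The space `(ℚ ⊗ Ẑ)²` of row vectors, on which `GL₂(ℚ ⊗ Ẑ)` acts on the right. -/
abbrev X : Type := Fin 2 → Adele

/-! ### Locally constant functions with compact support, algebraic distributions -/

/-- `LC_c(X, ℤ)`: the locally constant functions `X → ℤ` with compact support. -/
def LCc : Submodule ℤ (LocallyConstant X ℤ) where
  carrier := {φ | HasCompactSupport (φ : X → ℤ)}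
  zero_mem' := HasCompactSupport.zero
  add_mem' hf hg := HasCompactSupport.add hf hg
  smul_mem' c _ hf := HasCompactSupport.smul_left (f := fun _ => c) hf

instance : CoeFun LCc (fun _ => X → ℤ) := ⟨fun φ => (φ.1 : X → ℤ)⟩

/-- The homeomorphism `x ↦ x * γ` of `X`. -/
def mulRight (γ : GL (Fin 2) Adele) : X ≃ₜ X where
  toFun x := Matrix.vecMul x (γ : Matrix (Fin 2) (Fin 2) Adele)
  invFun x := Matrix.vecMul x ((γ⁻¹ : GL (Fin 2) Adele) : Matrix (Fin 2) (Fin 2) Adele)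
  left_inv x := by simp [Matrix.vecMul_vecMul, ← Units.val_mul, -Matrix.coe_units_inv]
  right_inv x := by simp [Matrix.vecMul_vecMul, ← Units.val_mul, -Matrix.coe_units_inv]
  continuous_toFun := by
    refine continuous_pi fun j => ?_
    simp only [Matrix.vecMul, dotProduct]
    fun_prop
  continuous_invFun := by
    refine continuous_pi fun j => ?_
    simp only [Matrix.vecMul, dotProduct]
    fun_prop

/-- The right action `(φ * γ)(x) = φ(x * γ⁻¹)` on `LC_c(X, ℤ)`. -/
def LCc.act (φ : LCc) (γ : GL (Fin 2) Adele) : LCc :=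
  ⟨LocallyConstant.comap ⟨mulRight γ⁻¹, (mulRight γ⁻¹).continuous⟩ φ.1, by
    have h := HasCompactSupport.comp_homeomorph φ.2 (mulRight γ⁻¹)
    exact h⟩

/-- The subset `(a + rẐ) × (b + rẐ)` of `X`, for `a, b ∈ ℚ` and `r ∈ ℚ^*`. -/
def box (a b r : ℚ) : Set X :=
  {x | (∃ t, InZhat t ∧ x 0 = ratAdele a + ratAdele r * t) ∧
       (∃ t, InZhat t ∧ x 1 = ratAdele b + ratAdele r * t)}

theorem isOpen_integral : IsOpen {x : Adele | InZhat x} :=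
  RestrictedProduct.isOpen_forall_mem isOpen_padicInt

theorem isCompact_integral : IsCompact {x : Adele | InZhat x} := by
  have : ∀ p : Nat.Primes, CompactSpace (PadicInt.subring (p : ℕ) : Set ℚ_[p]) :=
    compactPadicInt
  have h := isCompact_range
    (RestrictedProduct.isEmbedding_structureMap (R := fun p : Nat.Primes => ℚ_[p])
      (A := fun p : Nat.Primes => (PadicInt.subring (p : ℕ) : Set ℚ_[p]))
      (𝓕 := Filter.cofinite)).continuous
  rw [RestrictedProduct.range_structureMap] at h
  exact h

/-- The homeomorphism `t ↦ a + r t` of `ℚ ⊗ Ẑ`, for `r ∈ ℚ^*`. -/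
def affine (a r : ℚ) (hr : r ≠ 0) : Adele ≃ₜ Adele where
  toFun t := ratAdele a + ratAdele r * t
  invFun x := ratAdele r⁻¹ * (x - ratAdele a)
  left_inv t := by
    change ratAdele r⁻¹ * (ratAdele a + ratAdele r * t - ratAdele a) = t
    rw [add_sub_cancel_left, ← mul_assoc, ← map_mul, inv_mul_cancel₀ hr, map_one, one_mul]
  right_inv x := by
    change ratAdele a + ratAdele r * (ratAdele r⁻¹ * (x - ratAdele a)) = x
    rw [← mul_assoc, ← map_mul, mul_inv_cancel₀ hr, map_one, one_mul, add_sub_cancel]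
  continuous_toFun := by fun_prop
  continuous_invFun := by fun_prop

theorem box_eq (a b r : ℚ) (hr : r ≠ 0) :
    box a b r = Set.pi Set.univ
      ![affine a r hr '' {x | InZhat x}, affine b r hr '' {x | InZhat x}] := by
  ext x
  simp only [box, affine, Set.mem_ofPred_eq, Set.mem_pi, Set.mem_univ, true_implies,
    Fin.forall_fin_two, Matrix.cons_val_zero, Matrix.cons_val_one, Set.mem_image]
  constructor
  · rintro ⟨⟨t, ht, h⟩, u, hu, h'⟩
    exact ⟨⟨t, ht, h.symm⟩, u, hu, h'.symm⟩
  · rintro ⟨⟨t, ht, h⟩, u, hu, h'⟩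
    exact ⟨⟨t, ht, h.symm⟩, u, hu, h'.symm⟩

theorem isCompact_box (a b r : ℚ) (hr : r ≠ 0) : IsCompact (box a b r) := by
  rw [box_eq a b r hr]
  refine isCompact_univ_pi fun i => ?_
  fin_cases i
  · exact isCompact_integral.image (affine a r hr).continuous
  · exact isCompact_integral.image (affine b r hr).continuous

theorem isClopen_box (a b r : ℚ) (hr : r ≠ 0) : IsClopen (box a b r) := by
  refine ⟨(isCompact_box a b r hr).isClosed, ?_⟩
  rw [box_eq a b r hr]
  refine isOpen_set_pi Set.finite_univ fun i _ => ?_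
  fin_cases i
  · exact (affine a r hr).isOpenMap _ isOpen_integral
  · exact (affine b r hr).isOpenMap _ isOpen_integral

/-- The characteristic function of `(a + rẐ) × (b + rẐ)`. -/
def boxIndicator (a b r : ℚ) (hr : r ≠ 0) : LCc :=
  ⟨LocallyConstant.charFn ℤ (isClopen_box a b r hr), by
    refine HasCompactSupport.intro (isCompact_box a b r hr) fun x hx => ?_
    simp [LocallyConstant.charFn, hx]⟩

/-- The integral of `φ ∈ LC_c(X, ℤ)` against a Haar measure on `X`. -/
def haarIntegral (φ : LCc) : ℝ :=
  letI : MeasurableSpace X := borel X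
  haveI : BorelSpace X := ⟨rfl⟩
  ∫ x : X, (φ x : ℝ) ∂(MeasureTheory.Measure.addHaar : MeasureTheory.Measure X)

/-! ### Modular forms -/

/-- `ℚ^cycl ⊂ ℂ`, generated by all roots of unity. -/
def Qcycl : IntermediateField ℚ ℂ :=
  IntermediateField.adjoin ℚ {ζ : ℂ | ∃ n : ℕ, 1 ≤ n ∧ ζ ^ n = 1}

/-- `f(τ) = ∑_{n ≥ 0} a_n q^{n/N}` on the upper half plane, where `q = e^{2iπτ}`. -/
def HasQExp (N : ℕ) (a : ℕ → ℂ) (f : ℍ → ℂ) : Prop :=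
  ∀ τ : ℍ, HasSum
    (fun n : ℕ => a n * Complex.exp (2 * Real.pi * Complex.I * (n / N : ℂ) * (τ : ℂ))) (f τ)

/-- `f` is a modular form of weight `k` for some congruence subgroup of `SL₂(ℤ)`. -/
def IsCongModularForm (k : ℕ) (f : ℍ → ℂ) : Prop :=
  ∃ Γ : Subgroup SL(2, ℤ), CongruenceSubgroup.IsCongruenceSubgroup Γ ∧
    ∃ F : ModularForm (Γ.map (Matrix.SpecialLinearGroup.mapGL ℝ)) (k : ℤ), (F : ℍ → ℂ) = f

/-- The `q`-expansion of `f` has coefficients in `ℚ^cycl`. -/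
def HasCyclCoeffs (f : ℍ → ℂ) : Prop :=
  ∃ (N : ℕ) (a : ℕ → Qcycl), 1 ≤ N ∧ HasQExp N (fun n => (a n : ℂ)) f

theorem HasQExp.mul_level {N M : ℕ} (hN : 1 ≤ N) (hM : 1 ≤ M) {a : ℕ → Qcycl} {f : ℍ → ℂ}
    (h : HasQExp N (fun n => (a n : ℂ)) f) :
    HasQExp (N * M) (fun n => ((if M ∣ n then a (n / M) else 0 : Qcycl) : ℂ)) f := by
  intro τ
  have hM0 : (M : ℂ) ≠ 0 := by exact_mod_cast (by omega : M ≠ 0)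
  have hN0 : (N : ℂ) ≠ 0 := by exact_mod_cast (by omega : N ≠ 0)
  have hinj : Function.Injective (fun n : ℕ => n * M) :=
    fun x y hxy => Nat.eq_of_mul_eq_mul_right (by omega) hxy
  rw [← hinj.hasSum_iff]
  · refine (h τ).congr_fun ?_ |> fun h => h
    intro n
    have : n * M / M = n := Nat.mul_div_cancel _ (by omega)
    simp only [Function.comp, dvd_mul_left, if_true, this]
    congr 3
    push_cast
    field_simp
  · intro n hn
    have : ¬ M ∣ n := fun ⟨c, hc⟩ => hn ⟨c, by simp [hc, mul_comm]⟩
    simp [this]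

theorem HasCyclCoeffs.add {f g : ℍ → ℂ} (hf : HasCyclCoeffs f) (hg : HasCyclCoeffs g) :
    HasCyclCoeffs (f + g) := by
  obtain ⟨N, a, hN, ha⟩ := hf
  obtain ⟨M, b, hM, hb⟩ := hg
  have ha' := ha.mul_level hN hM
  have hb' := hb.mul_level hM hN
  rw [mul_comm M N] at hb'
  refine ⟨N * M, fun n => (if M ∣ n then a (n / M) else 0) + (if N ∣ n then b (n / N) else 0),
    Nat.mul_pos hN hM, fun τ => ?_⟩
  have := (ha' τ).add (hb' τ)
  simpa only [← add_mul, Pi.add_apply, IntermediateField.coe_add] using this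

/-- A modular form restricts to a smaller group. -/
def restrictLevel {Γ Γ' : Subgroup (GL (Fin 2) ℝ)} {k : ℤ} (h : Γ' ≤ Γ) (F : ModularForm Γ k) :
    ModularForm Γ' k where
  toFun := F
  slash_action_eq' γ hγ := F.slash_action_eq' γ (h hγ)
  holo' := F.holo'
  bdd_at_cusps' hc := F.bdd_at_cusps' (hc.mono h)

theorem Gamma_mono {N M : ℕ} (h : N ∣ M) :
    CongruenceSubgroup.Gamma M ≤ CongruenceSubgroup.Gamma N := by
  intro γ hγ
  rw [CongruenceSubgroup.Gamma_mem] at hγ ⊢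
  have key : ∀ x y : ℤ, (x : ZMod M) = y → (x : ZMod N) = y := fun x y hxy => by
    rw [ZMod.intCast_eq_intCast_iff] at hxy ⊢
    exact hxy.of_dvd (by exact_mod_cast h)
  obtain ⟨h1, h2, h3, h4⟩ := hγ
  exact ⟨by simpa using key _ 1 (by simpa using h1), by simpa using key _ 0 (by simpa using h2),
    by simpa using key _ 0 (by simpa using h3), by simpa using key _ 1 (by simpa using h4)⟩

theorem IsCongModularForm.add {k : ℕ} {f g : ℍ → ℂ} (hf : IsCongModularForm k f)
    (hg : IsCongModularForm k g) : IsCongModularForm k (f + g) := by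
  obtain ⟨Γ, ⟨N, hN, hΓ⟩, F, rfl⟩ := hf
  obtain ⟨Γ', ⟨M, hM, hΓ'⟩, G, rfl⟩ := hg
  have h1 : CongruenceSubgroup.Gamma (N * M) ≤ Γ :=
    le_trans (Gamma_mono (dvd_mul_right N M)) hΓ
  have h2 : CongruenceSubgroup.Gamma (N * M) ≤ Γ' :=
    le_trans (Gamma_mono (dvd_mul_left M N)) hΓ'
  exact ⟨CongruenceSubgroup.Gamma (N * M), ⟨N * M, Nat.mul_ne_zero hN hM, le_rfl⟩,
    restrictLevel (Subgroup.map_mono h1) F + restrictLevel (Subgroup.map_mono h2) G, rfl⟩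

/-- `M_k^cong(ℚ^cycl)`: modular forms of weight `k` for some congruence subgroup of `SL₂(ℤ)`
whose `q`-expansion has coefficients in `ℚ^cycl`. -/
def Mcong (k : ℕ) : Submodule ℚ (ℍ → ℂ) where
  carrier := {f | IsCongModularForm k f ∧ HasCyclCoeffs f}
  zero_mem' := by
    refine ⟨⟨⊤, ⟨1, one_ne_zero, le_top⟩, 0, rfl⟩, 1, 0, le_rfl, fun τ => ?_⟩
    simp [hasSum_zero]
  add_mem' hf hg := ⟨hf.1.add hg.1, hf.2.add hg.2⟩
  smul_mem' c f hf := by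
    obtain ⟨⟨Γ, hΓ, F, rfl⟩, N, a, hN, ha⟩ := hf
    refine ⟨⟨Γ, hΓ, (c : ℝ) • F, ?_⟩, N, fun n => (c : Qcycl) * a n, hN, fun τ => ?_⟩
    · ext τ
      simp [Rat.smul_def]
    · have hc : ∀ n, (((c : Qcycl) * a n : Qcycl) : ℂ) = (c : ℂ) * (a n : ℂ) := fun n => by
        push_cast; rfl
      have := (ha τ).mul_left (c : ℂ)
      simpa only [hc, Pi.smul_apply, Rat.smul_def, mul_assoc] using this

/-! ### The right action of `GL₂(ℚ ⊗ Ẑ)` on `M_k^cong(ℚ^cycl)` -/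

/-- The action `f * g = (det g)^{1-k} f|_k g` of `g ∈ GL₂(ℚ)` with `det g > 0`. -/
def ratStar (k : ℕ) (f : ℍ → ℂ) (g : GL (Fin 2) ℚ) : ℍ → ℂ :=
  (((g : Matrix (Fin 2) (Fin 2) ℚ).det ^ (1 - (k : ℤ)) : ℚ) : ℂ) •
    (f ∣[(k : ℤ)] (g.map (algebraMap ℚ ℝ) : GL (Fin 2) ℝ))

/-- `f' = f * δ` for `δ ∈ SL₂(Ẑ)`, i.e. `f' = f|_k s` where `s ∈ SL₂(ℤ)` is congruent to `δ`
modulo an integer `N ≥ 1` such that `f` is invariant under `Γ_N`. -/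
def IsSLStar (k : ℕ) (δ : Matrix (Fin 2) (Fin 2) Adele) (f f' : ℍ → ℂ) : Prop :=
  ∃ (N : ℕ) (s : SL(2, ℤ)), 1 ≤ N ∧
    (∀ γ ∈ CongruenceSubgroup.Gamma N, f ∣[(k : ℤ)] γ = f) ∧
    (∀ i j, ∃ t, InZhat t ∧ δ i j = ratAdele (s i j : ℤ) + ratAdele N * t) ∧
    f' = f ∣[(k : ℤ)] s

/-- `σ` is the automorphism `σ_d` of `ℚ^cycl` attached to `d ∈ Ẑ^*`:
`σ ζ = ζ ^ d` for every root of unity `ζ`. -/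
def IsCyclAut (d : Adele) (σ : Qcycl ≃ₐ[ℚ] Qcycl) : Prop :=
  ∀ n : ℕ, 1 ≤ n → ∀ m : ℕ, (∃ t, InZhat t ∧ d = ratAdele m + ratAdele n * t) →
    ∀ ζ : Qcycl, ζ ^ n = 1 → σ ζ = ζ ^ m

/-- `f'` is obtained from `f` by applying `σ_d` to the coefficients of the `q`-expansion. -/
def IsGalStar (d : Adele) (f f' : ℍ → ℂ) : Prop :=
  ∃ (σ : Qcycl ≃ₐ[ℚ] Qcycl) (N : ℕ) (a : ℕ → Qcycl), IsCyclAut d σ ∧ 1 ≤ N ∧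
    HasQExp N (fun n => (a n : ℂ)) f ∧ HasQExp N (fun n => (σ (a n) : ℂ)) f'

/-- `f' = f * γ` for `γ ∈ GL₂(ℚ ⊗ Ẑ)`.  One writes `γ = g δ (1, 0; 0, d)` with `g ∈ GL₂(ℚ)`,
`det g > 0`, `δ ∈ SL₂(Ẑ)` and `d ∈ Ẑ^*`; then `f * γ = ((f * g) * δ) * (1, 0; 0, d)`, where
`(1, 0; 0, d)` acts by `σ_d` on the coefficients of the `q`-expansion. -/
def IsStar (k : ℕ) (γ : GL (Fin 2) Adele) (f f' : ℍ → ℂ) : Prop :=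
  ∃ (g : GL (Fin 2) ℚ) (δ : Matrix (Fin 2) (Fin 2) Adele) (d : Adele) (f₁ : ℍ → ℂ),
    0 < (g : Matrix (Fin 2) (Fin 2) ℚ).det ∧
    (∀ i j, InZhat (δ i j)) ∧ δ.det = 1 ∧ IsUnitZhat d ∧
    (γ : Matrix (Fin 2) (Fin 2) Adele) =
      (g : Matrix (Fin 2) (Fin 2) ℚ).map ratAdele * δ * !![1, 0; 0, d] ∧
    IsSLStar k δ (ratStar k f g) f₁ ∧ IsGalStar d f₁ f'

/-- The right action `f * γ` of `γ ∈ GL₂(ℚ ⊗ Ẑ)` on `f ∈ M_k^cong(ℚ^cycl)`. -/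
def adelicStar {k : ℕ} (f : Mcong k) (γ : GL (Fin 2) Adele) : Mcong k :=
  Classical.epsilon fun f' : Mcong k => IsStar k γ f f'

/-- `𝔇_alg((ℚ ⊗ Ẑ)², M_k^cong(ℚ^cycl))`. -/
abbrev Dist (k : ℕ) : Type := LCc →ₗ[ℤ] Mcong k

/-- The value `∫ φ (μ * γ) = (∫ (φ * γ⁻¹) μ) * γ` of the distribution `μ * γ` at `φ`. -/
def Dist.act {k : ℕ} (μ : Dist k) (γ : GL (Fin 2) Adele) (φ : LCc) : Mcong k :=
  adelicStar (μ (LCc.act φ γ⁻¹)) γ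

/-- `γ` is the product of a nonzero rational scalar matrix and an element of `GL₂(Ẑ)`. -/
def IsScalarMulGLZhat (γ : GL (Fin 2) Adele) : Prop :=
  ∃ (c : ℚ) (u : GL (Fin 2) Adele), c ≠ 0 ∧
    (∀ i j, InZhat ((u : Matrix (Fin 2) (Fin 2) Adele) i j)) ∧
    (∀ i j, InZhat (((u⁻¹ : GL (Fin 2) Adele) : Matrix (Fin 2) (Fin 2) Adele) i j)) ∧
    (γ : Matrix (Fin 2) (Fin 2) Adele) = ratAdele c • (u : Matrix (Fin 2) (Fin 2) Adele)

/-! ### Eisenstein-Kronecker series -/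

/-- The Eisenstein-Kronecker series, for `Re s > 1 + k/2`:
`Γ(s) (-2iπ)^{-k} ((τ - τ̄)/(2iπ))^{s-k}
  ∑'_{ω ∈ ℤ + ℤτ} conj(ω + z)^k |ω + z|^{-2s} e((ω ū - u ω̄)/(τ - τ̄))`,
the term with `ω = -z` being omitted. -/
def ekSeries (k : ℕ) (τ : ℍ) (z u s : ℂ) : ℂ :=
  Complex.Gamma s / (-2 * Complex.I * Real.pi) ^ k *
    (((τ : ℂ) - (starRingEnd ℂ) τ) / (2 * Complex.I * Real.pi)) ^ (s - k) *
    ∑' w : ℤ × ℤ,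
      let ω : ℂ := w.1 + w.2 * τ
      if ω + z = 0 then 0 else
        (starRingEnd ℂ) (ω + z) ^ k / ((‖ω + z‖ : ℝ) : ℂ) ^ (2 * s) *
          Complex.exp (2 * Complex.I * Real.pi *
            ((ω * (starRingEnd ℂ) u - u * (starRingEnd ℂ) ω) / ((τ : ℂ) - (starRingEnd ℂ) τ)))

open Classical in
/-- `H_k(s, τ, z, u)` for `k ≥ 1` and all `s ∈ ℂ`: the analytic continuation of the
Eisenstein-Kronecker series, which is an entire function of `s` when `k ≥ 1`. -/
def H (k : ℕ) (s : ℂ) (τ : ℍ) (z u : ℂ) : ℂ :=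
  if h : ∃ h : ℂ → ℂ, Differentiable ℂ h ∧
      ∀ s : ℂ, 1 + (k : ℝ) / 2 < s.re → h s = ekSeries k τ z u s
  then h.choose s else 0

/-- `E^{(k)}_{a,b}(τ) = H_k(k, τ, aτ + b, 0)`. -/
def E (k : ℕ) (a b : ℚ) : ℍ → ℂ := fun τ => H k k τ (a * τ + b) 0

/-- `F^{(k)}_{a,b}(τ) = H_k(k, τ, 0, aτ + b)`. -/
def F (k : ℕ) (a b : ℚ) : ℍ → ℂ := fun τ => H k k τ 0 (a * τ + b)

end EisDist

end

/-!
To a function `φ` in `LC_c(X, ℤ)` attach the theta series `θ_φ(t) = ∑ φ(x, y) conj(xτ + y)^k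
exp(-πt |xτ + y|² / Im τ)`, the sum being over `(x, y) ∈ ℚ²` (`thetaFun`), and the values at
integers `s` of `(-2i Im τ)^{-k}` times its Mellin transform (`eisFun k s φ`). The rational points
of the box `(a + rẐ) × (b + rẐ)` form a dilated and translated lattice, so for the indicator of a
box this is a power of `r` times the Mellin transform of the theta series `thetaE` of a translated
lattice. At `s = k` that Mellin transform is `E` by definition (`E_eq_mellin`). At `s = 1` it is
`F`: two-dimensional Poisson summation relates `thetaE` to the theta series `thetaF` twisted by a
character (`thetaE_eq_thetaF`), which exchanges `s` and `k + 1 - s` (`F_eq_mellin`). The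
distributions are therefore `φ ↦ eisFun k k φ` and `φ ↦ eisFun k 1 φ`, except that in weight `2`
the nonholomorphic contributions are removed by subtracting the normalised Haar integral of `φ`
times `E 2 0 0`, respectively `φ(0)` times `F 2 0 0` (`distE`, `distF`).

*Rational matrices.* A linear substitution in the sum over `ℚ²` shows that `g ∈ GL₂(ℚ)` with `det
g > 0` multiplies `eisFun k s` by `(det g)^{s-k}` (`ratStar_eisFun`). For `s = k` the factor is
`1`, for `s = 1` it is `(det g)^{1-k}`.

*Galois action.* The substitution `β ↦ dβ` in `E_{α,β}` and `F_{α,β}` amounts to applying `σ_d` to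
the `q`-expansion (`galRel_regE`, `galRel_regF`). For `k ≥ 3` the series `E` converges absolutely
and the Lipschitz formula gives its expansion (`hasSum_qExp_of_three_le`); the constant term is a
finite Fourier transform of values of Bernoulli polynomials (`constTerm_eq`). For `k = 1, 2`
absolute convergence fails. Poisson summation in one variable only turns `thetaE` into a sum over
pairs `(l, n)` whose terms have elementary primitives in `t`. The terms with `l ≠ 0` give the
nonconstant terms of the expansion; those with `l = 0` are summed over `(ε, ∞)` and give, as `ε →
0`, the constant term `1/2 - {α}` in weight `1` (`integral_zeroTerm_one`) and the term `1 / (4π Im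
τ)` in weight `2` (`integral_zeroTerm_two`), which does not depend on `(α, β)` and so disappears
from `E - E 2 0 0`. In weight `1` with `α` integral, and for `F` in all weights, one uses that `F`
is a finite Fourier transform of `E` (`F_eq_sum`) and that `E = F` in weight `1`.

*The adelic group.* Every element of `GL₂(ℚ ⊗ Ẑ)` is a product of a rational matrix of positive
determinant, an element of `SL₂(Ẑ)` and a matrix `(1, 0; 0, d)` with `d ∈ Ẑ^*`
(`exists_isDecomp`). By strong approximation (`exists_SL2_memMul`) and the uniqueness of
`q`-expansions, equivariance under `SL₂(ℤ)` and under the matrices `(1, 0; 0, d)` implies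
equivariance under the last two factors, and also that the values are modular forms
(`exists_dist`). So only the rational factor matters (`act_eq_smul`). In weight `2` the correction
terms vanish on the test functions considered, or else `γ = c u` with `c ∈ ℚ^*` and `u ∈ GL₂(Ẑ)`;
then the rational factor carries the indicator of `Ẑ²` to that of `c⁻¹Ẑ²`, and the correction
terms transform like the main terms (`IsScalarMulGLZhat.exists_isPullback`).
-/

noncomputable section

namespace EisDist

open MeasureTheory Filter Topology

/-! ### Gaussian sums over lattices -/

theorem summable_exp_neg_abs_int : Summable fun m : ℤ => Real.exp (-|(m : ℝ)|) := by
  have h : Summable fun n : ℕ => Real.exp (-(n : ℝ)) := Real.summable_exp_neg_nat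
  refine Summable.of_nat_of_neg ?_ ?_ <;> simpa using h

theorem neg_mul_sq_add_le {c : ℝ} (hc : 0 < c) (r x : ℝ) :
    -c * x ^ 2 + r * |x| ≤ r ^ 2 / (4 * c) := by
  rw [le_div_iff₀ (by positivity), ← sq_abs x]
  nlinarith [sq_nonneg (2 * c * |x| - r)]

theorem summable_gauss {c : ℝ} (hc : 0 < c) (β r : ℝ) :
    Summable fun m : ℤ => Real.exp (-c * (m + β) ^ 2 + r * |m + β|) := by
  refine Summable.of_nonneg_of_le (fun _ => (Real.exp_pos _).le) (fun m => ?_)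
    (summable_exp_neg_abs_int.mul_left (Real.exp ((r + 1) ^ 2 / (4 * c) + |β|)))
  rw [← Real.exp_add, Real.exp_le_exp]
  have h1 := neg_mul_sq_add_le hc (r + 1) (m + β)
  have h2 : |(m : ℝ)| ≤ |m + β| + |β| := by
    have := abs_sub (m + β : ℝ) β
    simpa using this
  linarith

theorem summable_gauss_prod {c : ℝ} (hc : 0 < c) (α β r : ℝ) :
    Summable fun w : ℤ × ℤ => Real.exp (-c * ((w.1 + α) ^ 2 + (w.2 + β) ^ 2) +
      r * (|w.1 + α| + |w.2 + β|)) := by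
  refine ((summable_gauss hc α r).mul_of_nonneg (summable_gauss hc β r)
    (fun _ => (Real.exp_pos _).le) fun _ => (Real.exp_pos _).le).congr fun w => ?_
  rw [← Real.exp_add]
  congr 1
  ring

/-- The form used below: an exponential sum over `ℤ²` converges absolutely when the real part of
the exponent is at most a negative definite quadratic form plus linear terms. -/
theorem summable_cexp_of_re_le {c : ℝ} (hc : 0 < c) (α β r C : ℝ) {f : ℤ × ℤ → ℂ}
    (hf : ∀ w, (f w).re ≤ -c * ((w.1 + α) ^ 2 + (w.2 + β) ^ 2) +
      r * (|w.1 + α| + |w.2 + β|) + C) : Summable fun w => Complex.exp (f w) := by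
  refine Summable.of_norm_bounded ((summable_gauss_prod hc α β r).mul_right (Real.exp C))
    fun w => ?_
  rw [Complex.norm_exp, ← Real.exp_add, Real.exp_le_exp]
  exact hf w

/-- Poisson summation for a Gaussian with a complex shift. -/
theorem tsum_gauss_shift {b : ℝ} (hb : 0 < b) (a : ℂ) :
    ∑' m : ℤ, Complex.exp (-Real.pi * b * (m + a) ^ 2) =
      ((b ^ (-1 / 2 : ℝ) : ℝ) : ℂ) *
        ∑' l : ℤ, Complex.exp (-Real.pi * l ^ 2 / b + 2 * Real.pi * Complex.I * l * a) := by
  have h := Complex.tsum_exp_neg_quadratic (a := (b : ℂ)) (by simpa using hb) (-b * a)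
  have hb' : (b : ℂ) ≠ 0 := by exact_mod_cast hb.ne'
  have h1 : ∀ m : ℤ, Complex.exp (-Real.pi * b * (m + a) ^ 2) =
      Complex.exp (-Real.pi * b * m ^ 2 + 2 * Real.pi * (-b * a) * m) *
        Complex.exp (-Real.pi * b * a ^ 2) := fun m => by
    rw [← Complex.exp_add]; congr 1; ring
  have h2 : ∀ l : ℤ, Complex.exp (-Real.pi / b * (l + Complex.I * (-b * a)) ^ 2) =
      Complex.exp (-Real.pi * l ^ 2 / b + 2 * Real.pi * Complex.I * l * a) *
        Complex.exp (Real.pi * b * a ^ 2) := fun l => by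
    rw [← Complex.exp_add]; congr 1
    field_simp
    ring_nf
    simp only [Complex.I_sq]
    ring
  simp_rw [h1]
  rw [tsum_mul_right, h]
  simp_rw [h2]
  rw [tsum_mul_right, mul_assoc, mul_assoc, ← Complex.exp_add]
  have : (Real.pi * b * a ^ 2 + -Real.pi * b * a ^ 2 : ℂ) = 0 := by ring
  rw [this, Complex.exp_zero, mul_one, Complex.ofReal_cpow hb.le, one_div, ← Complex.cpow_neg]
  congr 2
  push_cast; ring

theorem hasDerivAt_tsum_exp {ι : Type*} {A B : ι → ℂ}
    (h : ∀ r : ℝ, Summable fun i => Real.exp ((A i).re + r * ‖B i‖)) (k : ℕ) (u : ℂ) :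
    Summable (fun i => B i ^ k * Complex.exp (A i + u * B i)) ∧
    HasDerivAt (fun u => ∑' i, B i ^ k * Complex.exp (A i + u * B i))
      (∑' i, B i ^ (k + 1) * Complex.exp (A i + u * B i)) u := by
  have hbd : ∀ (j : ℕ) (R : ℝ) (i : ι) (v : ℂ), ‖v‖ ≤ R →
      ‖B i ^ j * Complex.exp (A i + v * B i)‖ ≤
        (j.factorial : ℝ) * Real.exp ((A i).re + (R + 1) * ‖B i‖) := fun j R i v hv => by
    have h1 : ‖B i‖ ^ j ≤ j.factorial * Real.exp ‖B i‖ := by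
      have := Real.pow_div_factorial_le_exp ‖B i‖ (norm_nonneg _) j
      rwa [div_le_iff₀ (by positivity), mul_comm] at this
    have h2 : (v * B i).re ≤ R * ‖B i‖ :=
      (Complex.re_le_norm _).trans (by rw [norm_mul]; gcongr)
    rw [norm_mul, norm_pow, Complex.norm_exp, Complex.add_re]
    calc ‖B i‖ ^ j * Real.exp ((A i).re + (v * B i).re)
        ≤ (j.factorial * Real.exp ‖B i‖) * Real.exp ((A i).re + R * ‖B i‖) := by gcongr
      _ = _ := by rw [mul_assoc, ← Real.exp_add]; congr 2; ring
  have hs : ∀ (j : ℕ) (v : ℂ), Summable (fun i => B i ^ j * Complex.exp (A i + v * B i)) :=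
    fun j v => Summable.of_norm_bounded ((h (‖v‖ + 1)).mul_left _) fun i => hbd j _ i v le_rfl
  have hu : Summable fun i => ((k + 1).factorial : ℝ) *
      Real.exp ((A i).re + ((‖u‖ + 1) + 1) * ‖B i‖) := (h _).mul_left _
  have hd : ∀ (i : ι) (v : ℂ), v ∈ Metric.ball (0 : ℂ) (‖u‖ + 1) →
      HasDerivAt (fun v => B i ^ k * Complex.exp (A i + v * B i))
        (B i ^ (k + 1) * Complex.exp (A i + v * B i)) v := fun i v _ => by
    have h1 : HasDerivAt (fun v : ℂ => A i + v * B i) (B i) v := by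
      simpa using ((hasDerivAt_id v).mul_const (B i)).const_add (A i)
    have h2 := (h1.cexp).const_mul (B i ^ k)
    have h3 : B i ^ (k + 1) * Complex.exp (A i + v * B i) =
      B i ^ k * (Complex.exp (A i + v * B i) * B i) := by ring
    rw [h3]
    exact h2
  exact ⟨hs k u, hasDerivAt_tsum_of_isPreconnected hu Metric.isOpen_ball
    (convex_ball (0 : ℂ) (‖u‖ + 1)).isPreconnected hd
    (fun i v hv => hbd _ _ i v (by simpa using (Metric.mem_ball.1 hv).le))
    (y₀ := u) (by simp) (hs k u) (by simp)⟩

/-- An identity between two exponential series in a parameter `u` may be differentiated termwise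
any number of times. Applied to Gaussian sums, this introduces the powers `conj(ω + z)^k`. -/
theorem tsum_pow_mul_exp_eq {ι ι' : Type*} {A B : ι → ℂ} {A' B' : ι' → ℂ} {c : ℂ}
    (h : ∀ r : ℝ, Summable fun i => Real.exp ((A i).re + r * ‖B i‖))
    (h' : ∀ r : ℝ, Summable fun i => Real.exp ((A' i).re + r * ‖B' i‖))
    (heq : ∀ u : ℂ, ∑' i, Complex.exp (A i + u * B i) =
      c * ∑' i, Complex.exp (A' i + u * B' i)) (k : ℕ) :
    ∀ u : ℂ, ∑' i, B i ^ k * Complex.exp (A i + u * B i) =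
      c * ∑' i, B' i ^ k * Complex.exp (A' i + u * B' i) := by
  induction k with
  | zero => simpa using heq
  | succ k ih =>
    intro u
    have h1 := (hasDerivAt_tsum_exp h k u).2
    have h2 := ((hasDerivAt_tsum_exp h' k u).2).const_mul c
    rw [funext ih] at h1
    exact h1.unique h2

/-! ### The theta series and their functional equation -/

theorem coe_eq_re_add_im (τ : ℍ) : (τ : ℂ) = (τ.re : ℂ) + τ.im * Complex.I :=
  (Complex.re_add_im (τ : ℂ)).symm

theorem conj_coe_eq (τ : ℍ) : (starRingEnd ℂ) (τ : ℂ) = (τ.re : ℂ) - τ.im * Complex.I := by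
  rw [coe_eq_re_add_im τ]
  simp [sub_eq_add_neg]

theorem norm_sq_lin (τ : ℍ) (x y : ℝ) :
    ‖(x * τ + y : ℂ)‖ ^ 2 = (x * τ.re + y) ^ 2 + (x * τ.im) ^ 2 := by
  rw [← Complex.normSq_eq_norm_sq, Complex.normSq_apply, coe_eq_re_add_im τ]
  simp
  ring

theorem exists_lower_bound (τ : ℍ) : ∃ c : ℝ, 0 < c ∧ ∀ x y : ℝ,
    c * (x ^ 2 + y ^ 2) ≤ ‖(x * τ + y : ℂ)‖ ^ 2 := by
  have hy : 0 < τ.im := τ.im_pos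
  refine ⟨(2 + (1 + 2 * τ.re ^ 2) / τ.im ^ 2)⁻¹, by positivity, fun x y => ?_⟩
  rw [norm_sq_lin, inv_mul_le_iff₀ (by positivity)]
  have h1 : (1 + 2 * τ.re ^ 2) / τ.im ^ 2 * (x * τ.im) ^ 2 = (1 + 2 * τ.re ^ 2) * x ^ 2 := by
    field_simp
  have h2 : 0 ≤ (1 + 2 * τ.re ^ 2) / τ.im ^ 2 * (x * τ.re + y) ^ 2 := by positivity
  nlinarith [sq_nonneg (2 * x * τ.re + y), sq_nonneg (x * τ.im)]

theorem norm_lin_le (τ : ℍ) (x y : ℝ) :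
    ‖(x * τ + y : ℂ)‖ ≤ (‖(τ : ℂ)‖ + 1) * (|y| + |x|) := by
  calc ‖(x * τ + y : ℂ)‖ ≤ ‖(x * τ : ℂ)‖ + ‖(y : ℂ)‖ := norm_add_le _ _
    _ = |x| * ‖(τ : ℂ)‖ + |y| := by simp
    _ ≤ _ := by nlinarith [norm_nonneg (τ : ℂ), abs_nonneg x, abs_nonneg y]

/-- The point `ω + z` of `ℂ`, for `ω = m + nτ` and `z = ατ + β`. -/
def latPt (τ : ℍ) (α β : ℝ) (w : ℤ × ℤ) : ℂ :=
  ((w.2 + α : ℝ) : ℂ) * τ + ((w.1 + β : ℝ) : ℂ)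

/-- The exponent of the character `ω ↦ e(nβ - mα)` of the lattice. -/
def charExp (α β : ℝ) (w : ℤ × ℤ) : ℂ := 2 * Real.pi * Complex.I * (w.2 * β - w.1 * α)

theorem summable_exp_latPt (τ : ℍ) (α β : ℝ) {t : ℝ} (ht : 0 < t) (r : ℝ) :
    Summable fun w : ℤ × ℤ => Real.exp (-t * ‖latPt τ α β w‖ ^ 2 + r * ‖latPt τ α β w‖) := by
  obtain ⟨c, hc, h⟩ := exists_lower_bound τ
  refine Summable.of_nonneg_of_le (fun _ => (Real.exp_pos _).le) (fun w => ?_)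
    (summable_gauss_prod (c := t * c) (by positivity) β α (|r| * (‖(τ : ℂ)‖ + 1)))
  rw [Real.exp_le_exp]
  have h1 := mul_le_mul_of_nonneg_left (h (w.2 + α) (w.1 + β)) ht.le
  have h2 := norm_lin_le τ (w.2 + α) (w.1 + β)
  have h3 : r * ‖latPt τ α β w‖ ≤ |r| * ((‖(τ : ℂ)‖ + 1) * (|w.1 + β| + |w.2 + α|)) := by
    refine (mul_le_mul_of_nonneg_right (le_abs_self r) (norm_nonneg _)).trans ?_
    exact mul_le_mul_of_nonneg_left h2 (abs_nonneg _)
  simp only [latPt] at *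
  nlinarith

theorem conj_latPt (τ : ℍ) (α β : ℝ) (w : ℤ × ℤ) : (starRingEnd ℂ) (latPt τ α β w) =
    (w.2 + α) * (τ.re - τ.im * Complex.I) + (w.1 + β) := by
  simp only [latPt, map_add, map_mul, Complex.conj_ofReal, conj_coe_eq]
  push_cast; ring

theorem norm_sq_latPt (τ : ℍ) (α β : ℝ) (w : ℤ × ℤ) : ((‖latPt τ α β w‖ ^ 2 : ℝ) : ℂ) =
    ((w.2 + α) * τ.re + (w.1 + β)) ^ 2 + ((w.2 + α) * τ.im) ^ 2 := by
  rw [latPt, norm_sq_lin]; push_cast; ring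

/-- The exponents of the mixed expansion, obtained by Poisson summation in `m` alone;
`w = (l, n)` and `u` is the formal parameter. -/
def mixedExp (τ : ℍ) (α β t : ℝ) (u : ℂ) (w : ℤ × ℤ) : ℂ :=
  -Real.pi * w.1 ^ 2 * τ.im / t + 2 * Real.pi * Complex.I * w.1 *
      ((w.2 + α) * τ.re + β - u * τ.im / (2 * Real.pi * t)) -
    Real.pi * t / τ.im * ((w.2 + α) * τ.im + Complex.I * (u * τ.im / (2 * Real.pi * t))) ^ 2

/-- Poisson summation in `m` along the row `n` of the lattice. -/
theorem tsum_row_eq_mixed (τ : ℍ) (α β : ℝ) {t : ℝ} (ht : 0 < t) (u : ℂ) (n : ℤ) :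
    ∑' m : ℤ, Complex.exp (((-(Real.pi * t / τ.im) * ‖latPt τ α β (m, n)‖ ^ 2 : ℝ) : ℂ) +
        u * (starRingEnd ℂ) (latPt τ α β (m, n))) =
      (((t / τ.im) ^ (-1 / 2 : ℝ) : ℝ) : ℂ) *
        ∑' l : ℤ, Complex.exp (mixedExp τ α β t u (l, n)) := by
  have hy : 0 < τ.im := τ.im_pos
  have hy' : (τ.im : ℂ) ≠ 0 := by exact_mod_cast hy.ne'
  have ht' : (t : ℂ) ≠ 0 := by exact_mod_cast ht.ne'
  have hpi : (Real.pi : ℂ) ≠ 0 := by exact_mod_cast Real.pi_ne_zero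
  set p : ℂ := u * τ.im / (2 * Real.pi * t) with hp
  have hu : u = 2 * Real.pi * t * p / τ.im := by rw [hp]; field_simp
  set a : ℂ := (n + α) * τ.re + β - p with ha
  set D : ℂ := Real.pi * t / τ.im * ((n + α) * τ.im + Complex.I * p) ^ 2 with hD
  have h1 : ∀ m : ℤ, Complex.exp (((-(Real.pi * t / τ.im) * ‖latPt τ α β (m, n)‖ ^ 2 : ℝ) : ℂ) +
        u * (starRingEnd ℂ) (latPt τ α β (m, n))) =
      Complex.exp (-Real.pi * (t / τ.im : ℝ) * (m + a) ^ 2) * Complex.exp (-D) := fun m => by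
    rw [← Complex.exp_add, Complex.ofReal_mul, norm_sq_latPt, conj_latPt, hu, ha, hD]
    congr 1
    push_cast
    field_simp
    ring_nf
    simp only [Complex.I_sq]
    ring
  have h2 : ∀ l : ℤ, Complex.exp (mixedExp τ α β t u (l, n)) =
      Complex.exp (-Real.pi * l ^ 2 / (t / τ.im : ℝ) + 2 * Real.pi * Complex.I * l * a) *
        Complex.exp (-D) := fun l => by
    rw [← Complex.exp_add, mixedExp, ← hp, ha, hD]
    congr 1
    push_cast
    field_simp
    ring
  simp_rw [h1, h2]
  rw [tsum_mul_right, tsum_mul_right, tsum_gauss_shift (by positivity), mul_assoc]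

/-- The real part of the exponent is a negative definite quadratic form up to linear terms, which
gives absolute convergence of the mixed expansion. -/
theorem mixedExp_re_le (τ : ℍ) (α β : ℝ) {t : ℝ} (ht : 0 < t) (u : ℂ) :
    ∃ c r C : ℝ, 0 < c ∧ ∀ w : ℤ × ℤ, (mixedExp τ α β t u w).re ≤
      -c * ((w.1 + (0 : ℝ)) ^ 2 + (w.2 + α) ^ 2) + r * (|w.1 + (0 : ℝ)| + |w.2 + α|) + C := by
  have hy : 0 < τ.im := τ.im_pos
  set p : ℂ := u * τ.im / (2 * Real.pi * t) with hp
  have hpi := Real.pi_pos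
  refine ⟨min (Real.pi * τ.im / t) (Real.pi * t * τ.im),
    2 * Real.pi * |p.im| + 2 * Real.pi * t * |p.im|,
    Real.pi * t / τ.im * ((p.re) ^ 2),
    lt_min (by positivity) (by positivity), fun w => ?_⟩
  have hre : (mixedExp τ α β t u w).re = -(Real.pi * τ.im / t) * w.1 ^ 2 +
      2 * Real.pi * w.1 * p.im - Real.pi * t / τ.im * (((w.2 + α) * τ.im - p.im) ^ 2 - p.re ^ 2) := by
    have : mixedExp τ α β t u w = ((-(Real.pi * τ.im / t) * w.1 ^ 2 : ℝ) : ℂ) +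
        ((2 * Real.pi * w.1 : ℝ) : ℂ) * (Complex.I * (((w.2 + α) * τ.re + β : ℝ) - p)) -
        ((Real.pi * t / τ.im : ℝ) : ℂ) * (((w.2 + α) * τ.im : ℝ) + Complex.I * p) ^ 2 := by
      rw [mixedExp, ← hp]; push_cast; ring
    rw [this]
    simp only [Complex.add_re, Complex.sub_re, Complex.ofReal_re, sq,
      Complex.mul_re, Complex.mul_im, Complex.I_re, Complex.I_im, Complex.add_im, Complex.sub_im,
      Complex.ofReal_im]
    ring
  rw [hre]
  have e : Real.pi * t / τ.im * (((w.2 + α) * τ.im - p.im) ^ 2 - p.re ^ 2) =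
      Real.pi * t * τ.im * (w.2 + α) ^ 2 - 2 * Real.pi * t * p.im * (w.2 + α) +
      Real.pi * t / τ.im * p.im ^ 2 - Real.pi * t / τ.im * p.re ^ 2 := by
    field_simp
    ring
  rw [e]
  have h1 : min (Real.pi * τ.im / t) (Real.pi * t * τ.im) * (w.1 : ℝ) ^ 2 ≤
      Real.pi * τ.im / t * (w.1 : ℝ) ^ 2 :=
    mul_le_mul_of_nonneg_right (min_le_left _ _) (sq_nonneg _)
  have h2 : min (Real.pi * τ.im / t) (Real.pi * t * τ.im) * (w.2 + α : ℝ) ^ 2 ≤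
      Real.pi * t * τ.im * (w.2 + α : ℝ) ^ 2 :=
    mul_le_mul_of_nonneg_right (min_le_right _ _) (sq_nonneg _)
  have h3 : 2 * Real.pi * w.1 * p.im ≤ 2 * Real.pi * |p.im| * |(w.1 : ℝ)| := by
    have := (le_abs_self (w.1 * p.im)).trans (abs_mul _ _).le
    nlinarith
  have h4 : 2 * Real.pi * t * p.im * (w.2 + α) ≤ 2 * Real.pi * t * |p.im| * |w.2 + α| := by
    have := (le_abs_self (p.im * (w.2 + α))).trans (abs_mul _ _).le
    have h5 : 0 < 2 * Real.pi * t := by positivity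
    nlinarith
  have h6 : 0 ≤ Real.pi * t / τ.im * p.im ^ 2 := by positivity
  have h7 : 0 ≤ 2 * Real.pi * |p.im| * |w.2 + α| := by positivity
  have h8 : 0 ≤ 2 * Real.pi * t * |p.im| * |(w.1 : ℝ)| := by positivity
  rw [add_zero]
  linarith

theorem summable_exp_mixed (τ : ℍ) (α β : ℝ) {t : ℝ} (ht : 0 < t) (u : ℂ) :
    Summable fun w => Complex.exp (mixedExp τ α β t u w) := by
  obtain ⟨c, r, C, hc, h⟩ := mixedExp_re_le τ α β ht u
  exact summable_cexp_of_re_le hc 0 α r C h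

/-- Poisson summation in `n` along a column of the mixed expansion; it produces the terms of the
dual lattice sum in the order `j ↦ -j`. -/
theorem tsum_column_eq_dual (τ : ℍ) (α β : ℝ) {t : ℝ} (ht : 0 < t) (u : ℂ) (l : ℤ) :
    ∑' n : ℤ, Complex.exp (mixedExp τ α β t u (l, n)) =
      (((t * τ.im) ^ (-1 / 2 : ℝ) : ℝ) : ℂ) *
        ∑' j : ℤ, Complex.exp (charExp α β (-j, l) - ((Real.pi / (t * τ.im) *
          ‖latPt τ 0 0 (-j, l)‖ ^ 2 : ℝ) : ℂ) +
            u * ((starRingEnd ℂ) (latPt τ 0 0 (-j, l)) / t)) := by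
  have hy : 0 < τ.im := τ.im_pos
  have hy' : (τ.im : ℂ) ≠ 0 := by exact_mod_cast hy.ne'
  have ht' : (t : ℂ) ≠ 0 := by exact_mod_cast ht.ne'
  have hpi : (Real.pi : ℂ) ≠ 0 := by exact_mod_cast Real.pi_ne_zero
  set p : ℂ := u * τ.im / (2 * Real.pi * t) with hp
  have hu : u = 2 * Real.pi * t * p / τ.im := by rw [hp]; field_simp
  set e : ℂ := p / τ.im - l * τ.re / (t * τ.im) with he
  set D : ℂ := -Real.pi * t * τ.im * e ^ 2 - Real.pi * l ^ 2 * τ.im / t +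
    2 * Real.pi * Complex.I * l * (β - p) + Real.pi * t / τ.im * p ^ 2 with hD
  have h1 : ∀ n : ℤ, Complex.exp (mixedExp τ α β t u (l, n)) =
      Complex.exp (-Real.pi * (t * τ.im : ℝ) * (n + (α + Complex.I * e)) ^ 2) * Complex.exp D :=
    fun n => by
    rw [← Complex.exp_add, mixedExp, ← hp, hD, he]
    congr 1
    push_cast
    field_simp
    ring_nf
    simp only [Complex.I_sq]
    ring
  have h2 : ∀ j : ℤ, Complex.exp (charExp α β (-j, l) - ((Real.pi / (t * τ.im) *
          ‖latPt τ 0 0 (-j, l)‖ ^ 2 : ℝ) : ℂ) +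
            u * ((starRingEnd ℂ) (latPt τ 0 0 (-j, l)) / t)) =
      Complex.exp (-Real.pi * j ^ 2 / (t * τ.im : ℝ) +
        2 * Real.pi * Complex.I * j * (α + Complex.I * e)) * Complex.exp D := fun j => by
    rw [← Complex.exp_add, charExp, Complex.ofReal_mul, norm_sq_latPt, conj_latPt, hu, hD, he]
    congr 1
    push_cast
    field_simp
    ring_nf
    simp only [Complex.I_sq]
    ring
  simp_rw [h1, h2]
  rw [tsum_mul_right, tsum_mul_right, tsum_gauss_shift (by positivity), mul_assoc]

theorem summable_exp_shift (τ : ℍ) (α β : ℝ) {t : ℝ} (ht : 0 < t) (u : ℂ) :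
    Summable fun w => Complex.exp (((-(Real.pi * t / τ.im) * ‖latPt τ α β w‖ ^ 2 : ℝ) : ℂ) +
        u * (starRingEnd ℂ) (latPt τ α β w)) := by
  have hy : 0 < τ.im := τ.im_pos
  refine Summable.of_norm_bounded
    (summable_exp_latPt τ α β (t := Real.pi * t / τ.im) (by positivity) ‖u‖) fun w => ?_
  rw [Complex.norm_exp, Real.exp_le_exp, Complex.add_re, Complex.ofReal_re]
  gcongr
  exact (Complex.re_le_norm _).trans (by rw [norm_mul, RCLike.norm_conj])

theorem charExp_re (α β : ℝ) (w : ℤ × ℤ) : (charExp α β w).re = 0 := by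
  have : charExp α β w = ((2 * Real.pi * (w.2 * β - w.1 * α) : ℝ) : ℂ) * Complex.I := by
    rw [charExp]; push_cast; ring
  rw [this]; simp

theorem summable_exp_dual (τ : ℍ) (α β : ℝ) {t : ℝ} (ht : 0 < t) (u : ℂ) :
    Summable fun w => Complex.exp (charExp α β w - ((Real.pi / (t * τ.im) *
          ‖latPt τ 0 0 w‖ ^ 2 : ℝ) : ℂ) + u * ((starRingEnd ℂ) (latPt τ 0 0 w) / t)) := by
  have hy : 0 < τ.im := τ.im_pos
  refine Summable.of_norm_bounded
    (summable_exp_latPt τ 0 0 (t := Real.pi / (t * τ.im)) (by positivity) (‖u‖ / t)) fun w => ?_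
  rw [Complex.norm_exp, Real.exp_le_exp, Complex.add_re, Complex.sub_re, Complex.ofReal_re,
    charExp_re, zero_sub, neg_mul]
  gcongr
  refine (Complex.re_le_norm _).trans (le_of_eq ?_)
  rw [norm_mul, norm_div, RCLike.norm_conj, Complex.norm_real, Real.norm_of_nonneg ht.le]
  ring

theorem tsum_shift_eq_mixed (τ : ℍ) (α β : ℝ) {t : ℝ} (ht : 0 < t) (u : ℂ) :
    ∑' w, Complex.exp (((-(Real.pi * t / τ.im) * ‖latPt τ α β w‖ ^ 2 : ℝ) : ℂ) +
        u * (starRingEnd ℂ) (latPt τ α β w)) =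
      (((t / τ.im) ^ (-1 / 2 : ℝ) : ℝ) : ℂ) * ∑' w, Complex.exp (mixedExp τ α β t u w) := by
  have h1 := summable_exp_shift τ α β ht u
  have h2 := summable_exp_mixed τ α β ht u
  rw [← (Equiv.prodComm ℤ ℤ).tsum_eq, ← (Equiv.prodComm ℤ ℤ).tsum_eq
    (fun w => Complex.exp (mixedExp τ α β t u w)),
    Summable.tsum_prod (f := fun c => Complex.exp (_ + _))
      ((Equiv.prodComm ℤ ℤ).summable_iff.2 h1),
    Summable.tsum_prod (f := fun c => Complex.exp (mixedExp _ _ _ _ _ _))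
      ((Equiv.prodComm ℤ ℤ).summable_iff.2 h2), ← tsum_mul_left]
  exact tsum_congr fun n => tsum_row_eq_mixed τ α β ht u n

/-- The functional equation of the generating series of the theta series: two-dimensional
Poisson summation, carried out one variable at a time. -/
theorem tsum_shift_eq_dual (τ : ℍ) (α β : ℝ) {t : ℝ} (ht : 0 < t) (u : ℂ) :
    ∑' w, Complex.exp (((-(Real.pi * t / τ.im) * ‖latPt τ α β w‖ ^ 2 : ℝ) : ℂ) +
        u * (starRingEnd ℂ) (latPt τ α β w)) =
      (t⁻¹ : ℂ) * ∑' w, Complex.exp (charExp α β w - ((Real.pi / (t * τ.im) *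
          ‖latPt τ 0 0 w‖ ^ 2 : ℝ) : ℂ) + u * ((starRingEnd ℂ) (latPt τ 0 0 w) / t)) := by
  have hy : 0 < τ.im := τ.im_pos
  rw [tsum_shift_eq_mixed τ α β ht u, Summable.tsum_prod (summable_exp_mixed τ α β ht u)]
  simp_rw [tsum_column_eq_dual τ α β ht u]
  rw [tsum_mul_left, ← mul_assoc, ← Complex.ofReal_mul,
    Real.div_rpow ht.le hy.le, Real.mul_rpow ht.le hy.le]
  have e1 : t ^ (-1 / 2 : ℝ) / τ.im ^ (-1 / 2 : ℝ) * (t ^ (-1 / 2 : ℝ) * τ.im ^ (-1 / 2 : ℝ)) =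
      t⁻¹ := by
    have : τ.im ^ (-1 / 2 : ℝ) ≠ 0 := (Real.rpow_pos_of_pos hy _).ne'
    field_simp
    rw [← Real.rpow_natCast, ← Real.rpow_mul ht.le]
    norm_num [Real.rpow_neg_one]
    exact inv_mul_cancel₀ ht.ne'
  rw [e1, Complex.ofReal_inv]
  congr 1
  set f : ℤ × ℤ → ℂ := fun w => Complex.exp (charExp α β w - ((Real.pi / (t * τ.im) *
          ‖latPt τ 0 0 w‖ ^ 2 : ℝ) : ℂ) + u * ((starRingEnd ℂ) (latPt τ 0 0 w) / t)) with hf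
  have hs : Summable f := summable_exp_dual τ α β ht u
  let e : ℤ × ℤ ≃ ℤ × ℤ := (Equiv.prodComm ℤ ℤ).trans ((Equiv.neg ℤ).prodCongr (Equiv.refl ℤ))
  exact ((e.tsum_eq f).symm.trans (Summable.tsum_prod (e.summable_iff.2 hs))).symm

/-- The theta series `∑ conj(ω + z)^k exp(-πt|ω + z|²/y)` attached to `z = ατ + β`. -/
def thetaE (k : ℕ) (τ : ℍ) (α β t : ℝ) : ℂ :=
  ∑' w : ℤ × ℤ, (starRingEnd ℂ) (latPt τ α β w) ^ k *
    (Real.exp (-(Real.pi / τ.im * ‖latPt τ α β w‖ ^ 2) * t) : ℝ)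

/-- The theta series `∑ χ(ω) conj(ω)^k exp(-πt|ω|²/y)`, where `χ` is the character of the lattice
attached to `u = ατ + β`. -/
def thetaF (k : ℕ) (τ : ℍ) (α β t : ℝ) : ℂ :=
  ∑' w : ℤ × ℤ, (Complex.exp (charExp α β w) * (starRingEnd ℂ) (latPt τ 0 0 w) ^ k) *
    (Real.exp (-(Real.pi / τ.im * ‖latPt τ 0 0 w‖ ^ 2) * t) : ℝ)

theorem summable_pow_mul_latPt (k : ℕ) (τ : ℍ) (α β : ℝ) {t : ℝ} (ht : 0 < t) :
    Summable fun w : ℤ × ℤ => ‖(starRingEnd ℂ) (latPt τ α β w) ^ k‖ *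
      Real.exp (-(Real.pi / τ.im * ‖latPt τ α β w‖ ^ 2) * t) := by
  have hy : 0 < τ.im := τ.im_pos
  refine Summable.of_nonneg_of_le (fun _ => by positivity) (fun w => ?_)
    ((summable_exp_latPt τ α β (t := Real.pi * t / τ.im) (by positivity) 1).mul_left
      (k.factorial : ℝ))
  have h1 : ‖latPt τ α β w‖ ^ k ≤ k.factorial * Real.exp ‖latPt τ α β w‖ := by
    have := Real.pow_div_factorial_le_exp ‖latPt τ α β w‖ (norm_nonneg _) k
    rwa [div_le_iff₀ (by positivity), mul_comm] at this
  rw [norm_pow, RCLike.norm_conj]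
  calc _ ≤ (k.factorial * Real.exp ‖latPt τ α β w‖) *
        Real.exp (-(Real.pi / τ.im * ‖latPt τ α β w‖ ^ 2) * t) := by gcongr
    _ = _ := by rw [mul_assoc, ← Real.exp_add]; congr 2; ring

/-- The functional equation `thetaE (1 / t) = t^{k+1} thetaF t`, in the form required by
`WeakFEPair`: the coefficient of `u^k / k!` in `tsum_shift_eq_dual`. -/
theorem thetaE_eq_thetaF (k : ℕ) (τ : ℍ) (α β : ℝ) {t : ℝ} (ht : 0 < t) :
    thetaE k τ α β (1 / t) = ((1 : ℂ) * ((t ^ ((k : ℝ) + 1) : ℝ) : ℂ)) • thetaF k τ α β t := by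
  have hy : 0 < τ.im := τ.im_pos
  have ht' : 0 < 1 / t := by positivity
  have h := tsum_pow_mul_exp_eq (c := (((1 / t : ℝ) : ℂ)⁻¹))
    (A := fun w => ((-(Real.pi * (1 / t) / τ.im) * ‖latPt τ α β w‖ ^ 2 : ℝ) : ℂ))
    (B := fun w => (starRingEnd ℂ) (latPt τ α β w))
    (A' := fun w => charExp α β w - ((Real.pi / ((1 / t) * τ.im) *
          ‖latPt τ 0 0 w‖ ^ 2 : ℝ) : ℂ))
    (B' := fun w => (starRingEnd ℂ) (latPt τ 0 0 w) / ((1 / t : ℝ) : ℂ))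
    (fun r => by
      simp only [Complex.ofReal_re, RCLike.norm_conj]
      exact summable_exp_latPt τ α β (by positivity) r)
    (fun r => by
      refine (summable_exp_latPt τ 0 0 (t := Real.pi / ((1 / t) * τ.im)) (by positivity)
        (r * t)).congr fun w => ?_
      rw [Complex.sub_re, charExp_re, Complex.ofReal_re, norm_div, RCLike.norm_conj,
        Complex.norm_real, Real.norm_of_nonneg ht'.le]
      congr 1
      field_simp
      ring)
    (fun u => tsum_shift_eq_dual τ α β ht' u) k 0
  simp only [zero_mul, add_zero] at h
  rw [thetaE, thetaF, smul_eq_mul, one_mul]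
  convert h using 1
  · refine tsum_congr fun w => ?_
    rw [← Complex.ofReal_exp]
    congr 3
    field_simp
  · rw [← tsum_mul_left, ← tsum_mul_left]
    refine tsum_congr fun w => ?_
    rw [Complex.exp_sub, Complex.ofReal_exp, neg_mul, Complex.ofReal_neg, Complex.exp_neg]
    have e1 : ((t ^ ((k : ℝ) + 1) : ℝ) : ℂ) = (t : ℂ) ^ (k + 1) := by
      rw [← Complex.ofReal_pow, ← Real.rpow_natCast]; push_cast; rfl
    have e2 : Real.pi / (1 / t * τ.im) * ‖latPt τ 0 0 w‖ ^ 2 =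
        Real.pi / τ.im * ‖latPt τ 0 0 w‖ ^ 2 * t := by field_simp
    rw [e1, e2]
    push_cast
    rw [one_div, inv_inv, div_inv_eq_mul, mul_pow]
    ring

/-! ### Decay, and Mellin transforms -/

theorem continuousOn_expSum {ι : Type*} {a : ι → ℂ} {p : ι → ℝ} (hp : ∀ i, 0 ≤ p i)
    (h : ∀ t : ℝ, 0 < t → Summable fun i => ‖a i‖ * Real.exp (-p i * t)) :
    ContinuousOn (fun t : ℝ => ∑' i, a i * (Real.exp (-p i * t) : ℝ)) (Set.Ioi 0) := by
  intro t₀ ht₀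
  have ht₀' : 0 < t₀ := ht₀
  have hc : ContinuousOn (fun t : ℝ => ∑' i, a i * (Real.exp (-p i * t) : ℝ))
      (Set.Ioi (t₀ / 2)) := by
    refine continuousOn_tsum (fun i => ?_) (h (t₀ / 2) (by positivity)) fun i t ht => ?_
    · fun_prop
    · rw [norm_mul, Complex.norm_real, Real.norm_of_nonneg (Real.exp_pos _).le]
      have ht' : t₀ / 2 ≤ t := (Set.mem_Ioi.1 ht).le
      refine mul_le_mul_of_nonneg_left (Real.exp_le_exp.2 ?_) (norm_nonneg _)
      have := mul_le_mul_of_nonneg_left ht' (hp i)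
      linarith
  exact (hc.continuousAt (Ioi_mem_nhds (by linarith))).continuousWithinAt

/-- An exponential series whose nonzero terms have exponents bounded below by a positive constant
decays rapidly. -/
theorem isBigO_expSum {ι : Type*} {a : ι → ℂ} {p : ι → ℝ}
    (h : ∀ t : ℝ, 0 < t → Summable fun i => ‖a i‖ * Real.exp (-p i * t))
    {δ : ℝ} (hδ : 0 < δ) (hp : ∀ i, a i = 0 ∨ δ ≤ p i) (r : ℝ) :
    (fun t : ℝ => ∑' i, a i * (Real.exp (-p i * t) : ℝ)) =O[Filter.atTop] (fun t => t ^ r) := by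
  refine Asymptotics.IsBigO.trans ?_ (isLittleO_exp_neg_mul_rpow_atTop hδ r).isBigO
  refine Asymptotics.IsBigO.of_bound (Real.exp δ * ∑' i, ‖a i‖ * Real.exp (-p i * 1)) ?_
  filter_upwards [Filter.eventually_ge_atTop 1] with t ht
  rw [Real.norm_of_nonneg (Real.exp_pos _).le, mul_right_comm, ← tsum_mul_left]
  refine tsum_of_norm_bounded (((h 1 one_pos).mul_left _).hasSum) fun i => ?_
  rw [norm_mul, Complex.norm_real, Real.norm_of_nonneg (Real.exp_pos _).le, mul_left_comm,
    ← Real.exp_add, ← Real.exp_add]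
  rcases hp i with h0 | h0
  · simp [h0]
  · gcongr
    nlinarith

/-- The nonzero points of a translated lattice are bounded away from `0`. -/
theorem exists_min_norm_latPt (τ : ℍ) (α β : ℝ) :
    ∃ δ : ℝ, 0 < δ ∧ ∀ w, latPt τ α β w = 0 ∨ δ ≤ ‖latPt τ α β w‖ ^ 2 := by
  have h := (summable_exp_latPt τ α β one_pos 0).tendsto_cofinite_zero
  have hf : {w | ‖latPt τ α β w‖ ^ 2 ≤ 1}.Finite := by
    have := h.eventually (gt_mem_nhds (Real.exp_pos (-1)))
    rw [Filter.eventually_cofinite] at this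
    refine this.subset fun w hw => ?_
    simp only [Set.mem_ofPred_eq, not_lt, Real.exp_le_exp] at hw ⊢
    linarith
  set S := hf.toFinset.filter fun w => latPt τ α β w ≠ 0 with hS
  rcases S.eq_empty_or_nonempty with he | hne
  · refine ⟨1, one_pos, fun w => ?_⟩
    by_contra! hw
    have : w ∈ S := Finset.mem_filter.2 ⟨hf.mem_toFinset.2 hw.2.le, hw.1⟩
    simp [he] at this
  · obtain ⟨w₀, hw₀, hmin⟩ := S.exists_min_image (fun w => ‖latPt τ α β w‖ ^ 2) hne
    have h0 : latPt τ α β w₀ ≠ 0 := (Finset.mem_filter.1 hw₀).2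
    have h1 : ‖latPt τ α β w₀‖ ^ 2 ≤ 1 := by simpa using (Finset.mem_filter.1 hw₀).1
    refine ⟨‖latPt τ α β w₀‖ ^ 2, by positivity, fun w => ?_⟩
    by_contra! hw
    have : w ∈ S := Finset.mem_filter.2 ⟨hf.mem_toFinset.2 (hw.2.trans_le h1).le, hw.1⟩
    exact absurd (hmin w this) (not_le.2 hw.2)

theorem summable_thetaF (k : ℕ) (τ : ℍ) (α β : ℝ) {t : ℝ} (ht : 0 < t) :
    Summable fun w : ℤ × ℤ =>
      ‖Complex.exp (charExp α β w) * (starRingEnd ℂ) (latPt τ 0 0 w) ^ k‖ *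
      Real.exp (-(Real.pi / τ.im * ‖latPt τ 0 0 w‖ ^ 2) * t) := by
  refine (summable_pow_mul_latPt k τ 0 0 ht).congr fun w => ?_
  rw [norm_mul, Complex.norm_exp, charExp_re, Real.exp_zero, one_mul]

theorem exists_min_exponent {k : ℕ} (hk : 1 ≤ k) (τ : ℍ) (α β : ℝ) : ∃ δ : ℝ, 0 < δ ∧
    ∀ w, (starRingEnd ℂ) (latPt τ α β w) ^ k = 0 ∨ δ ≤ Real.pi / τ.im * ‖latPt τ α β w‖ ^ 2 := by
  have hy : 0 < τ.im := τ.im_pos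
  have hpi := Real.pi_pos
  obtain ⟨δ, hδ, h⟩ := exists_min_norm_latPt τ α β
  refine ⟨Real.pi / τ.im * δ, by positivity, fun w => (h w).imp (fun h => ?_) fun h => ?_⟩
  · rw [h]; simp; omega
  · gcongr

/-- The two theta series form a strong functional equation pair of weight `k + 1`. -/
def thetaPair {k : ℕ} (hk : 1 ≤ k) (τ : ℍ) (α β : ℝ) : WeakFEPair ℂ where
  f := thetaE k τ α β
  g := thetaF k τ α β
  k := k + 1
  ε := 1
  f₀ := 0
  g₀ := 0
  hf_int := (continuousOn_expSum (fun w => by have := τ.im_pos; positivity)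
    fun t ht => summable_pow_mul_latPt k τ α β ht).locallyIntegrableOn measurableSet_Ioi
  hg_int := (continuousOn_expSum (fun w => by have := τ.im_pos; positivity)
    fun t ht => summable_thetaF k τ α β ht).locallyIntegrableOn measurableSet_Ioi
  hk := by positivity
  hε := one_ne_zero
  h_feq x hx := thetaE_eq_thetaF k τ α β hx
  hf_top r := by
    obtain ⟨δ, hδ, h⟩ := exists_min_exponent hk τ α β
    simp only [sub_zero]
    exact isBigO_expSum (fun t ht => summable_pow_mul_latPt k τ α β ht) hδ h r
  hg_top r := by
    obtain ⟨δ, hδ, h⟩ := exists_min_exponent hk τ 0 0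
    simp only [sub_zero]
    exact isBigO_expSum (fun t ht => summable_thetaF k τ α β ht) hδ
      (fun w => (h w).imp_left fun h => by rw [h, mul_zero]) r

theorem isStrongFEPair_thetaPair {k : ℕ} (hk : 1 ≤ k) (τ : ℍ) (α β : ℝ) :
    IsStrongFEPair (thetaPair hk τ α β) := ⟨rfl, rfl⟩

theorem mellinConvergent_thetaE {k : ℕ} (hk : 1 ≤ k) (τ : ℍ) (α β : ℝ) (s : ℂ) :
    MellinConvergent (thetaE k τ α β) s :=
  ((isStrongFEPair_thetaPair hk τ α β).hasMellin s).1

theorem differentiable_mellin_thetaE {k : ℕ} (hk : 1 ≤ k) (τ : ℍ) (α β : ℝ) :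
    Differentiable ℂ (mellin (thetaE k τ α β)) := by
  have h := isStrongFEPair_thetaPair hk τ α β
  have := h.differentiable_Λ
  rwa [h.Λ_eq] at this

theorem differentiable_mellin_thetaF {k : ℕ} (hk : 1 ≤ k) (τ : ℍ) (α β : ℝ) :
    Differentiable ℂ (mellin (thetaF k τ α β)) := by
  have h := (isStrongFEPair_thetaPair hk τ α β).symm
  have := h.differentiable_Λ
  rwa [h.Λ_eq] at this

/-- The functional equation of the Mellin transforms; it expresses `F` in terms of the same theta
series as `E`. -/
theorem mellin_thetaF_eq {k : ℕ} (hk : 1 ≤ k) (τ : ℍ) (α β : ℝ) (s : ℂ) :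
    mellin (thetaF k τ α β) s = mellin (thetaE k τ α β) (k + 1 - s) := by
  have h := isStrongFEPair_thetaPair hk τ α β
  have h1 := (thetaPair hk τ α β).functional_equation s
  rw [h.Λ_eq, h.symm_Λ_eq] at h1
  simp only [thetaPair, one_smul] at h1
  rw [← h1]
  congr 1
  push_cast
  ring

/-! ### The Eisenstein-Kronecker series as Mellin transforms -/

/-- An entire function that agrees with the series in its half plane of convergence is `H`. -/
theorem H_eq {k : ℕ} {τ : ℍ} {z u : ℂ} {h : ℂ → ℂ} (hd : Differentiable ℂ h)
    (he : ∀ s : ℂ, 1 + (k : ℝ) / 2 < s.re → h s = ekSeries k τ z u s) (s : ℂ) :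
    H k s τ z u = h s := by
  have hex : ∃ h : ℂ → ℂ, Differentiable ℂ h ∧
      ∀ s : ℂ, 1 + (k : ℝ) / 2 < s.re → h s = ekSeries k τ z u s := ⟨h, hd, he⟩
  rw [H, dif_pos hex]
  obtain ⟨h1, h2⟩ := hex.choose_spec
  have hmem : (2 + k : ℂ) ∈ {s : ℂ | 1 + (k : ℝ) / 2 < s.re} := by
    simp only [Set.mem_ofPred_eq, Complex.add_re, Complex.re_ofNat, Complex.natCast_re]
    have : (0 : ℝ) ≤ k := k.cast_nonneg
    linarith
  have := AnalyticOnNhd.eq_of_eventuallyEq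
    (f := hex.choose) (g := h) (z₀ := (2 + k : ℂ))
    (h1.differentiableOn.analyticOnNhd isOpen_univ) (hd.differentiableOn.analyticOnNhd isOpen_univ)
    (Filter.eventually_of_mem
      ((isOpen_lt continuous_const Complex.continuous_re).mem_nhds hmem)
      fun s hs => (h2 s hs).trans (he s hs).symm)
  exact congrFun this s

theorem exists_common_denom (α β : ℚ) : ∃ (N : ℕ) (a b : ℤ), 1 ≤ N ∧ α = a / N ∧ β = b / N := by
  refine ⟨α.den * β.den, α.num * β.den, β.num * α.den,
    Nat.mul_pos α.den_pos β.den_pos, ?_, ?_⟩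
  · have h1 : (α.den : ℚ) ≠ 0 := by exact_mod_cast α.den_nz
    have h2 : (β.den : ℚ) ≠ 0 := by exact_mod_cast β.den_nz
    conv_lhs => rw [← Rat.num_div_den α]
    push_cast; field_simp
  · have h1 : (α.den : ℚ) ≠ 0 := by exact_mod_cast α.den_nz
    have h2 : (β.den : ℚ) ≠ 0 := by exact_mod_cast β.den_nz
    conv_lhs => rw [← Rat.num_div_den β]
    push_cast; field_simp

/-- Lattice points shifted by a rational point are lattice points up to a common denominator. -/
theorem summable_norm_latPt_rpow (τ : ℍ) (α β : ℚ) {r : ℝ} (hr : 2 < r) :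
    Summable fun w : ℤ × ℤ => ‖latPt τ α β w‖ ^ (-r) := by
  obtain ⟨N, a, b, hN, rfl, rfl⟩ := exists_common_denom α β
  have hN0 : (0 : ℝ) < N := by exact_mod_cast hN
  have h1 : Summable fun x : Fin 2 → ℤ => ‖(x 0 * (τ : ℂ) + x 1)‖ ^ (-r) := by
    refine Summable.of_nonneg_of_le (fun x => by positivity)
      (fun x => EisensteinSeries.summand_bound τ (by linarith) x)
      ((EisensteinSeries.summable_one_div_norm_rpow hr).mul_left _)
  have hinj : Function.Injective fun w : ℤ × ℤ => ![N * w.2 + a, N * w.1 + b] := by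
    intro w w' h
    have e0 := congrFun h 0
    have e1 := congrFun h 1
    have hN' : (N : ℤ) ≠ 0 := by positivity
    simp only [Matrix.cons_val_zero, Matrix.cons_val_one, add_left_inj, mul_eq_mul_left_iff, hN',
      or_false] at e0 e1
    exact Prod.ext e1 e0
  refine ((h1.comp_injective hinj).mul_left ((N : ℝ)⁻¹ ^ (-r))).congr fun w => ?_
  have e : latPt τ ((a / N : ℚ) : ℝ) ((b / N : ℚ) : ℝ) w =
      (((N : ℝ)⁻¹ : ℝ) : ℂ) * (((N * w.2 + a : ℤ) : ℂ) * τ + ((N * w.1 + b : ℤ) : ℂ)) := by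
    have : (N : ℂ) ≠ 0 := by exact_mod_cast hN0.ne'
    rw [latPt]; push_cast; field_simp
  rw [e, norm_mul, Complex.norm_real, Real.norm_of_nonneg (by positivity),
    Real.mul_rpow (by positivity) (norm_nonneg _)]
  simp

/-- The normalising factor `(-2iy)^{-k}`. -/
def normFac (k : ℕ) (τ : ℍ) : ℂ := ((-2 * Complex.I * τ.im) ^ k)⁻¹

/-- The factor in front of the Eisenstein-Kronecker series is `normFac k τ` times the factor `Γ(s)
(y / π)^s` of the Mellin transform of `exp(-πt|ω|² / y)`. -/
theorem ek_factor (k : ℕ) (τ : ℍ) (s : ℂ) :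
    Complex.Gamma s / (-2 * Complex.I * Real.pi) ^ k *
      (((τ : ℂ) - (starRingEnd ℂ) τ) / (2 * Complex.I * Real.pi)) ^ (s - k) =
    normFac k τ * (Complex.Gamma s * ((τ.im / Real.pi : ℝ) : ℂ) ^ s) := by
  have hy : 0 < τ.im := τ.im_pos
  have hpi := Real.pi_pos
  have h1 : ((τ : ℂ) - (starRingEnd ℂ) τ) / (2 * Complex.I * Real.pi) =
      ((τ.im / Real.pi : ℝ) : ℂ) := by
    have : (Real.pi : ℂ) ≠ 0 := by exact_mod_cast hpi.ne'
    rw [coe_eq_re_add_im, ← coe_eq_re_add_im, conj_coe_eq, coe_eq_re_add_im]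
    push_cast
    field_simp
    ring
  have h2 : ((τ.im / Real.pi : ℝ) : ℂ) ≠ 0 := by
    exact_mod_cast (by positivity : τ.im / Real.pi ≠ 0)
  have h3 : (Real.pi : ℂ) ≠ 0 := by exact_mod_cast hpi.ne'
  have h4 : (τ.im : ℂ) ≠ 0 := by exact_mod_cast hy.ne'
  rw [h1, Complex.cpow_sub _ _ h2, Complex.cpow_natCast, normFac]
  push_cast
  rw [div_pow, mul_pow, mul_pow (-2 * Complex.I) (τ.im : ℂ)]
  field_simp

theorem div_cpow_mul_sq (τ : ℍ) (s w : ℂ) (hw : w ≠ 0) (A : ℂ) :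
    A / (((Real.pi / τ.im * ‖w‖ ^ 2 : ℝ)) : ℂ) ^ s =
      ((τ.im / Real.pi : ℝ) : ℂ) ^ s * (A / ((‖w‖ : ℝ) : ℂ) ^ (2 * s)) := by
  have hy : 0 < τ.im := τ.im_pos
  have hpi := Real.pi_pos
  have hw' : 0 < ‖w‖ := norm_pos_iff.2 hw
  have h0 : ((‖w‖ : ℝ) : ℂ) ≠ 0 := by exact_mod_cast hw'.ne'
  rw [sq, Complex.ofReal_mul, Complex.mul_cpow_ofReal_nonneg (by positivity) (by positivity),
    Complex.ofReal_mul, Complex.mul_cpow_ofReal_nonneg (by positivity) (by positivity),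
    two_mul, Complex.cpow_add _ _ h0]
  have h1 : ((τ.im / Real.pi : ℝ) : ℂ) ^ s * ((Real.pi / τ.im : ℝ) : ℂ) ^ s = 1 := by
    rw [← Complex.mul_cpow_ofReal_nonneg (by positivity) (by positivity), ← Complex.ofReal_mul]
    have : τ.im / Real.pi * (Real.pi / τ.im) = 1 := by field_simp
    rw [this]; simp
  have h2 : ((Real.pi / τ.im : ℝ) : ℂ) ^ s ≠ 0 := right_ne_zero_of_mul_eq_one h1
  have h3 : ((‖w‖ : ℝ) : ℂ) ^ s ≠ 0 := by simp [Complex.cpow_eq_zero_iff, hw]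
  field_simp
  rw [mul_comm] at h1
  rw [mul_assoc, h1, mul_one]

theorem summable_mellin_coeff {k : ℕ} (hk : 1 ≤ k) (τ : ℍ) (α β : ℚ) {σ : ℝ}
    (hσ : 1 + (k : ℝ) / 2 < σ) :
    Summable fun w : ℤ × ℤ => ‖latPt τ α β w‖ ^ k / (Real.pi / τ.im * ‖latPt τ α β w‖ ^ 2) ^ σ := by
  have hy : 0 < τ.im := τ.im_pos
  have hpi := Real.pi_pos
  refine ((summable_norm_latPt_rpow τ α β (r := 2 * σ - k) (by linarith)).mul_left
    ((Real.pi / τ.im) ^ (-σ))).congr fun w => ?_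
  rcases (norm_nonneg (latPt τ α β w)).eq_or_lt' with h | h
  · rw [h, Real.zero_rpow (by linarith), zero_pow (by omega)]; simp
  · have hC : 0 < Real.pi / τ.im := by positivity
    generalize Real.pi / τ.im = C at hC
    rw [Real.mul_rpow hC.le (by positivity), div_eq_mul_inv, mul_inv,
      ← Real.rpow_neg (by positivity), ← Real.rpow_neg (by positivity), ← Real.rpow_natCast,
      ← Real.rpow_natCast, ← Real.rpow_mul h.le, neg_sub, mul_left_comm, ← Real.rpow_add h]
    congr 2
    push_cast; ring

/-- `E` is the value at `s = k` of the Mellin transform of `thetaE`. -/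
theorem E_eq_mellin {k : ℕ} (hk : 1 ≤ k) (α β : ℚ) (τ : ℍ) :
    E k α β τ = normFac k τ * mellin (thetaE k τ α β) k := by
  have hy : 0 < τ.im := τ.im_pos
  have hpi := Real.pi_pos
  refine H_eq (h := fun s => normFac k τ * mellin (thetaE k τ α β) s)
    ((differentiable_mellin_thetaE hk τ α β).const_mul _) (fun s hs => ?_) k
  have hp : ∀ w, (starRingEnd ℂ) (latPt τ α β w) ^ k = 0 ∨
      0 < Real.pi / τ.im * ‖latPt τ α β w‖ ^ 2 := fun w => by
    obtain ⟨δ, hδ, h⟩ := exists_min_exponent hk τ α β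
    exact (h w).imp_right hδ.trans_le
  have hs0 : 0 < s.re := by have : (0 : ℝ) ≤ k := k.cast_nonneg; linarith
  have hm := hasSum_mellin hp hs0
    (fun t ht => (Summable.of_norm_bounded (summable_pow_mul_latPt k τ α β ht) fun w => by
      rw [norm_mul, Complex.norm_real, Real.norm_of_nonneg (Real.exp_pos _).le]).hasSum)
    ((summable_mellin_coeff hk τ α β hs).congr fun w => by rw [norm_pow, RCLike.norm_conj])
  change normFac k τ * mellin (thetaE k τ α β) s = _
  rw [ekSeries, ek_factor, mul_assoc, ← tsum_mul_left]
  refine congrArg _ (hm.tsum_eq.symm.trans (tsum_congr fun w => ?_))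
  have e : ((w.1 : ℂ) + w.2 * τ + (α * τ + β)) = latPt τ α β w := by
    rw [latPt]; push_cast; ring
  simp only [e]
  split_ifs with h0
  · rw [h0]; simp [show k ≠ 0 by omega]
  · rw [mul_div_assoc, div_cpow_mul_sq τ s _ h0]
    simp
    ring

theorem F_eq_mellin_thetaF {k : ℕ} (hk : 1 ≤ k) (α β : ℚ) (τ : ℍ) :
    F k α β τ = normFac k τ * mellin (thetaF k τ α β) k := by
  have hy : 0 < τ.im := τ.im_pos
  have hpi := Real.pi_pos
  refine H_eq (h := fun s => normFac k τ * mellin (thetaF k τ α β) s)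
    ((differentiable_mellin_thetaF hk τ α β).const_mul _) (fun s hs => ?_) k
  have hp : ∀ w, Complex.exp (charExp α β w) * (starRingEnd ℂ) (latPt τ 0 0 w) ^ k = 0 ∨
      0 < Real.pi / τ.im * ‖latPt τ 0 0 w‖ ^ 2 := fun w => by
    obtain ⟨δ, hδ, h⟩ := exists_min_exponent hk τ 0 0
    exact (h w).imp (fun h => by rw [h, mul_zero]) hδ.trans_le
  have hs0 : 0 < s.re := by have : (0 : ℝ) ≤ k := k.cast_nonneg; linarith
  have hm := hasSum_mellin hp hs0
    (fun t ht => (Summable.of_norm_bounded (summable_thetaF k τ α β ht) fun w => by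
      rw [norm_mul, Complex.norm_real, Real.norm_of_nonneg (Real.exp_pos _).le]).hasSum)
    ((summable_mellin_coeff hk τ 0 0 hs).congr fun w => by
      rw [norm_mul, Complex.norm_exp, charExp_re, Real.exp_zero, one_mul, norm_pow,
        RCLike.norm_conj, Rat.cast_zero])
  change normFac k τ * mellin (thetaF k τ α β) s = _
  rw [ekSeries, ek_factor, mul_assoc, ← tsum_mul_left]
  refine congrArg _ (hm.tsum_eq.symm.trans (tsum_congr fun w => ?_))
  have e : ((w.1 : ℂ) + w.2 * τ + 0) = latPt τ 0 0 w := by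
    rw [latPt]; push_cast; ring
  have e' : Complex.exp (2 * Complex.I * Real.pi *
        ((((w.1 : ℂ) + w.2 * τ) * (starRingEnd ℂ) (α * τ + β : ℂ) -
          (α * τ + β) * (starRingEnd ℂ) ((w.1 : ℂ) + w.2 * τ)) /
            ((τ : ℂ) - (starRingEnd ℂ) τ))) = Complex.exp (charExp α β w) := by
    have hy' : (τ.im : ℂ) ≠ 0 := by exact_mod_cast hy.ne'
    have hd : (τ : ℂ) - (starRingEnd ℂ) τ ≠ 0 := by
      rw [coe_eq_re_add_im, ← coe_eq_re_add_im, conj_coe_eq, coe_eq_re_add_im]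
      have : (τ.re : ℂ) + τ.im * Complex.I - (τ.re - τ.im * Complex.I) =
        2 * τ.im * Complex.I := by ring
      rw [this]; simp [hy.ne']
    congr 1
    rw [charExp]
    simp only [map_add, map_mul, map_intCast, map_ratCast]
    field_simp
    push_cast
    ring
  simp only [e, e']
  split_ifs with h0
  · rw [h0]; simp [show k ≠ 0 by omega]
  · rw [mul_div_assoc, div_cpow_mul_sq τ s _ h0]
    ring

/-- `F` is the value at `s = 1` of the Mellin transform of `thetaE`. -/
theorem F_eq_mellin {k : ℕ} (hk : 1 ≤ k) (α β : ℚ) (τ : ℍ) :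
    F k α β τ = normFac k τ * mellin (thetaE k τ α β) 1 := by
  rw [F_eq_mellin_thetaF hk, mellin_thetaF_eq hk]
  congr 2
  ring

/-! ### The mixed expansion in weights one and two -/

/-- The linear coefficient of `mixedExp` in the formal parameter; `w = (l, n)`. -/
def slope (τ : ℍ) (α t : ℝ) (w : ℤ × ℤ) : ℂ := -Complex.I * τ.im * (w.1 / t + (w.2 + α))

/-- Dependence of the exponent on the formal parameter `u`. The quadratic term in `u` is
responsible for the nonholomorphic term in weight `2`. -/
theorem mixedExp_eq (τ : ℍ) (α β : ℝ) {t : ℝ} (ht : 0 < t) (u : ℂ) (w : ℤ × ℤ) :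
    mixedExp τ α β t u w = (mixedExp τ α β t 0 w + u * slope τ α t w) +
      τ.im / (4 * Real.pi * t) * u ^ 2 := by
  have hy' : (τ.im : ℂ) ≠ 0 := by exact_mod_cast τ.im_pos.ne'
  have ht' : (t : ℂ) ≠ 0 := by exact_mod_cast ht.ne'
  have hpi : (Real.pi : ℂ) ≠ 0 := by exact_mod_cast Real.pi_ne_zero
  rw [mixedExp, mixedExp, slope]
  field_simp
  ring_nf
  simp only [Complex.I_sq]
  ring

theorem mixedExp_zero_eq (τ : ℍ) (α β : ℝ) {t : ℝ} (ht : 0 < t) (w : ℤ × ℤ) :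
    mixedExp τ α β t 0 w =
      ((-Real.pi * τ.im * (w.1 ^ 2 / t + t * (w.2 + α) ^ 2) : ℝ) : ℂ) +
        2 * Real.pi * Complex.I * w.1 * ((w.2 + α) * τ.re + β) := by
  have hy' : (τ.im : ℂ) ≠ 0 := by exact_mod_cast τ.im_pos.ne'
  have ht' : (t : ℂ) ≠ 0 := by exact_mod_cast ht.ne'
  rw [mixedExp]
  push_cast
  field_simp
  ring

theorem mixedExp_zero_re (τ : ℍ) (α β : ℝ) {t : ℝ} (ht : 0 < t) (w : ℤ × ℤ) :
    (mixedExp τ α β t 0 w).re = -Real.pi * τ.im * (w.1 ^ 2 / t + t * (w.2 + α) ^ 2) := by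
  have : 2 * Real.pi * Complex.I * w.1 * ((w.2 + α) * τ.re + β) =
      ((2 * Real.pi * w.1 * ((w.2 + α) * τ.re + β) : ℝ) : ℂ) * Complex.I := by push_cast; ring
  rw [mixedExp_zero_eq τ α β ht, this, Complex.add_re, Complex.ofReal_re,
    Complex.re_ofReal_mul, Complex.I_re, mul_zero, add_zero]

theorem norm_slope (τ : ℍ) (α : ℝ) {t : ℝ} (w : ℤ × ℤ) :
    ‖slope τ α t w‖ = τ.im * |w.1 / t + (w.2 + α)| := by
  have : slope τ α t w = -Complex.I * ((τ.im * (w.1 / t + (w.2 + α)) : ℝ) : ℂ) := by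
    rw [slope]; push_cast; ring
  rw [this, norm_mul, norm_neg, Complex.norm_I, one_mul, Complex.norm_real, Real.norm_eq_abs,
    abs_mul, abs_of_pos τ.im_pos]

theorem summable_mixed_slope (τ : ℍ) (α β : ℝ) {t : ℝ} (ht : 0 < t) (r : ℝ) :
    Summable fun w : ℤ × ℤ =>
      Real.exp ((mixedExp τ α β t 0 w).re + r * ‖slope τ α t w‖) := by
  have hy : 0 < τ.im := τ.im_pos
  have hpi := Real.pi_pos
  set c := min (Real.pi * τ.im / t) (Real.pi * τ.im * t) with hc
  have hc0 : 0 < c := lt_min (by positivity) (by positivity)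
  refine Summable.of_nonneg_of_le (fun _ => (Real.exp_pos _).le) (fun w => ?_)
    (summable_gauss_prod hc0 0 α (|r| * (τ.im * (1 / t + 1))))
  rw [Real.exp_le_exp, mixedExp_zero_re τ α β ht, norm_slope, add_zero]
  have h1 : c * (w.1 : ℝ) ^ 2 ≤ Real.pi * τ.im / t * (w.1 : ℝ) ^ 2 :=
    mul_le_mul_of_nonneg_right (min_le_left _ _) (sq_nonneg _)
  have h2 : c * (w.2 + α : ℝ) ^ 2 ≤ Real.pi * τ.im * t * (w.2 + α : ℝ) ^ 2 :=
    mul_le_mul_of_nonneg_right (min_le_right _ _) (sq_nonneg _)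
  have h3 : |w.1 / t + (w.2 + α)| ≤ (1 / t + 1) * (|(w.1 : ℝ)| + |w.2 + α|) := by
    refine (abs_add_le _ _).trans ?_
    rw [abs_div, abs_of_pos ht]
    have a1 : 0 ≤ 1 / t * |w.2 + α| := by positivity
    have a2 := abs_nonneg (w.1 : ℝ)
    have a3 : |(w.1 : ℝ)| / t = 1 / t * |(w.1 : ℝ)| := by ring
    linarith
  have h4 : r * (τ.im * |w.1 / t + (w.2 + α)|) ≤
      |r| * (τ.im * ((1 / t + 1) * (|(w.1 : ℝ)| + |w.2 + α|))) := by
    refine (mul_le_mul_of_nonneg_right (le_abs_self r) (by positivity)).trans ?_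
    gcongr
  have e : Real.pi * τ.im * (w.1 ^ 2 / t + t * (w.2 + α) ^ 2) =
      Real.pi * τ.im / t * (w.1 : ℝ) ^ 2 + Real.pi * τ.im * t * (w.2 + α : ℝ) ^ 2 := by ring
  linarith

theorem summable_mixed_row (τ : ℍ) (α β : ℝ) {t : ℝ} (ht : 0 < t) (n : ℤ) (r : ℝ) :
    Summable fun l : ℤ =>
      Real.exp ((mixedExp τ α β t 0 (l, n)).re + r * ‖slope τ α t (l, n)‖) :=
  (summable_mixed_slope τ α β ht r).comp_injective (i := fun l : ℤ => (l, n))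
    fun _ _ h => (Prod.ext_iff.1 h).1

theorem summable_shift_row (τ : ℍ) (α β : ℝ) {t : ℝ} (ht : 0 < t) (n : ℤ) (r : ℝ) :
    Summable fun m : ℤ =>
      Real.exp (((-(Real.pi * t / τ.im) * ‖latPt τ α β (m, n)‖ ^ 2 : ℝ) : ℂ).re +
        r * ‖(starRingEnd ℂ) (latPt τ α β (m, n))‖) := by
  have hy : 0 < τ.im := τ.im_pos
  have hpi := Real.pi_pos
  simp only [Complex.ofReal_re, RCLike.norm_conj]
  exact (summable_exp_latPt τ α β (t := Real.pi * t / τ.im) (by positivity) r).comp_injective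
    (i := fun l : ℤ => (l, n)) fun _ _ h => (Prod.ext_iff.1 h).1

/-- The derivative in the formal parameter of the mixed expansion of one row. -/
theorem hasDerivAt_row (τ : ℍ) (α β : ℝ) {t : ℝ} (ht : 0 < t) (n : ℤ) :
    ∀ u : ℂ, ∑' m : ℤ, (starRingEnd ℂ) (latPt τ α β (m, n)) ^ 1 *
        Complex.exp (((-(Real.pi * t / τ.im) * ‖latPt τ α β (m, n)‖ ^ 2 : ℝ) : ℂ) +
          u * (starRingEnd ℂ) (latPt τ α β (m, n))) =
      (((t / τ.im) ^ (-1 / 2 : ℝ) : ℝ) : ℂ) * (Complex.exp (τ.im / (4 * Real.pi * t) * u ^ 2) *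
        (τ.im / (2 * Real.pi * t) * u * ∑' l : ℤ, slope τ α t (l, n) ^ 0 *
            Complex.exp (mixedExp τ α β t 0 (l, n) + u * slope τ α t (l, n)) +
          ∑' l : ℤ, slope τ α t (l, n) ^ 1 *
            Complex.exp (mixedExp τ α β t 0 (l, n) + u * slope τ α t (l, n)))) := by
  intro u
  have h1 := (hasDerivAt_tsum_exp (summable_shift_row τ α β ht n) 0 u).2
  have h2 := (hasDerivAt_tsum_exp (summable_mixed_row τ α β ht n) 0 u).2
  have h3 : HasDerivAt (fun u : ℂ => Complex.exp (τ.im / (4 * Real.pi * t) * u ^ 2))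
      (Complex.exp (τ.im / (4 * Real.pi * t) * u ^ 2) *
        (τ.im / (4 * Real.pi * t) * (2 * u))) u := by
    have := (((hasDerivAt_pow 2 u).const_mul (τ.im / (4 * Real.pi * t) : ℂ))).cexp
    simpa using this
  have h4 := (h3.mul h2).const_mul (((t / τ.im) ^ (-1 / 2 : ℝ) : ℝ) : ℂ)
  have e : (fun u => ∑' m : ℤ, (starRingEnd ℂ) (latPt τ α β (m, n)) ^ 0 *
        Complex.exp (((-(Real.pi * t / τ.im) * ‖latPt τ α β (m, n)‖ ^ 2 : ℝ) : ℂ) +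
          u * (starRingEnd ℂ) (latPt τ α β (m, n)))) =
      fun u => (((t / τ.im) ^ (-1 / 2 : ℝ) : ℝ) : ℂ) *
        (Complex.exp (τ.im / (4 * Real.pi * t) * u ^ 2) * ∑' l : ℤ, slope τ α t (l, n) ^ 0 *
          Complex.exp (mixedExp τ α β t 0 (l, n) + u * slope τ α t (l, n))) := by
    funext v
    simp only [pow_zero, one_mul]
    rw [tsum_row_eq_mixed τ α β ht v n, ← tsum_mul_left (a := Complex.exp _)]
    congr 1
    refine tsum_congr fun l => ?_
    rw [mixedExp_eq τ α β ht v, ← Complex.exp_add, add_comm (_ * v ^ 2)]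
  rw [e] at h1
  have h5 := h1.unique h4
  rw [zero_add] at h5
  rw [h5]
  congr 1
  have : (τ.im : ℂ) / (4 * Real.pi * t) * (2 * u) = τ.im / (2 * Real.pi * t) * u := by
    ring
  rw [this]
  ring

/-- The `k`-th derivative at `u = 0` of the exponential of the part of `mixedExp` that depends
on `u`, for `k = 1, 2`. The value for other `k` is not used. -/
def mixedCoeff (k : ℕ) (τ : ℍ) (α t : ℝ) (w : ℤ × ℤ) : ℂ :=
  if k = 1 then slope τ α t w else τ.im / (2 * Real.pi * t) + slope τ α t w ^ 2

/-- The terms of the mixed expansion of `thetaE k` for `k = 1, 2`, indexed by `w = (l, n)`. -/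
def mixedTerm (k : ℕ) (τ : ℍ) (α β t : ℝ) (w : ℤ × ℤ) : ℂ :=
  (((t / τ.im) ^ (-1 / 2 : ℝ) : ℝ) : ℂ) *
    (mixedCoeff k τ α t w * Complex.exp (mixedExp τ α β t 0 w))

/-- The row `n` of the theta series `thetaE`. -/
def rowE (k : ℕ) (τ : ℍ) (α β t : ℝ) (n : ℤ) : ℂ :=
  ∑' m : ℤ, (starRingEnd ℂ) (latPt τ α β (m, n)) ^ k *
    (Real.exp (-(Real.pi / τ.im * ‖latPt τ α β (m, n)‖ ^ 2) * t) : ℝ)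

theorem summable_mixedTerm {k : ℕ} (τ : ℍ) (α β : ℝ) {t : ℝ}
    (ht : 0 < t) : Summable (mixedTerm k τ α β t) := by
  have hs : ∀ j : ℕ, Summable fun w => slope τ α t w ^ j *
      Complex.exp (mixedExp τ α β t 0 w) := fun j => by
    simpa using (hasDerivAt_tsum_exp (summable_mixed_slope τ α β ht) j 0).1
  refine Summable.mul_left _ ?_
  unfold mixedCoeff
  split_ifs
  · simpa using hs 1
  · simp only [add_mul]
    exact ((by simpa using hs 0 : Summable _).mul_left _).add (hs 2)

/-- The mixed expansion of a row of the theta series in weights `1` and `2`. -/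
theorem rowE_eq {k : ℕ} (hk : k = 1 ∨ k = 2) (τ : ℍ) (α β : ℝ) {t : ℝ} (ht : 0 < t) (n : ℤ) :
    rowE k τ α β t n = ∑' l : ℤ, mixedTerm k τ α β t (l, n) := by
  have e0 : ∀ m : ℤ, ((Real.exp (-(Real.pi / τ.im * ‖latPt τ α β (m, n)‖ ^ 2) * t) : ℝ) : ℂ) =
      Complex.exp (((-(Real.pi * t / τ.im) * ‖latPt τ α β (m, n)‖ ^ 2 : ℝ) : ℂ) +
          0 * (starRingEnd ℂ) (latPt τ α β (m, n))) := fun m => by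
    rw [zero_mul, add_zero, ← Complex.ofReal_exp]
    congr 2
    ring
  simp only [rowE, e0, mixedTerm]
  rw [tsum_mul_left]
  have hrow := hasDerivAt_row τ α β ht n
  rcases hk with rfl | rfl
  · rw [hrow 0]
    simp [mixedCoeff]
  · have h1 := (hasDerivAt_tsum_exp (summable_shift_row τ α β ht n) 1 0).2
    have hS : ∀ j : ℕ, HasDerivAt (fun u => ∑' l : ℤ, slope τ α t (l, n) ^ j *
        Complex.exp (mixedExp τ α β t 0 (l, n) + u * slope τ α t (l, n)))
        (∑' l : ℤ, slope τ α t (l, n) ^ (j + 1) *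
        Complex.exp (mixedExp τ α β t 0 (l, n) + 0 * slope τ α t (l, n))) 0 := fun j =>
      (hasDerivAt_tsum_exp (summable_mixed_row τ α β ht n) j 0).2
    have h3 : HasDerivAt (fun u : ℂ => Complex.exp (τ.im / (4 * Real.pi * t) * u ^ 2)) 0 0 := by
      have := (((hasDerivAt_pow 2 (0 : ℂ)).const_mul (τ.im / (4 * Real.pi * t) : ℂ))).cexp
      simpa using this
    have h5 := (((hasDerivAt_id (0 : ℂ)).const_mul (τ.im / (2 * Real.pi * t) : ℂ)).mul
      (hS 0)).add (hS 1)
    have h4 := (h3.mul h5).const_mul (((t / τ.im) ^ (-1 / 2 : ℝ) : ℝ) : ℂ)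
    rw [funext hrow] at h1
    have h6 := h1.unique h4
    rw [h6]
    have hs : ∀ j : ℕ, Summable fun l : ℤ => slope τ α t (l, n) ^ j *
        Complex.exp (mixedExp τ α β t 0 (l, n)) := fun j => by
      simpa using (hasDerivAt_tsum_exp (summable_mixed_row τ α β ht n) j 0).1
    simp only [mixedCoeff, OfNat.ofNat_ne_one, if_false, add_mul]
    rw [((by simpa using hs 0 : Summable fun l : ℤ =>
      Complex.exp (mixedExp τ α β t 0 (l, n))).mul_left _).tsum_add (hs 2), tsum_mul_left]
    simp

theorem summable_thetaE (k : ℕ) (τ : ℍ) (α β : ℝ) {t : ℝ} (ht : 0 < t) :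
    Summable fun w : ℤ × ℤ => (starRingEnd ℂ) (latPt τ α β w) ^ k *
      (Real.exp (-(Real.pi / τ.im * ‖latPt τ α β w‖ ^ 2) * t) : ℝ) :=
  Summable.of_norm_bounded (summable_pow_mul_latPt k τ α β ht) fun w => by
    rw [norm_mul, Complex.norm_real, Real.norm_of_nonneg (Real.exp_pos _).le]

theorem hasSum_rowE (k : ℕ) (τ : ℍ) (α β : ℝ) {t : ℝ} (ht : 0 < t) :
    HasSum (rowE k τ α β t) (thetaE k τ α β t) := by
  have h := (Equiv.prodComm ℤ ℤ).summable_iff.2 (summable_thetaE k τ α β ht)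
  have h2 : thetaE k τ α β t = ∑' n, rowE k τ α β t n :=
    ((Equiv.prodComm ℤ ℤ).tsum_eq _).symm.trans (Summable.tsum_prod h)
  rw [h2]
  exact h.prod.hasSum

/-! ### Integrals of the terms of the mixed expansion -/

theorem pow_le_mul_exp (n : ℕ) {b x : ℝ} (hb : 0 < b) (hx : 0 ≤ x) :
    x ^ n ≤ n.factorial / b ^ n * Real.exp (b * x) := by
  have h := Real.pow_div_factorial_le_exp (b * x) (by positivity) n
  rw [div_le_iff₀ (by positivity), mul_pow] at h
  rw [div_mul_eq_mul_div, le_div_iff₀ (by positivity)]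
  linarith

/-- Improper integration over `(0, ∞)` with a limit of the primitive at both ends. -/
theorem integral_Ioi_zero_of_hasDerivAt {f f' : ℝ → ℂ} {a b : ℂ}
    (hf : ∀ t : ℝ, 0 < t → HasDerivAt f (f' t) t) (hi : IntegrableOn f' (Set.Ioi 0))
    (h0 : Tendsto f (𝓝[>] 0) (𝓝 a)) (h1 : Tendsto f atTop (𝓝 b)) :
    ∫ t in Set.Ioi (0 : ℝ), f' t = b - a := by
  have := integral_Ioi_of_hasDerivAt_of_tendsto (f := Function.update f 0 a) (f' := f') (a := 0)
    (m := b) ?_ (fun t ht => ?_) hi ?_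
  · simpa using this
  · have h2 := continuousWithinAt_update_same.2 (by
      rwa [Set.Ici_sdiff_left] : Tendsto f (𝓝[Set.Ici 0 \ {0}] 0) (𝓝 a))
    exact h2
  · have ht' : (0 : ℝ) < t := ht
    refine (hf t ht').congr_of_eventuallyEq ?_
    filter_upwards [Ioi_mem_nhds ht'] with x hx
    exact Function.update_of_ne (ne_of_gt hx) _ _
  · refine h1.congr' ?_
    filter_upwards [eventually_gt_atTop 0] with x hx
    exact (Function.update_of_ne (ne_of_gt hx) _ _).symm

/-- A primitive of the Gaussian `exp(-πyx²)`. -/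
def gaussPrim (y x : ℝ) : ℝ := ∫ s in (0 : ℝ)..x, Real.exp (-(Real.pi * y) * s ^ 2)

theorem hasDerivAt_gaussPrim (y x : ℝ) :
    HasDerivAt (gaussPrim y) (Real.exp (-(Real.pi * y) * x ^ 2)) x :=
  (Continuous.integral_hasStrictDerivAt (by fun_prop) 0 x).hasDerivAt

theorem tendsto_gaussPrim_atTop {y : ℝ} (hy : 0 < y) :
    Tendsto (gaussPrim y) atTop (𝓝 (1 / (2 * √y))) := by
  have hb : 0 < Real.pi * y := by positivity
  have h := intervalIntegral_tendsto_integral_Ioi 0 (integrable_exp_neg_mul_sq hb).integrableOn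
    tendsto_id
  rw [integral_gaussian_Ioi] at h
  have e : √(Real.pi / (Real.pi * y)) / 2 = 1 / (2 * √y) := by
    rw [div_mul_cancel_left₀ Real.pi_ne_zero, Real.sqrt_inv]
    field_simp
  rw [e] at h
  exact h

theorem gaussPrim_neg (y x : ℝ) : gaussPrim y (-x) = -gaussPrim y x := by
  have h := intervalIntegral.integral_comp_neg (a := 0) (b := x)
    (fun s => Real.exp (-(Real.pi * y) * s ^ 2))
  simp only [neg_sq, neg_zero] at h
  rw [gaussPrim, gaussPrim, h, ← intervalIntegral.integral_symm]

theorem tendsto_gaussPrim_atBot {y : ℝ} (hy : 0 < y) :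
    Tendsto (gaussPrim y) atBot (𝓝 (-(1 / (2 * √y)))) := by
  have := ((tendsto_gaussPrim_atTop hy).comp tendsto_neg_atBot_atTop).neg
  refine this.congr fun x => ?_
  simp [gaussPrim_neg]

/-- The variable in which the terms of the mixed expansion become Gaussian. -/
def uVar (l ν t : ℝ) : ℝ := √t * ν - l / √t

theorem hasDerivAt_uVar (l ν : ℝ) {t : ℝ} (ht : 0 < t) :
    HasDerivAt (uVar l ν) ((√t * ν + l / √t) / (2 * t)) t := by
  obtain ⟨s, hs, rfl⟩ : ∃ s : ℝ, 0 < s ∧ t = s ^ 2 :=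
    ⟨√t, Real.sqrt_pos.2 ht, (Real.sq_sqrt ht.le).symm⟩
  have h1 := Real.hasDerivAt_sqrt ht.ne'
  have h2 := (h1.mul_const ν).sub ((hasDerivAt_const (s ^ 2) l).div h1 (by positivity))
  rw [Real.sqrt_sq hs.le] at h2 ⊢
  refine h2.congr_deriv ?_
  field_simp
  ring

theorem tendsto_sqrt_nhdsGT_zero : Tendsto (fun t : ℝ => √t) (𝓝[>] 0) (𝓝[>] 0) := by
  refine tendsto_nhdsWithin_iff.2 ⟨?_, ?_⟩
  · have := Real.continuous_sqrt.tendsto 0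
    rw [Real.sqrt_zero] at this
    exact this.mono_left nhdsWithin_le_nhds
  · filter_upwards [self_mem_nhdsWithin] with t ht
    exact Real.sqrt_pos.2 ht

theorem tendsto_gaussPrim_uVar_atTop {y l ν : ℝ} (hy : 0 < y) (hν : ν ≠ 0) :
    Tendsto (fun t => gaussPrim y (uVar l ν t)) atTop (𝓝 (Real.sign ν / (2 * √y))) := by
  have h0 : Tendsto (fun t : ℝ => l / √t) atTop (𝓝 0) :=
    tendsto_const_nhds.div_atTop Real.tendsto_sqrt_atTop
  rcases hν.lt_or_gt with h | h
  · rw [Real.sign_of_neg h, neg_div]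
    refine (tendsto_gaussPrim_atBot hy).comp ?_
    have := (Real.tendsto_sqrt_atTop.atTop_mul_const_of_neg h).atBot_add h0.neg
    exact this.congr fun t => by rw [uVar, sub_eq_add_neg]
  · rw [Real.sign_of_pos h]
    refine (tendsto_gaussPrim_atTop hy).comp ?_
    have := (Real.tendsto_sqrt_atTop.atTop_mul_const h).atTop_add h0.neg
    exact this.congr fun t => by rw [uVar, sub_eq_add_neg]

theorem tendsto_gaussPrim_uVar_zero {y l ν : ℝ} (hy : 0 < y) (hl : l ≠ 0) :
    Tendsto (fun t => gaussPrim y (uVar l ν t)) (𝓝[>] 0) (𝓝 (-Real.sign l / (2 * √y))) := by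
  have h0 : Tendsto (fun t : ℝ => √t * ν) (𝓝[>] 0) (𝓝 0) := by
    have := (tendsto_sqrt_nhdsGT_zero.mono_right nhdsWithin_le_nhds).mul_const ν
    rwa [zero_mul] at this
  have hi : Tendsto (fun t : ℝ => (√t)⁻¹) (𝓝[>] 0) atTop :=
    tendsto_inv_nhdsGT_zero.comp tendsto_sqrt_nhdsGT_zero
  rcases hl.lt_or_gt with h | h
  · rw [Real.sign_of_neg h, neg_neg]
    refine (tendsto_gaussPrim_atTop hy).comp ?_
    have := h0.add_atTop (hi.const_mul_atTop (neg_pos.2 h))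
    refine this.congr fun t => ?_
    rw [uVar]; ring
  · rw [Real.sign_of_pos h, neg_div]
    refine (tendsto_gaussPrim_atBot hy).comp ?_
    have := h0.add_atBot (hi.const_mul_atTop_of_neg (neg_lt_zero.2 h))
    refine this.congr fun t => ?_
    rw [uVar]; ring

/-- The factor `e(l(ντ + β))`, with `w = (l, n)` and `ν = n + α`. -/
def qFac (τ : ℍ) (α β : ℝ) (w : ℤ × ℤ) : ℂ :=
  Complex.exp (2 * Real.pi * Complex.I * (w.1 * ((w.2 + α) * τ + β)))

/-- Completing the square: `l² / t + tν² = U² + 2lν` with `U = √t ν - l / √t`. -/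
theorem exp_mixedExp_eq (τ : ℍ) (α β : ℝ) {t : ℝ} (ht : 0 < t) (w : ℤ × ℤ) :
    Complex.exp (mixedExp τ α β t 0 w) =
      ((Real.exp (-(Real.pi * τ.im) * uVar w.1 (w.2 + α) t ^ 2) : ℝ) : ℂ) * qFac τ α β w := by
  have hs : 0 < √t := Real.sqrt_pos.2 ht
  have e : uVar w.1 (w.2 + α) t ^ 2 = w.1 ^ 2 / t + t * (w.2 + α) ^ 2 - 2 * w.1 * (w.2 + α) := by
    rw [uVar]
    have : t = √t ^ 2 := (Real.sq_sqrt ht.le).symm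
    generalize √t = s at *
    subst this
    field_simp
    ring
  rw [mixedExp_zero_eq τ α β ht, qFac, Complex.ofReal_exp, ← Complex.exp_add, e,
    coe_eq_re_add_im τ]
  congr 1
  push_cast
  ring_nf
  simp only [Complex.I_sq]
  ring

theorem rpow_neg_half_eq (y : ℝ) (hy : 0 < y) {t : ℝ} (ht : 0 < t) :
    (t / y) ^ (-1 / 2 : ℝ) = √y / √t := by
  rw [show (-1 / 2 : ℝ) = -(1 / 2) by norm_num, Real.rpow_neg (by positivity),
    ← Real.sqrt_eq_rpow, Real.sqrt_div ht.le, inv_div]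

theorem sq_sqrt_bounds {t : ℝ} (ht : 0 < t) : 1 ≤ t + 1 / t ∧ 1 / √t ≤ 2 * (t + 1 / t) ∧
    √t ≤ 2 * (t + 1 / t) := by
  have hs0 : 0 < √t := Real.sqrt_pos.2 ht
  have hts : √t ^ 2 = t := Real.sq_sqrt ht.le
  have ht1 : 0 < 1 / t := by positivity
  have h1 : t * (1 / t) = 1 := by field_simp
  have hq1 : 1 ≤ t + 1 / t := by nlinarith [sq_nonneg (t - 1 / t)]
  have h2 : (1 / √t) ^ 2 = 1 / t := by rw [div_pow, hts, one_pow]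
  exact ⟨hq1, by nlinarith [sq_nonneg (1 / √t - 1)], by nlinarith [sq_nonneg (√t - 1)]⟩

/-- Polynomial bound for the coefficients in terms of `q = t + 1 / t` and `X = |l| + |ν|`. -/
theorem norm_mixedCoeff_le {k : ℕ} (hk : k = 1 ∨ k = 2) (τ : ℍ) (α : ℝ) {t q X : ℝ} (ht : 0 < t)
    (hq : q = t + 1 / t) {w : ℤ × ℤ} (hX : X = |(w.1 : ℝ)| + |(w.2 : ℝ) + α|) (hX1 : 1 ≤ X) :
    ‖(t : ℂ) ^ (k - 1)‖ * (1 / √t) * ‖mixedCoeff k τ α t w‖ ≤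
      2 * (τ.im + τ.im ^ 2) * (q ^ 3 * X ^ 2) := by
  have hy : 0 < τ.im := τ.im_pos
  set y := τ.im with hydef
  have hpi := Real.pi_pos
  have hs0 : 0 < √t := Real.sqrt_pos.2 ht
  have ht1 : 0 < 1 / t := by positivity
  obtain ⟨hq1, hsinv, hsle⟩ := sq_sqrt_bounds ht
  rw [← hq] at hq1 hsinv hsle
  have hqt : 1 / t ≤ q := by linarith
  have hlin : |w.1 / t + (w.2 + α)| ≤ q * X := by
    refine (abs_add_le _ _).trans ?_
    rw [abs_div, abs_of_pos ht, hX, mul_add]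
    have e1 : |(w.1 : ℝ)| / t = 1 / t * |(w.1 : ℝ)| := by ring
    rw [e1]
    have h1 : 1 / t * |(w.1 : ℝ)| ≤ q * |(w.1 : ℝ)| :=
      mul_le_mul_of_nonneg_right hqt (abs_nonneg _)
    have h2 : |(w.2 : ℝ) + α| ≤ q * |(w.2 : ℝ) + α| := le_mul_of_one_le_left (abs_nonneg _) hq1
    linarith
  have hslope : ‖slope τ α t w‖ ≤ y * (q * X) := by
    rw [norm_slope]; gcongr
  have hqX : 1 ≤ q * X := one_le_mul_of_one_le_of_one_le hq1 hX1
  rcases hk with rfl | rfl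
  · simp only [mixedCoeff, if_true, tsub_self, pow_zero, norm_one, one_mul]
    calc 1 / √t * ‖slope τ α t w‖ ≤ 2 * q * (y * (q * X)) := by gcongr
      _ = 2 * y * (q ^ 2 * X) := by ring
      _ ≤ 2 * (y + y ^ 2) * (q ^ 3 * X ^ 2) := by
        have h1 : q ^ 2 * X ≤ q ^ 3 * X ^ 2 := by
          have : q ^ 3 * X ^ 2 = (q ^ 2 * X) * (q * X) := by ring
          rw [this]
          exact le_mul_of_one_le_right (by positivity) hqX
        have h2 : 2 * y ≤ 2 * (y + y ^ 2) := by
          have := sq_nonneg y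
          linarith
        gcongr
  · simp only [mixedCoeff, OfNat.ofNat_ne_one, if_false, Nat.add_one_sub_one, pow_one]
    have e1 : ‖(t : ℂ)‖ * (1 / √t) = √t := by
      rw [Complex.norm_real, Real.norm_of_nonneg ht.le, mul_one_div, Real.div_sqrt]
    have e2 : ‖(y : ℂ) / (2 * Real.pi * t) + slope τ α t w ^ 2‖ ≤
        y * (q * X) ^ 2 + (y * (q * X)) ^ 2 := by
      refine (norm_add_le _ _).trans (add_le_add ?_ (by rw [norm_pow]; gcongr))
      have : (y : ℂ) / (2 * Real.pi * t) = ((y * (1 / (2 * Real.pi)) * (1 / t) : ℝ) : ℂ) := by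
        push_cast; field_simp
      rw [this, Complex.norm_real, Real.norm_of_nonneg (by positivity)]
      have h3 : 1 / (2 * Real.pi) ≤ 1 := by
        rw [div_le_one (by positivity)]; linarith [Real.pi_gt_three]
      have h4 : q ≤ q * X := le_mul_of_one_le_right (by linarith) hX1
      have h5 : q * X ≤ (q * X) ^ 2 := le_self_pow₀ hqX two_ne_zero
      calc y * (1 / (2 * Real.pi)) * (1 / t) ≤ y * 1 * q := by gcongr
        _ ≤ y * (q * X) ^ 2 := by
          rw [mul_one]
          exact mul_le_mul_of_nonneg_left (h4.trans h5) hy.le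
    calc ‖(t : ℂ)‖ * (1 / √t) * ‖(y : ℂ) / (2 * Real.pi * t) + slope τ α t w ^ 2‖
        ≤ 2 * q * (y * (q * X) ^ 2 + (y * (q * X)) ^ 2) := by rw [e1]; gcongr
      _ = _ := by ring

/-- Gaussian bound for `l ≠ 0` and `ν ≠ 0`: half of the exponent `l² / t + tν²` dominates `|lν|`,
hence `X`, and the other half dominates `q`. -/
theorem exp_mixedExp_le (τ : ℍ) (α β : ℝ) {t q X δ : ℝ} (ht : 0 < t)
    (hq : q = t + 1 / t) {w : ℤ × ℤ} (hX : X = |(w.1 : ℝ)| + |(w.2 : ℝ) + α|) (hδ : 0 < δ)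
    (hδ1 : δ ≤ 1) (hL1 : 1 ≤ |(w.1 : ℝ)|) (hν : δ ≤ |(w.2 : ℝ) + α|) :
    Real.exp ((mixedExp τ α β t 0 w).re) ≤
      Real.exp (-(Real.pi * τ.im * δ / 2) * X) * Real.exp (-(Real.pi * τ.im * δ ^ 2 / 2) * q) := by
  have hy : 0 < τ.im := τ.im_pos
  have hpi := Real.pi_pos
  rw [← Real.exp_add, Real.exp_le_exp, mixedExp_zero_re τ α β ht, ← sq_abs (w.1 : ℝ),
    ← sq_abs ((w.2 : ℝ) + α)]
  set L := |(w.1 : ℝ)| with hL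
  set V := |(w.2 : ℝ) + α| with hV
  have h1 : 2 * (L * V) ≤ L ^ 2 / t + t * V ^ 2 := by
    obtain ⟨s, hs, rfl⟩ : ∃ s : ℝ, 0 < s ∧ t = s ^ 2 :=
      ⟨√t, Real.sqrt_pos.2 ht, (Real.sq_sqrt ht.le).symm⟩
    have : L ^ 2 / s ^ 2 + s ^ 2 * V ^ 2 - 2 * (L * V) = (L / s - s * V) ^ 2 := by
      field_simp; ring
    have := sq_nonneg (L / s - s * V)
    linarith
  have h2 : δ * X ≤ 2 * (L * V) := by
    have a1 : δ * L ≤ L * V := by rw [mul_comm]; gcongr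
    have a2 : δ * V ≤ L * V := mul_le_mul_of_nonneg_right (hδ1.trans hL1) (abs_nonneg _)
    rw [hX, mul_add]; linarith
  have h3 : δ ^ 2 * q ≤ L ^ 2 / t + t * V ^ 2 := by
    have e1 : δ ^ 2 * (1 / t) ≤ L ^ 2 / t := by
      rw [mul_one_div]; gcongr; linarith
    have e2 : δ ^ 2 * t ≤ t * V ^ 2 := by rw [mul_comm]; gcongr
    rw [hq, mul_add]; linarith
  have h4 : δ * X + δ ^ 2 * q ≤ 2 * (L ^ 2 / t + t * V ^ 2) := by linarith
  have h5 := mul_le_mul_of_nonneg_left h4 (by positivity : 0 ≤ Real.pi * τ.im / 2)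
  linarith

/-- A bound for the terms of the mixed expansion that separates the summation and the integration
variables. -/
theorem exists_mixedTerm_bound {k : ℕ} (hk : k = 1 ∨ k = 2) (τ : ℍ) (α β : ℝ) {δ : ℝ} (hδ : 0 < δ)
    (hδ1 : δ ≤ 1) : ∃ C c ε : ℝ, 0 < c ∧ 0 < ε ∧ ∀ (w : ℤ × ℤ) (t : ℝ), w.1 ≠ 0 →
      δ ≤ |w.2 + α| → 0 < t → ‖(t : ℂ) ^ (k - 1) * mixedTerm k τ α β t w‖ ≤
        C * Real.exp (-c * (|(w.1 : ℝ)| + |w.2 + α|)) * Real.exp (-ε * t) := by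
  have hy : 0 < τ.im := τ.im_pos
  have hpi := Real.pi_pos
  obtain ⟨a, ha⟩ : ∃ a, a = Real.pi * τ.im * δ / 2 := ⟨_, rfl⟩
  obtain ⟨b, hb⟩ : ∃ b, b = Real.pi * τ.im * δ ^ 2 / 2 := ⟨_, rfl⟩
  have ha0 : 0 < a := by rw [ha]; positivity
  have hb0 : 0 < b := by rw [hb]; positivity
  -- half of the exponential decay in `X` and `q` absorbs the polynomial `q ^ 3 * X ^ 2`
  refine ⟨√τ.im * (2 * (τ.im + τ.im ^ 2)) * (((2 : ℕ).factorial / (a / 2) ^ 2) *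
    ((3 : ℕ).factorial / (b / 2) ^ 3)), a / 2, b / 2, by positivity, by positivity,
    fun w t hl hν ht => ?_⟩
  obtain ⟨X, hX⟩ : ∃ X, X = |(w.1 : ℝ)| + |(w.2 : ℝ) + α| := ⟨_, rfl⟩
  obtain ⟨q, hq⟩ : ∃ q, q = t + 1 / t := ⟨_, rfl⟩
  have hL1 : 1 ≤ |(w.1 : ℝ)| := by
    rw [← Int.cast_abs]
    exact_mod_cast Int.one_le_abs hl
  have hX1 : 1 ≤ X := by rw [hX]; linarith
  have hq1 : 1 ≤ q := by rw [hq]; exact (sq_sqrt_bounds ht).1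
  have hpoly := norm_mixedCoeff_le hk τ α ht hq hX hX1
  have hexp := exp_mixedExp_le τ α β ht hq hX hδ hδ1 hL1 hν
  rw [← ha, ← hb] at hexp
  have hX2 := pow_le_mul_exp 2 (b := a / 2) (x := X) (by positivity) (by positivity)
  have hq3 := pow_le_mul_exp 3 (b := b / 2) (x := q) (by positivity) (by positivity)
  have hqt : Real.exp (-(b / 2) * q) ≤ Real.exp (-(b / 2) * t) := by
    rw [Real.exp_le_exp, neg_mul, neg_mul, neg_le_neg_iff]
    have : 0 < 1 / t := by positivity
    gcongr
    linarith
  rw [← hX, mixedTerm, rpow_neg_half_eq _ hy ht, norm_mul, norm_mul, norm_mul, Complex.norm_exp,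
    Complex.norm_real, Real.norm_of_nonneg (by positivity)]
  calc ‖(t : ℂ) ^ (k - 1)‖ * (√τ.im / √t * (‖mixedCoeff k τ α t w‖ *
        Real.exp ((mixedExp τ α β t 0 w).re)))
      = √τ.im * (‖(t : ℂ) ^ (k - 1)‖ * (1 / √t) * ‖mixedCoeff k τ α t w‖) *
        Real.exp ((mixedExp τ α β t 0 w).re) := by ring
    _ ≤ √τ.im * (2 * (τ.im + τ.im ^ 2) * (q ^ 3 * X ^ 2)) *
        (Real.exp (-a * X) * Real.exp (-b * q)) := by gcongr
    _ ≤ √τ.im * (2 * (τ.im + τ.im ^ 2) * (((3 : ℕ).factorial / (b / 2) ^ 3 *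
        Real.exp (b / 2 * q)) * ((2 : ℕ).factorial / (a / 2) ^ 2 * Real.exp (a / 2 * X)))) *
          (Real.exp (-a * X) * Real.exp (-b * q)) := by gcongr
    _ = √τ.im * (2 * (τ.im + τ.im ^ 2)) * (((2 : ℕ).factorial / (a / 2) ^ 2) *
        ((3 : ℕ).factorial / (b / 2) ^ 3)) * (Real.exp (a / 2 * X) * Real.exp (-a * X)) *
          (Real.exp (b / 2 * q) * Real.exp (-b * q)) := by ring
    _ = √τ.im * (2 * (τ.im + τ.im ^ 2)) * (((2 : ℕ).factorial / (a / 2) ^ 2) *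
        ((3 : ℕ).factorial / (b / 2) ^ 3)) * Real.exp (-(a / 2) * X) *
          Real.exp (-(b / 2) * q) := by
        rw [← Real.exp_add, ← Real.exp_add]
        ring_nf
    _ ≤ _ := mul_le_mul_of_nonneg_left hqt (by positivity)

/-! ### Termwise integration and the holomorphic terms -/

/-- The sum of a series of continuous functions on `(a, ∞)` which is dominated by
`c i * exp (-ε t)` may be integrated term by term. -/
theorem integrableOn_hasSum_of_exp_bound {ι : Type*} [Countable ι] {f : ι → ℝ → ℂ} {c : ι → ℝ}
    {ε a : ℝ} (ha : 0 ≤ a) (hε : 0 < ε) (hc : Summable c)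
    (hf : ∀ i, ContinuousOn (f i) (Set.Ioi a))
    (hb : ∀ i t, a < t → ‖f i t‖ ≤ c i * Real.exp (-ε * t)) :
    (∀ i, IntegrableOn (f i) (Set.Ioi a)) ∧
      IntegrableOn (fun t => ∑' i, f i t) (Set.Ioi a) ∧
      HasSum (fun i => ∫ t in Set.Ioi a, f i t)
        (∫ t in Set.Ioi a, ∑' i, f i t) := by
  have he : IntegrableOn (fun t : ℝ => Real.exp (-ε * t)) (Set.Ioi a) :=
    integrableOn_exp_mul_Ioi (by linarith) a
  have hc0 : ∀ i, 0 ≤ c i := fun i => by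
    have := (norm_nonneg _).trans (hb i (a + 1) (by linarith))
    exact nonneg_of_mul_nonneg_left this (Real.exp_pos _)
  have hm : ∀ i, AEStronglyMeasurable (f i) (volume.restrict (Set.Ioi a)) := fun i =>
    (hf i).aestronglyMeasurable measurableSet_Ioi
  have hbi : ∀ i, ∀ᵐ t ∂(volume.restrict (Set.Ioi a)),
      ‖f i t‖ ≤ c i * Real.exp (-ε * t) := fun i => by
    filter_upwards [ae_restrict_mem measurableSet_Ioi] with t ht using hb i t ht
  have hi : ∀ i, IntegrableOn (f i) (Set.Ioi a) := fun i =>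
    (he.const_mul (c i)).mono' (hm i) (hbi i)
  have hcont : ContinuousOn (fun t => ∑' i, f i t) (Set.Ioi a) := by
    refine continuousOn_tsum hf hc fun i t ht => (hb i t ht).trans ?_
    refine mul_le_of_le_one_right (hc0 i) (Real.exp_le_one_iff.2 ?_)
    have : a < t := ht
    nlinarith
  refine ⟨hi, ?_, hasSum_integral_of_summable_integral_norm hi ?_⟩
  · refine (he.const_mul (∑' i, c i)).mono' (hcont.aestronglyMeasurable measurableSet_Ioi) ?_
    filter_upwards [ae_restrict_mem measurableSet_Ioi] with t ht
    rw [← tsum_mul_right]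
    exact tsum_of_norm_bounded (hc.mul_right _).hasSum fun i => hb i t ht
  · refine Summable.of_nonneg_of_le (fun i => integral_nonneg fun t => norm_nonneg _)
      (fun i => ?_) (hc.mul_right (∫ t in Set.Ioi a, Real.exp (-ε * t)))
    rw [← integral_const_mul]
    exact integral_mono_ae (hi i).norm (he.const_mul (c i)) (hbi i)

/-- The nonzero elements of `ℤ + α` are bounded away from `0`. -/
theorem exists_lower_bound_shift (α : ℝ) :
    ∃ δ : ℝ, 0 < δ ∧ δ ≤ 1 ∧ ∀ n : ℤ, (n : ℝ) + α ≠ 0 → δ ≤ |(n : ℝ) + α| := by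
  have hf0 := Int.fract_nonneg α
  have hf1 := Int.fract_lt_one α
  have hα : (⌊α⌋ : ℝ) + Int.fract α = α := Int.floor_add_fract α
  rcases hf0.eq_or_lt with h | h
  · refine ⟨1, one_pos, le_rfl, fun n hn => ?_⟩
    have e : (n : ℝ) + α = ((n + ⌊α⌋ : ℤ) : ℝ) := by push_cast; linarith
    rw [e] at hn ⊢
    rw [← Int.cast_abs]
    exact_mod_cast Int.one_le_abs (by exact_mod_cast hn)
  · refine ⟨min (Int.fract α) (1 - Int.fract α), lt_min h (by linarith),
      (min_le_left _ _).trans hf1.le, fun n _ => ?_⟩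
    have e : (n : ℝ) + α = ((n + ⌊α⌋ : ℤ) : ℝ) + Int.fract α := by push_cast; linarith
    rw [e]
    rcases le_or_gt 0 (n + ⌊α⌋) with h0 | h0
    · have : (0 : ℝ) ≤ ((n + ⌊α⌋ : ℤ) : ℝ) := by exact_mod_cast h0
      rw [abs_of_nonneg (by linarith)]
      exact (min_le_left _ _).trans (by linarith)
    · have : ((n + ⌊α⌋ : ℤ) : ℝ) ≤ -1 := by exact_mod_cast (by omega : n + ⌊α⌋ ≤ -1)
      rw [abs_of_nonpos (by linarith)]
      exact (min_le_right _ _).trans (by linarith)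

theorem summable_exp_neg_mul_abs_int {c : ℝ} (hc : 0 < c) :
    Summable fun n : ℤ => Real.exp (-c * |(n : ℝ)|) := by
  have h : Summable fun n : ℕ => Real.exp (-c * |((n : ℤ) : ℝ)|) := by
    refine (Real.summable_exp_nat_mul_iff.2 (neg_lt_zero.2 hc)).congr fun n => ?_
    rw [Int.cast_natCast, Nat.abs_cast, mul_comm]
  refine Summable.of_nat_of_neg h (h.congr fun n => ?_)
  rw [Int.cast_neg, abs_neg]

theorem summable_exp_neg_abs_prod {c : ℝ} (hc : 0 < c) (α : ℝ) :
    Summable fun w : ℤ × ℤ => Real.exp (-c * (|(w.1 : ℝ)| + |(w.2 : ℝ) + α|)) := by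
  have h1 := summable_exp_neg_mul_abs_int hc
  have h2 : Summable fun n : ℤ => Real.exp (c * |α|) * Real.exp (-c * |(n : ℝ)|) :=
    h1.mul_left _
  refine Summable.of_nonneg_of_le (fun w => (Real.exp_pos _).le) (fun w => ?_)
    (h1.mul_of_nonneg h2 (fun _ => (Real.exp_pos _).le) fun _ => by positivity)
  rw [← Real.exp_add, ← Real.exp_add, Real.exp_le_exp]
  have : |(w.2 : ℝ)| ≤ |(w.2 : ℝ) + α| + |α| := by
    have := abs_sub ((w.2 : ℝ) + α) α
    simpa using this
  nlinarith

theorem uVar_sq (l ν : ℝ) {t : ℝ} (ht : 0 < t) :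
    uVar l ν t ^ 2 = l ^ 2 / t + t * ν ^ 2 - 2 * l * ν := by
  have hs : 0 < √t := Real.sqrt_pos.2 ht
  have : t = √t ^ 2 := (Real.sq_sqrt ht.le).symm
  rw [uVar]
  conv_rhs => rw [this]
  field_simp
  ring

theorem tendsto_sqrt_mul_exp_atTop {y l ν : ℝ} (hy : 0 < y) (hν : ν ≠ 0) :
    Tendsto (fun t => √t * Real.exp (-(Real.pi * y) * uVar l ν t ^ 2)) atTop (𝓝 0) := by
  have hpi := Real.pi_pos
  have hc : 0 < Real.pi * y * ν ^ 2 := by positivity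
  have h1 := (tendsto_rpow_mul_exp_neg_mul_atTop_nhds_zero (1 / 2) _ hc).const_mul
    (Real.exp (Real.pi * y * (2 * l * ν)))
  rw [mul_zero] at h1
  refine squeeze_zero' (Eventually.of_forall fun t => by positivity) ?_ h1
  filter_upwards [eventually_gt_atTop 0] with t ht
  rw [← Real.sqrt_eq_rpow, mul_left_comm, ← Real.exp_add, uVar_sq l ν ht]
  gcongr
  have : 0 ≤ Real.pi * y * (l ^ 2 / t) := by positivity
  linarith

theorem tendsto_sqrt_mul_exp_zero {y l ν : ℝ} (hy : 0 < y) :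
    Tendsto (fun t => √t * Real.exp (-(Real.pi * y) * uVar l ν t ^ 2)) (𝓝[>] 0) (𝓝 0) := by
  have hpi := Real.pi_pos
  refine squeeze_zero (fun t => by positivity) (fun t => ?_)
    (tendsto_sqrt_nhdsGT_zero.mono_right nhdsWithin_le_nhds)
  refine mul_le_of_le_one_right (Real.sqrt_nonneg _) (Real.exp_le_one_iff.2 ?_)
  have : 0 ≤ Real.pi * y * uVar l ν t ^ 2 := by positivity
  linarith

/-- A primitive of `t ^ (k - 1)` times a term of the mixed expansion. -/
def mixedPrim (k : ℕ) (y l ν t : ℝ) : ℂ :=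
  if k = 1 then -2 * Complex.I * y * √y * gaussPrim y (uVar l ν t) else
    √y * (y / Real.pi * (√t * Real.exp (-(Real.pi * y) * uVar l ν t ^ 2) : ℝ) -
      4 * l * y ^ 2 * gaussPrim y (uVar l ν t))

/-- The terms of the mixed expansion are total derivatives in `t`: the coefficient is, up to a
derivative of `√t exp(-πyU²)`, a multiple of the derivative of `U = uVar`. -/
theorem hasDerivAt_mixedPrim {k : ℕ} (hk : k = 1 ∨ k = 2) (τ : ℍ) (α β : ℝ) {t : ℝ} (ht : 0 < t)
    (w : ℤ × ℤ) : HasDerivAt (fun t => mixedPrim k τ.im w.1 (w.2 + α) t * qFac τ α β w)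
      ((t : ℂ) ^ (k - 1) * mixedTerm k τ α β t w) t := by
  have hy : 0 < τ.im := τ.im_pos
  set ν : ℝ := w.2 + α with hν
  have hU := hasDerivAt_uVar w.1 ν ht
  have hP := ((hasDerivAt_gaussPrim τ.im (uVar w.1 ν t)).comp t hU).ofReal_comp
  have hs : 0 < √t := Real.sqrt_pos.2 ht
  have hsC : ((√t : ℝ) : ℂ) ≠ 0 := by exact_mod_cast hs.ne'
  have hpi : (Real.pi : ℂ) ≠ 0 := by exact_mod_cast Real.pi_ne_zero
  have hts : (t : ℂ) = ((√t : ℝ) : ℂ) ^ 2 := by exact_mod_cast (Real.sq_sqrt ht.le).symm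
  have hνC : (w.2 : ℂ) + α = (ν : ℂ) := by rw [hν]; push_cast; rfl
  have hsl : slope τ α t w = -Complex.I * τ.im * (w.1 / t + ν) := by rw [slope, hνC]
  rcases hk with rfl | rfl
  · have h := (hP.const_mul (-2 * Complex.I * τ.im * √τ.im)).mul_const (qFac τ α β w)
    have e : (fun t => mixedPrim 1 τ.im w.1 ν t * qFac τ α β w) = fun t =>
        -2 * Complex.I * τ.im * √τ.im * ((gaussPrim τ.im ∘ uVar w.1 ν) t : ℝ) *
          qFac τ α β w := by
      ext t; simp [mixedPrim]
    rw [e]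
    refine h.congr_deriv ?_
    rw [mixedTerm, exp_mixedExp_eq τ α β ht, rpow_neg_half_eq _ hy ht, mixedCoeff, if_pos rfl,
      ← hν, hsl]
    push_cast
    rw [hts]
    field_simp
    ring
  · have h1 := Real.hasDerivAt_sqrt ht.ne'
    have h2 := (((hU.pow 2).const_mul (-(Real.pi * τ.im))).exp)
    have h3 := (h1.mul h2).ofReal_comp
    have h := (((h3.const_mul (τ.im / Real.pi : ℂ)).sub
      (hP.const_mul (4 * w.1 * τ.im ^ 2 : ℂ))).const_mul (√τ.im : ℂ)).mul_const (qFac τ α β w)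
    have e : (fun t => mixedPrim 2 τ.im w.1 ν t * qFac τ α β w) = fun t =>
        (√τ.im : ℂ) * ((τ.im / Real.pi : ℂ) * (((fun t => √t) * fun t =>
          Real.exp (-(Real.pi * τ.im) * (uVar w.1 ν ^ 2) t)) t : ℝ) -
          (4 * w.1 * τ.im ^ 2 : ℂ) * ((gaussPrim τ.im ∘ uVar w.1 ν) t : ℝ)) *
          qFac τ α β w := by
      ext t; simp [mixedPrim]
    rw [e]
    refine h.congr_deriv ?_
    rw [mixedTerm, exp_mixedExp_eq τ α β ht, rpow_neg_half_eq _ hy ht, mixedCoeff,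
      if_neg (by norm_num), ← hν, hsl]
    have hu : ((uVar w.1 ν t : ℝ) : ℂ) = √t * ν - w.1 / √t := by rw [uVar]; push_cast; rfl
    simp only [Pi.pow_apply]
    push_cast
    simp only [hu]
    obtain ⟨X, hX⟩ : ∃ X : ℂ, X =
      Complex.exp (-(Real.pi * τ.im) * (√t * ν - w.1 / √t) ^ 2) := ⟨_, rfl⟩
    simp only [← hX]
    rw [hts]
    have hI : Complex.I ^ 2 = -1 := Complex.I_sq
    field_simp
    ring_nf
    simp only [hI]
    ring

theorem tendsto_mixedPrim_atTop {k : ℕ} {y l ν : ℝ} (hy : 0 < y) (hν : ν ≠ 0) :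
    Tendsto (mixedPrim k y l ν) atTop (𝓝 (if k = 1 then -Complex.I * y * Real.sign ν else
      -2 * l * y ^ 2 * Real.sign ν)) := by
  have hG := (Complex.continuous_ofReal.tendsto _).comp
    (tendsto_gaussPrim_uVar_atTop (l := l) hy hν)
  have hE := (Complex.continuous_ofReal.tendsto _).comp
    (tendsto_sqrt_mul_exp_atTop (l := l) hy hν)
  have hs : ((√y : ℝ) : ℂ) ≠ 0 := by exact_mod_cast (Real.sqrt_pos.2 hy).ne'
  unfold mixedPrim
  split_ifs
  · refine (hG.const_mul (-2 * Complex.I * y * √y)).congr' (Eventually.of_forall fun t => rfl)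
      |>.trans_eq ?_
    congr 1; push_cast; field_simp
  · refine (((hE.const_mul (y / Real.pi : ℂ)).sub (hG.const_mul (4 * l * y ^ 2 : ℂ))).const_mul
      (√y : ℂ)).congr' (Eventually.of_forall fun t => rfl) |>.trans_eq ?_
    congr 1; push_cast; field_simp; ring

theorem tendsto_mixedPrim_zero {k : ℕ} {y l ν : ℝ} (hy : 0 < y) (hl : l ≠ 0) :
    Tendsto (mixedPrim k y l ν) (𝓝[>] 0) (𝓝 (if k = 1 then Complex.I * y * Real.sign l else
      2 * l * y ^ 2 * Real.sign l)) := by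
  have hG := (Complex.continuous_ofReal.tendsto _).comp
    (tendsto_gaussPrim_uVar_zero (ν := ν) hy hl)
  have hE := (Complex.continuous_ofReal.tendsto _).comp
    (tendsto_sqrt_mul_exp_zero (l := l) (ν := ν) hy)
  have hs : ((√y : ℝ) : ℂ) ≠ 0 := by exact_mod_cast (Real.sqrt_pos.2 hy).ne'
  unfold mixedPrim
  split_ifs
  · refine (hG.const_mul (-2 * Complex.I * y * √y)).congr' (Eventually.of_forall fun t => rfl)
      |>.trans_eq ?_
    congr 1; push_cast; field_simp
  · refine (((hE.const_mul (y / Real.pi : ℂ)).sub (hG.const_mul (4 * l * y ^ 2 : ℂ))).const_mul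
      (√y : ℂ)).congr' (Eventually.of_forall fun t => rfl) |>.trans_eq ?_
    congr 1; push_cast; field_simp; ring

/-- The coefficient of `e(l(ντ + β))` in the `q`-expansion: `sign l * l ^ (k - 1)` if `l` and `ν`
have the same sign, and `0` otherwise. -/
def signCoeff (k : ℕ) (l : ℤ) (ν : ℝ) : ℂ :=
  if 0 < (l : ℝ) * ν then ((l.sign * l ^ (k - 1) : ℤ) : ℂ) else 0

/-- The integral of a term of the mixed expansion is the corresponding term of the `q`-expansion.
The limits of the primitive at `0` and `∞` depend only on the signs of `l` and `ν`, and cancel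
unless these agree. -/
theorem integral_mixedTerm {k : ℕ} (hk : k = 1 ∨ k = 2) (τ : ℍ) (α β : ℝ) {w : ℤ × ℤ}
    (hl : w.1 ≠ 0) (hν : (w.2 : ℝ) + α ≠ 0)
    (hi : IntegrableOn (fun t : ℝ => (t : ℂ) ^ (k - 1) * mixedTerm k τ α β t w) (Set.Ioi 0)) :
    normFac k τ * ∫ t in Set.Ioi (0 : ℝ), (t : ℂ) ^ (k - 1) * mixedTerm k τ α β t w =
      signCoeff k w.1 (w.2 + α) * qFac τ α β w := by
  have hy : 0 < τ.im := τ.im_pos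
  have hl' : (w.1 : ℝ) ≠ 0 := by exact_mod_cast hl
  rw [integral_Ioi_zero_of_hasDerivAt (fun t ht => hasDerivAt_mixedPrim hk τ α β ht w) hi
    ((tendsto_mixedPrim_zero hy hl').mul_const _) ((tendsto_mixedPrim_atTop hy hν).mul_const _)]
  have hyC : (τ.im : ℂ) ≠ 0 := by exact_mod_cast hy.ne'
  have hI : Complex.I ^ 2 = -1 := Complex.I_sq
  rw [normFac, signCoeff]
  rcases hl'.lt_or_gt with h1 | h1 <;> rcases hν.lt_or_gt with h2 | h2
  · have h3 : 0 < (w.1 : ℝ) * (w.2 + α) := mul_pos_of_neg_of_neg h1 h2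
    rw [if_pos h3, Real.sign_of_neg h1, Real.sign_of_neg h2,
      Int.sign_eq_neg_one_of_neg (by exact_mod_cast h1)]
    rcases hk with rfl | rfl
    · simp; field_simp; linear_combination (2 * qFac τ α β w) * hI
    · simp; rw [inv_mul_eq_iff_eq_mul₀ (by simp [hyC])]; ring_nf; simp [hI]
  · have h3 : ¬ 0 < (w.1 : ℝ) * (w.2 + α) := (mul_neg_of_neg_of_pos h1 h2).le.not_gt
    rw [if_neg h3, Real.sign_of_neg h1, Real.sign_of_pos h2]
    rcases hk with rfl | rfl <;> simp
  · have h3 : ¬ 0 < (w.1 : ℝ) * (w.2 + α) := (mul_neg_of_pos_of_neg h1 h2).le.not_gt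
    rw [if_neg h3, Real.sign_of_pos h1, Real.sign_of_neg h2]
    rcases hk with rfl | rfl <;> simp
  · have h3 : 0 < (w.1 : ℝ) * (w.2 + α) := mul_pos h1 h2
    rw [if_pos h3, Real.sign_of_pos h1, Real.sign_of_pos h2,
      Int.sign_eq_one_of_pos (by exact_mod_cast h1)]
    rcases hk with rfl | rfl
    · simp; field_simp; linear_combination (-2 * qFac τ α β w) * hI
    · simp; rw [inv_mul_eq_iff_eq_mul₀ (by simp [hyC])]; ring_nf; simp [hI]

/-! ### The mixed expansion away from the zero column -/

theorem continuousOn_pow_mul_mixedTerm (k : ℕ) (τ : ℍ) (α β : ℝ)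
    (w : ℤ × ℤ) :
    ContinuousOn (fun t : ℝ => (t : ℂ) ^ (k - 1) * mixedTerm k τ α β t w) (Set.Ioi 0) := by
  have hy : 0 < τ.im := τ.im_pos
  have h0 : ∀ t ∈ Set.Ioi (0 : ℝ), (t : ℂ) ≠ 0 := fun t ht => by exact_mod_cast (ne_of_gt ht)
  have h00 : ∀ t ∈ Set.Ioi (0 : ℝ), 2 * (Real.pi : ℂ) * t ≠ 0 := fun t ht => by
    have := h0 t ht
    have hpi : (Real.pi : ℂ) ≠ 0 := by exact_mod_cast Real.pi_ne_zero
    simp [this]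
  have h1 : ContinuousOn (fun t : ℝ => slope τ α t w) (Set.Ioi 0) := by
    unfold slope
    fun_prop (disch := assumption)
  have h2 : ContinuousOn (fun t : ℝ => mixedCoeff k τ α t w) (Set.Ioi 0) := by
    unfold mixedCoeff
    split_ifs
    · exact h1
    · have : ContinuousOn (fun t : ℝ => (τ.im : ℂ) / (2 * Real.pi * t)) (Set.Ioi 0) := by
        fun_prop (disch := assumption)
      exact this.add (h1.pow 2)
  have h3 : ContinuousOn (fun t : ℝ => uVar w.1 (w.2 + α) t) (Set.Ioi 0) := by
    unfold uVar
    have : ∀ t ∈ Set.Ioi (0 : ℝ), √t ≠ 0 := fun t ht => (Real.sqrt_pos.2 ht).ne'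
    fun_prop (disch := assumption)
  have h4 : ContinuousOn (fun t : ℝ => (t : ℂ) ^ (k - 1) * (((√τ.im / √t : ℝ) : ℂ) *
      (mixedCoeff k τ α t w * (((Real.exp (-(Real.pi * τ.im) * uVar w.1 (w.2 + α) t ^ 2) : ℝ) : ℂ)
        * qFac τ α β w)))) (Set.Ioi 0) := by
    have h5 : ContinuousOn (fun t : ℝ => √τ.im / √t) (Set.Ioi 0) := by
      have : ∀ t ∈ Set.Ioi (0 : ℝ), √t ≠ 0 := fun t ht => (Real.sqrt_pos.2 ht).ne'
      fun_prop (disch := assumption)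
    have h6 := Complex.continuous_ofReal.comp_continuousOn h5
    have h7 := Complex.continuous_ofReal.comp_continuousOn
      (((h3.pow 2).const_mul (-(Real.pi * τ.im))).rexp)
    exact (by fun_prop : ContinuousOn (fun t : ℝ => (t : ℂ) ^ (k - 1)) (Set.Ioi 0)).mul
      (h6.mul (h2.mul (h7.mul continuousOn_const)))
  refine h4.congr fun t ht => ?_
  simp only [mixedTerm]
  rw [exp_mixedExp_eq τ α β ht, rpow_neg_half_eq _ hy ht]

/-- The terms of the mixed expansion which decay at both ends of `(0, ∞)`. -/
def offTerm (k : ℕ) (τ : ℍ) (α β t : ℝ) (w : ℤ × ℤ) : ℂ :=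
  if w.1 ≠ 0 ∧ (w.2 : ℝ) + α ≠ 0 then mixedTerm k τ α β t w else 0

theorem summable_offTerm {k : ℕ} (τ : ℍ) (α β : ℝ) {t : ℝ} (ht : 0 < t) :
    Summable (offTerm k τ α β t) :=
  (summable_mixedTerm (k := k) τ α β ht).indicator {w | w.1 ≠ 0 ∧ (w.2 : ℝ) + α ≠ 0}
    |>.congr fun w => by
      simp only [offTerm, Set.indicator_apply, Set.mem_ofPred_eq]

/-- The terms with `l ≠ 0` and `ν ≠ 0` contribute the nonconstant part of the `q`-expansion. -/
theorem integral_offTerm {k : ℕ} (hk : k = 1 ∨ k = 2) (τ : ℍ) (α β : ℝ) :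
    IntegrableOn (fun t : ℝ => (t : ℂ) ^ (k - 1) * ∑' w, offTerm k τ α β t w) (Set.Ioi 0) ∧
      HasSum (fun w : ℤ × ℤ => signCoeff k w.1 (w.2 + α) * qFac τ α β w)
        (normFac k τ * ∫ t in Set.Ioi (0 : ℝ), (t : ℂ) ^ (k - 1) *
          ∑' w, offTerm k τ α β t w) := by
  obtain ⟨δ, hδ, hδ1, hδ2⟩ := exists_lower_bound_shift α
  obtain ⟨C, c, ε, hc, hε, hb⟩ := exists_mixedTerm_bound hk τ α β hδ hδ1
  have hC : 0 ≤ C := by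
    obtain ⟨n, hn⟩ : ∃ n : ℤ, (n : ℝ) + α ≠ 0 := by
      by_contra! h
      have h0 := h 0
      have h1 := h 1
      push_cast at h0 h1
      linarith
    have := (norm_nonneg _).trans (hb (1, n) 1 (by norm_num) (hδ2 n hn) one_pos)
    exact nonneg_of_mul_nonneg_left (nonneg_of_mul_nonneg_left this (Real.exp_pos _))
      (Real.exp_pos _)
  obtain ⟨h1, h2, h3⟩ := integrableOn_hasSum_of_exp_bound
    (f := fun (w : ℤ × ℤ) (t : ℝ) => (t : ℂ) ^ (k - 1) * offTerm k τ α β t w)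
    (c := fun w => C * Real.exp (-c * (|(w.1 : ℝ)| + |(w.2 : ℝ) + α|))) le_rfl hε
    ((summable_exp_neg_abs_prod hc α).mul_left C)
    (fun w => by
      by_cases h : w.1 ≠ 0 ∧ (w.2 : ℝ) + α ≠ 0
      · simp only [offTerm, if_pos h]
        exact continuousOn_pow_mul_mixedTerm k τ α β w
      · simp only [offTerm, if_neg h, mul_zero]
        exact continuousOn_const)
    (fun w t ht => by
      by_cases h : w.1 ≠ 0 ∧ (w.2 : ℝ) + α ≠ 0
      · simp only [offTerm, if_pos h]
        exact hb w t h.1 (hδ2 _ h.2) ht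
      · simp only [offTerm, if_neg h, mul_zero, norm_zero]
        positivity)
  simp only [tsum_mul_left] at h2 h3
  refine ⟨h2, (h3.mul_left (normFac k τ)).congr_fun fun w => ?_⟩
  by_cases h : w.1 ≠ 0 ∧ (w.2 : ℝ) + α ≠ 0
  · have h4 := h1 w
    simp only [offTerm, if_pos h] at h4 ⊢
    exact (integral_mixedTerm hk τ α β h.1 h.2 h4).symm
  · have : ¬ 0 < (w.1 : ℝ) * (w.2 + α) := fun h0 => h
      ⟨fun h1 => by simp [h1] at h0, fun h1 => by simp [h1] at h0⟩
    simp [offTerm, if_neg h, signCoeff, if_neg this]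

/-- The terms with zero frequency in the mixed expansion of the rows. -/
def zeroTerm (k : ℕ) (τ : ℍ) (α β t : ℝ) (n : ℤ) : ℂ :=
  if (n : ℝ) + α ≠ 0 then mixedTerm k τ α β t (0, n) else 0

/-- The row through the real axis, if there is one. -/
def realRow (k : ℕ) (τ : ℍ) (α β t : ℝ) (n : ℤ) : ℂ :=
  if (n : ℝ) + α ≠ 0 then 0 else rowE k τ α β t n

theorem summable_zeroTerm {k : ℕ} (τ : ℍ) (α β : ℝ) {t : ℝ} (ht : 0 < t) :
    Summable (zeroTerm k τ α β t) :=
  (((summable_mixedTerm (k := k) τ α β ht).comp_injective (i := fun n : ℤ => ((0 : ℤ), n))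
    fun _ _ h => (Prod.ext_iff.1 h).2).indicator {n : ℤ | (n : ℝ) + α ≠ 0}).congr fun n => by
      simp only [zeroTerm, Set.indicator_apply, Set.mem_ofPred_eq, Function.comp]

/-- The theta series is the sum of three parts: the terms with `l ≠ 0` in the rows off the real
axis, the terms with `l = 0` in these rows, and the row on the real axis, to which Poisson
summation is not applied. -/
theorem thetaE_eq {k : ℕ} (hk : k = 1 ∨ k = 2) (τ : ℍ) (α β : ℝ) {t : ℝ} (ht : 0 < t) :
    thetaE k τ α β t = ∑' w, offTerm k τ α β t w + ∑' n, zeroTerm k τ α β t n +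
      ∑' n, realRow k τ α β t n := by
  have h := hasSum_rowE k τ α β ht
  have ho := (Equiv.prodComm ℤ ℤ).summable_iff.2 (summable_offTerm (k := k) τ α β ht)
  have hr : Summable (realRow k τ α β t) := by
    refine (h.summable.indicator {n : ℤ | ¬ (n : ℝ) + α ≠ 0}).congr fun n => ?_
    by_cases h0 : (n : ℝ) + α = 0 <;> simp [realRow, h0]
  have e1 : ∑' w, offTerm k τ α β t w = ∑' n, ∑' l, offTerm k τ α β t (l, n) :=
    ((Equiv.prodComm ℤ ℤ).tsum_eq _).symm.trans (Summable.tsum_prod ho)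
  have hp : Summable fun n => ∑' l, offTerm k τ α β t (l, n) := ho.prod
  rw [e1, ← Summable.tsum_add hp (summable_zeroTerm τ α β ht),
    ← Summable.tsum_add (hp.add (summable_zeroTerm τ α β ht)) hr, ← h.tsum_eq]
  refine tsum_congr fun n => ?_
  change _ = ∑' l, offTerm k τ α β t (l, n) + _ + _
  by_cases h0 : (n : ℝ) + α = 0
  · simp [offTerm, zeroTerm, realRow, h0]
  · have hs : Summable fun l : ℤ => mixedTerm k τ α β t (l, n) :=
      (summable_mixedTerm (k := k) τ α β ht).comp_injective (i := fun l : ℤ => (l, n)) fun _ _ h => (Prod.ext_iff.1 h).1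
    rw [rowE_eq hk τ α β ht, Summable.tsum_eq_add_tsum_ite hs 0]
    simp only [zeroTerm, realRow, if_pos h0, add_zero, offTerm]
    rw [add_comm]
    congr 1
    refine tsum_congr fun l => ?_
    by_cases hl : l = 0 <;> simp [hl, h0]

/-! ### The zero column, cut off at a positive radius -/

/-- A bound for the terms with `l = 0` on `(ε, ∞)`. It is not uniform in `ε`: the series of their
integrals over `(0, ∞)` diverges, which is why the integral is first cut off at `ε`. -/
theorem norm_pow_mul_mixedTerm_zero_le {k : ℕ} (hk : k = 1 ∨ k = 2) (τ : ℍ) (α β : ℝ)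
    {δ ε : ℝ} (hδ : 0 < δ) (hε : 0 < ε) {t : ℝ} (ht : ε < t) {n : ℤ}
    (hν : δ ≤ |(n : ℝ) + α|) :
    ‖(t : ℂ) ^ (k - 1) * mixedTerm k τ α β t (0, n)‖ ≤
      √τ.im * (τ.im / (ε * √ε * δ) + (τ.im / (2 * Real.pi * (ε * √ε * δ ^ 2)) + τ.im ^ 2 / √ε)) *
        (t * |(n : ℝ) + α| ^ 2 * Real.exp (-(Real.pi * τ.im) * (t * |(n : ℝ) + α| ^ 2))) := by
  have hy : 0 < τ.im := τ.im_pos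
  have ht0 : 0 < t := hε.trans ht
  have hpi := Real.pi_pos
  set ν := (n : ℝ) + α with hνdef
  have hν0 : 0 < |ν| := hδ.trans_le hν
  have hse : 0 < √ε := Real.sqrt_pos.2 hε
  have hst : 0 < √t := Real.sqrt_pos.2 ht0
  have hss : √ε ≤ √t := Real.sqrt_le_sqrt ht.le
  have hts : t = √t * √t := (Real.mul_self_sqrt ht0.le).symm
  have hexp : Real.exp ((mixedExp τ α β t 0 (0, n)).re) =
      Real.exp (-(Real.pi * τ.im) * (t * |ν| ^ 2)) := by
    rw [mixedExp_zero_re τ α β ht0, sq_abs]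
    congr 1
    simp only [Int.cast_zero]
    ring
  have hsl : ‖slope τ α t (0, n)‖ = τ.im * |ν| := by
    rw [norm_slope]
    simp [hνdef]
  rw [mixedTerm, rpow_neg_half_eq _ hy ht0, norm_mul, norm_mul, norm_mul, Complex.norm_exp, hexp,
    Complex.norm_real, Real.norm_of_nonneg (by positivity)]
  have key : ‖(t : ℂ) ^ (k - 1)‖ * (√τ.im / √t * ‖mixedCoeff k τ α t (0, n)‖) ≤
      √τ.im * (τ.im / (ε * √ε * δ) + (τ.im / (2 * Real.pi * (ε * √ε * δ ^ 2)) + τ.im ^ 2 / √ε)) *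
        (t * |ν| ^ 2) := by
    rcases hk with rfl | rfl
    · rw [mixedCoeff, if_pos rfl, hsl]
      have h1 : √τ.im / √t * (τ.im * |ν|) = √τ.im * (τ.im / (t * √t * |ν|)) * (t * |ν| ^ 2) := by
        field_simp
      simp only [Nat.sub_self, pow_zero, norm_one, one_mul]
      rw [h1]
      have h2 : τ.im / (t * √t * |ν|) ≤ τ.im / (ε * √ε * δ) := by gcongr
      have h3 : 0 ≤ τ.im / (2 * Real.pi * (ε * √ε * δ ^ 2)) + τ.im ^ 2 / √ε := by positivity
      gcongr
      linarith
    · rw [mixedCoeff, if_neg (by norm_num)]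
      have h0 : ‖(τ.im : ℂ) / (2 * Real.pi * t) + slope τ α t (0, n) ^ 2‖ ≤
          τ.im / (2 * Real.pi * t) + τ.im ^ 2 * |ν| ^ 2 := by
        refine (norm_add_le _ _).trans (add_le_add (le_of_eq ?_) (le_of_eq ?_))
        · rw [show (τ.im : ℂ) / (2 * Real.pi * t) = ((τ.im / (2 * Real.pi * t) : ℝ) : ℂ) by
            push_cast; rfl, Complex.norm_real, Real.norm_of_nonneg (by positivity)]
        · rw [norm_pow, hsl, mul_pow]
      have h1 : ‖(t : ℂ) ^ (2 - 1)‖ = t := by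
        simp [abs_of_pos ht0]
      rw [h1]
      have h2 : t * (√τ.im / √t * (τ.im / (2 * Real.pi * t) + τ.im ^ 2 * |ν| ^ 2)) =
          √τ.im * (τ.im / (2 * Real.pi * (t * √t * |ν| ^ 2)) + τ.im ^ 2 / √t) * (t * |ν| ^ 2) := by
        field_simp
      have h3 : τ.im / (2 * Real.pi * (t * √t * |ν| ^ 2)) ≤
          τ.im / (2 * Real.pi * (ε * √ε * δ ^ 2)) := by gcongr
      have h4 : τ.im ^ 2 / √t ≤ τ.im ^ 2 / √ε := by gcongr
      have h5 : 0 ≤ τ.im / (ε * √ε * δ) := by positivity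
      calc _ ≤ t * (√τ.im / √t * (τ.im / (2 * Real.pi * t) + τ.im ^ 2 * |ν| ^ 2)) := by gcongr
        _ = _ := h2
        _ ≤ _ := mul_le_mul_of_nonneg_right
            (mul_le_mul_of_nonneg_left (by linarith) (by positivity)) (by positivity)
  calc _ = ‖(t : ℂ) ^ (k - 1)‖ * (√τ.im / √t * ‖mixedCoeff k τ α t (0, n)‖) *
      Real.exp (-(Real.pi * τ.im) * (t * |ν| ^ 2)) := by ring
    _ ≤ _ := mul_le_mul_of_nonneg_right key (Real.exp_pos _).le
    _ = _ := by ring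

/-- The integral over `(ε, ∞)` of the terms with `l = 0`, as a series of differences of values of
the primitive at `∞` and at `ε`. -/
theorem hasSum_integral_zeroTerm {k : ℕ} (hk : k = 1 ∨ k = 2) (τ : ℍ) (α β : ℝ) {ε : ℝ}
    (hε : 0 < ε) :
    HasSum (fun n : ℤ => if (n : ℝ) + α ≠ 0 then
        (if k = 1 then -Complex.I * τ.im * Real.sign (n + α) else 0) -
          mixedPrim k τ.im 0 (n + α) ε else 0)
      (∫ t in Set.Ioi ε, (t : ℂ) ^ (k - 1) * ∑' n, zeroTerm k τ α β t n) := by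
  have hy : 0 < τ.im := τ.im_pos
  have hpi := Real.pi_pos
  obtain ⟨δ, hδ, hδ1, hδ2⟩ := exists_lower_bound_shift α
  obtain ⟨D, hD⟩ : ∃ D, D = √τ.im * (τ.im / (ε * √ε * δ) +
    (τ.im / (2 * Real.pi * (ε * √ε * δ ^ 2)) + τ.im ^ 2 / √ε)) := ⟨_, rfl⟩
  have hD0 : 0 ≤ D := by rw [hD]; positivity
  obtain ⟨b, hb⟩ : ∃ b, b = Real.pi * τ.im := ⟨_, rfl⟩
  have hb0 : 0 < b := by rw [hb]; positivity
  have hs : Summable fun n : ℤ => Real.exp (-(b / 4 * ε * δ) * |(n : ℝ) + α|) := by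
    have := (summable_exp_neg_abs_prod (c := b / 4 * ε * δ) (by positivity) α).comp_injective
      (i := fun n : ℤ => ((0 : ℤ), n)) fun _ _ h => (Prod.ext_iff.1 h).2
    simpa [Function.comp_def] using this
  obtain ⟨h1, -, h3⟩ := integrableOn_hasSum_of_exp_bound
    (f := fun (n : ℤ) (t : ℝ) => (t : ℂ) ^ (k - 1) * zeroTerm k τ α β t n) (a := ε)
    (c := fun n => D * (2 / b) * Real.exp (-(b / 4 * ε * δ) * |(n : ℝ) + α|))
    (ε := b / 4 * δ ^ 2) hε.le (by positivity) (hs.mul_left _)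
    (fun n => by
      by_cases h : (n : ℝ) + α ≠ 0
      · simp only [zeroTerm, if_pos h]
        exact (continuousOn_pow_mul_mixedTerm k τ α β _).mono (Set.Ioi_subset_Ioi hε.le)
      · simp only [zeroTerm, if_neg h, mul_zero]
        exact continuousOn_const)
    (fun n t ht => by
      by_cases h : (n : ℝ) + α ≠ 0
      · simp only [zeroTerm, if_pos h]
        have hν := hδ2 n h
        have ht0 : 0 < t := hε.trans ht
        refine (norm_pow_mul_mixedTerm_zero_le hk τ α β hδ hε ht hν).trans ?_
        rw [← hD, ← hb]
        set x := t * |(n : ℝ) + α| ^ 2 with hx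
        have hx0 : 0 ≤ x := by positivity
        have hxe : x ≤ 2 / b * Real.exp (b / 2 * x) := by
          have := pow_le_mul_exp 1 (b := b / 2) (x := x) (by positivity) hx0
          simpa [div_eq_mul_inv, mul_comm] using this
        -- half of the decay in `x = tν²` absorbs the factor `x`, the other half is split between
        -- the summation variable and the integration variable
        have hxl : b / 4 * ε * δ * |(n : ℝ) + α| + b / 4 * δ ^ 2 * t ≤ b / 2 * x := by
          have g1 : ε * (δ * |(n : ℝ) + α|) ≤ x := by
            rw [hx, sq]; gcongr
          have g2 : t * δ ^ 2 ≤ x := by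
            rw [hx]; gcongr
          nlinarith
        calc D * (x * Real.exp (-b * x))
            ≤ D * (2 / b * Real.exp (b / 2 * x) * Real.exp (-b * x)) := by gcongr
          _ = D * (2 / b) * Real.exp (-(b / 2 * x)) := by
              rw [mul_assoc (2 / b), ← Real.exp_add]
              ring_nf
          _ ≤ D * (2 / b) * Real.exp (-(b / 4 * ε * δ * |(n : ℝ) + α| + b / 4 * δ ^ 2 * t)) := by
              gcongr
          _ = _ := by
              rw [mul_assoc (D * (2 / b)), ← Real.exp_add]
              ring_nf
      · simp only [zeroTerm, if_neg h, mul_zero, norm_zero]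
        positivity)
  simp only [tsum_mul_left] at h3
  refine h3.congr_fun fun n => ?_
  by_cases h : (n : ℝ) + α ≠ 0
  · have h4 := h1 n
    simp only [zeroTerm, if_pos h] at h4 ⊢
    have hd : ∀ t ∈ Set.Ici ε, HasDerivAt (fun t => mixedPrim k τ.im 0 (n + α) t)
        ((t : ℂ) ^ (k - 1) * mixedTerm k τ α β t (0, n)) t := fun t ht => by
      have := hasDerivAt_mixedPrim hk τ α β (hε.trans_le ht) (0, n)
      simpa [qFac] using this
    rw [integral_Ioi_of_hasDerivAt_of_tendsto' hd h4 (tendsto_mixedPrim_atTop hy h)]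
    simp
  · simp [zeroTerm, if_neg h]

/-- The function `1 - 2√y ∫₀ˣ exp(-πys²) ds`, which decreases from `1` to `0` on `[0, ∞)`. -/
def gaussTail (y x : ℝ) : ℝ := 1 - 2 * √y * gaussPrim y x

theorem gaussTail_zero (y : ℝ) : gaussTail y 0 = 1 := by simp [gaussTail, gaussPrim]

theorem hasDerivAt_gaussTail (y x : ℝ) :
    HasDerivAt (gaussTail y) (-(2 * √y * Real.exp (-(Real.pi * y) * x ^ 2))) x :=
  ((hasDerivAt_gaussPrim y x).const_mul (2 * √y)).const_sub 1

theorem tendsto_gaussTail {y : ℝ} (hy : 0 < y) : Tendsto (gaussTail y) atTop (𝓝 0) := by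
  have h := ((tendsto_gaussPrim_atTop hy).const_mul (2 * √y)).const_sub 1
  have hs := (Real.sqrt_pos.2 hy).ne'
  rwa [mul_one_div_cancel (by positivity), sub_self] at h

/-- The derivative of the Gaussian tail increases on `[0, ∞)`. -/
theorem convexOn_gaussTail {y : ℝ} (hy : 0 < y) : ConvexOn ℝ (Set.Ici 0) (gaussTail y) := by
  refine MonotoneOn.convexOn_of_deriv (convex_Ici 0)
    (fun x _ => (hasDerivAt_gaussTail y x).continuousAt.continuousWithinAt)
    (fun x _ => (hasDerivAt_gaussTail y x).differentiableAt.differentiableWithinAt) ?_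
  intro a ha b hb hab
  rw [interior_Ici, Set.mem_Ioi] at ha hb
  rw [(hasDerivAt_gaussTail y a).deriv, (hasDerivAt_gaussTail y b).deriv]
  have hpi := Real.pi_pos
  refine neg_le_neg (mul_le_mul_of_nonneg_left (Real.exp_le_exp.2 ?_) (by positivity))
  have : a ^ 2 ≤ b ^ 2 := by gcongr
  have h0 : 0 < Real.pi * y := by positivity
  nlinarith

/-! ### The zero column as the radius tends to zero -/

theorem tendsto_integral_Ioi_nhdsGT_zero {f : ℝ → ℂ} (hf : IntegrableOn f (Set.Ioi 0)) :
    Tendsto (fun ε => ∫ t in Set.Ioi ε, f t) (𝓝[>] 0) (𝓝 (∫ t in Set.Ioi (0 : ℝ), f t)) := by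
  have hc : AECover (volume.restrict (Set.Ioi (0 : ℝ))) (𝓝[>] (0 : ℝ)) fun ε => Set.Ioi ε :=
    aecover_Ioi_of_Ioi (tendsto_id.mono_right nhdsWithin_le_nhds)
  refine (hc.integral_tendsto_of_countably_generated hf).congr' ?_
  filter_upwards [self_mem_nhdsWithin] with ε hε
  rw [Measure.restrict_restrict measurableSet_Ioi,
    Set.inter_eq_self_of_subset_left (Set.Ioi_subset_Ioi (le_of_lt hε))]

theorem integrable_tsum_of_summable_norm {ι Ω : Type*} [Countable ι] [MeasurableSpace Ω]
    {μ : Measure Ω} {f : ι → Ω → ℂ} (hf : ∀ i, Integrable (f i) μ)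
    (hs : Summable fun i => ∫ x, ‖f i x‖ ∂μ)
    (hm : AEStronglyMeasurable (fun x => ∑' i, f i x) μ) :
    Integrable (fun x => ∑' i, f i x) μ := by
  refine ⟨hm, ?_⟩
  refine lt_of_le_of_lt (lintegral_mono fun x => enorm_tsum_le_tsum_enorm) ?_
  rw [lintegral_tsum fun i => (hf i).1.enorm, lt_top_iff_ne_top]
  have (i : ι) : ∫⁻ a, ‖f i a‖ₑ ∂μ = ENNReal.ofReal (∫ a, ‖f i a‖ ∂μ) := by
    rw [ofReal_integral_norm_eq_lintegral_enorm (hf i)]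
  rw [funext this]
  exact hs.tsum_ofReal_ne_top

/-- For a convex function `G` on `[0, ∞)` decreasing from `1` to `0`, the sums of the differences
`G (δ (n + a)) - G (δ (n + 1 - a))` tend to `1 - 2a` as `δ → 0`: by convexity each difference is
squeezed between `1 - 2a` times differences at distance `δ`, which telescope. -/
theorem tendsto_sum_convex_of_le_half {G S : ℝ → ℝ} (hG : ConvexOn ℝ (Set.Ici 0) G)
    (hc : ContinuousAt G 0) (hG0 : G 0 = 1) (hG1 : Tendsto G atTop (𝓝 0)) {a : ℝ} (ha : 0 < a)
    (ha1 : a ≤ 1 / 2)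
    (hS : ∀ δ : ℝ, 0 < δ → HasSum (fun n : ℕ => G (δ * (n + a)) - G (δ * (n + 1 - a))) (S δ)) :
    Tendsto S (𝓝[>] 0) (𝓝 (1 - 2 * a)) := by
  -- `n + 1 - a` is the convex combination of `n + a` and `n + 1 + a` with weights `1 - θ` and `θ`
  set θ := 1 - 2 * a with hθ
  have hθ0 : 0 ≤ θ := by rw [hθ]; linarith
  have hθ1 : 0 ≤ 1 - θ := by rw [hθ]; linarith
  have hlim : ∀ b : ℝ, Tendsto (fun δ => G (δ * b)) (𝓝[>] 0) (𝓝 1) := fun b => by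
    have h1 : Tendsto (fun δ : ℝ => δ * b) (𝓝[>] 0) (𝓝 0) := by
      have : Tendsto (fun δ : ℝ => δ * b) (𝓝 0) (𝓝 (0 * b)) := tendsto_id.mul_const b
      rw [zero_mul] at this
      exact this.mono_left nhdsWithin_le_nhds
    have := hc.tendsto.comp h1
    rwa [hG0] at this
  have hinf : ∀ δ b : ℝ, 0 < δ → Tendsto (fun n : ℕ => G (δ * (n + b))) atTop (𝓝 0) :=
    fun δ b hδ => hG1.comp ((tendsto_atTop_add_const_right _ b
      tendsto_natCast_atTop_atTop).const_mul_atTop hδ)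
  have hlow : ∀ δ : ℝ, 0 < δ → θ * G (δ * a) ≤ S δ := fun δ hδ => by
    have h1 : Tendsto (fun N : ℕ => θ * (G (δ * a) - G (δ * (N + a)))) atTop
        (𝓝 (θ * (G (δ * a) - 0))) := ((hinf δ a hδ).const_sub _).const_mul θ
    rw [sub_zero] at h1
    refine le_of_tendsto_of_tendsto' h1 (hS δ hδ).tendsto_sum_nat fun N => ?_
    have e : θ * (G (δ * a) - G (δ * (N + a))) =
        ∑ n ∈ Finset.range N, θ * (G (δ * (n + a)) - G (δ * ((n + 1 : ℕ) + a))) := by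
      rw [← Finset.mul_sum, Finset.sum_range_sub' (fun n : ℕ => G (δ * (n + a)))]
      simp
    rw [e]
    refine Finset.sum_le_sum fun n _ => ?_
    have hx : δ * (n + a) ∈ Set.Ici (0 : ℝ) := Set.mem_Ici.2 (by positivity)
    have hy : δ * ((n + 1 : ℕ) + a) ∈ Set.Ici (0 : ℝ) := Set.mem_Ici.2 (by positivity)
    have := hG.2 hx hy hθ1 hθ0 (by ring)
    simp only [smul_eq_mul] at this
    have e2 : (1 - θ) * (δ * (n + a)) + θ * (δ * ((n + 1 : ℕ) + a)) = δ * (n + 1 - a) := by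
      rw [hθ]; push_cast; ring
    rw [e2] at this
    linarith
  -- `n + 1 + a` lies between `n + 1 - a` and `n + 2 - a`, which bounds all but the first term
  have hup : ∀ δ : ℝ, 0 < δ →
      S δ ≤ G (δ * a) - G (δ * (1 - a)) + θ * G (δ * (1 - a)) := fun δ hδ => by
    have h1 : Tendsto (fun N : ℕ => G (δ * a) - G (δ * (1 - a)) +
        θ * (G (δ * (1 - a)) - G (δ * (N + (1 - a))))) atTop
        (𝓝 (G (δ * a) - G (δ * (1 - a)) + θ * (G (δ * (1 - a)) - 0))) :=
      (((hinf δ (1 - a) hδ).const_sub _).const_mul θ).const_add _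
    rw [sub_zero] at h1
    refine le_of_tendsto_of_tendsto' ((tendsto_add_atTop_iff_nat 1).2
      (hS δ hδ).tendsto_sum_nat) h1 fun N => ?_
    have e : θ * (G (δ * (1 - a)) - G (δ * (N + (1 - a)))) =
        ∑ n ∈ Finset.range N, θ * (G (δ * (n + (1 - a))) -
          G (δ * ((n + 1 : ℕ) + (1 - a)))) := by
      rw [← Finset.mul_sum, Finset.sum_range_sub' (fun n : ℕ => G (δ * (n + (1 - a))))]
      simp
    rw [e, Finset.sum_range_succ']
    simp only [Nat.cast_zero, zero_add]
    rw [add_comm]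
    refine add_le_add le_rfl (Finset.sum_le_sum fun n _ => ?_)
    have hx : δ * (n + (1 - a)) ∈ Set.Ici (0 : ℝ) :=
      Set.mem_Ici.2 (mul_nonneg hδ.le (by have : (0 : ℝ) ≤ n := Nat.cast_nonneg n; linarith))
    have hy : δ * ((n + 1 : ℕ) + (1 - a)) ∈ Set.Ici (0 : ℝ) :=
      Set.mem_Ici.2 (mul_nonneg hδ.le
        (by have : (0 : ℝ) ≤ (n + 1 : ℕ) := Nat.cast_nonneg _; linarith))
    have := hG.2 hx hy hθ0 hθ1 (by ring)
    simp only [smul_eq_mul] at this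
    have e2 : θ * (δ * (n + (1 - a))) + (1 - θ) * (δ * ((n + 1 : ℕ) + (1 - a))) =
        δ * ((n + 1 : ℕ) + a) := by
      rw [hθ]; push_cast; ring
    have e3 : δ * (((n + 1 : ℕ) : ℝ) + 1 - a) = δ * ((n + 1 : ℕ) + (1 - a)) := by ring
    rw [e2] at this
    rw [e3]
    linarith
  have l1 : Tendsto (fun δ => θ * G (δ * a)) (𝓝[>] 0) (𝓝 θ) := by
    simpa using (hlim a).const_mul θ
  have l2 : Tendsto (fun δ => G (δ * a) - G (δ * (1 - a)) + θ * G (δ * (1 - a))) (𝓝[>] 0)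
      (𝓝 θ) := by
    simpa using ((hlim a).sub (hlim (1 - a))).add ((hlim (1 - a)).const_mul θ)
  exact tendsto_of_tendsto_of_tendsto_of_le_of_le' l1 l2
    (by filter_upwards [self_mem_nhdsWithin] with δ hδ using hlow δ hδ)
    (by filter_upwards [self_mem_nhdsWithin] with δ hδ using hup δ hδ)

/-- The case `a ≥ 1 / 2` follows from `tendsto_sum_convex_of_le_half` by exchanging `a` and `1 -
a`. -/
theorem tendsto_sum_convex {G S : ℝ → ℝ} (hG : ConvexOn ℝ (Set.Ici 0) G)
    (hc : ContinuousAt G 0) (hG0 : G 0 = 1) (hG1 : Tendsto G atTop (𝓝 0)) {a : ℝ} (ha : 0 < a)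
    (ha1 : a < 1)
    (hS : ∀ δ : ℝ, 0 < δ → HasSum (fun n : ℕ => G (δ * (n + a)) - G (δ * (n + 1 - a))) (S δ)) :
    Tendsto S (𝓝[>] 0) (𝓝 (1 - 2 * a)) := by
  rcases le_total a (1 / 2) with h | h
  · exact tendsto_sum_convex_of_le_half hG hc hG0 hG1 ha h hS
  · have := (tendsto_sum_convex_of_le_half (S := fun δ => -S δ) hG hc hG0 hG1
      (a := 1 - a) (by linarith) (by linarith) fun δ hδ => ?_).neg
    · simp only [neg_neg] at this
      convert this using 2
      ring
    · refine (hS δ hδ).neg.congr_fun fun n => ?_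
      rw [show (n : ℝ) + (1 - a) = n + 1 - a by ring, show (n : ℝ) + 1 - (1 - a) = n + a by ring]
      ring

/-- In weight `1` the rows `ν = n + a` and `ν = -(n + 1 - a)`, where `a` is the fractional part of
`α`, contribute with opposite signs. Grouped in pairs, the terms with `l = 0` form the sum of
`tendsto_sum_convex` for the Gaussian tail. -/
theorem integral_zeroTerm_one (τ : ℍ) {α : ℝ} (hα : ∀ n : ℤ, (n : ℝ) + α ≠ 0) (β : ℝ)
    (hi : IntegrableOn (fun t : ℝ => (t : ℂ) ^ (1 - 1) * ∑' n, zeroTerm 1 τ α β t n)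
      (Set.Ioi 0)) :
    ∫ t in Set.Ioi (0 : ℝ), (t : ℂ) ^ (1 - 1) * ∑' n, zeroTerm 1 τ α β t n =
      -Complex.I * τ.im * (1 - 2 * Int.fract α : ℝ) := by
  have hy : 0 < τ.im := τ.im_pos
  have hyC : (τ.im : ℂ) ≠ 0 := by exact_mod_cast hy.ne'
  set a := Int.fract α with ha
  have hfl : (⌊α⌋ : ℝ) + a = α := Int.floor_add_fract α
  have ha0 : 0 < a := (Int.fract_nonneg α).lt_of_ne fun h => hα (-⌊α⌋) (by push_cast; linarith)
  have ha1 : a < 1 := Int.fract_lt_one α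
  set J : ℝ → ℂ := fun ε => ∫ t in Set.Ioi ε, (t : ℂ) ^ (1 - 1) * ∑' n, zeroTerm 1 τ α β t n
    with hJ
  have hsum : ∀ δ : ℝ, 0 < δ → HasSum (fun n : ℕ =>
      ((gaussTail τ.im (δ * (n + a)) - gaussTail τ.im (δ * (n + 1 - a)) : ℝ) : ℂ))
      (Complex.I / τ.im * J (δ ^ 2)) := fun δ hδ => by
    have h := hasSum_integral_zeroTerm (k := 1) (Or.inl rfl) τ α β (ε := δ ^ 2) (by positivity)
    have h2 := (((Equiv.addRight (-⌊α⌋)).hasSum_iff.2 h).nat_add_neg_add_one).mul_left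
      (Complex.I / τ.im)
    refine h2.congr_fun fun n => ?_
    simp only [Function.comp, Equiv.coe_addRight, mixedPrim, if_true, if_pos (hα _)]
    have e1 : (((n : ℤ) + -⌊α⌋ : ℤ) : ℝ) + α = n + a := by push_cast; linarith
    have e2 : ((-((n : ℤ) + 1) + -⌊α⌋ : ℤ) : ℝ) + α = -(n + 1 - a) := by push_cast; linarith
    have hn : (0 : ℝ) ≤ n := Nat.cast_nonneg n
    have e3 : ∀ x, uVar 0 x (δ ^ 2) = δ * x := fun x => by
      simp [uVar, Real.sqrt_sq hδ.le]
    rw [e1, e2, e3, e3, Real.sign_of_pos (by linarith), Real.sign_of_neg (by linarith), mul_neg,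
      gaussPrim_neg, gaussTail, gaussTail]
    push_cast
    field_simp
    ring_nf
    simp only [Complex.I_sq]
    ring
  have hre : ∀ δ : ℝ, 0 < δ → HasSum (fun n : ℕ =>
      gaussTail τ.im (δ * (n + a)) - gaussTail τ.im (δ * (n + 1 - a)))
      (Complex.I / τ.im * J (δ ^ 2)).re := fun δ hδ => by
    simpa using Complex.hasSum_re (hsum δ hδ)
  have hval : ∀ δ : ℝ, 0 < δ →
      J (δ ^ 2) = -Complex.I * τ.im * ((Complex.I / τ.im * J (δ ^ 2)).re : ℝ) := fun δ hδ => by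
    have := (hsum δ hδ).unique (Complex.hasSum_ofReal.2 (hre δ hδ))
    rw [← this]
    field_simp
    rw [Complex.I_sq]
    ring
  have hlim := tendsto_sum_convex (convexOn_gaussTail hy)
    (hasDerivAt_gaussTail τ.im 0).continuousAt (gaussTail_zero _) (tendsto_gaussTail hy) ha0 ha1
    hre
  have hlimC := ((Complex.continuous_ofReal.tendsto _).comp hlim).const_mul
    (-Complex.I * τ.im)
  have hJlim := (tendsto_integral_Ioi_nhdsGT_zero hi).comp
    (tendsto_nhdsWithin_iff.2 ⟨((continuous_pow 2).tendsto' (0 : ℝ) 0 (by simp)).mono_left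
      (nhdsWithin_le_nhds (s := Set.Ioi 0)), by
        filter_upwards [self_mem_nhdsWithin] with δ hδ
        have : (0 : ℝ) < δ := hδ
        exact Set.mem_Ioi.2 (by positivity)⟩)
  refine tendsto_nhds_unique hJlim (hlimC.congr' ?_)
  filter_upwards [self_mem_nhdsWithin] with δ hδ
  exact (hval δ hδ).symm

/-- In weight `2` the terms with `l = 0` integrate over `(ε, ∞)` to a multiple of `√ε` times a
one-dimensional theta series, whose behaviour as `ε → 0` is given by its functional equation. -/
theorem integral_zeroTerm_two (τ : ℍ) (α β : ℝ)
    (hi : IntegrableOn (fun t : ℝ => (t : ℂ) ^ (2 - 1) * ∑' n, zeroTerm 2 τ α β t n)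
      (Set.Ioi 0)) :
    ∫ t in Set.Ioi (0 : ℝ), (t : ℂ) ^ (2 - 1) * ∑' n, zeroTerm 2 τ α β t n =
      -(τ.im / Real.pi : ℝ) := by
  have hy : 0 < τ.im := τ.im_pos
  have hpi := Real.pi_pos
  -- the term `n + α = 0`, if there is one, is missing from the sum and is accounted for by `c`
  obtain ⟨c, hc⟩ : ∃ c : ℝ, c = if (α : UnitAddCircle) = 0 then 1 else 0 := ⟨_, rfl⟩
  have hval : ∀ ε : ℝ, 0 < ε →
      ∫ t in Set.Ioi ε, (t : ℂ) ^ (2 - 1) * ∑' n, zeroTerm 2 τ α β t n =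
        ((-(τ.im / Real.pi) * (HurwitzZeta.cosKernel α (1 / (τ.im * ε)) - √τ.im * √ε * c) : ℝ)
          : ℂ) := fun ε hε => by
    have h := hasSum_integral_zeroTerm (k := 2) (Or.inr rfl) τ α β hε
    have h2 := HurwitzZeta.hasSum_int_evenKernel₀ α (t := τ.im * ε) (by positivity)
    rw [← hc] at h2
    have h3 := Complex.hasSum_ofReal.2 (h2.mul_left (-(√τ.im * (τ.im / Real.pi * √ε))))
    refine (h.unique (h3.congr_fun fun n => ?_)).trans ?_
    · by_cases h0 : (n : ℝ) + α = 0
      · simp [h0]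
      · rw [if_pos h0, if_neg h0, mixedPrim, if_neg (by norm_num), if_neg (by norm_num)]
        have e1 : uVar 0 ((n : ℝ) + α) ε ^ 2 = ε * (n + α) ^ 2 := by
          rw [uVar_sq _ _ hε]; ring
        have e2 : -Real.pi * ((n : ℝ) + α) ^ 2 * (τ.im * ε) =
          -(Real.pi * τ.im) * (ε * (n + α) ^ 2) := by ring
        rw [e1, e2]
        push_cast
        ring
    · rw [HurwitzZeta.evenKernel_functional_equation, ← Real.sqrt_eq_rpow,
        Real.sqrt_mul hy.le]
      have h1 : √τ.im ≠ 0 := (Real.sqrt_pos.2 hy).ne'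
      have h2 : √ε ≠ 0 := (Real.sqrt_pos.2 hε).ne'
      congr 1
      field_simp
  have hinv : Tendsto (fun ε : ℝ => 1 / (τ.im * ε)) (𝓝[>] 0) atTop := by
    have := (tendsto_inv_nhdsGT_zero (𝕜 := ℝ)).const_mul_atTop (inv_pos.2 hy)
    refine this.congr fun ε => ?_
    rw [one_div, mul_inv]
  have hcos : Tendsto (fun ε : ℝ => HurwitzZeta.cosKernel α (1 / (τ.im * ε))) (𝓝[>] 0) (𝓝 1) := by
    obtain ⟨p, hp, hO⟩ := HurwitzZeta.isBigO_atTop_cosKernel_sub α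
    have h1 : Tendsto (fun x : ℝ => Real.exp (-p * x)) atTop (𝓝 0) := by
      refine Real.tendsto_exp_atBot.comp ?_
      exact tendsto_id.const_mul_atTop_of_neg (by linarith)
    have h2 := (hO.trans_tendsto h1).add_const 1
    simp only [sub_add_cancel, zero_add] at h2
    exact h2.comp hinv
  have hsq := (tendsto_sqrt_nhdsGT_zero.mono_right nhdsWithin_le_nhds).const_mul √τ.im
  have hlim := (Complex.continuous_ofReal.tendsto _).comp
    ((hcos.sub (hsq.mul_const c)).const_mul (-(τ.im / Real.pi)))
  have e : ((-(τ.im / Real.pi : ℝ) : ℂ)) =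
      ((-(τ.im / Real.pi) * (1 - √τ.im * 0 * c) : ℝ) : ℂ) := by push_cast; ring
  rw [e]
  refine tendsto_nhds_unique (tendsto_integral_Ioi_nhdsGT_zero hi) (hlim.congr' ?_)
  filter_upwards [self_mem_nhdsWithin] with ε hε
  exact (hval ε hε).symm

/-! ### The `q`-expansions in weights one and two -/

theorem mellin_natCast_eq {k : ℕ} (hk : 1 ≤ k) (f : ℝ → ℂ) :
    mellin f k = ∫ t in Set.Ioi (0 : ℝ), (t : ℂ) ^ (k - 1) * f t := by
  rw [mellin]
  refine setIntegral_congr_fun measurableSet_Ioi fun t ht => ?_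
  simp only [smul_eq_mul]
  rw [← Complex.cpow_natCast, Nat.cast_sub hk, Nat.cast_one]

theorem integrableOn_pow_mul_thetaE {k : ℕ} (hk : 1 ≤ k) (τ : ℍ) (α β : ℝ) :
    IntegrableOn (fun t : ℝ => (t : ℂ) ^ (k - 1) * thetaE k τ α β t) (Set.Ioi 0) := by
  refine (mellinConvergent_thetaE hk τ α β k).congr_fun (fun t ht => ?_) measurableSet_Ioi
  simp only [smul_eq_mul]
  rw [← Complex.cpow_natCast, Nat.cast_sub hk, Nat.cast_one]

/-- The `q`-expansion of `E` in weight `1` for `α` not an integer. Its constant term is `1 / 2 -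
{α}`, with `{α}` the fractional part of `α`. -/
theorem hasSum_E_one (τ : ℍ) (α β : ℚ) (hα : ∀ n : ℤ, (n : ℝ) + (α : ℝ) ≠ 0) :
    HasSum (fun w : ℤ × ℤ => signCoeff 1 w.1 (w.2 + (α : ℝ)) * qFac τ α β w)
      (E 1 α β τ - ((1 / 2 - Int.fract α : ℚ) : ℂ)) := by
  have hk : (1 : ℕ) = 1 ∨ (1 : ℕ) = 2 := Or.inl rfl
  have hy : (τ.im : ℂ) ≠ 0 := by exact_mod_cast τ.im_pos.ne'
  obtain ⟨h1, h2⟩ := integral_offTerm hk τ α β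
  have h3 := integrableOn_pow_mul_thetaE le_rfl τ α β
  have hr : ∀ t, ∑' n, realRow 1 τ α β t n = 0 := fun t => by
    simp [realRow, hα]
  have e : ∀ t : ℝ, t ∈ Set.Ioi (0 : ℝ) → (t : ℂ) ^ (1 - 1) * thetaE 1 τ α β t -
      (t : ℂ) ^ (1 - 1) * ∑' w, offTerm 1 τ α β t w =
        (t : ℂ) ^ (1 - 1) * ∑' n, zeroTerm 1 τ α β t n := fun t ht => by
    rw [thetaE_eq hk τ α β ht, hr]
    ring
  have h4 := (h3.sub h1).congr_fun e measurableSet_Ioi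
  have h5 := integral_zeroTerm_one τ hα β h4
  have h6 := integral_sub h3 h1
  rw [setIntegral_congr_fun measurableSet_Ioi e, h5] at h6
  have hf : ((Int.fract (α : ℝ) : ℝ) : ℂ) = ((Int.fract α : ℚ) : ℂ) := by
    rw [← Rat.cast_fract]
    exact Complex.ofReal_ratCast _
  convert h2 using 1
  have h7 := mellin_natCast_eq le_rfl (thetaE 1 τ α β)
  rw [E_eq_mellin le_rfl α β τ, h7, eq_add_of_sub_eq h6.symm, mul_add, normFac]
  push_cast
  rw [hf]
  field_simp
  ring

/-- The constant term of the `q`-expansion of an Eisenstein series of weight `k ≥ 2`. A term with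
`m + β = 0` of the series vanishes, by the convention `0⁻¹ = 0`. -/
def constTerm (k : ℕ) (α β : ℝ) : ℂ :=
  open Classical in
  if ∃ n : ℤ, (n : ℝ) + α = 0 then
    (k - 1).factorial / (-2 * Real.pi * Complex.I) ^ k * ∑' m : ℤ, (((m : ℂ) + β) ^ k)⁻¹
  else 0

theorem integral_mul_exp_neg {r : ℝ} (hr : 0 < r) :
    ∫ t in Set.Ioi (0 : ℝ), t * Real.exp (-r * t) = 1 / r ^ 2 := by
  have h := Real.integral_rpow_mul_exp_neg_mul_Ioi (a := 2) (r := r) two_pos hr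
  rw [Real.Gamma_two, mul_one] at h
  rw [← one_div_pow, ← Real.rpow_natCast (1 / r) 2]
  push_cast
  rw [← h]
  refine setIntegral_congr_fun measurableSet_Ioi fun t _ => ?_
  norm_num

theorem summable_inv_sq_shift (β : ℝ) : Summable fun m : ℤ => (((m : ℝ) + β) ^ 2)⁻¹ := by
  have := (Real.summable_one_div_int_add_rpow β 2).2 (by norm_num)
  refine this.congr fun m => ?_
  rw [one_div, ← sq_abs ((m : ℝ) + β)]
  norm_num

/-- The contribution of the row on the real axis in weight `2`. Termwise integration is allowed,
since the series of integrals converges absolutely. -/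
theorem integral_row_two (y β : ℝ) (hy : 0 < y) :
    IntegrableOn (fun t : ℝ => (t : ℂ) ^ (2 - 1) * ∑' m : ℤ, ((m : ℂ) + β) ^ 2 *
      (Real.exp (-(Real.pi / y * ((m : ℝ) + β) ^ 2) * t) : ℝ)) (Set.Ioi 0) ∧
    ∫ t in Set.Ioi (0 : ℝ), (t : ℂ) ^ (2 - 1) * ∑' m : ℤ, ((m : ℂ) + β) ^ 2 *
      (Real.exp (-(Real.pi / y * ((m : ℝ) + β) ^ 2) * t) : ℝ) =
        (y / Real.pi) ^ 2 * ∑' m : ℤ, (((m : ℂ) + β) ^ 2)⁻¹ := by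
  have hpi := Real.pi_pos
  set f : ℤ → ℝ → ℝ := fun m t => ((m : ℝ) + β) ^ 2 *
    (t * Real.exp (-(Real.pi / y * ((m : ℝ) + β) ^ 2) * t)) with hf
  have hval : ∀ m, ∫ t in Set.Ioi (0 : ℝ), f m t = (y / Real.pi) ^ 2 * (((m : ℝ) + β) ^ 2)⁻¹ :=
    fun m => by
      by_cases h : (m : ℝ) + β = 0
      · simp [hf, h]
      · have h0 : 0 < ((m : ℝ) + β) ^ 2 := by positivity
        simp only [hf]
        rw [integral_const_mul, integral_mul_exp_neg (by positivity)]
        field_simp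
  -- the integral is nonzero, hence not the value assigned to a function that is not integrable
  have hint : ∀ m, IntegrableOn (f m) (Set.Ioi 0) := fun m => by
    by_cases h : (m : ℝ) + β = 0
    · simp [hf, h]
    · by_contra hn
      have h1 := integral_undef hn
      rw [hval] at h1
      have : (y / Real.pi) ^ 2 * (((m : ℝ) + β) ^ 2)⁻¹ ≠ 0 := by positivity
      exact this h1
  have hintC : ∀ m, IntegrableOn (fun t => (f m t : ℂ)) (Set.Ioi 0) := fun m => (hint m).ofReal
  have hnorm : ∀ m, ∫ t in Set.Ioi (0 : ℝ), ‖(f m t : ℂ)‖ =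
      (y / Real.pi) ^ 2 * (((m : ℝ) + β) ^ 2)⁻¹ := fun m => by
    rw [← hval m]
    refine setIntegral_congr_fun measurableSet_Ioi fun t ht => ?_
    have : (0 : ℝ) < t := ht
    simp only [Complex.norm_real]
    exact Real.norm_of_nonneg (by simp only [hf]; positivity)
  have hs : Summable fun m => ∫ t in Set.Ioi (0 : ℝ), ‖(f m t : ℂ)‖ :=
    ((summable_inv_sq_shift β).mul_left _).congr fun m => (hnorm m).symm
  have he : ∀ t : ℝ, ∑' m, (f m t : ℂ) = (t : ℂ) ^ (2 - 1) * ∑' m : ℤ, ((m : ℂ) + β) ^ 2 *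
      (Real.exp (-(Real.pi / y * ((m : ℝ) + β) ^ 2) * t) : ℝ) := fun t => by
    rw [← tsum_mul_left]
    refine tsum_congr fun m => ?_
    simp only [hf]
    push_cast
    ring
  have hcont : ContinuousOn (fun t : ℝ => (t : ℂ) ^ (2 - 1) * ∑' m : ℤ, ((m : ℂ) + β) ^ 2 *
      (Real.exp (-(Real.pi / y * ((m : ℝ) + β) ^ 2) * t) : ℝ)) (Set.Ioi 0) := by
    refine ContinuousOn.mul (by fun_prop) (continuousOn_expSum (fun m => by positivity) ?_)
    intro t ht
    -- the row is part of the theta series of the lattice `ℤ + ℤiy`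
    have h1 := summable_pow_mul_latPt 2 ⟨Complex.I * y, by simpa using hy⟩ 0 β ht
    have h2 := h1.comp_injective (i := fun m : ℤ => (m, (0 : ℤ)))
      fun _ _ h => (Prod.ext_iff.1 h).1
    refine h2.congr fun m => ?_
    have e1 : latPt ⟨Complex.I * y, by simpa using hy⟩ 0 β (m, 0) = (((m : ℝ) + β : ℝ) : ℂ) := by
      simp [latPt]
    have e2 : UpperHalfPlane.im ⟨Complex.I * y, by simpa using hy⟩ = y := by
      simp [UpperHalfPlane.im]
    simp only [Function.comp, e1, e2, Complex.conj_ofReal, Complex.norm_real, Real.norm_eq_abs,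
      sq_abs]
    push_cast
    rfl
  refine ⟨?_, ?_⟩
  · have := integrable_tsum_of_summable_norm hintC hs (by
      simp only [he]
      exact hcont.aestronglyMeasurable measurableSet_Ioi)
    simp only [he] at this
    exact this
  · have := (hasSum_integral_of_summable_integral_norm hintC hs).tsum_eq
    simp only [he] at this
    rw [← this, ← tsum_mul_left]
    refine tsum_congr fun m => ?_
    rw [integral_complex_ofReal, hval]
    push_cast
    rfl

theorem tsum_realRow_two (τ : ℍ) (α β : ℝ) {n₀ : ℤ} (hn : (n₀ : ℝ) + α = 0) (t : ℝ) :
    ∑' n, realRow 2 τ α β t n = ∑' m : ℤ, ((m : ℂ) + β) ^ 2 *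
      (Real.exp (-(Real.pi / τ.im * ((m : ℝ) + β) ^ 2) * t) : ℝ) := by
  have hz : ∀ n, n ≠ n₀ → realRow 2 τ α β t n = 0 := fun n h => if_pos fun h0 => h (by
    exact_mod_cast (show (n : ℝ) = n₀ by linarith))
  rw [tsum_eq_single n₀ hz, realRow, if_neg (by simpa using hn), rowE]
  refine tsum_congr fun m => ?_
  have e1 : latPt τ α β (m, n₀) = (((m : ℝ) + β : ℝ) : ℂ) := by
    rw [latPt, hn]
    simp
  rw [e1, Complex.conj_ofReal, Complex.norm_real, Real.norm_eq_abs, sq_abs]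
  push_cast
  rfl

theorem integral_realRow_two (τ : ℍ) (α β : ℝ) :
    IntegrableOn (fun t : ℝ => (t : ℂ) ^ (2 - 1) * ∑' n, realRow 2 τ α β t n) (Set.Ioi 0) ∧
      normFac 2 τ * ∫ t in Set.Ioi (0 : ℝ), (t : ℂ) ^ (2 - 1) * ∑' n, realRow 2 τ α β t n =
        constTerm 2 α β := by
  have hy : (τ.im : ℂ) ≠ 0 := by exact_mod_cast τ.im_pos.ne'
  have hpi : (Real.pi : ℂ) ≠ 0 := by exact_mod_cast Real.pi_ne_zero
  by_cases h : ∃ n : ℤ, (n : ℝ) + α = 0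
  · obtain ⟨n₀, hn⟩ := h
    obtain ⟨h1, h2⟩ := integral_row_two τ.im β τ.im_pos
    simp only [tsum_realRow_two τ α β hn]
    refine ⟨h1, ?_⟩
    rw [h2, constTerm, if_pos ⟨n₀, hn⟩, normFac]
    simp only [Nat.add_one_sub_one, Nat.factorial_one, Nat.cast_one]
    field_simp
  · have hz : ∀ t, ∑' n, realRow 2 τ α β t n = 0 := fun t => by
      have : ∀ n, realRow 2 τ α β t n = 0 := fun n => if_pos fun h0 => h ⟨n, h0⟩
      simp [this]
    simp only [hz, constTerm, if_neg h]
    simp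

/-- The `q`-expansion of `E` in weight `2`, up to the nonholomorphic term `1 / (4πy)`, which does
not depend on `α` and `β`. -/
theorem hasSum_E_two (τ : ℍ) (α β : ℚ) :
    HasSum (fun w : ℤ × ℤ => signCoeff 2 w.1 (w.2 + (α : ℝ)) * qFac τ α β w)
      (E 2 α β τ - constTerm 2 α β - 1 / (4 * Real.pi * τ.im)) := by
  have hk : (2 : ℕ) = 1 ∨ (2 : ℕ) = 2 := Or.inr rfl
  have hy : (τ.im : ℂ) ≠ 0 := by exact_mod_cast τ.im_pos.ne'
  have hpi : (Real.pi : ℂ) ≠ 0 := by exact_mod_cast Real.pi_ne_zero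
  obtain ⟨h1, h2⟩ := integral_offTerm hk τ α β
  obtain ⟨h8, h9⟩ := integral_realRow_two τ α β
  have h3 := integrableOn_pow_mul_thetaE one_le_two τ α β
  have e : ∀ t : ℝ, t ∈ Set.Ioi (0 : ℝ) → (t : ℂ) ^ (2 - 1) * thetaE 2 τ α β t -
      (t : ℂ) ^ (2 - 1) * ∑' w, offTerm 2 τ α β t w -
      (t : ℂ) ^ (2 - 1) * ∑' w, realRow 2 τ α β t w =
        (t : ℂ) ^ (2 - 1) * ∑' n, zeroTerm 2 τ α β t n := fun t ht => by
    rw [thetaE_eq hk τ α β ht]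
    ring
  have h4 := ((h3.sub h1).sub h8).congr_fun e measurableSet_Ioi
  have h5 := integral_zeroTerm_two τ α β h4
  have h6 := (integral_sub (h3.sub h1) h8)
  simp only [Pi.sub_apply] at h6
  rw [integral_sub h3 h1, setIntegral_congr_fun measurableSet_Ioi e, h5] at h6
  convert h2 using 1
  have h7 := mellin_natCast_eq one_le_two (thetaE 2 τ α β)
  rw [E_eq_mellin one_le_two α β τ, h7, ← h9]
  rw [eq_sub_iff_add_eq, eq_sub_iff_add_eq] at h6
  rw [← h6, mul_add, mul_add]
  have : normFac 2 τ * (-(τ.im / Real.pi : ℝ) : ℂ) = 1 / (4 * Real.pi * τ.im) := by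
    rw [normFac]
    push_cast
    rw [inv_mul_eq_iff_eq_mul₀ (by simp [hy])]
    field_simp
    rw [Complex.I_sq]
    ring
  rw [this]
  ring

/-! ### The `q`-expansions in weight at least three -/

theorem norm_qFac (τ : ℍ) (α β : ℝ) (w : ℤ × ℤ) :
    ‖qFac τ α β w‖ = Real.exp (-(2 * Real.pi * τ.im) * (w.1 * (w.2 + α))) := by
  rw [qFac, Complex.norm_exp]
  congr 1
  have e : 2 * (Real.pi : ℂ) * Complex.I * (w.1 * ((w.2 + α) * τ + β)) =
      ((2 * Real.pi * w.1 * (w.2 + α) : ℝ) : ℂ) * (Complex.I * τ) +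
        ((2 * Real.pi * w.1 * β : ℝ) : ℂ) * Complex.I := by push_cast; ring
  rw [e, Complex.add_re, Complex.re_ofReal_mul, Complex.re_ofReal_mul, Complex.I_re, mul_zero,
    add_zero, Complex.I_mul_re, UpperHalfPlane.coe_im]
  ring

theorem norm_signCoeff_le (k : ℕ) (l : ℤ) (ν : ℝ) : ‖signCoeff k l ν‖ ≤ |(l : ℝ)| ^ (k - 1) := by
  rw [signCoeff]
  split_ifs with h
  · rw [Complex.norm_intCast, Int.cast_mul, Int.cast_pow, abs_mul, abs_pow]
    refine mul_le_of_le_one_left (by positivity) ?_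
    rcases lt_trichotomy l 0 with h1 | rfl | h1
    · simp [Int.sign_eq_neg_one_of_neg h1]
    · simp
    · simp [Int.sign_eq_one_of_pos h1]
  · rw [norm_zero]; positivity

theorem summable_signCoeff_mul_qFac (k : ℕ) (τ : ℍ) (α β : ℝ) :
    Summable fun w : ℤ × ℤ => signCoeff k w.1 (w.2 + α) * qFac τ α β w := by
  have hy : 0 < τ.im := τ.im_pos
  have hpi := Real.pi_pos
  obtain ⟨δ, hδ, hδ1, hδ2⟩ := exists_lower_bound_shift α
  obtain ⟨b, hb⟩ : ∃ b, b = Real.pi * τ.im * δ / 2 := ⟨_, rfl⟩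
  have hb0 : 0 < b := by rw [hb]; positivity
  refine Summable.of_norm_bounded
    ((summable_exp_neg_abs_prod hb0 α).mul_left ((k - 1).factorial / b ^ (k - 1))) fun w => ?_
  by_cases h : 0 < (w.1 : ℝ) * (w.2 + α)
  · have hl : w.1 ≠ 0 := fun h0 => by simp [h0] at h
    have hν : (w.2 : ℝ) + α ≠ 0 := fun h0 => by simp [h0] at h
    have hL1 : 1 ≤ |(w.1 : ℝ)| := by
      rw [← Int.cast_abs]
      exact_mod_cast Int.one_le_abs hl
    have hν1 := hδ2 _ hν
    have hprod : (w.1 : ℝ) * (w.2 + α) = |(w.1 : ℝ)| * |(w.2 : ℝ) + α| := by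
      rw [← abs_mul, abs_of_pos h]
    rw [norm_mul, norm_qFac, hprod]
    have h1 := norm_signCoeff_le k w.1 (w.2 + α)
    have h2 := pow_le_mul_exp (k - 1) hb0 (abs_nonneg (w.1 : ℝ))
    have h3 : b * |(w.1 : ℝ)| + -(2 * Real.pi * τ.im) * (|(w.1 : ℝ)| * |(w.2 : ℝ) + α|) ≤
        -b * (|(w.1 : ℝ)| + |(w.2 : ℝ) + α|) := by
      have g1 : |(w.1 : ℝ)| * δ ≤ |(w.1 : ℝ)| * |(w.2 : ℝ) + α| := by gcongr
      have g2 : 1 * |(w.2 : ℝ) + α| ≤ |(w.1 : ℝ)| * |(w.2 : ℝ) + α| := by gcongr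
      have g3 : δ * |(w.2 : ℝ) + α| ≤ 1 * |(w.2 : ℝ) + α| := by gcongr
      have g4 : 0 < Real.pi * τ.im := by positivity
      rw [hb]
      nlinarith
    calc _ ≤ |(w.1 : ℝ)| ^ (k - 1) *
          Real.exp (-(2 * Real.pi * τ.im) * (|(w.1 : ℝ)| * |(w.2 : ℝ) + α|)) := by gcongr
      _ ≤ ((k - 1).factorial / b ^ (k - 1) * Real.exp (b * |(w.1 : ℝ)|)) *
          Real.exp (-(2 * Real.pi * τ.im) * (|(w.1 : ℝ)| * |(w.2 : ℝ) + α|)) := by gcongr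
      _ = (k - 1).factorial / b ^ (k - 1) * Real.exp (b * |(w.1 : ℝ)| +
          -(2 * Real.pi * τ.im) * (|(w.1 : ℝ)| * |(w.2 : ℝ) + α|)) := by
          rw [Real.exp_add, mul_assoc]
      _ ≤ _ := by gcongr
  · rw [signCoeff, if_neg h, zero_mul, norm_zero]
    positivity

/-- In weight `k ≥ 3` the series that defines `E` converges absolutely at `s = k`, where its terms
are multiples of `(ω + z)^{-k}`. -/
theorem hasSum_E_of_three_le {k : ℕ} (hk : 3 ≤ k) (τ : ℍ) (α β : ℚ) :
    HasSum (fun w : ℤ × ℤ => (k - 1).factorial / (-2 * Real.pi * Complex.I) ^ k *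
      ((latPt τ α β w) ^ k)⁻¹) (E k α β τ) := by
  have hy : 0 < τ.im := τ.im_pos
  have hpi := Real.pi_pos
  have hk1 : 1 ≤ k := by omega
  have hkr : (3 : ℝ) ≤ k := by exact_mod_cast hk
  have hp : ∀ w, (starRingEnd ℂ) (latPt τ α β w) ^ k = 0 ∨
      0 < Real.pi / τ.im * ‖latPt τ α β w‖ ^ 2 := fun w => by
    by_cases h : latPt τ α β w = 0
    · left; rw [h, map_zero, zero_pow (by omega)]
    · right
      have := norm_pos_iff.2 h
      positivity
  have h := hasSum_mellin (F := thetaE k τ α β) (s := k) hp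
    (by rw [Complex.natCast_re]; linarith)
    (fun t ht => (summable_thetaE k τ α β ht).hasSum) (by
      simp only [norm_pow, RCLike.norm_conj, Complex.natCast_re]
      exact summable_mellin_coeff hk1 τ α β (by linarith))
  rw [E_eq_mellin hk1]
  refine (h.mul_left (normFac k τ)).congr_fun fun w => ?_
  have hyC : (τ.im : ℂ) ≠ 0 := by exact_mod_cast hy.ne'
  have hpiC : (Real.pi : ℂ) ≠ 0 := by exact_mod_cast hpi.ne'
  have hG : Complex.Gamma k = ((k - 1).factorial : ℂ) := by
    have := Complex.Gamma_nat_eq_factorial (k - 1)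
    rwa [← Nat.cast_add_one, Nat.sub_add_cancel hk1] at this
  rw [hG, Complex.cpow_natCast, normFac]
  by_cases h0 : latPt τ α β w = 0
  · simp [h0, show k ≠ 0 by omega]
  · have hc : (starRingEnd ℂ) (latPt τ α β w) ≠ 0 := by simpa using h0
    have e : ((Real.pi / τ.im * ‖latPt τ α β w‖ ^ 2 : ℝ) : ℂ) =
        Real.pi / τ.im * ((starRingEnd ℂ) (latPt τ α β w) * latPt τ α β w) := by
      rw [← Complex.normSq_eq_conj_mul_self, Complex.normSq_eq_norm_sq]
      push_cast
      rfl
    rw [e]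
    set c := (starRingEnd ℂ) (latPt τ α β w)
    set L := latPt τ α β w
    set P : ℂ := Real.pi / τ.im * (c * L) with hP
    have hP0 : P ≠ 0 := mul_ne_zero (div_ne_zero hpiC hyC) (mul_ne_zero hc h0)
    have key : -2 * Real.pi * Complex.I * L * c = -2 * Complex.I * τ.im * P := by
      rw [hP]
      field_simp
    calc ((k - 1).factorial : ℂ) / (-2 * Real.pi * Complex.I) ^ k * (L ^ k)⁻¹
        = (k - 1).factorial * c ^ k / (-2 * Real.pi * Complex.I * L * c) ^ k := by
          rw [mul_pow _ c, mul_pow _ L]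
          have h1 : c ^ k ≠ 0 := pow_ne_zero _ hc
          rw [mul_div_mul_right _ _ h1, div_mul_eq_div_div, div_eq_mul_inv (_ / _) (L ^ k)]
      _ = _ := by
          rw [key, mul_pow _ P, div_eq_mul_inv, div_eq_mul_inv, mul_inv]
          ring

/-- The Lipschitz formula for the row `n`. For `ν < 0` it is applied to the point `-(ντ + β)` of
the upper half plane. -/
theorem tsum_row_eq {k : ℕ} (hk : 2 ≤ k) (τ : ℍ) (α β : ℝ) {n : ℤ} (hν : (n : ℝ) + α ≠ 0) :
    ∑' m : ℤ, (k - 1).factorial / (-2 * Real.pi * Complex.I) ^ k *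
      ((latPt τ α β (m, n)) ^ k)⁻¹ =
    ∑' l : ℤ, signCoeff k l (n + α) * qFac τ α β (l, n) := by
  have hy : 0 < τ.im := τ.im_pos
  have hpiC : (Real.pi : ℂ) ≠ 0 := by exact_mod_cast Real.pi_ne_zero
  have hk1 : 1 ≤ k - 1 := by omega
  have hkk : k - 1 + 1 = k := by omega
  set ν : ℝ := n + α with hνdef
  have hconst : ∀ x : ℂ, (k - 1).factorial / (-2 * Real.pi * Complex.I) ^ k *
      ((-2 * Real.pi * Complex.I) ^ k / (k - 1).factorial * x) = x := fun x => by
    have h1 : (-2 * Real.pi * Complex.I) ^ k ≠ 0 := by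
      refine pow_ne_zero _ (by simp [hpiC])
    have h2 : ((k - 1).factorial : ℂ) ≠ 0 := by exact_mod_cast (Nat.factorial_ne_zero _)
    field_simp
  have hneg : (-1 : ℂ) ^ k = -(-1) ^ (k - 1) := by
    obtain ⟨j, rfl⟩ : ∃ j, k = j + 1 := ⟨k - 1, hkk.symm⟩
    simp [pow_succ]
  rw [tsum_mul_left]
  rcases hν.lt_or_gt with h | h
  · set z : ℍ := ⟨-((ν : ℂ) * τ + β), by
      have : (-((ν : ℂ) * τ + β)).im = -ν * τ.im := by
        simp
      rw [this]
      exact mul_pos (by linarith) hy⟩ with hz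
    have hL := EisensteinSeries.qExpansion_identity hk1 z
    rw [hkk] at hL
    have e1 : ∑' m : ℤ, ((latPt τ α β (m, n)) ^ k)⁻¹ =
        (-1) ^ k * ∑' m : ℤ, 1 / ((z : ℂ) + m) ^ k := by
      rw [← tsum_mul_left, ← (Equiv.neg ℤ).tsum_eq]
      refine tsum_congr fun m => ?_
      have : latPt τ α β (Equiv.neg ℤ m, n) = -1 * ((z : ℂ) + m) := by
        rw [latPt, hz]
        simp only [Equiv.neg_apply]
        rw [← hνdef]
        push_cast
        ring
      rw [this, mul_pow, mul_inv, one_div, ← inv_pow]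
      norm_num
    rw [e1, hL, mul_left_comm ((-1 : ℂ) ^ k), hconst, ← tsum_mul_left]
    have hinj : Function.Injective (fun j : ℕ => -(j : ℤ)) := fun a b hab => by
      simpa using hab
    rw [← hinj.tsum_eq (f := fun l : ℤ => signCoeff k l ν * qFac τ α β (l, n))]
    · refine tsum_congr fun j => ?_
      rcases Nat.eq_zero_or_pos j with rfl | hj
      · simp [signCoeff, show k - 1 ≠ 0 by omega]
      · have h1 : 0 < ((-(j : ℤ) : ℤ) : ℝ) * ν := by
          push_cast
          have : (0 : ℝ) < j := by exact_mod_cast hj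
          nlinarith
        rw [signCoeff, if_pos h1, Int.sign_eq_neg_one_of_neg (by omega), ← Complex.exp_nat_mul,
          qFac, ← mul_assoc]
        congr 1
        · push_cast
          rw [neg_pow (j : ℂ), hneg]
          ring
        · congr 1
          rw [hz]
          push_cast
          rw [show (n : ℂ) + α = ν by rw [hνdef]; push_cast; rfl]
          ring
    · intro l hl
      rw [Function.mem_support] at hl
      have h1 : 0 < (l : ℝ) * ν := by
        by_contra h0
        exact hl (by rw [signCoeff, if_neg h0, zero_mul])
      have h2 : (l : ℝ) < 0 := by nlinarith
      have h3 : l < 0 := by exact_mod_cast h2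
      exact ⟨l.natAbs, by simp only; omega⟩
  · set z : ℍ := ⟨(ν : ℂ) * τ + β, by
      have : ((ν : ℂ) * τ + β).im = ν * τ.im := by
        simp
      rw [this]
      exact mul_pos (by linarith) hy⟩ with hz
    have hL := EisensteinSeries.qExpansion_identity hk1 z
    rw [hkk] at hL
    have e1 : ∑' m : ℤ, ((latPt τ α β (m, n)) ^ k)⁻¹ =
        ∑' m : ℤ, 1 / ((z : ℂ) + m) ^ k := by
      refine tsum_congr fun m => ?_
      have : latPt τ α β (m, n) = (z : ℂ) + m := by
        rw [latPt, hz]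
        simp only
        rw [← hνdef]
        push_cast
        ring
      rw [this, one_div]
    rw [e1, hL, hconst]
    rw [← (Nat.cast_injective (R := ℤ)).tsum_eq
      (f := fun l : ℤ => signCoeff k l ν * qFac τ α β (l, n))]
    · refine tsum_congr fun j => ?_
      rcases Nat.eq_zero_or_pos j with rfl | hj
      · simp [signCoeff, show k - 1 ≠ 0 by omega]
      · have h1 : 0 < (((j : ℕ) : ℤ) : ℝ) * ν := by
          push_cast
          have : (0 : ℝ) < j := by exact_mod_cast hj
          positivity
        rw [signCoeff, if_pos h1, Int.sign_eq_one_of_pos (by omega), ← Complex.exp_nat_mul, qFac]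
        congr 1
        · push_cast
          ring
        · congr 1
          rw [hz]
          push_cast
          rw [show (n : ℂ) + α = ν by rw [hνdef]; push_cast; rfl]
          ring
    · intro l hl
      rw [Function.mem_support] at hl
      have h1 : 0 < (l : ℝ) * ν := by
        by_contra h0
        exact hl (by rw [signCoeff, if_neg h0, zero_mul])
      have h2 : 0 < (l : ℝ) := by nlinarith
      have h3 : 0 < l := by exact_mod_cast h2
      exact ⟨l.natAbs, by omega⟩

/-- The `q`-expansion of `E` in weight `k ≥ 3`. -/
theorem hasSum_qExp_of_three_le {k : ℕ} (hk : 3 ≤ k) (τ : ℍ) (α β : ℚ) :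
    HasSum (fun w : ℤ × ℤ => signCoeff k w.1 (w.2 + (α : ℝ)) * qFac τ α β w)
      (E k α β τ - constTerm k α β) := by
  have h := hasSum_E_of_three_le hk τ α β
  have hs := (Equiv.prodComm ℤ ℤ).summable_iff.2 h.summable
  have e1 : E k α β τ = ∑' n, ∑' m, ((k - 1).factorial / (-2 * Real.pi * Complex.I) ^ k *
      ((latPt τ α β (m, n)) ^ k)⁻¹ : ℂ) := by
    rw [← h.tsum_eq]
    exact ((Equiv.prodComm ℤ ℤ).tsum_eq _).symm.trans (Summable.tsum_prod hs)
  have hs2 := summable_signCoeff_mul_qFac k τ α β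
  have hs3 := (Equiv.prodComm ℤ ℤ).summable_iff.2 hs2
  have e2 : ∑' w : ℤ × ℤ, signCoeff k w.1 (w.2 + (α : ℝ)) * qFac τ α β w =
      ∑' n : ℤ, ∑' l : ℤ, signCoeff k l (n + (α : ℝ)) * qFac τ α β (l, n) :=
    ((Equiv.prodComm ℤ ℤ).tsum_eq _).symm.trans (Summable.tsum_prod hs3)
  have hp : Summable fun n : ℤ => ∑' m, ((k - 1).factorial / (-2 * Real.pi * Complex.I) ^ k *
      ((latPt τ α β (m, n)) ^ k)⁻¹ : ℂ) := hs.prod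
  refine (hs2.hasSum_iff).2 ?_
  rw [e2, e1]
  by_cases hα : ∃ n : ℤ, (n : ℝ) + (α : ℝ) = 0
  · obtain ⟨n₀, hn⟩ := hα
    rw [constTerm, if_pos ⟨n₀, hn⟩, hp.tsum_eq_add_tsum_ite n₀, ← tsum_mul_left]
    have e3 : ∀ m : ℤ, latPt τ α β (m, n₀) = (m : ℂ) + (β : ℝ) := fun m => by
      rw [latPt, hn]
      simp
    simp only [e3, add_sub_cancel_left]
    refine tsum_congr fun n => ?_
    by_cases h0 : n = n₀
    · rw [if_pos h0, h0, hn]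
      simp [signCoeff]
    · have : (n : ℝ) + (α : ℝ) ≠ 0 := fun h1 => h0 (by
        exact_mod_cast (show (n : ℝ) = n₀ by linarith))
      rw [if_neg h0, tsum_row_eq (by omega) τ α β this]
  · rw [constTerm, if_neg hα, sub_zero]
    exact tsum_congr fun n => (tsum_row_eq (by omega) τ α β fun h0 => hα ⟨n, h0⟩).symm

/-! ### Galois action on `q`-expansions -/

section

/-- The root of unity `e ^ (2πix)`, for rational `x`, as an element of `ℚ^cycl`. -/
def rootQ (x : ℚ) : Qcycl :=
  ⟨Complex.exp (2 * Real.pi * Complex.I * x), IntermediateField.subset_adjoin _ _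
    ⟨x.den, x.den_pos, by
      rw [← Complex.exp_nat_mul, Complex.exp_eq_one_iff]
      refine ⟨x.num, ?_⟩
      have : (x.den : ℂ) * (x : ℂ) = x.num := by
        exact_mod_cast (by rw [mul_comm]; exact Rat.mul_den_eq_num x : (x.den : ℚ) * x = x.num)
      linear_combination (2 * Real.pi * Complex.I) * this⟩⟩

theorem coe_rootQ (x : ℚ) : (rootQ x : ℂ) = Complex.exp (2 * Real.pi * Complex.I * x) := rfl

theorem rootQ_add (x y : ℚ) : rootQ (x + y) = rootQ x * rootQ y := by
  ext
  push_cast [coe_rootQ]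
  rw [← Complex.exp_add]
  congr 1
  ring

theorem rootQ_nat_mul (n : ℕ) (x : ℚ) : rootQ (n * x) = rootQ x ^ n := by
  ext
  push_cast [coe_rootQ]
  rw [← Complex.exp_nat_mul]
  congr 1
  ring

theorem rootQ_int (n : ℤ) : rootQ n = 1 := by
  ext
  rw [coe_rootQ, IntermediateField.coe_one, Complex.exp_eq_one_iff]
  exact ⟨n, by push_cast; ring⟩

theorem rootQ_pow_eq_one {N : ℕ} (hN : 1 ≤ N) (a : ℤ) : rootQ (a / N) ^ N = 1 := by
  rw [← rootQ_nat_mul, mul_div_cancel₀ _ (by exact_mod_cast (by omega : N ≠ 0)), rootQ_int]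

/-- `f'` has a `q`-expansion obtained from one of `f` by applying `σ` to the coefficients. -/
def GalRel (σ : Qcycl ≃ₐ[ℚ] Qcycl) (f f' : ℍ → ℂ) : Prop :=
  ∃ (N : ℕ) (a : ℕ → Qcycl), 1 ≤ N ∧ HasQExp N (fun n => (a n : ℂ)) f ∧
    HasQExp N (fun n => (σ (a n) : ℂ)) f'

variable {σ : Qcycl ≃ₐ[ℚ] Qcycl}

theorem GalRel.add {f f' g g' : ℍ → ℂ} (hf : GalRel σ f f') (hg : GalRel σ g g') :
    GalRel σ (f + g) (f' + g') := by
  obtain ⟨N, a, hN, ha, ha'⟩ := hf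
  obtain ⟨M, b, hM, hb, hb'⟩ := hg
  have h1 := ha.mul_level hN hM
  have h1' := HasQExp.mul_level hN hM (a := fun n => σ (a n)) ha'
  have h2 := hb.mul_level hM hN
  have h2' := HasQExp.mul_level hM hN (a := fun n => σ (b n)) hb'
  rw [mul_comm M N] at h2 h2'
  refine ⟨N * M, fun n => (if M ∣ n then a (n / M) else 0) + (if N ∣ n then b (n / N) else 0),
    Nat.mul_pos hN hM, fun τ => ?_, fun τ => ?_⟩
  · have := (h1 τ).add (h2 τ)
    simpa only [← add_mul, Pi.add_apply, IntermediateField.coe_add] using this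
  · have := (h1' τ).add (h2' τ)
    simp only [← add_mul] at this
    refine this.congr_fun fun n => ?_
    dsimp only
    rw [map_add, apply_ite σ, apply_ite σ, map_zero, IntermediateField.coe_add]

theorem GalRel.const_mul (c : Qcycl) {f f' : ℍ → ℂ} (h : GalRel σ f f') :
    GalRel σ (fun τ => (c : ℂ) * f τ) (fun τ => (σ c : ℂ) * f' τ) := by
  obtain ⟨N, a, hN, ha, ha'⟩ := h
  refine ⟨N, fun n => c * a n, hN, fun τ => ?_, fun τ => ?_⟩
  · refine ((ha τ).mul_left (c : ℂ)).congr_fun fun n => ?_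
    dsimp only
    rw [IntermediateField.coe_mul, mul_assoc]
  · refine ((ha' τ).mul_left (σ c : ℂ)).congr_fun fun n => ?_
    dsimp only
    rw [map_mul, IntermediateField.coe_mul, mul_assoc]

theorem GalRel.const (c : Qcycl) : GalRel σ (fun _ => (c : ℂ)) (fun _ => (σ c : ℂ)) := by
  refine ⟨1, fun n => if n = 0 then c else 0, le_rfl, fun τ => ?_, fun τ => ?_⟩
  · convert hasSum_ite_eq (0 : ℕ) (c : ℂ) using 2 with n
    split_ifs with h <;> simp [h]
  · convert hasSum_ite_eq (0 : ℕ) (σ c : ℂ) using 2 with n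
    split_ifs with h <;> simp [h]

theorem GalRel.ratConst (c : ℚ) : GalRel σ (fun _ => (c : ℂ)) (fun _ => (c : ℂ)) := by
  have h := GalRel.const (σ := σ) (algebraMap ℚ Qcycl c)
  rwa [AlgEquiv.commutes, show ((algebraMap ℚ Qcycl c : Qcycl) : ℂ) = (c : ℂ) from rfl] at h

theorem GalRel.sum {ι : Type*} (s : Finset ι) {f f' : ι → ℍ → ℂ}
    (h : ∀ i ∈ s, GalRel σ (f i) (f' i)) :
    GalRel σ (fun τ => ∑ i ∈ s, f i τ) (fun τ => ∑ i ∈ s, f' i τ) := by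
  classical
  induction s using Finset.induction_on with
  | empty => simpa using GalRel.ratConst (σ := σ) 0
  | insert i s hi ih =>
    simp only [Finset.sum_insert hi]
    exact (h i (Finset.mem_insert_self i s)).add
      (ih fun j hj => h j (Finset.mem_insert_of_mem hj))

theorem GalRel.congr {f f' g g' : ℍ → ℂ} (h : GalRel σ f f') (h1 : ∀ τ, g τ = f τ)
    (h2 : ∀ τ, g' τ = f' τ) : GalRel σ g g' := by
  rwa [show g = f from funext h1, show g' = f' from funext h2]

/-- Grouping the terms of a series with the same power of `q` gives a `q`-expansion. -/
theorem hasQExp_of_hasSum {ι : Type*} {N : ℕ} (m : ι → ℕ) [hfin : ∀ n, Fintype {i // m i = n}]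
    {c : ι → ℂ} {f : ℍ → ℂ} (h : ∀ τ : ℍ, HasSum
      (fun i => c i * Complex.exp (2 * Real.pi * Complex.I * (m i / N : ℂ) * (τ : ℂ))) (f τ)) :
    HasQExp N (fun n => ∑ i : {i // m i = n}, c i) f := by
  intro τ
  have h1 := ((Equiv.sigmaFiberEquiv m).hasSum_iff.2 (h τ)).sigma fun n => hasSum_fintype _
  refine h1.congr_fun fun n => ?_
  rw [Finset.sum_mul]
  refine Finset.sum_congr rfl fun i _ => ?_
  simp only [Function.comp, Equiv.sigmaFiberEquiv_apply, i.2]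

/-- A form of `hasQExp_of_hasSum` for pairs of conjugate series. -/
theorem GalRel.of_hasSum {ι : Type*} {N : ℕ} (hN : 1 ≤ N) (m : ι → ℕ)
    (hfin : ∀ n, Finite {i // m i = n}) (c : ι → Qcycl) {f f' : ℍ → ℂ}
    (h : ∀ τ : ℍ, HasSum (fun i => (c i : ℂ) *
      Complex.exp (2 * Real.pi * Complex.I * (m i / N : ℂ) * (τ : ℂ))) (f τ))
    (h' : ∀ τ : ℍ, HasSum (fun i => (σ (c i) : ℂ) *
      Complex.exp (2 * Real.pi * Complex.I * (m i / N : ℂ) * (τ : ℂ))) (f' τ)) :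
    GalRel σ f f' := by
  have := fun n => Fintype.ofFinite {i // m i = n}
  refine ⟨N, fun n => ∑ i : {i // m i = n}, c i, hN, fun τ => ?_, fun τ => ?_⟩
  · refine (hasQExp_of_hasSum m h τ).congr_fun fun n => ?_
    dsimp only
    rw [IntermediateField.coe_sum]
  · refine (hasQExp_of_hasSum m h' τ).congr_fun fun n => ?_
    dsimp only
    rw [map_sum, IntermediateField.coe_sum]

/-- A positive integer has finitely many factorisations `l (nN + a)`. -/
theorem finite_factor_fibre {N : ℕ} (hN : 1 ≤ N) (a n : ℤ) :
    {w : ℤ × ℤ | 0 < w.1 * (w.2 * N + a) ∧ w.1 * (w.2 * N + a) = n}.Finite := by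
  have hNz : (N : ℤ) ≠ 0 := by exact_mod_cast (by omega : N ≠ 0)
  refine Set.Finite.of_injOn (f := fun w : ℤ × ℤ => (w.1, w.2 * N + a))
    (t := Set.Icc (-n) n ×ˢ Set.Icc (-n) n) ?_ ?_
    ((Set.finite_Icc _ _).prod (Set.finite_Icc _ _))
  · rintro ⟨l, j⟩ ⟨h1, h2⟩
    simp only at h1 h2
    have hl : l ≠ 0 := fun h => by simp [h] at h1
    have hj : j * N + a ≠ 0 := fun h => by simp [h] at h1
    have h3 : |l| * |j * N + a| = n := by rw [← abs_mul, abs_of_pos h1, h2]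
    have h4 := Int.one_le_abs hl
    have h5 := Int.one_le_abs hj
    refine ⟨abs_le.1 ?_, abs_le.1 ?_⟩ <;> simp only <;> nlinarith
  · rintro ⟨l, j⟩ _ ⟨l', j'⟩ _ h
    simp only [Prod.mk.injEq] at h
    obtain ⟨h1, h2⟩ := h
    rw [Prod.mk.injEq]
    exact ⟨h1, mul_right_cancel₀ hNz (by linarith)⟩

/-- The nonconstant part of the `q`-expansions of the Eisenstein series is transformed by
`ζ ↦ ζ ^ m` in the expected way. -/
theorem galRel_of_hasSum_signCoeff {k N m : ℕ} (hN : 1 ≤ N)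
    (hσ : ∀ ζ : Qcycl, ζ ^ N = 1 → σ ζ = ζ ^ m) (a b : ℤ) {f f' : ℍ → ℂ}
    (h : ∀ τ : ℍ, HasSum (fun w : ℤ × ℤ => signCoeff k w.1 (w.2 + ((a / N : ℚ) : ℝ)) *
      qFac τ (a / N : ℚ) (b / N : ℚ) w) (f τ))
    (h' : ∀ τ : ℍ, HasSum (fun w : ℤ × ℤ => signCoeff k w.1 (w.2 + ((a / N : ℚ) : ℝ)) *
      qFac τ (a / N : ℚ) (m * (b / N) : ℚ) w) (f' τ)) :
    GalRel σ f f' := by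
  have hN0 : (0 : ℝ) < N := by exact_mod_cast hN
  have hNC : (N : ℂ) ≠ 0 := by exact_mod_cast (by omega : N ≠ 0)
  -- the coefficients are supported on `S`, where the exponent of `q` is positive
  set S : Set (ℤ × ℤ) := {w | 0 < w.1 * (w.2 * N + a)} with hS
  have hiff : ∀ w : ℤ × ℤ, 0 < (w.1 : ℝ) * (w.2 + ((a / N : ℚ) : ℝ)) ↔ w ∈ S := fun w => by
    have e : (w.1 : ℝ) * (w.2 + ((a / N : ℚ) : ℝ)) = ((w.1 * (w.2 * N + a) : ℤ) : ℝ) / N := by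
      push_cast
      field_simp
    rw [e, div_pos_iff_of_pos_right hN0]
    exact_mod_cast Iff.rfl
  have hsupp : ∀ (β : ℝ) (τ : ℍ), Function.support (fun w : ℤ × ℤ =>
      signCoeff k w.1 (w.2 + ((a / N : ℚ) : ℝ)) * qFac τ (a / N : ℚ) β w) ⊆ S := fun β τ w hw => by
    rw [← hiff]
    by_contra h0
    exact hw (by simp only; rw [signCoeff, if_neg h0, zero_mul])
  have key : ∀ (β : ℚ) (τ : ℍ) (w : S), signCoeff k (w : ℤ × ℤ).1
      ((w : ℤ × ℤ).2 + ((a / N : ℚ) : ℝ)) * qFac τ (a / N : ℚ) β w =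
        (((((w : ℤ × ℤ).1.sign * (w : ℤ × ℤ).1 ^ (k - 1) : ℤ) : Qcycl) *
          rootQ ((w : ℤ × ℤ).1 * β) : Qcycl) : ℂ) *
          Complex.exp (2 * Real.pi * Complex.I *
            ((((w : ℤ × ℤ).1 * ((w : ℤ × ℤ).2 * N + a)).toNat : ℕ) / N : ℂ) * (τ : ℂ)) :=
    fun β τ ⟨w, hw⟩ => by
      have hw' : 0 < w.1 * (w.2 * N + a) := hw
      rw [signCoeff, if_pos ((hiff w).2 hw), IntermediateField.coe_mul, mul_assoc, coe_rootQ,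
        ← Complex.exp_add, qFac]
      have e : (((w.1 * (w.2 * N + a)).toNat : ℕ) : ℂ) = w.1 * (w.2 * N + a) := by
        have : (((w.1 * (w.2 * N + a)).toNat : ℕ) : ℤ) = w.1 * (w.2 * N + a) :=
          Int.toNat_of_nonneg hw'.le
        exact_mod_cast congrArg (Int.cast : ℤ → ℂ) this
      rw [e]
      congr 2
      push_cast
      field_simp
      ring
  refine GalRel.of_hasSum hN
    (fun w : S => ((w : ℤ × ℤ).1 * ((w : ℤ × ℤ).2 * N + a)).toNat) (fun n => ?_)
    (fun w : S => (((w : ℤ × ℤ).1.sign * (w : ℤ × ℤ).1 ^ (k - 1) : ℤ) : Qcycl) *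
      rootQ ((w : ℤ × ℤ).1 * (b / N))) (fun τ => ?_) (fun τ => ?_)
  · have hf := finite_factor_fibre hN a n
    refine Set.Finite.to_subtype (s := {w : S |
      ((w : ℤ × ℤ).1 * ((w : ℤ × ℤ).2 * N + a)).toNat = n}) ?_
    refine Set.Finite.of_injOn (f := fun w : S => (w : ℤ × ℤ)) ?_ Subtype.val_injective.injOn hf
    intro w hw
    have hw' : 0 < (w : ℤ × ℤ).1 * ((w : ℤ × ℤ).2 * N + a) := w.2
    have hw2 : ((w : ℤ × ℤ).1 * ((w : ℤ × ℤ).2 * N + a)).toNat = n := hw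
    refine ⟨hw', ?_⟩
    dsimp only
    omega
  · refine ((hasSum_subtype_iff_of_support_subset (hsupp _ τ)).2 (h τ)).congr_fun fun w => ?_
    exact (key (b / N) τ w).symm
  · refine ((hasSum_subtype_iff_of_support_subset (hsupp _ τ)).2 (h' τ)).congr_fun fun w => ?_
    have e : σ ((((w : ℤ × ℤ).1.sign * (w : ℤ × ℤ).1 ^ (k - 1) : ℤ) : Qcycl) *
        rootQ ((w : ℤ × ℤ).1 * (b / N))) =
        (((w : ℤ × ℤ).1.sign * (w : ℤ × ℤ).1 ^ (k - 1) : ℤ) : Qcycl) *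
          rootQ ((w : ℤ × ℤ).1 * (m * (b / N))) := by
      rw [map_mul, map_intCast, hσ, ← rootQ_nat_mul]
      · congr 2; ring
      · rw [show (((w : ℤ × ℤ).1 : ℚ) * (b / N)) = (((w : ℤ × ℤ).1 * b : ℤ) : ℚ) / N by
          push_cast; ring]
        exact rootQ_pow_eq_one hN _
    rw [e]
    exact (key (m * (b / N)) τ w).symm

/-! ### The constant terms -/

theorem sum_pow_of_pow_eq_one {N : ℕ} {ζ : ℂ} (hζ : ζ ^ N = 1) :
    ∑ j ∈ Finset.range N, ζ ^ j = if ζ = 1 then (N : ℂ) else 0 := by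
  split_ifs with h
  · simp [h]
  · rw [geom_sum_eq h, hζ, sub_self, zero_div]

/-- Finite Fourier expansion of `∑ (m + b / N)^{-k}` in terms of values of Bernoulli
polynomials. -/
theorem tsum_inv_pow_shift {k N : ℕ} (hk : 2 ≤ k) (hN : 1 ≤ N) (b : ℤ) :
    ∑' m : ℤ, (((m : ℂ) + ((b / N : ℚ) : ℝ)) ^ k)⁻¹ =
      (N : ℂ) ^ (k - 1) * (-(2 * Real.pi * Complex.I) ^ k / k.factorial) *
        ∑ j ∈ Finset.range N, ((rootQ (j * (-(b / N)))) : ℂ) *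
          (((Polynomial.bernoulli k).eval (j / N : ℚ) : ℚ) : ℂ) := by
  have hN0 : (0 : ℝ) < N := by exact_mod_cast hN
  have hNC : (N : ℂ) ≠ 0 := by exact_mod_cast (by omega : N ≠ 0)
  have hpiC : (Real.pi : ℂ) ≠ 0 := by exact_mod_cast Real.pi_ne_zero
  have hB : ∀ j ∈ Finset.range N, HasSum (fun n : ℤ => ((rootQ (j * (-(b / N)))) : ℂ) *
      (1 / (n : ℂ) ^ k * Complex.exp (2 * Real.pi * Complex.I * n * (j / N))))
      ((rootQ (j * (-(b / N)))) * (-(2 * Real.pi * Complex.I) ^ k / k.factorial *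
        (((Polynomial.bernoulli k).eval (j / N : ℚ) : ℚ) : ℂ))) := fun j hj => by
    have hj' : (j : ℝ) < N := by exact_mod_cast Finset.mem_range.1 hj
    have h := hasSum_one_div_pow_mul_fourier_mul_bernoulliFun hk (x := j / N)
      ⟨by positivity, (div_le_one hN0).2 hj'.le⟩
    have e : (bernoulliFun k (j / N) : ℂ) = (((Polynomial.bernoulli k).eval (j / N : ℚ) : ℚ) : ℂ) := by
      rw [bernoulliFun, Polynomial.eval_map_algebraMap,
        show ((j : ℝ) / N) = algebraMap ℚ ℝ (j / N : ℚ) by simp,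
        Polynomial.aeval_algebraMap_apply]
      simp
    rw [e] at h
    refine (h.mul_left _).congr_fun fun n => ?_
    rw [fourier_coe_apply]
    congr 3
    push_cast
    ring
  have h := hasSum_sum hB
  -- summation over `j` selects the integers congruent to `b` modulo `N`
  have h1 : ∀ n : ℤ, ∑ j ∈ Finset.range N, ((rootQ (j * (-(b / N)))) : ℂ) *
      (1 / (n : ℂ) ^ k * Complex.exp (2 * Real.pi * Complex.I * n * (j / N))) =
        if (N : ℤ) ∣ n - b then (N : ℂ) * ((n : ℂ) ^ k)⁻¹ else 0 := fun n => by
    have e1 : ∀ j ∈ Finset.range N, ((rootQ (j * (-(b / N)))) : ℂ) *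
      (1 / (n : ℂ) ^ k * Complex.exp (2 * Real.pi * Complex.I * n * (j / N))) =
        ((n : ℂ) ^ k)⁻¹ * Complex.exp (2 * Real.pi * Complex.I * ((n - b) / N)) ^ j :=
      fun j _ => by
        rw [← Complex.exp_nat_mul, coe_rootQ, mul_left_comm, ← Complex.exp_add, one_div]
        congr 2
        push_cast
        ring
    have hz : Complex.exp (2 * Real.pi * Complex.I * ((n - b) / N)) ^ N = 1 := by
      rw [← Complex.exp_nat_mul, Complex.exp_eq_one_iff]
      exact ⟨n - b, by push_cast; field_simp⟩
    have hdvd : Complex.exp (2 * Real.pi * Complex.I * ((n - b) / N)) = 1 ↔ (N : ℤ) ∣ n - b := by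
      rw [Complex.exp_eq_one_iff]
      constructor
      · rintro ⟨c, hc⟩
        refine ⟨c, ?_⟩
        have : ((n : ℂ) - b) = N * c := by
          have h0 : 2 * (Real.pi : ℂ) * Complex.I ≠ 0 := by simp [hpiC]
          have := mul_left_cancel₀ h0 (hc.trans (mul_comm (c : ℂ) _))
          rw [← this]; field_simp
        exact_mod_cast this
      · rintro ⟨c, hc⟩
        refine ⟨c, ?_⟩
        have : ((n : ℂ) - b) = N * c := by exact_mod_cast congrArg (Int.cast : ℤ → ℂ) hc
        rw [this]; field_simp
    rw [Finset.sum_congr rfl e1, ← Finset.mul_sum, sum_pow_of_pow_eq_one hz]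
    simp only [hdvd]
    split_ifs <;> ring
  simp only [h1] at h
  have hinj : Function.Injective (fun m : ℤ => b + N * m) := fun x y hxy => by
    have : (N : ℤ) ≠ 0 := by exact_mod_cast (by omega : N ≠ 0)
    exact mul_left_cancel₀ this (add_left_cancel hxy)
  have h2 := (hinj.hasSum_iff (fun n hn => if_neg fun ⟨c, hc⟩ => hn ⟨c, by
    simp only; omega⟩)).2 h
  have h3 : ∀ m : ℤ, (if (N : ℤ) ∣ (b + N * m) - b then (N : ℂ) * (((b + N * m : ℤ) : ℂ) ^ k)⁻¹
      else 0) = (N : ℂ) * ((N : ℂ) ^ k)⁻¹ * (((m : ℂ) + ((b / N : ℚ) : ℝ)) ^ k)⁻¹ := fun m => by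
    rw [if_pos ⟨m, by ring⟩, mul_assoc, ← mul_inv, ← mul_pow]
    congr 3
    push_cast
    field_simp
    ring
  simp only [Function.comp_def, h3] at h2
  have h4 := h2.tsum_eq
  rw [tsum_mul_left] at h4
  have h5 : (N : ℂ) ^ (k - 1) * ((N : ℂ) * ((N : ℂ) ^ k)⁻¹) = 1 := by
    obtain ⟨j, rfl⟩ : ∃ j, k = j + 1 := ⟨k - 1, by omega⟩
    rw [Nat.add_sub_cancel, pow_succ]
    field_simp
  calc _ = (N : ℂ) ^ (k - 1) * ((N : ℂ) * ((N : ℂ) ^ k)⁻¹) *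
        ∑' m : ℤ, (((m : ℂ) + ((b / N : ℚ) : ℝ)) ^ k)⁻¹ := by rw [h5, one_mul]
    _ = _ := by
      rw [mul_assoc, h4, Finset.mul_sum, Finset.mul_sum]
      refine Finset.sum_congr rfl fun j _ => ?_
      ring

/-- An explicit element of `ℚ^cycl` equal to the constant term of an Eisenstein series. -/
theorem constTerm_eq {k N : ℕ} (hk : 2 ≤ k) (hN : 1 ≤ N) {α : ℝ} (hα : ∃ n : ℤ, (n : ℝ) + α = 0)
    (b : ℤ) : constTerm k α ((b / N : ℚ) : ℝ) =
      (((algebraMap ℚ Qcycl ((-1) ^ (k + 1) * N ^ (k - 1) / k)) *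
        ∑ j ∈ Finset.range N, rootQ (j * (-(b / N))) *
          algebraMap ℚ Qcycl ((Polynomial.bernoulli k).eval (j / N : ℚ)) : Qcycl) : ℂ) := by
  have hpiC : (Real.pi : ℂ) ≠ 0 := by exact_mod_cast Real.pi_ne_zero
  have hc : ∀ x : ℚ, ((algebraMap ℚ Qcycl x : Qcycl) : ℂ) = (x : ℂ) := fun x => rfl
  rw [constTerm, if_pos hα, tsum_inv_pow_shift hk hN, ← mul_assoc, IntermediateField.coe_mul,
    AddSubmonoidClass.coe_finsetSum, hc]
  congr 1
  obtain ⟨j, rfl⟩ : ∃ j, k = j + 1 := ⟨k - 1, by omega⟩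
  rw [Nat.add_sub_cancel, Nat.factorial_succ,
    show (-2 * Real.pi * Complex.I : ℂ) = -1 * (2 * Real.pi * Complex.I) by ring, mul_pow (-1 : ℂ)]
  have h1 : (2 * Real.pi * Complex.I : ℂ) ^ (j + 1) ≠ 0 := pow_ne_zero _ (by simp [hpiC])
  have h2 : (j.factorial : ℂ) ≠ 0 := by exact_mod_cast Nat.factorial_ne_zero j
  have h3 : (j : ℂ) + 1 ≠ 0 := by exact_mod_cast Nat.succ_ne_zero j
  have h4 : ((-1 : ℂ) ^ (j + 1)) * (-1) ^ (j + 1) = 1 := by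
    rw [← mul_pow]; norm_num
  have h5 : ((-1 : ℂ) ^ (j + 1)) ≠ 0 := pow_ne_zero _ (by norm_num)
  push_cast
  field_simp
  rw [pow_succ (-1 : ℂ) (j + 1)]
  linear_combination ((N : ℂ) ^ j) * h4

/-- The constant terms are transformed by `ζ ↦ ζ ^ m` in the expected way. -/
theorem galRel_constTerm {k N m : ℕ} (hk : 2 ≤ k) (hN : 1 ≤ N)
    (hσ : ∀ ζ : Qcycl, ζ ^ N = 1 → σ ζ = ζ ^ m) (α : ℝ) (b : ℤ) :
    GalRel σ (fun _ => constTerm k α ((b / N : ℚ) : ℝ))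
      (fun _ => constTerm k α ((m * (b / N) : ℚ) : ℝ)) := by
  by_cases hα : ∃ n : ℤ, (n : ℝ) + α = 0
  · rw [constTerm_eq hk hN hα, show ((m * (b / N) : ℚ)) = (((m * b : ℤ) : ℚ) / N) by
      push_cast; ring, constTerm_eq hk hN hα]
    convert GalRel.const (σ := σ) _ using 3
    rw [map_mul, map_sum, AlgEquiv.commutes]
    congr 1
    refine Finset.sum_congr rfl fun j _ => ?_
    rw [map_mul, AlgEquiv.commutes, hσ, ← rootQ_nat_mul]
    · congr 2
      push_cast
      ring
    · rw [show ((j : ℚ) * (-(b / N))) = ((-(j * b) : ℤ) : ℚ) / N by push_cast; ring]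
      exact rootQ_pow_eq_one hN _
  · simp only [constTerm, if_neg hα]
    simpa using GalRel.ratConst (σ := σ) 0

/-! ### Periodicity, parity, and `F` as a finite Fourier transform of `E` -/

theorem thetaE_add_int (k : ℕ) (τ : ℍ) (α β t : ℝ) (m n : ℤ) :
    thetaE k τ (α + n) (β + m) t = thetaE k τ α β t := by
  rw [thetaE, thetaE, ← ((Equiv.addRight m).prodCongr (Equiv.addRight n)).tsum_eq
    (fun w => (starRingEnd ℂ) (latPt τ α β w) ^ k *
      (Real.exp (-(Real.pi / τ.im * ‖latPt τ α β w‖ ^ 2) * t) : ℝ))]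
  refine tsum_congr fun w => ?_
  have : latPt τ (α + n) (β + m) w =
      latPt τ α β (((Equiv.addRight m).prodCongr (Equiv.addRight n)) w) := by
    simp only [latPt, Equiv.prodCongr_apply, Prod.map, Equiv.coe_addRight]
    push_cast
    ring
  rw [this]

theorem thetaE_neg (k : ℕ) (τ : ℍ) (α β t : ℝ) :
    thetaE k τ (-α) (-β) t = (-1) ^ k * thetaE k τ α β t := by
  rw [thetaE, thetaE, ← (Equiv.neg (ℤ × ℤ)).tsum_eq, ← tsum_mul_left]
  refine tsum_congr fun w => ?_
  have : latPt τ (-α) (-β) (Equiv.neg (ℤ × ℤ) w) = -latPt τ α β w := by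
    simp only [latPt, Equiv.neg_apply, Prod.fst_neg, Prod.snd_neg]
    push_cast
    ring
  rw [this, map_neg, neg_pow, norm_neg, mul_assoc]

theorem E_add_int {k : ℕ} (hk : 1 ≤ k) (α β : ℚ) (m n : ℤ) : E k (α + n) (β + m) = E k α β := by
  funext τ
  rw [E_eq_mellin hk, E_eq_mellin hk]
  congr 2
  funext t
  push_cast
  exact thetaE_add_int k τ α β t m n

theorem F_add_int {k : ℕ} (hk : 1 ≤ k) (α β : ℚ) (m n : ℤ) : F k (α + n) (β + m) = F k α β := by
  funext τ
  rw [F_eq_mellin hk, F_eq_mellin hk]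
  congr 2
  funext t
  push_cast
  exact thetaE_add_int k τ α β t m n

theorem E_neg {k : ℕ} (hk : 1 ≤ k) (α β : ℚ) (τ : ℍ) :
    E k (-α) (-β) τ = (-1) ^ k * E k α β τ := by
  rw [E_eq_mellin hk, E_eq_mellin hk]
  have : thetaE k τ ((-α : ℚ) : ℝ) ((-β : ℚ) : ℝ) = fun t => (-1 : ℂ) ^ k • thetaE k τ α β t := by
    funext t
    push_cast
    exact thetaE_neg k τ α β t
  rw [this, mellin_const_smul, smul_eq_mul]
  ring

/-- In weight `1` both series are the value of the same Mellin transform at `s = 1`. -/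
theorem E_one_eq_F_one (α β : ℚ) : E 1 α β = F 1 α β := by
  funext τ
  rw [E_eq_mellin le_rfl, F_eq_mellin le_rfl, Nat.cast_one]

/-- The character of the lattice attached to an `N`-torsion point is constant on the cosets of
`N(ℤ + ℤτ)`, each of which is a dilated and translated lattice. -/
theorem thetaF_eq_sum {k N : ℕ} [NeZero N] (τ : ℍ) (a b : ℤ) {t : ℝ} (ht : 0 < t) :
    thetaF k τ (a / N : ℚ) (b / N : ℚ) t = ∑ p : Fin N × Fin N,
      (rootQ ((p.2 * b - p.1 * a) / N) : ℂ) * (N : ℂ) ^ k *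
        thetaE k τ ((p.2 : ℕ) / N : ℚ) ((p.1 : ℕ) / N : ℚ) ((N : ℝ) ^ 2 * t) := by
  have hN : (N : ℝ) ≠ 0 := by exact_mod_cast NeZero.ne N
  have hNC : (N : ℂ) ≠ 0 := by exact_mod_cast NeZero.ne N
  -- division with remainder by `N` in both coordinates
  set e : (Fin N × Fin N) × (ℤ × ℤ) ≃ ℤ × ℤ :=
    (Equiv.prodComm _ _).trans ((Equiv.prodProdProdComm ℤ ℤ (Fin N) (Fin N)).trans
      ((Int.divModEquiv N).symm.prodCongr (Int.divModEquiv N).symm)) with he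
  have hs : Summable fun w : ℤ × ℤ => (Complex.exp (charExp (a / N : ℚ) (b / N : ℚ) w) *
      (starRingEnd ℂ) (latPt τ 0 0 w) ^ k) *
      (Real.exp (-(Real.pi / τ.im * ‖latPt τ 0 0 w‖ ^ 2) * t) : ℝ) := by
    refine Summable.of_norm_bounded (summable_thetaF k τ (a / N : ℚ) (b / N : ℚ) ht) fun w => ?_
    rw [norm_mul, Complex.norm_real, Real.norm_of_nonneg (Real.exp_pos _).le]
  have hs2 := e.summable_iff.2 hs
  rw [thetaF, ← e.tsum_eq]
  refine (Summable.tsum_prod hs2).trans ?_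
  rw [tsum_fintype]
  refine Finset.sum_congr rfl fun p _ => ?_
  rw [thetaE, ← tsum_mul_left]
  refine tsum_congr fun w => ?_
  have e1 : e (p, w) = (w.1 * N + (p.1 : ℕ), w.2 * N + (p.2 : ℕ)) := by
    simp [he, Int.divModEquiv]
  have e2 : latPt τ 0 0 (e (p, w)) =
      N * latPt τ ((p.2 : ℕ) / N : ℚ) ((p.1 : ℕ) / N : ℚ) w := by
    rw [e1, latPt, latPt]
    push_cast
    field_simp
    ring
  have e3 : Complex.exp (charExp (a / N : ℚ) (b / N : ℚ) (e (p, w))) =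
      (rootQ ((p.2 * b - p.1 * a) / N) : ℂ) := by
    rw [e1, coe_rootQ, Complex.exp_eq_exp_iff_exists_int]
    refine ⟨w.2 * b - w.1 * a, ?_⟩
    rw [charExp]
    push_cast
    field_simp
    ring
  simp only [Function.comp]
  rw [e2, e3, map_mul, Complex.conj_natCast, mul_pow, norm_mul, Complex.norm_natCast, mul_pow]
  rw [show -(Real.pi / τ.im * ((N : ℝ) ^ 2 * ‖latPt τ ((p.2 : ℕ) / N : ℚ) ((p.1 : ℕ) / N : ℚ) w‖ ^ 2)) * t =
    -(Real.pi / τ.im * ‖latPt τ ((p.2 : ℕ) / N : ℚ) ((p.1 : ℕ) / N : ℚ) w‖ ^ 2) * (N ^ 2 * t) by ring]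
  ring

/-- The series `F` is the finite Fourier transform of the series `E`. -/
theorem F_eq_sum {k N : ℕ} (hk : 1 ≤ k) [NeZero N] (a b : ℤ) (τ : ℍ) :
    F k (a / N) (b / N) τ = ((N : ℂ) ^ k)⁻¹ * ∑ p : Fin N × Fin N,
      (rootQ ((p.2 * b - p.1 * a) / N) : ℂ) * E k ((p.2 : ℕ) / N) ((p.1 : ℕ) / N) τ := by
  have hN : (0 : ℝ) < N := by exact_mod_cast Nat.pos_of_ne_zero (NeZero.ne N)
  have hNC : (N : ℂ) ≠ 0 := by exact_mod_cast NeZero.ne N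
  have hN2 : (0 : ℝ) < (N : ℝ) ^ 2 := by positivity
  rw [F_eq_mellin_thetaF hk]
  have h1 : mellin (thetaF k τ (a / N : ℚ) (b / N : ℚ)) k = ∑ p : Fin N × Fin N,
      (rootQ ((p.2 * b - p.1 * a) / N) : ℂ) * (N : ℂ) ^ k * ((((N : ℝ) ^ 2 : ℝ) : ℂ) ^ (-(k : ℂ)) *
        mellin (thetaE k τ ((p.2 : ℕ) / N : ℚ) ((p.1 : ℕ) / N : ℚ)) k) := by
    have h2 : ∀ p : Fin N × Fin N, IntegrableOn (fun t : ℝ => (t : ℂ) ^ ((k : ℂ) - 1) •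
        ((rootQ ((p.2 * b - p.1 * a) / N) : ℂ) * (N : ℂ) ^ k *
          thetaE k τ ((p.2 : ℕ) / N : ℚ) ((p.1 : ℕ) / N : ℚ) ((N : ℝ) ^ 2 * t))) (Set.Ioi 0) :=
      fun p => ((MellinConvergent.comp_mul_left hN2).2
        (mellinConvergent_thetaE hk τ ((p.2 : ℕ) / N : ℚ) ((p.1 : ℕ) / N : ℚ) k)).const_smul
          ((rootQ ((p.2 * b - p.1 * a) / N) : ℂ) * (N : ℂ) ^ k)
    have h3 := integral_finsetSum Finset.univ fun p _ => h2 p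
    rw [mellin]
    refine (setIntegral_congr_fun measurableSet_Ioi fun t ht => ?_).trans (h3.trans ?_)
    · rw [thetaF_eq_sum τ a b ht, Finset.smul_sum]
    · refine Finset.sum_congr rfl fun p _ => ?_
      have := mellin_const_smul (fun t => thetaE k τ ((p.2 : ℕ) / N : ℚ) ((p.1 : ℕ) / N : ℚ)
        ((N : ℝ) ^ 2 * t)) k ((rootQ ((p.2 * b - p.1 * a) / N) : ℂ) * (N : ℂ) ^ k)
      rw [mellin_comp_mul_left _ _ hN2] at this
      exact this
  rw [h1, Finset.mul_sum, Finset.mul_sum]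
  refine Finset.sum_congr rfl fun p _ => ?_
  rw [E_eq_mellin hk, Complex.cpow_neg, Complex.cpow_natCast]
  push_cast
  field_simp
  ring

/-- Multiplication by a unit permutes the residue classes modulo `N`. -/
theorem sum_mul_unit_of_periodic {N m : ℕ} [NeZero N] (hm : m.Coprime N) {f : ℤ → ℂ}
    (hf : ∀ x c : ℤ, f (x + c * N) = f x) :
    ∑ i : Fin N, f (m * (i : ℕ)) = ∑ i : Fin N, f (i : ℕ) := by
  have h1 : ∀ x y : ℤ, x % N = y % N → f x = f y := fun x y h => by
    have h2 : (N : ℤ) ∣ x - y := Int.ModEq.dvd (Int.ModEq.symm h)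
    obtain ⟨c, hc⟩ := h2
    rw [show x = y + c * N by linarith, hf]
  have hinj : Function.Injective fun i : Fin N =>
      (⟨(m * i) % N, Nat.mod_lt _ (Nat.pos_of_ne_zero (NeZero.ne N))⟩ : Fin N) := by
    intro i j hij
    have h3 : m * (i : ℕ) ≡ m * (j : ℕ) [MOD N] := Fin.mk.inj_iff.1 hij
    have h4 := Nat.ModEq.cancel_left_of_coprime (by rwa [Nat.gcd_comm]) h3
    rw [Nat.ModEq, Nat.mod_eq_of_lt i.2, Nat.mod_eq_of_lt j.2] at h4
    exact Fin.ext h4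
  have hbij := Finite.injective_iff_bijective.1 hinj
  rw [← Function.Bijective.sum_comp hbij fun i : Fin N => f (i : ℕ)]
  refine Finset.sum_congr rfl fun i _ => h1 _ _ ?_
  push_cast
  rw [Int.emod_emod_of_dvd _ dvd_rfl]

/-! ### Galois action on the Eisenstein series -/

/-- The Eisenstein series `E`, corrected in weight `2` by subtracting `E 2 0 0`. -/
def regE (k : ℕ) (α β : ℚ) : ℍ → ℂ := fun τ => E k α β τ - if k = 2 then E 2 0 0 τ else 0

theorem regE_add_int {k : ℕ} (hk : 1 ≤ k) (α β : ℚ) (m n : ℤ) :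
    regE k (α + n) (β + m) = regE k α β := by
  unfold regE
  rw [E_add_int hk]

/-- The Galois action on `E` in weight `k ≥ 2`, read off from the `q`-expansion. In weight `2` the
nonholomorphic terms of `E` and `E 2 0 0` cancel. -/
theorem galRel_regE_of_two_le {k N m : ℕ} (hk : 2 ≤ k) (hN : 1 ≤ N)
    (hσ : ∀ ζ : Qcycl, ζ ^ N = 1 → σ ζ = ζ ^ m) (a b : ℤ) :
    GalRel σ (regE k (a / N) (b / N)) (regE k (a / N) (m * (b / N))) := by
  rcases hk.eq_or_lt with rfl | hk3
  · have h1 := galRel_of_hasSum_signCoeff (k := 2) hN hσ a b (fun τ => hasSum_E_two τ _ _)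
      (fun τ => hasSum_E_two τ _ _)
    have h2 := galRel_of_hasSum_signCoeff (k := 2) hN hσ 0 0 (fun τ => hasSum_E_two τ _ _)
      (fun τ => hasSum_E_two τ _ _)
    have h3 := galRel_constTerm (σ := σ) (k := 2) le_rfl hN hσ ((a / N : ℚ) : ℝ) b
    have h4 := galRel_constTerm (σ := σ) (k := 2) le_rfl hN hσ ((0 / N : ℚ) : ℝ) 0
    have h5 := (h1.add h3).add ((h2.add h4).const_mul (-1))
    refine h5.congr (fun τ => ?_) fun τ => ?_
    · simp only [regE, if_true, Pi.add_apply]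
      push_cast
      simp only [zero_div]
      ring
    · simp only [regE, if_true, Pi.add_apply, map_neg, map_one]
      push_cast
      simp only [zero_div, mul_zero]
      ring
  · have h1 := galRel_of_hasSum_signCoeff (k := k) hN hσ a b
      (fun τ => hasSum_qExp_of_three_le hk3 τ _ _) (fun τ => hasSum_qExp_of_three_le hk3 τ _ _)
    have h3 := galRel_constTerm (σ := σ) hk hN hσ ((a / N : ℚ) : ℝ) b
    refine (h1.add h3).congr (fun τ => ?_) fun τ => ?_
    · simp [regE, show k ≠ 2 by omega]
    · simp [regE, show k ≠ 2 by omega]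

/-- In weight `1` with `α` not integral, the constant term is rational and does not depend on `β`.
-/
theorem galRel_E_one_of_not_int {N m : ℕ} (hN : 1 ≤ N)
    (hσ : ∀ ζ : Qcycl, ζ ^ N = 1 → σ ζ = ζ ^ m) {a : ℤ} (ha : ¬ (N : ℤ) ∣ a) (b : ℤ) :
    GalRel σ (E 1 (a / N) (b / N)) (E 1 (a / N) (m * (b / N))) := by
  have hNR : (N : ℝ) ≠ 0 := by exact_mod_cast (by omega : N ≠ 0)
  have hα : ∀ n : ℤ, (n : ℝ) + ((a / N : ℚ) : ℝ) ≠ 0 := fun n h => ha ⟨-n, by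
    push_cast at h
    field_simp at h
    have : n * (N : ℤ) + a = 0 := by exact_mod_cast h
    linarith⟩
  have h1 := galRel_of_hasSum_signCoeff (k := 1) hN hσ a b
    (fun τ => hasSum_E_one τ _ _ hα) (fun τ => hasSum_E_one τ _ _ hα)
  refine (h1.add (GalRel.ratConst (1 / 2 - Int.fract (a / N : ℚ)))).congr (fun τ => ?_) fun τ => ?_
  · simp only [Pi.add_apply, sub_add_cancel]
  · simp only [Pi.add_apply, sub_add_cancel]

/-- The sum over the torsion points on the real axis vanishes in weight `1`, because `E` is odd. -/
theorem sum_E_one_zero (N : ℕ) [NeZero N] (τ : ℍ) :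
    ∑ i : Fin N, E 1 0 ((i : ℕ) / N) τ = 0 := by
  have hNQ : (N : ℚ) ≠ 0 := by exact_mod_cast NeZero.ne N
  have hinv : ∑ i : Fin N, E 1 0 ((i : ℕ) / N) τ = ∑ i : Fin N, E 1 0 (((-i : Fin N) : ℕ) / N) τ :=
    (Equiv.sum_comp (Equiv.neg (Fin N)) fun i : Fin N => E 1 0 ((i : ℕ) / N) τ).symm
  have hneg : ∀ i : Fin N, E 1 0 (((-i : Fin N) : ℕ) / N) τ = -E 1 0 ((i : ℕ) / N) τ := fun i => by
    have h1 := E_neg le_rfl 0 ((i : ℕ) / N) τ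
    rw [neg_zero, pow_one, neg_one_mul] at h1
    rw [← h1]
    have h2 : ∃ c : ℤ, (((-i : Fin N) : ℕ) : ℚ) / N = -((i : ℕ) / N) + c := by
      rw [Fin.val_neg']
      have h3 := Nat.div_add_mod (N - (i : ℕ)) N
      have h4 : ((N - (i : ℕ) : ℕ) : ℚ) = N - (i : ℕ) := Nat.cast_sub i.2.le
      refine ⟨1 - ((N - (i : ℕ)) / N : ℕ), ?_⟩
      have h5 : (N : ℚ) * ((N - (i : ℕ)) / N : ℕ) + ((N - (i : ℕ)) % N : ℕ) = N - (i : ℕ) := by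
        rw [← h4]
        exact_mod_cast h3
      rw [eq_sub_of_add_eq' h5, Int.cast_sub, Int.cast_one, Int.cast_natCast]
      field_simp
      ring
    obtain ⟨c, hc⟩ := h2
    rw [hc]
    have := E_add_int le_rfl 0 (-((i : ℕ) / N : ℚ)) c 0
    rw [Int.cast_zero, add_zero] at this
    rw [this]
  rw [Finset.sum_congr rfl fun i _ => hneg i, Finset.sum_neg_distrib] at hinv
  exact self_eq_neg.1 hinv

theorem rootQ_add_int (x : ℚ) (n : ℤ) : rootQ (x + n) = rootQ x := by
  rw [rootQ_add, rootQ_int, mul_one]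

/-- Transport of a finite Fourier sum by `ζ ↦ ζ ^ m`. -/
theorem galRel_fourier_sum {N m : ℕ} [NeZero N] (hm : m.Coprime N)
    (hσ : ∀ ζ : Qcycl, ζ ^ N = 1 → σ ζ = ζ ^ m) {e : ℚ → ℚ → ℍ → ℂ}
    (he : ∀ α β : ℚ, ∀ n : ℤ, e α (β + n) = e α β) (s : Finset (Fin N))
    (hg : ∀ j ∈ s, ∀ i : Fin N, GalRel σ (e ((j : ℕ) / N) ((i : ℕ) / N))
      (e ((j : ℕ) / N) (m * ((i : ℕ) / N)))) (a b : ℤ) :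
    GalRel σ (fun τ => ∑ j ∈ s, ∑ i : Fin N, (rootQ (((j : ℕ) * b - (i : ℕ) * a) / N) : ℂ) *
        e ((j : ℕ) / N) ((i : ℕ) / N) τ)
      (fun τ => ∑ j ∈ s, ∑ i : Fin N, (rootQ (((j : ℕ) * (m * b) - (i : ℕ) * a) / N) : ℂ) *
        e ((j : ℕ) / N) ((i : ℕ) / N) τ) := by
  have hNQ : (N : ℚ) ≠ 0 := by exact_mod_cast NeZero.ne N
  have h := GalRel.sum s fun j hj => GalRel.sum Finset.univ fun i _ =>
    (hg j hj i).const_mul (rootQ (((j : ℕ) * b - (i : ℕ) * a) / N))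
  refine h.congr (fun τ => rfl) fun τ => ?_
  refine Finset.sum_congr rfl fun j _ => ?_
  have hS := sum_mul_unit_of_periodic hm (f := fun i : ℤ =>
    (rootQ (((j : ℕ) * (m * b) - i * a) / N) : ℂ) * e ((j : ℕ) / N) (i / N) τ) fun x c => by
      rw [show (((x + c * N : ℤ)) : ℚ) / N = x / N + c by push_cast; field_simp, he,
        show (((j : ℕ) : ℚ) * (m * b) - ((x + c * N : ℤ) : ℚ) * a) / N =
          (((j : ℕ) : ℚ) * (m * b) - x * a) / N + ((-(c * a) : ℤ) : ℚ) by
            push_cast; field_simp; ring, rootQ_add_int]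
  refine (Finset.sum_congr rfl fun i _ => ?_).trans
    (hS.symm.trans (Finset.sum_congr rfl fun i _ => ?_))
  · simp only [Int.cast_natCast]
  · congr 2
    · rw [hσ, ← rootQ_nat_mul]
      · congr 1
        push_cast
        ring
      · rw [show (((j : ℕ) : ℚ) * b - ((i : ℕ) : ℚ) * a) / N =
          (((j : ℕ) * b - (i : ℕ) * a : ℤ) : ℚ) / N by push_cast; ring]
        exact rootQ_pow_eq_one (Nat.pos_of_ne_zero (NeZero.ne N)) _
    · push_cast
      ring

theorem F_eq_sum_sum {k N : ℕ} (hk : 1 ≤ k) [NeZero N] (a b : ℤ) (τ : ℍ) :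
    F k (a / N) (b / N) τ = ((N : ℂ) ^ k)⁻¹ * ∑ j : Fin N, ∑ i : Fin N,
      (rootQ (((j : ℕ) * b - (i : ℕ) * a) / N) : ℂ) * E k ((j : ℕ) / N) ((i : ℕ) / N) τ := by
  rw [F_eq_sum hk, Fintype.sum_prod_type_right]

theorem GalRel.nat_inv_mul (n : ℕ) {f f' : ℍ → ℂ} (h : GalRel σ f f') :
    GalRel σ (fun τ => (n : ℂ)⁻¹ * f τ) (fun τ => (n : ℂ)⁻¹ * f' τ) := by
  refine (h.const_mul ((n : Qcycl)⁻¹)).congr (fun τ => ?_) fun τ => ?_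
  · push_cast; rfl
  · rw [map_inv₀, map_natCast]
    push_cast; rfl

/-- In weight `1` with `α` integral, `E = F` is a finite Fourier transform of `E` in which the
terms with integral first argument cancel by oddness. The remaining ones are covered by
`galRel_E_one_of_not_int`. -/
theorem galRel_E_one_of_int {N m : ℕ} (hN : 1 ≤ N) (hm : m.Coprime N)
    (hσ : ∀ ζ : Qcycl, ζ ^ N = 1 → σ ζ = ζ ^ m) {a : ℤ} (ha : (N : ℤ) ∣ a) (b : ℤ) :
    GalRel σ (E 1 (a / N) (b / N)) (E 1 (a / N) (m * (b / N))) := by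
  classical
  have : NeZero N := ⟨by omega⟩
  have hNQ : (N : ℚ) ≠ 0 := by exact_mod_cast NeZero.ne N
  obtain ⟨c, rfl⟩ := ha
  have key : ∀ (b : ℤ) (τ : ℍ), E 1 ((N * c : ℤ) / N) (b / N) τ = (N : ℂ)⁻¹ *
      ∑ j ∈ Finset.univ.erase (0 : Fin N), ∑ i : Fin N,
        (rootQ (((j : ℕ) * b - (i : ℕ) * (N * c : ℤ)) / N) : ℂ) *
          E 1 ((j : ℕ) / N) ((i : ℕ) / N) τ := fun b τ => by
    rw [E_one_eq_F_one, F_eq_sum_sum le_rfl, pow_one, ← Finset.add_sum_erase _ _ (Finset.mem_univ 0)]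
    have h0 : ∑ i : Fin N, (rootQ ((((0 : Fin N) : ℕ) * b - (i : ℕ) * (N * c : ℤ)) / N) : ℂ) *
        E 1 (((0 : Fin N) : ℕ) / N) ((i : ℕ) / N) τ = 0 := by
      rw [← sum_E_one_zero N τ]
      refine Finset.sum_congr rfl fun i _ => ?_
      have e : ((((0 : Fin N) : ℕ) : ℚ) * b - ((i : ℕ) : ℚ) * (N * c : ℤ)) / N =
          ((-((i : ℕ) * c) : ℤ) : ℚ) := by
        push_cast
        simp only [Fin.val_zero, Nat.cast_zero]
        field_simp
        ring
      rw [e, rootQ_int]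
      simp
    rw [h0, zero_add]
  have h1 := galRel_fourier_sum (e := E 1) hm hσ (fun α β n => by
    simpa using E_add_int le_rfl α β n 0) (Finset.univ.erase (0 : Fin N)) (fun j hj i => by
      have hj0 : (j : ℕ) ≠ 0 := fun h => (Finset.mem_erase.1 hj).1 (Fin.ext h)
      have := galRel_E_one_of_not_int hN hσ (a := (j : ℕ)) (fun hd => by
        have h2 := Nat.le_of_dvd (Nat.pos_of_ne_zero hj0) (Int.natCast_dvd_natCast.1 hd)
        have h3 := j.2
        omega) (i : ℕ)
      simpa using this) (N * c) b
  refine (h1.nat_inv_mul N).congr (key b) fun τ => ?_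
  rw [show (m : ℚ) * (b / N) = ((m * b : ℤ) : ℚ) / N by push_cast; ring, key]
  push_cast
  rfl

/-- The automorphisms that act on `N`-th roots of unity by `ζ ↦ ζ ^ m` send `E_{α,β}` to
`E_{α,mβ}` for `α, β ∈ N⁻¹ℤ`, after the correction in weight `2`. -/
theorem galRel_regE {k N m : ℕ} (hk : 1 ≤ k) (hN : 1 ≤ N) (hm : m.Coprime N)
    (hσ : ∀ ζ : Qcycl, ζ ^ N = 1 → σ ζ = ζ ^ m) (a b : ℤ) :
    GalRel σ (regE k (a / N) (b / N)) (regE k (a / N) (m * (b / N))) := by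
  rcases hk.eq_or_lt with rfl | hk2
  · have e : ∀ α β, regE 1 α β = E 1 α β := fun α β => by
      funext τ; simp [regE]
    rw [e, e]
    by_cases ha : (N : ℤ) ∣ a
    · exact galRel_E_one_of_int hN hm hσ ha b
    · exact galRel_E_one_of_not_int hN hσ ha b
  · exact galRel_regE_of_two_le hk2 hN hσ a b

/-- The Eisenstein series `F`, replaced by `0` in weight `2` for integral arguments. -/
def regF (k : ℕ) (α β : ℚ) : ℍ → ℂ :=
  open Classical in
  fun τ => F k α β τ - if k = 2 ∧ (∃ n : ℤ, α = n) ∧ (∃ n : ℤ, β = n) then F 2 0 0 τ else 0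

/-- The analogue of `galRel_regE` for `F`, by means of its expression as a finite Fourier
transform of `E`. In weight `2` one may replace `E` by `E - E 2 0 0`, since the coefficients of
the Fourier transform add up to `0` when `(α, β)` is not integral. -/
theorem galRel_regF {k N m : ℕ} (hk : 1 ≤ k) (hN : 1 ≤ N) (hm : m.Coprime N)
    (hσ : ∀ ζ : Qcycl, ζ ^ N = 1 → σ ζ = ζ ^ m) (a b : ℤ) :
    GalRel σ (regF k (a / N) (b / N)) (regF k (a / N) (m * (b / N))) := by
  have : NeZero N := ⟨by omega⟩
  have hNQ : (N : ℚ) ≠ 0 := by exact_mod_cast NeZero.ne N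
  have hmul : (m : ℚ) * (b / N) = ((m * b : ℤ) : ℚ) / N := by push_cast; ring
  have hdvd : ∀ c : ℤ, (∃ n : ℤ, (c / N : ℚ) = n) ↔ (N : ℤ) ∣ c := fun c => by
    constructor
    · rintro ⟨n, hn⟩
      refine ⟨n, ?_⟩
      field_simp at hn
      exact_mod_cast hn
    · rintro ⟨n, rfl⟩
      exact ⟨n, by push_cast; field_simp⟩
  have hdm : (N : ℤ) ∣ m * b ↔ (N : ℤ) ∣ b :=
    ⟨fun h => (Int.isCoprime_iff_gcd_eq_one.2 (by
      rw [Int.gcd_natCast_natCast]; exact hm)).symm.dvd_of_dvd_mul_left h, fun h => h.mul_left _⟩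
  by_cases h2 : k = 2 ∧ (N : ℤ) ∣ a ∧ (N : ℤ) ∣ b
  · obtain ⟨rfl, ⟨c, rfl⟩, ⟨d, rfl⟩⟩ := h2
    have hz : ∀ x y : ℤ, regF 2 ((N * x : ℤ) / N) ((N * y : ℤ) / N) = fun _ => ((0 : ℚ) : ℂ) :=
      fun x y => by
        funext τ
        rw [regF, if_pos ⟨rfl, (hdvd _).2 ⟨x, rfl⟩, (hdvd _).2 ⟨y, rfl⟩⟩]
        have e : ∀ x : ℤ, ((N * x : ℤ) : ℚ) / N = 0 + x := fun x => by
          push_cast; field_simp; simp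
        rw [e, e, F_add_int one_le_two, sub_self, Rat.cast_zero]
    rw [hmul, show (m : ℤ) * (N * d) = N * (m * d) by ring, hz, hz]
    exact GalRel.ratConst 0
  · have key : ∀ b' : ℤ, ¬ (k = 2 ∧ (N : ℤ) ∣ a ∧ (N : ℤ) ∣ b') → ∀ τ,
        regF k (a / N) (b' / N) τ = ((N ^ k : ℕ) : ℂ)⁻¹ * ∑ j : Fin N, ∑ i : Fin N,
          (rootQ (((j : ℕ) * b' - (i : ℕ) * a) / N) : ℂ) *
            regE k ((j : ℕ) / N) ((i : ℕ) / N) τ := fun b' hb τ => by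
      rw [regF, hdvd, hdvd, if_neg hb, sub_zero, F_eq_sum_sum hk]
      push_cast
      congr 1
      by_cases hk2 : k = 2
      · subst hk2
        -- the coefficients of the Fourier transform add up to `0`, as `(a, b')` is not divisible by `N`
        have hsum : ∑ j : Fin N, ∑ i : Fin N,
            (rootQ (((j : ℕ) * b' - (i : ℕ) * a) / N) : ℂ) = 0 := by
          have e1 : ∀ i j : Fin N, (rootQ (((j : ℕ) * b' - (i : ℕ) * a) / N) : ℂ) =
              (rootQ (b' / N) : ℂ) ^ (j : ℕ) * (rootQ ((-a : ℤ) / N) : ℂ) ^ (i : ℕ) :=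
            fun i j => by
              rw [← IntermediateField.coe_pow, ← IntermediateField.coe_pow, ← rootQ_nat_mul,
                ← rootQ_nat_mul, ← IntermediateField.coe_mul, ← rootQ_add]
              congr 2
              push_cast
              ring
          have e2 : ∀ c : ℤ, ∑ i : Fin N, (rootQ (c / N) : ℂ) ^ (i : ℕ) =
              if (N : ℤ) ∣ c then (N : ℂ) else 0 := fun c => by
            rw [Fin.sum_univ_eq_sum_range (fun i => (rootQ (c / N) : ℂ) ^ i),
              sum_pow_of_pow_eq_one (by
                rw [← IntermediateField.coe_pow, rootQ_pow_eq_one hN, IntermediateField.coe_one])]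
            have : (rootQ (c / N) : ℂ) = 1 ↔ (N : ℤ) ∣ c := by
              rw [← hdvd, coe_rootQ, Complex.exp_eq_one_iff]
              have hpi : 2 * (Real.pi : ℂ) * Complex.I ≠ 0 := by
                simp [Real.pi_ne_zero]
              refine exists_congr fun n => ?_
              rw [mul_comm (n : ℂ), mul_right_inj' hpi]
              exact_mod_cast Iff.rfl
            simp only [this]
          simp only [e1]
          simp only [← Finset.mul_sum, ← Finset.sum_mul]
          simp only [e2, dvd_neg]
          by_cases h3 : (N : ℤ) ∣ a
          · rw [if_neg fun h4 => hb ⟨rfl, h3, h4⟩, zero_mul]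
          · rw [if_neg h3, mul_zero]
        simp only [regE, if_true, mul_sub, Finset.sum_sub_distrib, ← Finset.sum_mul]
        rw [hsum, zero_mul, sub_zero]
      · simp [regE, hk2]
    have h1 := galRel_fourier_sum (e := regE k) hm hσ (fun α β n => by
      simpa using regE_add_int hk α β n 0) Finset.univ (fun j _ i => by
        simpa using galRel_regE hk hN hm hσ (j : ℕ) (i : ℕ)) a b
    rw [hmul]
    refine (h1.nat_inv_mul (N ^ k)).congr (key b h2) fun τ => ?_
    rw [key _ (by rwa [hdm])]
    push_cast
    rfl

end

/-! ### Finite adeles -/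

theorem adele_sub_apply (x y : Adele) (p : Nat.Primes) : (x - y) p = x p - y p := rfl
theorem adele_mul_apply (x y : Adele) (p : Nat.Primes) : (x * y) p = x p * y p := rfl
theorem adele_neg_apply (x : Adele) (p : Nat.Primes) : (-x) p = -x p := rfl
theorem ratAdele_apply (x : ℚ) (p : Nat.Primes) : ratAdele x p = (x : ℚ_[p]) := rfl

theorem InZhat.add {x y : Adele} (hx : InZhat x) (hy : InZhat y) : InZhat (x + y) := fun p =>
  (IsUltrametricDist.norm_add_le_max (x p) (y p)).trans (max_le (hx p) (hy p))

theorem InZhat.neg {x : Adele} (hx : InZhat x) : InZhat (-x) := fun p => by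
  rw [adele_neg_apply, norm_neg]; exact hx p

theorem InZhat.sub {x y : Adele} (hx : InZhat x) (hy : InZhat y) : InZhat (x - y) := by
  rw [sub_eq_add_neg]; exact hx.add hy.neg

theorem InZhat.mul {x y : Adele} (hx : InZhat x) (hy : InZhat y) : InZhat (x * y) := fun p => by
  rw [adele_mul_apply, norm_mul]; exact mul_le_one₀ (hx p) (norm_nonneg _) (hy p)

theorem inZhat_int (n : ℤ) : InZhat (ratAdele n) := fun p => by
  rw [ratAdele_apply, Rat.cast_intCast]
  exact Padic.norm_int_le_one n

theorem inZhat_zero : InZhat 0 := by simpa using inZhat_int 0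

theorem inZhat_one : InZhat 1 := by simpa using inZhat_int 1

theorem InZhat.sum {ι : Type*} {s : Finset ι} {f : ι → Adele} (h : ∀ i ∈ s, InZhat (f i)) :
    InZhat (∑ i ∈ s, f i) := by
  classical
  induction s using Finset.induction_on with
  | empty => simpa using inZhat_zero
  | insert i s hi ih =>
    rw [Finset.sum_insert hi]
    exact (h i (Finset.mem_insert_self i s)).add
      (ih fun j hj => h j (Finset.mem_insert_of_mem hj))

/-- A rational number is integral at all primes if and only if it is an integer. -/
theorem inZhat_ratAdele_iff (x : ℚ) : InZhat (ratAdele x) ↔ ∃ n : ℤ, x = n := by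
  constructor
  · intro h
    refine ⟨x.num, (Rat.den_eq_one_iff x).1 ?_ |>.symm⟩
    by_contra hd
    obtain ⟨p, hp, hpd⟩ := Nat.exists_prime_and_dvd hd
    have : Fact p.Prime := ⟨hp⟩
    have h1 : ‖(x : ℚ_[p])‖ ≤ 1 := h ⟨p, hp⟩
    have h2 : (x : ℚ_[p]) * ((x.den : ℤ) : ℚ_[p]) = (x.num : ℚ_[p]) := by
      exact_mod_cast congrArg (fun y : ℚ => (y : ℚ_[p])) (Rat.mul_den_eq_num x)
    have h3 : ‖(x.num : ℚ_[p])‖ < 1 := by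
      rw [← h2, norm_mul]
      refine mul_lt_one_of_nonneg_of_lt_one_right h1 (norm_nonneg _) ?_
      exact (Padic.norm_intCast_lt_one_iff).2 (by exact_mod_cast hpd)
    have h4 := (Padic.norm_intCast_lt_one_iff).1 h3
    exact hp.one_lt.ne' (Nat.dvd_one.1 (x.reduced ▸ Nat.dvd_gcd (Int.natCast_dvd.1 h4) hpd))
  · rintro ⟨n, rfl⟩
    exact inZhat_int n

theorem norm_sub_le_max_padic {p : Nat.Primes} (x y : ℚ_[p]) : ‖x - y‖ ≤ max ‖x‖ ‖y‖ := by
  rw [sub_eq_add_neg, ← norm_neg y]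
  exact IsUltrametricDist.norm_add_le_max x (-y)

/-- Partial fractions: an element of `ℚ_p` is congruent modulo `ℤ_p` to a rational number
that is integral at all other primes. -/
theorem exists_rat_padic (p : Nat.Primes) (x : ℚ_[p]) :
    ∃ r : ℚ, ‖x - r‖ ≤ 1 ∧ ∀ q : Nat.Primes, q ≠ p → ‖(r : ℚ_[q])‖ ≤ 1 := by
  have hp0 : (0 : ℝ) < ((p : ℕ) : ℝ) := by exact_mod_cast p.2.pos
  have hp0' : ((p : ℕ) : ℚ_[p]) ≠ 0 := by exact_mod_cast p.2.ne_zero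
  obtain ⟨e, he⟩ : ∃ e : ℕ, ‖((p : ℕ) : ℚ_[p]) ^ e * x‖ ≤ 1 := by
    obtain ⟨e, he⟩ := pow_unbounded_of_one_lt ‖x‖ (y := ((p : ℕ) : ℝ))
      (by exact_mod_cast p.2.one_lt)
    refine ⟨e, ?_⟩
    rw [norm_mul, norm_pow, Padic.norm_p, inv_pow, inv_mul_le_one₀ (by positivity)]
    exact he.le
  set y : ℤ_[p] := ⟨_, he⟩ with hy
  obtain ⟨z, hz⟩ := Ideal.mem_span_singleton.1 (PadicInt.appr_spec e y)
  have hz' : ((p : ℕ) : ℚ_[p]) ^ e * x - (y.appr e : ℚ_[p]) = ((p : ℕ) : ℚ_[p]) ^ e * (z : ℚ_[p]) := by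
    have := congrArg (fun w : ℤ_[p] => (w : ℚ_[p])) hz
    rw [PadicInt.coe_sub, PadicInt.coe_mul] at this
    simpa [hy] using this
  refine ⟨(y.appr e : ℚ) / ((p : ℕ) : ℚ) ^ e, ?_, fun q hq => ?_⟩
  · have : x - (((y.appr e : ℚ) / ((p : ℕ) : ℚ) ^ e : ℚ) : ℚ_[p]) = z := by
      push_cast
      field_simp
      linear_combination hz'
    rw [this]
    exact z.2
  · push_cast
    rw [norm_div, norm_pow, (Padic.norm_natCast_eq_one_iff (p := q)).2
      ((Nat.coprime_primes q.2 p.2).2 fun h => hq (Subtype.ext h)), one_pow, div_one]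
    exact_mod_cast Padic.norm_int_le_one (p := q) (y.appr e)

/-- Every finite adele is the sum of a rational number and an integral adele. -/
theorem exists_rat_add_inZhat (x : Adele) : ∃ a : ℚ, InZhat (x - ratAdele a) := by
  classical
  have hfin : {p : Nat.Primes | ¬ ‖x p‖ ≤ 1}.Finite := x.2
  choose r hr hr' using fun p : Nat.Primes => exists_rat_padic p (x p)
  refine ⟨∑ p ∈ hfin.toFinset, r p, fun q => ?_⟩
  have hsum : ∀ s : Finset Nat.Primes, q ∉ s → ‖((∑ p ∈ s, r p : ℚ) : ℚ_[q])‖ ≤ 1 := by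
    intro s hs
    rw [Rat.cast_sum]
    refine IsUltrametricDist.norm_sum_le_of_forall_le_of_nonneg zero_le_one fun p hp => ?_
    exact hr' p q fun h => hs (h ▸ hp)
  rw [adele_sub_apply, ratAdele_apply]
  by_cases hq : q ∈ hfin.toFinset
  · rw [← Finset.add_sum_erase _ _ hq, Rat.cast_add, ← sub_sub]
    refine (norm_sub_le_max_padic _ _).trans (max_le (hr q) (hsum _ ?_))
    exact Finset.notMem_erase q _
  · refine (norm_sub_le_max_padic _ _).trans (max_le ?_ (hsum _ hq))
    simpa using hq

/-- `x ∈ rẐ`. -/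
def MemMul (r : ℚ) (x : Adele) : Prop := InZhat (ratAdele r⁻¹ * x)

theorem MemMul.add {r : ℚ} {x y : Adele} (hx : MemMul r x) (hy : MemMul r y) :
    MemMul r (x + y) := by
  unfold MemMul; rw [mul_add]; exact InZhat.add hx hy

theorem MemMul.neg {r : ℚ} {x : Adele} (hx : MemMul r x) : MemMul r (-x) := by
  unfold MemMul; rw [mul_neg]; exact InZhat.neg hx

theorem MemMul.sub {r : ℚ} {x y : Adele} (hx : MemMul r x) (hy : MemMul r y) :
    MemMul r (x - y) := by
  rw [sub_eq_add_neg]; exact hx.add hy.neg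

theorem MemMul.mul {r : ℚ} {x y : Adele} (hx : MemMul r x) (hy : InZhat y) :
    MemMul r (x * y) := by
  unfold MemMul; rw [← mul_assoc]; exact InZhat.mul hx hy

theorem memMul_zero (r : ℚ) : MemMul r 0 := by
  unfold MemMul; rw [mul_zero]; exact inZhat_zero

theorem memMul_one_iff {x : Adele} : MemMul 1 x ↔ InZhat x := by simp [MemMul]

theorem ratAdele_mul_cancel {r : ℚ} (hr : r ≠ 0) (x : Adele) :
    ratAdele r⁻¹ * (ratAdele r * x) = x := by
  rw [← mul_assoc, ← map_mul, inv_mul_cancel₀ hr, map_one, one_mul]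

theorem memMul_iff {r : ℚ} (hr : r ≠ 0) {x : Adele} :
    MemMul r x ↔ ∃ t, InZhat t ∧ x = ratAdele r * t := by
  constructor
  · intro h
    refine ⟨_, h, ?_⟩
    have := ratAdele_mul_cancel (inv_ne_zero hr) x
    rw [inv_inv] at this
    exact this.symm
  · rintro ⟨t, ht, rfl⟩
    unfold MemMul
    rwa [ratAdele_mul_cancel hr]

theorem memMul_sub_iff {r : ℚ} (hr : r ≠ 0) {x y : Adele} :
    MemMul r (x - y) ↔ ∃ t, InZhat t ∧ x = y + ratAdele r * t := by
  rw [memMul_iff hr]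
  simp only [sub_eq_iff_eq_add']

theorem memMul_mul_iff {r s : ℚ} (hs : s ≠ 0) {x : Adele} :
    MemMul (s * r) (ratAdele s * x) ↔ MemMul r x := by
  unfold MemMul
  rw [← mul_assoc, ← map_mul, mul_inv, mul_comm s⁻¹, mul_assoc, inv_mul_cancel₀ hs, mul_one]

theorem MemMul.of_int_mul {r : ℚ} {n : ℤ} (hn : n ≠ 0) {x : Adele} (h : MemMul (r * n) x) :
    MemMul r x := by
  have hn' : (n : ℚ) ≠ 0 := by exact_mod_cast hn
  have := InZhat.mul (inZhat_int n) h
  unfold MemMul at *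
  rwa [← mul_assoc, ← map_mul, mul_inv, mul_comm r⁻¹, ← mul_assoc, mul_inv_cancel₀ hn',
    one_mul] at this

theorem memMul_rat_iff {r : ℚ} (hr : r ≠ 0) (x : ℚ) :
    MemMul r (ratAdele x) ↔ ∃ n : ℤ, x = r * n := by
  unfold MemMul
  rw [← map_mul, inZhat_ratAdele_iff]
  simp only [inv_mul_eq_iff_eq_mul₀ hr]

theorem memMul_neg_left {r : ℚ} {x : Adele} : MemMul (-r) x ↔ MemMul r x := by
  unfold MemMul
  rw [inv_neg, map_neg, neg_mul]
  exact ⟨fun h => by simpa using h.neg, fun h => h.neg⟩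

theorem exists_rat_memMul {r : ℚ} (hr : r ≠ 0) (x : Adele) :
    ∃ a : ℚ, MemMul r (x - ratAdele a) := by
  obtain ⟨a, ha⟩ := exists_rat_add_inZhat (ratAdele r⁻¹ * x)
  refine ⟨r * a, ?_⟩
  unfold MemMul
  rwa [mul_sub, map_mul, ratAdele_mul_cancel hr]

/-- An integral adele is congruent to a natural number modulo any `N ≥ 1`. -/
theorem InZhat.exists_nat {x : Adele} (hx : InZhat x) {N : ℕ} (hN : 1 ≤ N) :
    ∃ n : ℕ, n < N ∧ MemMul N (x - ratAdele n) := by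
  have hN0 : (N : ℚ) ≠ 0 := by exact_mod_cast (by omega : N ≠ 0)
  obtain ⟨a, ha⟩ := exists_rat_memMul hN0 x
  obtain ⟨t, ht, h⟩ := (memMul_sub_iff hN0).1 ha
  have : InZhat (ratAdele a) := by
    rw [eq_sub_of_add_eq h.symm]
    exact hx.sub (InZhat.mul (by exact_mod_cast inZhat_int N) ht)
  obtain ⟨m, rfl⟩ := (inZhat_ratAdele_iff a).1 this
  have hm := Int.emod_nonneg m (by omega : (N : ℤ) ≠ 0)
  refine ⟨(m % N).toNat, by have := Int.emod_lt_of_pos m (by omega : (0 : ℤ) < N); omega, ?_⟩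
  have h1 : MemMul N (ratAdele ((m : ℚ) - ((m % N).toNat : ℚ))) := by
    refine (memMul_rat_iff hN0 _).2 ⟨m / N, ?_⟩
    have h2 : ((m % N).toNat : ℤ) = m % N := Int.toNat_of_nonneg hm
    have h3 : (((m % N).toNat : ℤ) : ℚ) = ((m % N : ℤ) : ℚ) := by rw [h2]
    have h4 : ((N * (m / N) + m % N : ℤ) : ℚ) = (m : ℚ) := by rw [Int.mul_ediv_add_emod]
    push_cast at h3 h4
    rw [h3]
    linear_combination -h4
  have := ha.add h1
  rwa [map_sub, sub_add_sub_cancel] at this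

theorem isOpen_memMul (r : ℚ) : IsOpen {x : Adele | MemMul r x} :=
  isOpen_integral.preimage (by fun_prop : Continuous fun x : Adele => ratAdele r⁻¹ * x)

theorem isCompact_memMul {r : ℚ} (hr : r ≠ 0) : IsCompact {x : Adele | MemMul r x} := by
  convert isCompact_integral.image (affine 0 r hr).continuous using 1
  ext x
  change MemMul r x ↔ ∃ t, InZhat t ∧ ratAdele 0 + ratAdele r * t = x
  rw [memMul_iff hr]
  simp only [map_zero, zero_add, eq_comm]

theorem eq_zero_of_forall_memMul {x : Adele} (h : ∀ N : ℕ, 1 ≤ N → MemMul N x) : x = 0 := by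
  ext p
  change x p = 0
  by_contra hx
  have hp1 : (1 : ℝ) < ((p : ℕ) : ℝ) := by exact_mod_cast p.2.one_lt
  obtain ⟨e, he⟩ := pow_unbounded_of_one_lt ‖x p‖⁻¹ hp1
  have h1 := h ((p : ℕ) ^ e) (Nat.one_le_pow _ _ p.2.pos) p
  rw [adele_mul_apply, ratAdele_apply, norm_mul] at h1
  push_cast at h1
  rw [norm_inv, norm_pow, Padic.norm_p, inv_pow, inv_inv] at h1
  have h2 : 0 < ‖x p‖ := norm_pos_iff.2 hx
  rw [inv_lt_iff_one_lt_mul₀ h2] at he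
  rw [mul_comm] at h1
  linarith

/-- The subgroups `NẐ²` form a basis of neighbourhoods of `0` in `X`. -/
theorem exists_memMul_subset_nhds {U : Set X} (hU : U ∈ 𝓝 (0 : X)) :
    ∃ N : ℕ, 1 ≤ N ∧ ∀ y : X, (∀ i, MemMul N (y i)) → y ∈ U := by
  have hcast : ∀ N : ℕ+, ((N : ℕ) : ℚ) ≠ 0 := fun N => by exact_mod_cast N.ne_zero
  let V : ℕ+ → Set X := fun N => Set.pi Set.univ fun _ => {x | MemMul (N : ℕ) x}
  have hVc : ∀ N, IsCompact (V N) := fun N => isCompact_univ_pi fun _ => isCompact_memMul (hcast N)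
  have hmono : ∀ N M, V (N * M) ⊆ V N := by
    intro N M x hx i hi
    refine MemMul.of_int_mul (n := (M : ℕ)) (by exact_mod_cast M.ne_zero) ?_
    have := hx i hi
    simpa using this
  have hdir : Directed (· ⊇ ·) V := fun N M =>
    ⟨N * M, hmono N M, by rw [mul_comm]; exact hmono M N⟩
  obtain ⟨N, hN⟩ := exists_subset_nhds_of_isCompact' hdir hVc (fun N => (hVc N).isClosed)
    (U := U) (by
      intro x hx
      have : x = 0 := by
        funext i
        refine eq_zero_of_forall_memMul fun N hN => ?_
        exact Set.mem_iInter.1 hx ⟨N, hN⟩ i (Set.mem_univ i)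
      rw [this]; exact hU)
  exact ⟨N, N.2, fun y hy => hN fun i _ => hy i⟩

/-! ### Test functions as combinations of indicators of boxes -/

theorem mem_box_iff {a b r : ℚ} (hr : r ≠ 0) {x : X} :
    x ∈ box a b r ↔ MemMul r (x 0 - ratAdele a) ∧ MemMul r (x 1 - ratAdele b) := by
  rw [memMul_sub_iff hr, memMul_sub_iff hr]
  rfl

open Classical in
theorem boxIndicator_apply {a b r : ℚ} (hr : r ≠ 0) (x : X) :
    boxIndicator a b r hr x =
      if MemMul r (x 0 - ratAdele a) ∧ MemMul r (x 1 - ratAdele b) then 1 else 0 := by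
  change (LocallyConstant.charFn ℤ (isClopen_box a b r hr)) x = _
  rw [LocallyConstant.coe_charFn, Set.indicator_apply, Pi.one_apply]
  exact if_congr (mem_box_iff hr) rfl rfl

theorem LCc.ext {φ ψ : LCc} (h : ∀ x, φ x = ψ x) : φ = ψ :=
  Subtype.ext (LocallyConstant.ext h)

theorem LCc.add_apply (φ ψ : LCc) (x : X) : (φ + ψ) x = φ x + ψ x := rfl

theorem LCc.smul_apply (c : ℤ) (φ : LCc) (x : X) : (c • φ) x = c * φ x := rfl

theorem LCc.sum_apply {ι : Type*} (s : Finset ι) (f : ι → LCc) (x : X) :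
    (∑ i ∈ s, f i) x = ∑ i ∈ s, f i x := by
  classical
  induction s using Finset.induction_on with
  | empty => rfl
  | insert i s hi ih => rw [Finset.sum_insert hi, Finset.sum_insert hi, LCc.add_apply, ih]

theorem LCc.act_apply (φ : LCc) (γ : GL (Fin 2) Adele) (x : X) :
    LCc.act φ γ x = φ (Matrix.vecMul x ((γ⁻¹ : GL (Fin 2) Adele) : Matrix (Fin 2) (Fin 2) Adele)) :=
  rfl

/-- A compact subset of `X` lies in `M⁻¹Ẑ²` for some `M ≥ 1`. -/
theorem exists_denominator {K : Set X} (hK : IsCompact K) :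
    ∃ M : ℕ, 1 ≤ M ∧ ∀ x ∈ K, ∀ i, InZhat (ratAdele M * x i) := by
  refine hK.induction_on (p := fun K => ∃ M : ℕ, 1 ≤ M ∧ ∀ x ∈ K, ∀ i, InZhat (ratAdele M * x i))
    ⟨1, le_rfl, by simp⟩ ?_ ?_ ?_
  · rintro s t hst ⟨M, hM, h⟩
    exact ⟨M, hM, fun x hx => h x (hst hx)⟩
  · rintro s t ⟨M, hM, h⟩ ⟨M', hM', h'⟩
    refine ⟨M * M', Nat.mul_pos hM hM', ?_⟩
    have hI : ∀ n : ℕ, InZhat (ratAdele n) := fun n => by exact_mod_cast inZhat_int n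
    rintro x (hx | hx) i
    · rw [Nat.cast_mul, map_mul, mul_comm (ratAdele _), mul_assoc]
      exact (hI _).mul (h x hx i)
    · rw [Nat.cast_mul, map_mul, mul_assoc]
      exact (hI _).mul (h' x hx i)
  · intro x _
    choose a ha using fun i => exists_rat_add_inZhat (x i)
    have hI : ∀ n : ℕ, InZhat (ratAdele n) := fun n => by exact_mod_cast inZhat_int n
    have hd : ∀ q : ℚ, ratAdele q.den * ratAdele q = ratAdele q.num := fun q => by
      rw [← map_mul, Rat.den_mul_eq_num]
    refine ⟨{y | ∀ i, InZhat (ratAdele ((a 0).den * (a 1).den : ℕ) * y i)},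
      mem_nhdsWithin_of_mem_nhds (IsOpen.mem_nhds ?_ ?_), (a 0).den * (a 1).den,
      Nat.mul_pos (a 0).den_pos (a 1).den_pos, fun y hy => hy⟩
    · rw [Set.ofPred_forall]
      exact isOpen_iInter_of_finite fun i => isOpen_integral.preimage
        (by fun_prop : Continuous fun y : X => ratAdele ((a 0).den * (a 1).den : ℕ) * y i)
    · rw [Set.mem_ofPred_eq, Fin.forall_fin_two]
      constructor
      · have h := ((hI ((a 0).den * (a 1).den)).mul (ha 0)).add
          ((hI (a 1).den).mul (inZhat_int (a 0).num))
        rw [← hd] at h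
        convert h using 1
        push_cast
        rw [map_mul]
        ring
      · have h := ((hI ((a 0).den * (a 1).den)).mul (ha 1)).add
          ((hI (a 0).den).mul (inZhat_int (a 1).num))
        rw [← hd] at h
        convert h using 1
        push_cast
        rw [map_mul]
        ring

/-- A function in `LC_c(X, ℤ)` is supported in `M⁻¹Ẑ²` and invariant under translation
by `NẐ²`, for some `M, N ≥ 1`. -/
theorem LCc.exists_support_period (φ : LCc) : ∃ M N : ℕ, 1 ≤ M ∧ 1 ≤ N ∧
    (∀ x : X, φ x ≠ 0 → ∀ i, InZhat (ratAdele M * x i)) ∧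
    ∀ x y : X, (∀ i, MemMul N (y i - x i)) → φ y = φ x := by
  obtain ⟨M, hM, hsupp⟩ := exists_denominator φ.2.isCompact
  have hsupp' : ∀ x : X, φ x ≠ 0 → ∀ i, InZhat (ratAdele M * x i) := fun x hx =>
    hsupp x (subset_tsupport _ hx)
  have hM0 : (M : ℚ) ≠ 0 := by exact_mod_cast (by omega : M ≠ 0)
  have hI : ∀ n : ℕ, InZhat (ratAdele n) := fun n => by exact_mod_cast inZhat_int n
  have hmem : ∀ (N : ℕ) (x : Adele), 1 ≤ N → MemMul N x → InZhat x := fun N x hN hx => by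
    obtain ⟨t, ht, rfl⟩ := (memMul_iff (by exact_mod_cast (by omega : N ≠ 0) : (N : ℚ) ≠ 0)).1 hx
    exact (hI N).mul ht
  let B : Set X := Set.pi Set.univ fun _ => {x | MemMul (M : ℚ)⁻¹ x}
  have hB : IsCompact B := isCompact_univ_pi fun _ => isCompact_memMul (inv_ne_zero hM0)
  have hBiff : ∀ x, x ∈ B ↔ ∀ i, InZhat (ratAdele M * x i) := fun x => by
    simp [B, MemMul]
  -- a period that is uniform on the compact set `B = M⁻¹Ẑ²`
  obtain ⟨N, hN, hper⟩ : ∃ N : ℕ, 1 ≤ N ∧ ∀ x ∈ B, ∀ y : X, (∀ i, MemMul N (y i - x i)) →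
      φ y = φ x := by
    refine hB.induction_on (p := fun B => ∃ N : ℕ, 1 ≤ N ∧ ∀ x ∈ B, ∀ y : X,
      (∀ i, MemMul N (y i - x i)) → φ y = φ x) ⟨1, le_rfl, by simp⟩ ?_ ?_ ?_
    · rintro s t hst ⟨N, hN, h⟩
      exact ⟨N, hN, fun x hx => h x (hst hx)⟩
    · rintro s t ⟨N, hN, h⟩ ⟨N', hN', h'⟩
      refine ⟨N * N', Nat.mul_pos hN hN', ?_⟩
      rintro x (hx | hx) y hy
      · refine h x hx y fun i => MemMul.of_int_mul (n := N')
          (by exact_mod_cast (by omega : N' ≠ 0)) ?_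
        simpa using hy i
      · refine h' x hx y fun i => MemMul.of_int_mul (n := N)
          (by exact_mod_cast (by omega : N ≠ 0)) ?_
        simpa [mul_comm] using hy i
    · intro x _
      have hU : {y : X | φ (x + y) = φ x} ∈ 𝓝 (0 : X) := by
        refine IsOpen.mem_nhds ?_ (by simp)
        exact (φ.1.isLocallyConstant.isOpen_fiber (φ x)).preimage
          (by fun_prop : Continuous fun y : X => x + y)
      obtain ⟨N, hN, h⟩ := exists_memMul_subset_nhds hU
      have h2 : ∀ y : X, (∀ i, MemMul N (y i - x i)) → φ y = φ x := fun y hy => by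
        have := h (y - x) hy
        simpa using this
      refine ⟨{y | ∀ i, MemMul N (y i - x i)},
        mem_nhdsWithin_of_mem_nhds (IsOpen.mem_nhds ?_ fun i => ?_), N, hN, fun y hy z hz => ?_⟩
      · rw [Set.ofPred_forall]
        exact isOpen_iInter_of_finite fun i => (isOpen_memMul N).preimage
          (by fun_prop : Continuous fun y : X => y i - x i)
      · rw [sub_self]; exact memMul_zero _
      · rw [h2 y hy, h2 z fun i => ?_]
        have := (hz i).add (hy i)
        rwa [sub_add_sub_cancel] at this
  refine ⟨M, N, hM, hN, hsupp', fun x y hy => ?_⟩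
  by_cases hx : φ x = 0
  · rw [hx]
    by_contra hy0
    have hy' := (hBiff y).2 (hsupp' y hy0)
    refine hy0 ((hper y hy' x fun i => ?_).symm.trans hx)
    rw [← neg_sub]
    exact (hy i).neg
  · exact hper x ((hBiff x).2 (hsupp' x hx)) y hy

/-- Every `φ ∈ LC_c(X, ℤ)` is a combination of characteristic functions of boxes. -/
theorem LCc.eq_sum_boxIndicator (φ : LCc) : ∃ (M N : ℕ) (hN : (N : ℚ) ≠ 0), φ =
    ∑ i ∈ Finset.range (M * N), ∑ j ∈ Finset.range (M * N),
      φ ![ratAdele (i / M), ratAdele (j / M)] • boxIndicator (i / M) (j / M) N hN := by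
  classical
  obtain ⟨M, N, hM, hN, hsupp, hper⟩ := LCc.exists_support_period φ
  have hM0 : (M : ℚ) ≠ 0 := by exact_mod_cast (by omega : M ≠ 0)
  have hN0 : (N : ℚ) ≠ 0 := by exact_mod_cast (by omega : N ≠ 0)
  refine ⟨M, N, hN0, LCc.ext fun x => ?_⟩
  simp only [LCc.sum_apply, LCc.smul_apply, boxIndicator_apply]
  have hmul : ∀ (y : Adele) (i : ℕ), MemMul N (y - ratAdele (i / M)) ↔
      MemMul (M * N : ℕ) (ratAdele M * y - ratAdele i) := fun y i => by
    rw [← memMul_mul_iff hM0, mul_sub, ← map_mul, mul_div_cancel₀ _ hM0, Nat.cast_mul]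
  by_cases hx : ∀ i, InZhat (ratAdele M * x i)
  · obtain ⟨i, hi, hi'⟩ := (hx 0).exists_nat (Nat.mul_pos hM hN)
    obtain ⟨j, hj, hj'⟩ := (hx 1).exists_nat (Nat.mul_pos hM hN)
    have huniq : ∀ (y : Adele) (i i' : ℕ), i < M * N → i' < M * N →
        MemMul (M * N : ℕ) (y - ratAdele i) → MemMul (M * N : ℕ) (y - ratAdele i') →
        i = i' := by
      intro y i i' hi hi' h h'
      have := h.sub h'
      rw [sub_sub_sub_cancel_left, ← map_sub, memMul_rat_iff (by positivity)] at this
      obtain ⟨n, hn⟩ := this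
      have hn' : (i' : ℤ) - i = (M * N : ℕ) * n := by exact_mod_cast hn
      have h1 : |(i' : ℤ) - i| < (M * N : ℕ) := by rw [abs_lt]; constructor <;> omega
      have h2 := Int.eq_zero_of_abs_lt_dvd ⟨n, hn'⟩ h1
      omega
    rw [Finset.sum_eq_single i, Finset.sum_eq_single j]
    · rw [if_pos ⟨(hmul _ _).2 hi', (hmul _ _).2 hj'⟩, mul_one]
      refine hper _ _ ?_
      rw [Fin.forall_fin_two]
      exact ⟨(hmul _ _).2 hi', (hmul _ _).2 hj'⟩
    · intro j' hj1 hne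
      rw [if_neg, mul_zero]
      rintro ⟨_, h⟩
      exact hne (huniq _ _ _ (Finset.mem_range.1 hj1) hj ((hmul _ _).1 h) hj')
    · intro h; exact absurd (Finset.mem_range.2 hj) h
    · intro i' hi1 hne
      refine Finset.sum_eq_zero fun j' _ => ?_
      rw [if_neg, mul_zero]
      rintro ⟨h, _⟩
      exact hne (huniq _ _ _ (Finset.mem_range.1 hi1) hi ((hmul _ _).1 h) hi')
    · intro h; exact absurd (Finset.mem_range.2 hi) h
  · have h0 : φ x = 0 := by
      by_contra h
      exact hx (hsupp x h)
    rw [h0]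
    symm
    refine Finset.sum_eq_zero fun i _ => Finset.sum_eq_zero fun j _ => ?_
    rw [if_neg, mul_zero]
    rintro ⟨h, h'⟩
    have key : ∀ (y : Adele) (i : ℕ), MemMul N (y - ratAdele (i / M)) →
        InZhat (ratAdele M * y) := fun y i hy => by
      obtain ⟨t, ht, hy'⟩ := (memMul_sub_iff (by exact_mod_cast (Nat.mul_pos hM hN).ne')).1
        ((hmul y i).1 hy)
      rw [hy']
      exact InZhat.add (by exact_mod_cast inZhat_int i)
        (InZhat.mul (by exact_mod_cast inZhat_int (M * N : ℕ)) ht)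
    exact hx (Fin.forall_fin_two.2 ⟨key _ _ h, key _ _ h'⟩)

/-- The characteristic functions of boxes generate `LC_c(X, ℤ)`. -/
theorem LCc.induction_on {P : LCc → Prop} (φ : LCc)
    (hbox : ∀ (a b r : ℚ) (hr : r ≠ 0), P (boxIndicator a b r hr))
    (hadd : ∀ φ ψ, P φ → P ψ → P (φ + ψ)) (hsmul : ∀ (c : ℤ) φ, P φ → P (c • φ)) : P φ := by
  have h0 : P 0 := by
    have := hsmul 0 _ (hbox 0 0 1 one_ne_zero)
    rwa [zero_smul] at this
  have hsum : ∀ (s : Finset ℕ) (f : ℕ → LCc), (∀ i, P (f i)) → P (∑ i ∈ s, f i) := by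
    intro s f hf
    induction s using Finset.induction_on with
    | empty => exact h0
    | insert i s hi ih => rw [Finset.sum_insert hi]; exact hadd _ _ (hf i) ih
  obtain ⟨M, N, hN, h⟩ := LCc.eq_sum_boxIndicator φ
  rw [h]
  exact hsum _ _ fun i => hsum _ _ fun j => hsmul _ _ (hbox _ _ _ _)

/-! ### Functions with a `q`-expansion -/

section

open Manifold

theorem HasQExp.hasSum_qParam {N : ℕ} (hN : 1 ≤ N) {a : ℕ → ℂ} {f : ℍ → ℂ} (h : HasQExp N a f)
    (τ : ℍ) : HasSum (fun n => a n • Function.Periodic.qParam N τ ^ n) (f τ) := by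
  refine (h τ).congr_fun fun n => ?_
  have hN0 : (N : ℂ) ≠ 0 := by exact_mod_cast (by omega : N ≠ 0)
  rw [smul_eq_mul, Function.Periodic.qParam, ← Complex.exp_nat_mul]
  congr 2
  push_cast
  field_simp

/-- Every `q ≠ 0` in the unit disc comes from a point of the upper half plane. -/
theorem HasQExp.hasSum_of_norm_lt_one {N : ℕ} (hN : 1 ≤ N) {a : ℕ → ℂ} {f : ℍ → ℂ}
    (h : HasQExp N a f) {q : ℂ} (hq : ‖q‖ < 1) (hq0 : q ≠ 0) : ∃ τ : ℍ,
      Function.Periodic.qParam N τ = q ∧ HasSum (fun n => a n * q ^ n) (f τ) := by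
  have hN0 : (0 : ℝ) < N := by exact_mod_cast hN
  refine ⟨⟨Function.Periodic.invQParam N q,
    Function.Periodic.im_invQParam_pos_of_norm_lt_one hN0 hq hq0⟩, ?_, ?_⟩
  · exact Function.Periodic.qParam_right_inv hN0.ne' hq0
  · have := h.hasSum_qParam hN ⟨Function.Periodic.invQParam N q,
      Function.Periodic.im_invQParam_pos_of_norm_lt_one hN0 hq hq0⟩
    rw [UpperHalfPlane.coe_mk, Function.Periodic.qParam_right_inv hN0.ne' hq0] at this
    exact this

theorem HasQExp.hasFPowerSeriesOnBall {N : ℕ} (hN : 1 ≤ N) {a : ℕ → ℂ} {f : ℍ → ℂ}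
    (h : HasQExp N a f) :
    HasFPowerSeriesOnBall (fun q => ∑' n, a n * q ^ n) (.ofScalars ℂ a) 0 1 := by
  have hs : ∀ q : ℂ, ‖q‖ < 1 → Summable fun n => a n * q ^ n := fun q hq => by
    rcases eq_or_ne q 0 with rfl | hq0
    · refine summable_of_ne_finset_zero (s := {0}) fun n hn => ?_
      rw [zero_pow (by simpa using hn), mul_zero]
    · obtain ⟨τ, -, h⟩ := h.hasSum_of_norm_lt_one hN hq hq0
      exact h.summable
  constructor
  · refine le_of_forall_lt_imp_le_of_dense fun r hr => ?_
    lift r to NNReal using hr.ne_top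
    apply FormalMultilinearSeries.le_radius_of_summable
    have := (hs (r : ℝ) (by simpa using hr)).norm
    simpa using this
  · simp
  · intro y hy
    rw [← ENNReal.coe_one, Metric.eball_coe, NNReal.coe_one, mem_ball_zero_iff] at hy
    simpa [mul_comm] using (hs y hy).hasSum

/-- A function with a `q`-expansion is holomorphic. -/
theorem HasQExp.mdifferentiable {N : ℕ} (hN : 1 ≤ N) {a : ℕ → ℂ} {f : ℍ → ℂ}
    (h : HasQExp N a f) : MDiff f := by
  have hN0 : (0 : ℝ) < N := by exact_mod_cast hN
  rw [UpperHalfPlane.mdifferentiable_iff]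
  have hd := (h.hasFPowerSeriesOnBall hN).differentiableOn
  rw [← ENNReal.coe_one, Metric.eball_coe, NNReal.coe_one] at hd
  refine ((hd.comp (Function.Periodic.differentiable_qParam (h := N)).differentiableOn
    (s := {z | 0 < z.im}) fun z hz => ?_)).congr fun z hz => ?_
  · rw [mem_ball_zero_iff]
    exact Function.Periodic.norm_qParam_lt_one hN0 hz
  · rw [Function.comp_apply, Function.comp_apply, UpperHalfPlane.ofComplex_apply_of_im_pos hz]
    exact (h.hasSum_qParam hN ⟨z, hz⟩).tsum_eq.symm

theorem HasQExp.isBoundedAtImInfty {N : ℕ} (hN : 1 ≤ N) {a : ℕ → ℂ} {f : ℍ → ℂ}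
    (h : HasQExp N a f) : IsBoundedAtImInfty f :=
  UpperHalfPlane.isBoundedAtImInfty_of_hasSum_qExpansion (by exact_mod_cast hN)
    (h.hasSum_qParam hN)

theorem HasQExp.sub {N : ℕ} {a b : ℕ → ℂ} {f g : ℍ → ℂ} (hf : HasQExp N a f)
    (hg : HasQExp N b g) : HasQExp N (a - b) (f - g) := fun τ => by
  refine ((hf τ).sub (hg τ)).congr_fun fun n => ?_
  rw [Pi.sub_apply, sub_mul]

theorem HasQExp.unique {N : ℕ} (hN : 1 ≤ N) {a b : ℕ → ℂ} {f : ℍ → ℂ} (ha : HasQExp N a f)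
    (hb : HasQExp N b f) : a = b := by
  have h := ha.sub hb
  rw [sub_self] at h
  have hF := (h.hasFPowerSeriesOnBall hN).hasFPowerSeriesAt
  have h0 : (fun q : ℂ => ∑' n, (a - b) n * q ^ n) =ᶠ[𝓝[≠] 0] fun _ => (0 : ℂ) := by
    filter_upwards [self_mem_nhdsWithin, mem_nhdsWithin_of_mem_nhds
      (Metric.ball_mem_nhds (0 : ℂ) one_pos)] with q hq hq1
    obtain ⟨τ, -, hs⟩ := h.hasSum_of_norm_lt_one hN (mem_ball_zero_iff.1 hq1) hq
    exact hs.tsum_eq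
  have h1 := (hF.continuousAt.eventuallyEq_nhds_iff_eventuallyEq_nhdsNE continuousAt_const).1 h0
  have h2 := (hF.congr h1).eq_zero
  have h3 : a - b = 0 := (FormalMultilinearSeries.ofScalars_series_eq_zero ℂ).1 h2
  funext n
  exact sub_eq_zero.1 (congrFun h3 n)

/-- A relation of `σ`-conjugacy determines the conjugate function. -/
theorem GalRel.eq_of_hasQExp {σ : Qcycl ≃ₐ[ℚ] Qcycl} {f f' f'' : ℍ → ℂ} (h : GalRel σ f f')
    {N : ℕ} (hN : 1 ≤ N) {a : ℕ → Qcycl} (ha : HasQExp N (fun n => (a n : ℂ)) f)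
    (ha' : HasQExp N (fun n => (σ (a n) : ℂ)) f'') : f'' = f' := by
  obtain ⟨M, b, hM, hb, hb'⟩ := h
  have h1 := ha.mul_level hN hM
  have h2 := hb.mul_level hM hN
  have h1' := ha'.mul_level hN hM
  have h2' := hb'.mul_level hM hN
  rw [mul_comm M N] at h2 h2'
  have key := h1.unique (Nat.mul_pos hN hM) h2
  funext τ
  refine (h1' τ).unique ((h2' τ).congr_fun fun n => ?_)
  have hn := congrFun key n
  dsimp only at hn ⊢
  have hn' := congrArg σ (Subtype.ext hn :
    (if M ∣ n then a (n / M) else 0) = if N ∣ n then b (n / N) else 0)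
  rw [apply_ite σ, apply_ite σ, map_zero] at hn'
  rw [hn']

theorem GalRel.hasCyclCoeffs {σ : Qcycl ≃ₐ[ℚ] Qcycl} {f f' : ℍ → ℂ} (h : GalRel σ f f') :
    HasCyclCoeffs f := by
  obtain ⟨N, a, hN, ha, -⟩ := h
  exact ⟨N, a, hN, ha⟩

/-- A function invariant under `Γ_N` all of whose transforms under `SL₂(ℤ)` have `q`-expansions
is a modular form. -/
theorem isCongModularForm_of_slash {k N : ℕ} (hN : 1 ≤ N) {f : ℍ → ℂ}
    (hinv : ∀ γ ∈ CongruenceSubgroup.Gamma N, f ∣[(k : ℤ)] γ = f)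
    (hq : ∀ γ : SL(2, ℤ), HasCyclCoeffs (f ∣[(k : ℤ)] γ)) : IsCongModularForm k f := by
  have hN0 : N ≠ 0 := by omega
  have hne : NeZero N := ⟨hN0⟩
  have hfin := (CongruenceSubgroup.Gamma_is_cong_sub N).finiteIndex
  refine ⟨CongruenceSubgroup.Gamma N, ⟨N, hN0, le_rfl⟩,
    { toFun := f
      slash_action_eq' := ?_
      holo' := ?_
      bdd_at_cusps' := ?_ }, rfl⟩
  · rintro _ ⟨γ, hγ, rfl⟩
    exact hinv γ hγ
  · obtain ⟨M, a, hM, ha⟩ := hq 1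
    rw [SlashAction.slash_one] at ha
    exact ha.mdifferentiable hM
  · intro c hc
    rw [OnePoint.isBoundedAt_iff_forall_SL2Z
      ((Subgroup.IsArithmetic.isCusp_iff_isCusp_SL2Z _).1 hc)]
    intro γ _
    obtain ⟨M, a, hM, ha⟩ := hq γ
    exact ha.isBoundedAtImInfty hM

end

/-! ### Strong approximation for `SL₂` -/

/-- A class that is prime to `gcd(N, c)` has a representative modulo `N` prime to `c`. -/
theorem exists_coprime_modEq {c e N : ℕ} (hc : 1 ≤ c) (h : e.Coprime (Nat.gcd N c)) :
    ∃ e' : ℤ, (N : ℤ) ∣ e' - e ∧ IsCoprime (c : ℤ) e' := by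
  have hne : NeZero c := ⟨by omega⟩
  obtain ⟨y, hy⟩ := ZMod.unitsMap_surjective (Nat.gcd_dvd_right N c) (ZMod.unitOfCoprime e h)
  have hcop := ZMod.val_coe_unit_coprime y
  have h1 : (((y : ZMod c).val : ℤ) : ZMod (Nat.gcd N c)) = ((e : ℤ) : ZMod (Nat.gcd N c)) := by
    have := congrArg (fun u : (ZMod (Nat.gcd N c))ˣ => (u : ZMod (Nat.gcd N c))) hy
    simp only [ZMod.unitsMap_def, Units.coe_map, ZMod.coe_unitOfCoprime] at this
    rw [Int.cast_natCast, Int.cast_natCast, ← this, ZMod.natCast_val]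
    rfl
  rw [ZMod.intCast_eq_intCast_iff_dvd_sub] at h1
  obtain ⟨m, hm⟩ := h1
  rw [Nat.gcd_eq_gcd_ab] at hm
  refine ⟨e - N * Nat.gcdA N c * m, ⟨-(Nat.gcdA N c * m), by ring⟩, ?_⟩
  have h2 : (e : ℤ) - N * Nat.gcdA N c * m = (y : ZMod c).val + c * (Nat.gcdB N c * m) := by
    linear_combination hm
  rw [h2]
  refine IsCoprime.add_mul_left_right ?_ _
  exact (Nat.isCoprime_iff_coprime.2 hcop).symm

/-- `SL₂(ℤ)` surjects onto `SL₂(ℤ/N)`. -/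
theorem exists_SL2_modEq {N : ℕ} (a b c e : ℕ) (hN : 1 ≤ N) (h : (N : ℤ) ∣ a * e - b * c - 1) :
    ∃ s : SL(2, ℤ), (N : ℤ) ∣ s 0 0 - a ∧ (N : ℤ) ∣ s 0 1 - b ∧ (N : ℤ) ∣ s 1 0 - c ∧
      (N : ℤ) ∣ s 1 1 - e := by
  have hcop : e.Coprime (Nat.gcd N (c + N)) := by
    have h1 : (Nat.gcd e (Nat.gcd N (c + N)) : ℤ) ∣ 1 := by
      have hN' : (Nat.gcd e (Nat.gcd N (c + N)) : ℤ) ∣ N := by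
        exact_mod_cast (Nat.gcd_dvd_right _ _).trans (Nat.gcd_dvd_left _ _)
      have he : (Nat.gcd e (Nat.gcd N (c + N)) : ℤ) ∣ e := by
        exact_mod_cast Nat.gcd_dvd_left _ _
      have hc : (Nat.gcd e (Nat.gcd N (c + N)) : ℤ) ∣ c + N := by
        exact_mod_cast (Nat.gcd_dvd_right _ _).trans (Nat.gcd_dvd_right _ _)
      have hc' := (dvd_add_left hN').1 hc
      have := dvd_sub (dvd_sub (he.mul_left a) (hc'.mul_left b)) (hN'.trans h)
      rwa [sub_sub_cancel] at this
    exact Nat.dvd_one.1 (by exact_mod_cast h1)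
  obtain ⟨e', he', hce⟩ := exists_coprime_modEq (by omega : 1 ≤ c + N) hcop
  obtain ⟨g, hg0, hg1⟩ := IsCoprime.exists_SL2_row hce 1
  have hdet := g.2
  rw [Matrix.det_fin_two] at hdet
  set a₀ : ℤ := g 0 0
  set b₀ : ℤ := g 0 1
  have hdet' : a₀ * e' - b₀ * (c + N : ℕ) = 1 := by rw [← hg0, ← hg1]; exact hdet
  set t : ℤ := a₀ * b - b₀ * a with ht
  obtain ⟨u, hu⟩ := h
  obtain ⟨v, hv⟩ := he'
  refine ⟨⟨!![a₀ + t * (c + N : ℕ), b₀ + t * e'; (c + N : ℕ), e'], ?_⟩, ?_, ?_, ?_, ?_⟩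
  · rw [Matrix.det_fin_two_of]
    linear_combination hdet'
  · change (N : ℤ) ∣ (a₀ + t * (c + N : ℕ)) - a
    refine ⟨a₀ * b - a₀ * u - a₀ * a * v, ?_⟩
    push_cast at hdet' ⊢
    rw [ht]
    linear_combination a * hdet' - a₀ * hu - a * a₀ * hv
  · change (N : ℤ) ∣ (b₀ + t * e') - b
    refine ⟨b₀ * b - b₀ * u - b₀ * a * v, ?_⟩
    push_cast at hdet' ⊢
    rw [ht]
    linear_combination b * hdet' - b₀ * hu - a * b₀ * hv
  · change (N : ℤ) ∣ ((c + N : ℕ) : ℤ) - c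
    exact ⟨1, by push_cast; ring⟩
  · exact ⟨v, hv⟩

theorem memMul_natCast_iff {N : ℕ} (hN : 1 ≤ N) (x : ℤ) :
    MemMul N (ratAdele x) ↔ (N : ℤ) ∣ x := by
  rw [memMul_rat_iff (by exact_mod_cast (by omega : N ≠ 0))]
  exact exists_congr fun n => by exact_mod_cast Iff.rfl

/-- Strong approximation for `SL₂`. -/
theorem exists_SL2_memMul {δ : Matrix (Fin 2) (Fin 2) Adele} (hδ : ∀ i j, InZhat (δ i j))
    (hdet : δ.det = 1) {N : ℕ} (hN : 1 ≤ N) :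
    ∃ s : SL(2, ℤ), ∀ i j, MemMul N (δ i j - ratAdele (s i j : ℤ)) := by
  choose x hxN hx using fun i j => (hδ i j).exists_nat hN
  rw [Matrix.det_fin_two] at hdet
  have hI : ∀ n : ℕ, InZhat (ratAdele n) := fun n => by exact_mod_cast inZhat_int n
  have h1 : MemMul N (ratAdele ((x 0 0 * x 1 1 - x 0 1 * x 1 0 - 1 : ℤ) : ℚ)) := by
    have h2 := (((hx 0 0).mul (hδ 1 1)).add ((hx 1 1).mul (hI (x 0 0)))).sub
      (((hx 0 1).mul (hδ 1 0)).add ((hx 1 0).mul (hI (x 0 1))))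
    convert h2.neg using 1
    push_cast
    simp only [map_sub, map_mul, map_one]
    linear_combination hdet
  obtain ⟨s, h00, h01, h10, h11⟩ :=
    exists_SL2_modEq _ _ _ _ hN ((memMul_natCast_iff hN _).1 h1)
  have key : ∀ i j, (N : ℤ) ∣ s i j - x i j → MemMul N (δ i j - ratAdele (s i j : ℤ)) := by
    intro i j h
    have := (hx i j).sub ((memMul_natCast_iff hN _).2 h)
    push_cast at this
    rwa [map_sub, sub_sub_sub_cancel_right] at this
  refine ⟨s, fun i j => key i j ?_⟩
  fin_cases i <;> fin_cases j
  exacts [h00, h01, h10, h11]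

/-- A natural number congruent modulo `n` to a unit of `Ẑ` is prime to `n`. -/
theorem IsUnitZhat.coprime {d : Adele} (hd : IsUnitZhat d) {n m : ℕ} (hn : 1 ≤ n)
    (h : MemMul n (d - ratAdele m)) : m.Coprime n := by
  rw [← Nat.coprime_comm, Nat.coprime_iff_gcd_eq_one]
  by_contra hne
  obtain ⟨p, hp, hpd⟩ := Nat.exists_prime_and_dvd hne
  obtain ⟨t, ht, hdt⟩ := (memMul_sub_iff (by exact_mod_cast (by omega : n ≠ 0))).1 h
  have : Fact p.Prime := ⟨hp⟩
  have h1 : d ⟨p, hp⟩ = (m : ℚ_[p]) + n * t ⟨p, hp⟩ := by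
    have h2 : d ⟨p, hp⟩ = ((m : ℚ) : ℚ_[p]) + ((n : ℚ) : ℚ_[p]) * t ⟨p, hp⟩ :=
      congrArg (fun z : Adele => z ⟨p, hp⟩) hdt
    simpa using h2
  have h2 : ‖d ⟨p, hp⟩‖ < 1 := by
    rw [h1]
    refine (IsUltrametricDist.norm_add_le_max _ _).trans_lt (max_lt ?_ ?_)
    · exact Padic.norm_natCast_lt_one_iff.2 (hpd.trans (Nat.gcd_dvd_right _ _))
    · rw [norm_mul]
      exact mul_lt_one_of_nonneg_of_lt_one_left (norm_nonneg _)
        (Padic.norm_natCast_lt_one_iff.2 (hpd.trans (Nat.gcd_dvd_left _ _))) (ht ⟨p, hp⟩)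
  exact absurd (hd ⟨p, hp⟩) h2.ne

/-! ### The cyclotomic automorphisms -/

instance isCyclotomicExtension_Qcycl : IsCyclotomicExtension Set.univ ℚ Qcycl := by
  have hS : {ζ : ℂ | ∃ n : ℕ, 1 ≤ n ∧ ζ ^ n = 1} = {x : ℂ | ∃ n ∈ Set.univ, n ≠ 0 ∧ x ^ n = 1} := by
    ext ζ
    simp [Nat.one_le_iff_ne_zero]
  refine (isCyclotomicExtension_iff_eq_adjoin Set.univ Qcycl.toSubalgebra fun n _ hn =>
    ⟨_, Complex.isPrimitiveRoot_exp n hn⟩).2 ?_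
  rw [← hS]
  refine IntermediateField.adjoin_toSubalgebra_of_isAlgebraic ?_
  rintro ζ ⟨n, hn, h⟩
  exact (IsIntegral.of_pow hn (by rw [h]; exact isIntegral_one)).isAlgebraic

instance isGalois_Qcycl : IsGalois ℚ Qcycl := IsCyclotomicExtension.isGalois Set.univ ℚ Qcycl

theorem exists_algEquiv_pow {n m : ℕ} (hn : 1 ≤ n) (hm : m.Coprime n) :
    ∃ σ : Qcycl ≃ₐ[ℚ] Qcycl, ∀ ζ : Qcycl, ζ ^ n = 1 → σ ζ = ζ ^ m := by
  have hne : NeZero n := ⟨by omega⟩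
  obtain ⟨ζ, hζ⟩ := IsCyclotomicExtension.exists_isPrimitiveRoot ℚ Qcycl (Set.mem_univ n) hne.1
  have hint : ∀ j : ℕ, IsIntegral ℤ (ζ ^ j) := fun j => (hζ.isIntegral hn).pow j
  have h1 : minpoly ℚ (ζ ^ m) = minpoly ℚ ζ := by
    rw [minpoly.isIntegrallyClosed_eq_field_fractions' ℚ (hint m), ← hζ.minpoly_eq_pow_coprime hm,
      minpoly.isIntegrallyClosed_eq_field_fractions' ℚ (hζ.isIntegral hn)]
  obtain ⟨σ, hσ⟩ := (isConjRoot_iff_exists_algEquiv (K := ℚ) (x := ζ ^ m) (y := ζ)).1 h1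
  refine ⟨σ, fun ξ hξ => ?_⟩
  obtain ⟨j, _, rfl⟩ := hζ.eq_pow_of_pow_eq_one hξ
  rw [map_pow, hσ, ← pow_mul, ← pow_mul, mul_comm]

/-- The set is empty or a coset of the subgroup fixing `ℚ(x)`, which is closed in the Krull
topology. -/
theorem isClosed_setOf_algEquiv_apply_eq (x y : Qcycl) :
    IsClosed {σ : Qcycl ≃ₐ[ℚ] Qcycl | σ x = y} := by
  rcases Set.eq_empty_or_nonempty {σ : Qcycl ≃ₐ[ℚ] Qcycl | σ x = y} with h | ⟨σ, hσ⟩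
  · rw [h]; exact isClosed_empty
  · have := IntermediateField.adjoin.finiteDimensional
      (Algebra.IsIntegral.isIntegral (R := ℚ) x)
    convert ((IntermediateField.adjoin ℚ {x}).fixingSubgroup_isClosed).leftCoset σ using 1
    ext τ
    rw [mem_leftCoset_iff, SetLike.mem_coe, IntermediateField.mem_fixingSubgroup_iff]
    have hσ' : σ x = y := hσ
    have hinv : ∀ z, σ⁻¹ (σ z) = z := σ.symm_apply_apply
    constructor
    · intro h z hz
      have hle : IntermediateField.adjoin ℚ {x} ≤
          IntermediateField.fixedField (Subgroup.zpowers (σ⁻¹ * τ)) := by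
        rw [IntermediateField.adjoin_simple_le_iff, IntermediateField.mem_fixedField_iff]
        have h1 : (σ⁻¹ * τ) • x = x := by
          change σ⁻¹ (τ x) = x
          rw [show τ x = y from h, ← hσ', hinv]
        intro f hf
        exact (MulAction.mem_stabilizer_iff.1
          ((Subgroup.zpowers_le (H := MulAction.stabilizer _ x)).2
            (MulAction.mem_stabilizer_iff.2 h1) hf))
      exact (IntermediateField.mem_fixedField_iff _ _).1 (hle hz) _
        (Subgroup.mem_zpowers _)
    · intro h
      have h1 : σ⁻¹ (τ x) = x := h x (IntermediateField.mem_adjoin_simple_self ℚ x)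
      change τ x = y
      rw [← hσ']
      exact (σ.apply_symm_apply (τ x)).symm.trans (congrArg σ h1)

/-- The automorphism `σ_d` of `ℚ^cycl` exists, by compactness of the Galois group. -/
theorem exists_isCyclAut {d : Adele} (hd : IsUnitZhat d) :
    ∃ σ : Qcycl ≃ₐ[ℚ] Qcycl, IsCyclAut d σ := by
  have hdI : InZhat d := fun p => (hd p).le
  have hcast : ∀ n : ℕ+, ((n : ℕ) : ℚ) ≠ 0 := fun n => by exact_mod_cast n.ne_zero
  -- the automorphisms that are correct on `n`-th roots of unity; these closed sets are nonempty and
  -- directed by divisibility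
  let C : ℕ+ → Set (Qcycl ≃ₐ[ℚ] Qcycl) := fun n => {σ | ∀ ζ : Qcycl, ζ ^ (n : ℕ) = 1 →
    ∀ m : ℕ, MemMul (n : ℕ) (d - ratAdele m) → σ ζ = ζ ^ m}
  have hpow : ∀ (n : ℕ+) (ζ : Qcycl) (m m' : ℕ), ζ ^ (n : ℕ) = 1 →
      MemMul (n : ℕ) (d - ratAdele m) → MemMul (n : ℕ) (d - ratAdele m') → ζ ^ m = ζ ^ m' := by
    intro n ζ m m' hζ hm hm'
    have h := hm.sub hm'
    rw [sub_sub_sub_cancel_left, ← map_sub] at h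
    have h1 : MemMul (n : ℕ) (ratAdele ((m' - m : ℤ) : ℚ)) := by push_cast; exact h
    have h2 : m ≡ m' [MOD n] :=
      (Nat.modEq_iff_dvd).2 ((memMul_natCast_iff (N := (n : ℕ)) n.2 _).1 h1)
    exact pow_eq_pow_of_modEq (h2.of_dvd (orderOf_dvd_of_pow_eq_one hζ)) (pow_orderOf_eq_one ζ)
  have hmono : ∀ n n' : ℕ+, C (n * n') ⊆ C n := by
    intro n n' σ hσ ζ hζ m hm
    obtain ⟨m', -, hm'⟩ := hdI.exists_nat (n * n').2
    rw [hσ ζ (by rw [PNat.mul_coe, pow_mul, hζ, one_pow]) m' hm']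
    refine hpow n ζ m' m hζ (MemMul.of_int_mul (n := (n' : ℕ))
      (by exact_mod_cast n'.ne_zero) ?_) hm
    have e : ((n : ℕ) : ℚ) * (((n' : ℕ) : ℤ) : ℚ) = ((n * n' : ℕ+) : ℕ) := by
      rw [PNat.mul_coe]; push_cast; rfl
    rw [e]
    exact hm'
  have hclosed : ∀ n, IsClosed (C n) := by
    intro n
    have : C n = ⋂ ζ : {ζ : Qcycl // ζ ^ (n : ℕ) = 1}, ⋂ m : {m : ℕ //
        MemMul (n : ℕ) (d - ratAdele m)}, {σ | σ ζ = (ζ : Qcycl) ^ (m : ℕ)} := by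
      ext σ
      simp [C]
    rw [this]
    exact isClosed_iInter fun _ => isClosed_iInter fun _ => isClosed_setOf_algEquiv_apply_eq _ _
  have hne : ∀ n, (C n).Nonempty := by
    intro n
    obtain ⟨m, -, hm⟩ := hdI.exists_nat n.2
    obtain ⟨σ, hσ⟩ := exists_algEquiv_pow n.2 (hd.coprime n.2 hm)
    exact ⟨σ, fun ζ hζ m' hm' => (hσ ζ hζ).trans (hpow n ζ m m' hζ hm hm')⟩
  obtain ⟨σ, hσ⟩ := IsCompact.nonempty_iInter_of_directed_nonempty_isCompact_isClosed C
    (fun n n' => ⟨n * n', hmono n n', by rw [mul_comm]; exact hmono n' n⟩) hne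
    (fun n => (hclosed n).isCompact) hclosed
  refine ⟨σ, fun n hn m hm ζ hζ => ?_⟩
  refine Set.mem_iInter.1 hσ ⟨n, hn⟩ ζ hζ m ?_
  exact (memMul_sub_iff (hcast ⟨n, hn⟩)).2 hm

/-! ### Decomposition of `GL₂` of the finite adeles -/

theorem IsUnitZhat.inZhat {d : Adele} (hd : IsUnitZhat d) : InZhat d := fun p => (hd p).le

theorem IsUnitZhat.mul {x y : Adele} (hx : IsUnitZhat x) (hy : IsUnitZhat y) :
    IsUnitZhat (x * y) := fun p => by rw [adele_mul_apply, norm_mul, hx p, hy p, one_mul]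

theorem exists_adele (u : ∀ p : Nat.Primes, ℚ_[p]) (h : ∀ p, ‖u p‖ ≤ 1) :
    ∃ x : Adele, InZhat x ∧ ∀ p, x p = u p :=
  ⟨⟨u, Filter.Eventually.of_forall h⟩, h, fun _ => rfl⟩

theorem IsUnitZhat.exists_inv {d : Adele} (hd : IsUnitZhat d) :
    ∃ d', IsUnitZhat d' ∧ d * d' = 1 := by
  have hn : ∀ p, ‖(d p)⁻¹‖ = 1 := fun p => by rw [norm_inv, hd p, inv_one]
  obtain ⟨d', -, h⟩ := exists_adele (fun p => (d p)⁻¹) fun p => (hn p).le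
  refine ⟨d', fun p => by rw [h]; exact hn p, ?_⟩
  ext p
  change d p * d' p = 1
  rw [h]
  exact mul_inv_cancel₀ (norm_ne_zero_iff.1 (by rw [hd p]; exact one_ne_zero))

theorem isUnit_adele_apply_ne_zero {x : Adele} (hx : IsUnit x) (p : Nat.Primes) : x p ≠ 0 := by
  obtain ⟨y, hy⟩ := hx.exists_right_inv
  intro h0
  have h : x p * y p = 1 := congrArg (fun z : Adele => z p) hy
  rw [h0, zero_mul] at h
  exact zero_ne_one h

theorem norm_natCast_prime {p q : Nat.Primes} (h : q ≠ p) : ‖((q : ℕ) : ℚ_[p])‖ = 1 :=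
  (Padic.norm_natCast_eq_one_iff (p := p)).2
    ((Nat.coprime_primes p.2 q.2).2 fun e => h (Subtype.ext e.symm))

/-- An idele is the product of the positive rational number `absAdele x` and a unit of `Ẑ`. -/
theorem exists_eq_absAdele_mul {x : Adele} (hx : IsUnit x) : 0 < absAdele x ∧
    ∃ w, IsUnitZhat w ∧ x = ratAdele (absAdele x) * w := by
  have hfin : {p : Nat.Primes | ‖x p‖ ≠ 1}.Finite := by
    obtain ⟨y, hy⟩ := hx.exists_right_inv
    have h1 : {p : Nat.Primes | ¬ ‖x p‖ ≤ 1}.Finite := x.2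
    have h2 : {p : Nat.Primes | ¬ ‖y p‖ ≤ 1}.Finite := y.2
    refine (h1.union h2).subset fun p hp => ?_
    by_contra hn
    simp only [Set.mem_union, Set.mem_ofPred_eq, not_or, not_not] at hn
    have h : x p * y p = 1 := congrArg (fun z : Adele => z p) hy
    have h3 : ‖x p‖ * ‖y p‖ = 1 := by rw [← norm_mul, h, norm_one]
    refine hp (le_antisymm hn.1 ?_)
    nlinarith [norm_nonneg (x p)]
  have hval : ∀ p : Nat.Primes, p ∉ hfin.toFinset → (x p).valuation = 0 := by
    intro p hp
    have h1 : ‖x p‖ = 1 := by simpa using hp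
    rw [Padic.norm_eq_zpow_neg_valuation (isUnit_adele_apply_ne_zero hx p),
      zpow_eq_one_iff_right₀ (by positivity) (by exact_mod_cast p.2.one_lt.ne')] at h1
    simpa using h1
  have heq : absAdele x = ∏ p ∈ hfin.toFinset, ((p : ℕ) : ℚ) ^ (x p).valuation := by
    refine finprod_eq_prod_of_mulSupport_subset _ fun p hp => ?_
    by_contra h
    exact hp (by simp only; rw [hval p (by simpa using h), zpow_zero])
  have hpos : 0 < absAdele x := by
    rw [heq]
    exact Finset.prod_pos fun p _ => zpow_pos (by exact_mod_cast p.2.pos) _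
  have hnorm : ∀ p : Nat.Primes, ‖((absAdele x : ℚ) : ℚ_[p])‖ = ‖x p‖ := by
    intro p
    have hone : ∀ q ∈ hfin.toFinset.erase p,
        ‖((((q : ℕ) : ℚ) ^ (x q).valuation : ℚ) : ℚ_[p])‖ = 1 := fun q hq => by
      push_cast
      rw [norm_zpow, norm_natCast_prime (Finset.ne_of_mem_erase hq), one_zpow]
    have hp : ‖((((p : ℕ) : ℚ) ^ (x p).valuation : ℚ) : ℚ_[p])‖ = ‖x p‖ := by
      push_cast
      rw [norm_zpow, Padic.norm_p, inv_zpow', Padic.norm_eq_zpow_neg_valuation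
        (isUnit_adele_apply_ne_zero hx p)]
    rw [heq, Rat.cast_prod, norm_prod]
    by_cases hm : p ∈ hfin.toFinset
    · rw [← Finset.mul_prod_erase _ _ hm, Finset.prod_congr rfl hone, Finset.prod_const_one,
        mul_one, hp]
    · rw [Finset.erase_eq_of_notMem hm] at hone
      rw [Finset.prod_congr rfl hone, Finset.prod_const_one]
      simpa [eq_comm] using hm
  refine ⟨hpos, ratAdele (absAdele x)⁻¹ * x, fun p => ?_, ?_⟩
  · rw [adele_mul_apply, ratAdele_apply, Rat.cast_inv, norm_mul, norm_inv, hnorm,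
      inv_mul_cancel₀ (norm_ne_zero_iff.2 (isUnit_adele_apply_ne_zero hx p))]
  · rw [← mul_assoc, ← map_mul, mul_inv_cancel₀ hpos.ne', map_one, one_mul]

/-- A positive rational number that is a unit at all primes is `1`. -/
theorem eq_one_of_isUnitZhat_ratAdele {q : ℚ} (hq : 0 < q) (h : IsUnitZhat (ratAdele q)) :
    q = 1 := by
  obtain ⟨n, hn⟩ := (inZhat_ratAdele_iff q).1 h.inZhat
  have h' : InZhat (ratAdele q⁻¹) := fun p => by
    have := h p
    rw [ratAdele_apply] at this ⊢
    rw [Rat.cast_inv, norm_inv, this, inv_one]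
  obtain ⟨m, hm⟩ := (inZhat_ratAdele_iff q⁻¹).1 h'
  have h1 : n * m = 1 := by
    have : (n : ℚ) * m = 1 := by rw [← hn, ← hm, mul_inv_cancel₀ hq.ne']
    exact_mod_cast this
  have h2 : 0 < n := by
    rw [hn] at hq
    exact_mod_cast hq
  rw [hn, Int.eq_one_of_mul_eq_one_right h2.le h1, Int.cast_one]

theorem eq_of_ratAdele_mul_eq {q q' : ℚ} (hq : 0 < q) (hq' : 0 < q') {w w' : Adele}
    (hw : IsUnitZhat w) (hw' : IsUnitZhat w') (h : ratAdele q * w = ratAdele q' * w') :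
    q = q' := by
  have h1 : IsUnitZhat (ratAdele (q / q')) := fun p => by
    have h2 : (q : ℚ_[p]) * w p = q' * w' p := congrArg (fun z : Adele => z p) h
    have h3 := congrArg norm h2
    rw [norm_mul, norm_mul, hw p, hw' p, mul_one, mul_one] at h3
    rw [ratAdele_apply, Rat.cast_div, norm_div, h3, div_self]
    exact norm_ne_zero_iff.2 (by exact_mod_cast hq'.ne')
  exact (div_eq_one_iff_eq hq'.ne').1 (eq_one_of_isUnitZhat_ratAdele (div_pos hq hq') h1)

theorem absAdele_ratAdele_mul {q : ℚ} (hq : 0 < q) {w : Adele} (hw : IsUnitZhat w) :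
    absAdele (ratAdele q * w) = q := by
  obtain ⟨w', -, hww⟩ := hw.exists_inv
  have hu : IsUnit (ratAdele q * w) := by
    refine IsUnit.mul ?_ (IsUnit.of_mul_eq_one w' hww)
    refine IsUnit.of_mul_eq_one (ratAdele q⁻¹) ?_
    rw [← map_mul, mul_inv_cancel₀ hq.ne', map_one]
  obtain ⟨hpos, v, hv, h⟩ := exists_eq_absAdele_mul hu
  exact (eq_of_ratAdele_mul_eq hq hpos hw hv h).symm

/-- `γ = g δ (1, 0; 0, d)` with `g ∈ GL₂(ℚ)`, `det g > 0`, `δ ∈ SL₂(Ẑ)` and `d ∈ Ẑ^*`. -/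
structure IsDecomp (γ : Matrix (Fin 2) (Fin 2) Adele) (g : GL (Fin 2) ℚ)
    (δ : Matrix (Fin 2) (Fin 2) Adele) (d : Adele) : Prop where
  det_pos : 0 < (g : Matrix (Fin 2) (Fin 2) ℚ).det
  integral : ∀ i j, InZhat (δ i j)
  det_eq_one : δ.det = 1
  isUnit : IsUnitZhat d
  eq : γ = (g : Matrix (Fin 2) (Fin 2) ℚ).map ratAdele * δ * !![1, 0; 0, d]

theorem IsDecomp.absAdele_det {γ : Matrix (Fin 2) (Fin 2) Adele} {g : GL (Fin 2) ℚ}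
    {δ : Matrix (Fin 2) (Fin 2) Adele} {d : Adele} (h : IsDecomp γ g δ d) :
    absAdele γ.det = (g : Matrix (Fin 2) (Fin 2) ℚ).det := by
  rw [h.eq, Matrix.det_mul, Matrix.det_mul, h.det_eq_one, Matrix.det_fin_two_of, mul_one,
    one_mul, mul_zero, sub_zero, ← absAdele_ratAdele_mul h.det_pos h.isUnit, RingHom.map_det]
  rfl

/-- A row vector of size two over `ℚ_p` is made lower triangular by an integral column operation
of determinant one. -/
theorem exists_column_operation {p : Nat.Primes} (c d : ℚ_[p]) (h : c ≠ 0 ∨ d ≠ 0) :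
    ∃ u v w z : ℚ_[p], (‖u‖ ≤ 1 ∧ ‖v‖ ≤ 1 ∧ ‖w‖ ≤ 1 ∧ ‖z‖ ≤ 1) ∧ u * z - v * w = 1 ∧
      c * u + d * w = 0 := by
  rcases le_or_gt ‖c‖ ‖d‖ with hcd | hcd
  · have hd : d ≠ 0 := by
      rintro rfl
      rw [norm_zero] at hcd
      exact h.elim (fun hc => hc (norm_le_zero_iff.1 hcd)) fun h => h rfl
    refine ⟨1, 0, -c / d, 1, ⟨by simp, by simp, ?_, by simp⟩, by ring, by field_simp; ring⟩
    rw [norm_div, norm_neg]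
    exact div_le_one_of_le₀ hcd (norm_nonneg _)
  · have hc : c ≠ 0 := by
      rintro rfl
      rw [norm_zero] at hcd
      exact absurd hcd (norm_nonneg _).not_gt
    refine ⟨d / c, 1, -1, 0, ⟨?_, by simp, by simp, by simp⟩, by ring, by field_simp; ring⟩
    rw [norm_div]
    exact div_le_one_of_le₀ hcd.le (norm_nonneg _)

/-- `GL₂(ℚ ⊗ Ẑ)` is generated by `GL₂(ℚ)` (with positive determinant) and `GL₂(Ẑ)`. -/
theorem exists_isDecomp (γ : GL (Fin 2) Adele) :
    ∃ g δ d, IsDecomp (γ : Matrix (Fin 2) (Fin 2) Adele) g δ d := by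
  have hdet : IsUnit (γ : Matrix (Fin 2) (Fin 2) Adele).det :=
    (Matrix.isUnit_iff_isUnit_det _).1 γ.isUnit
  generalize (γ : Matrix (Fin 2) (Fin 2) Adele) = Γ at hdet ⊢
  have hrow : ∀ p, Γ 1 0 p ≠ 0 ∨ Γ 1 1 p ≠ 0 := by
    intro p
    by_contra hn
    push Not at hn
    refine isUnit_adele_apply_ne_zero hdet p ?_
    rw [Matrix.det_fin_two]
    change Γ 0 0 p * Γ 1 1 p - Γ 0 1 p * Γ 1 0 p = 0
    rw [hn.1, hn.2]
    ring
  -- a local column operation at each prime makes the matrix upper triangular, with rows `(A, B)`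
  -- and `(0, D)`
  choose u v w z hint hdetp hrowp using fun p => exists_column_operation (Γ 1 0 p) (Γ 1 1 p) (hrow p)
  obtain ⟨U, hUI, hU⟩ := exists_adele u fun p => (hint p).1
  obtain ⟨V, hVI, hV⟩ := exists_adele v fun p => (hint p).2.1
  obtain ⟨W, hWI, hW⟩ := exists_adele w fun p => (hint p).2.2.1
  obtain ⟨Z, hZI, hZ⟩ := exists_adele z fun p => (hint p).2.2.2
  have h1 : U * Z - V * W = 1 := by
    ext p
    change U p * Z p - V p * W p = 1
    rw [hU, hV, hW, hZ, hdetp]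
  have h2 : Γ 1 0 * U + Γ 1 1 * W = 0 := by
    ext p
    change Γ 1 0 p * U p + Γ 1 1 p * W p = 0
    rw [hU, hW, hrowp]
  set A := Γ 0 0 * U + Γ 0 1 * W with hA
  set B := Γ 0 0 * V + Γ 0 1 * Z with hB
  set D := Γ 1 0 * V + Γ 1 1 * Z with hD
  have hAD : A * D = Γ.det := by
    rw [Matrix.det_fin_two, hA, hD]
    linear_combination (Γ 0 0 * Γ 1 1 - Γ 0 1 * Γ 1 0) * h1 + (Γ 0 0 * V + Γ 0 1 * Z) * h2
  have hADu : IsUnit (A * D) := hAD ▸ hdet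
  obtain ⟨hα, a, ha, hAa⟩ := exists_eq_absAdele_mul (isUnit_of_mul_isUnit_left hADu)
  obtain ⟨hβ, e, he, hDe⟩ := exists_eq_absAdele_mul (isUnit_of_mul_isUnit_right hADu)
  -- the rational factor is `(α, x; 0, β)`, where `x` approximates `B / e` modulo `αẐ`
  set α := absAdele A
  set β := absAdele D
  obtain ⟨e', he', hee⟩ := he.exists_inv
  obtain ⟨x, hx⟩ := exists_rat_memMul hα.ne' (B * e')
  obtain ⟨t, ht, hxt⟩ := (memMul_sub_iff hα.ne').1 hx
  have hBt : B = ratAdele x * e + ratAdele α * (t * e) := by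
    linear_combination e * hxt - B * hee
  obtain ⟨f, hf, hff⟩ := (ha.mul he).exists_inv
  have hgdet : (!![α, x; 0, β] : Matrix (Fin 2) (Fin 2) ℚ).det = α * β := by
    rw [Matrix.det_fin_two_of]; ring
  -- the integral factor is `(a, t e; 0, e) * (Z, -V; -W, U)`, of determinant `a e`
  refine ⟨Matrix.GeneralLinearGroup.mkOfDetNeZero !![α, x; 0, β]
      (by rw [hgdet]; exact mul_ne_zero hα.ne' hβ.ne'),
    !![a * Z - t * e * W, (-(a * V) + t * e * U) * f; -(e * W), e * U * f], a * e,
    ⟨?_, ?_, ?_, ha.mul he, ?_⟩⟩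
  · change 0 < (!![α, x; 0, β] : Matrix (Fin 2) (Fin 2) ℚ).det
    rw [hgdet]
    exact mul_pos hα hβ
  · have h3 := ht.mul he.inZhat
    intro i j
    fin_cases i <;> fin_cases j
    · exact (ha.inZhat.mul hZI).sub (h3.mul hWI)
    · exact ((ha.inZhat.mul hVI).neg.add (h3.mul hUI)).mul hf.inZhat
    · exact (he.inZhat.mul hWI).neg
    · exact (he.inZhat.mul hUI).mul hf.inZhat
  · rw [Matrix.det_fin_two_of]
    linear_combination (a * e * f) * h1 + hff
  · change Γ = (!![α, x; 0, β] : Matrix (Fin 2) (Fin 2) ℚ).map ratAdele * _ * _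
    have e00 : Γ 0 0 = A * Z - B * W := by
      rw [hA, hB]; linear_combination (-Γ 0 0) * h1
    have e01 : Γ 0 1 = -(A * V) + B * U := by
      rw [hA, hB]; linear_combination (-Γ 0 1) * h1
    have e10 : Γ 1 0 = -(D * W) := by
      rw [hD]; linear_combination (-Γ 1 0) * h1 + Z * h2
    have e11 : Γ 1 1 = D * U := by
      rw [hD]; linear_combination (-Γ 1 1) * h1 - V * h2
    ext i j : 1
    fin_cases i <;> fin_cases j <;> simp [Matrix.mul_apply, Fin.sum_univ_two]
    · rw [e00, hAa, hBt]; ring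
    · rw [e01, hAa, hBt]
      linear_combination (-(ratAdele α * (-(a * V) + t * e * U) + ratAdele x * e * U)) * hff
    · rw [e10, hDe]; ring
    · rw [e11, hDe]
      linear_combination (-(ratAdele β * e * U)) * hff

/-! ### The action of the finite adelic group -/

/-- `ψ(x) = φ(xA)`. -/
def IsPullback (A : Matrix (Fin 2) (Fin 2) Adele) (φ ψ : LCc) : Prop :=
  ∀ x, ψ x = φ (Matrix.vecMul x A)

theorem exists_isPullback {A : Matrix (Fin 2) (Fin 2) Adele} (hA : IsUnit A.det) (φ : LCc) :
    ∃ ψ, IsPullback A φ ψ := by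
  obtain ⟨u, hu⟩ := (Matrix.isUnit_iff_isUnit_det A).2 hA
  refine ⟨LCc.act φ u⁻¹, fun x => ?_⟩
  rw [LCc.act_apply, inv_inv, hu]

theorem IsPullback.comp {A B : Matrix (Fin 2) (Fin 2) Adele} {φ ψ ψ' : LCc}
    (h : IsPullback A φ ψ) (h' : IsPullback B ψ ψ') : IsPullback (B * A) φ ψ' := fun x => by
  rw [h', h, Matrix.vecMul_vecMul]

theorem IsPullback.unique {A : Matrix (Fin 2) (Fin 2) Adele} {φ ψ ψ' : LCc}
    (h : IsPullback A φ ψ) (h' : IsPullback A φ ψ') : ψ = ψ' :=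
  LCc.ext fun x => (h x).trans (h' x).symm

theorem vecMul_two (x : X) (A : Matrix (Fin 2) (Fin 2) Adele) (i : Fin 2) :
    Matrix.vecMul x A i = x 0 * A 0 i + x 1 * A 1 i := by
  simp [Matrix.vecMul, dotProduct, Fin.sum_univ_two]

/-- The image of an integral matrix in `M₂(ℚ ⊗ Ẑ)`. -/
def intMatrix (s : SL(2, ℤ)) : Matrix (Fin 2) (Fin 2) Adele :=
  fun i j => ratAdele (s i j : ℤ)

theorem intMatrix_integral (s : SL(2, ℤ)) (i j : Fin 2) : InZhat (intMatrix s i j) :=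
  inZhat_int _

theorem intMatrix_det (s : SL(2, ℤ)) : (intMatrix s).det = 1 := by
  have h := s.2
  rw [Matrix.det_fin_two] at h ⊢
  have h' := congrArg (fun n : ℤ => ratAdele n) h
  simpa [intMatrix] using h'

theorem isUnit_det_of_eq_one {A : Matrix (Fin 2) (Fin 2) Adele} (h : A.det = 1) :
    IsUnit A.det := by rw [h]; exact isUnit_one

theorem isUnit_det_diag {d : Adele} (hd : IsUnitZhat d) :
    IsUnit (!![1, 0; 0, d] : Matrix (Fin 2) (Fin 2) Adele).det := by
  obtain ⟨d', -, h⟩ := hd.exists_inv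
  rw [Matrix.det_fin_two_of, one_mul, zero_mul, sub_zero]
  exact IsUnit.of_mul_eq_one d' h

/-- Congruent elements of `SL₂(Ẑ)` act in the same way on a given `φ`. -/
theorem exists_level (φ : LCc) : ∃ N : ℕ, 1 ≤ N ∧ ∀ A B : Matrix (Fin 2) (Fin 2) Adele,
    (∀ i j, InZhat (A i j)) → A.det = 1 → (∀ i j, InZhat (B i j)) → B.det = 1 →
    (∀ i j, MemMul N (A i j - B i j)) → ∀ x : X,
      φ (Matrix.vecMul x A) = φ (Matrix.vecMul x B) := by
  obtain ⟨M, N, hM, hN, hsupp, hper⟩ := LCc.exists_support_period φ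
  have hM0 : (M : ℚ) ≠ 0 := by exact_mod_cast (by omega : M ≠ 0)
  -- if `φ(xA) ≠ 0`, then `Mx` is integral, and `xA`, `xB` are congruent modulo `NẐ²`
  have key : ∀ A B : Matrix (Fin 2) (Fin 2) Adele,
      (∀ i j, InZhat (A i j)) → A.det = 1 →
      (∀ i j, MemMul (M * N : ℕ) (A i j - B i j)) → ∀ x : X, φ (Matrix.vecMul x A) ≠ 0 →
        φ (Matrix.vecMul x A) = φ (Matrix.vecMul x B) := by
    intro A B hA hdet hAB x hx
    have h1 := hsupp _ hx
    rw [Matrix.det_fin_two] at hdet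
    have hx0 : InZhat (ratAdele M * x 0) := by
      have := ((h1 0).mul (hA 1 1)).sub ((h1 1).mul (hA 1 0))
      rw [vecMul_two, vecMul_two] at this
      convert this using 1
      linear_combination (-(ratAdele M * x 0)) * hdet
    have hx1 : InZhat (ratAdele M * x 1) := by
      have := ((h1 1).mul (hA 0 0)).sub ((h1 0).mul (hA 0 1))
      rw [vecMul_two, vecMul_two] at this
      convert this using 1
      linear_combination (-(ratAdele M * x 1)) * hdet
    refine hper _ _ fun i => ?_
    rw [← memMul_mul_iff hM0, vecMul_two, vecMul_two]
    have := ((hAB 0 i).mul hx0).add ((hAB 1 i).mul hx1)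
    rw [Nat.cast_mul] at this
    convert this using 1
    ring
  refine ⟨M * N, Nat.mul_pos hM hN, fun A B hA hdA hB hdB hAB x => ?_⟩
  by_cases hx : φ (Matrix.vecMul x A) = 0
  · rw [hx]
    by_contra hne
    refine hne ((key B A hB hdB (fun i j => ?_) x (Ne.symm hne)).trans hx).symm
    rw [← neg_sub]
    exact (hAB i j).neg
  · exact key A B hA hdA hAB x hx

/-- `Z` is equivariant under `SL₂(ℤ)`, for the action in weight `k`. -/
def IsSLEquivariant (k : ℕ) (Z : LCc → ℍ → ℂ) : Prop :=
  ∀ (s : SL(2, ℤ)) (φ ψ : LCc), IsPullback (intMatrix s) φ ψ → Z ψ ∣[(k : ℤ)] s = Z φ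

/-- `Z` is equivariant under the matrices `(1, 0; 0, d)` with `d ∈ Ẑ^*`. -/
def IsGalEquivariant (Z : LCc → ℍ → ℂ) : Prop :=
  ∀ (d : Adele) (σ : Qcycl ≃ₐ[ℚ] Qcycl), IsUnitZhat d → IsCyclAut d σ → ∀ φ ψ : LCc,
    IsPullback !![1, 0; 0, d] φ ψ → GalRel σ (Z ψ) (Z φ)

/-- The values of an equivariant family are invariant under principal congruence subgroups. -/
theorem IsSLEquivariant.exists_invariant {k : ℕ} {Z : LCc → ℍ → ℂ} (hZ : IsSLEquivariant k Z)
    (φ : LCc) : ∃ N : ℕ, 1 ≤ N ∧ ∀ γ ∈ CongruenceSubgroup.Gamma N, Z φ ∣[(k : ℤ)] γ = Z φ := by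
  obtain ⟨N, hN, h⟩ := exists_level φ
  refine ⟨N, hN, fun γ hγ => hZ γ φ φ fun x => ?_⟩
  have h1 := h (intMatrix γ) 1 (intMatrix_integral γ) (intMatrix_det γ) (fun i j => ?_)
    Matrix.det_one (fun i j => ?_) x
  · rw [h1, Matrix.vecMul_one]
  · rw [Matrix.one_apply]
    split_ifs
    exacts [inZhat_one, inZhat_zero]
  · have h2 : ((γ i j : ℤ) : ZMod N) = ((1 : Matrix (Fin 2) (Fin 2) ℤ) i j : ℤ) := by
      have h3 := congrFun (congrFun (congrArg Subtype.val
        (CongruenceSubgroup.Gamma_mem'.1 hγ)) i) j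
      rw [Matrix.SpecialLinearGroup.coe_one] at h3
      rw [← SL_reduction_mod_hom_val]
      rw [Matrix.one_apply] at h3 ⊢
      refine h3.trans ?_
      split_ifs <;> simp
    rw [eq_comm, ZMod.intCast_eq_intCast_iff_dvd_sub] at h2
    have h3 := (memMul_natCast_iff hN _).2 h2
    convert h3 using 1
    rw [Int.cast_sub, map_sub, Matrix.one_apply, Matrix.one_apply]
    split_ifs <;> simp [intMatrix]

theorem smul_slash_SL {k : ℕ} (c : ℚ) (f : ℍ → ℂ) (s : SL(2, ℤ)) :
    (c • f) ∣[(k : ℤ)] s = c • (f ∣[(k : ℤ)] s) := by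
  rw [ModularForm.SL_smul_slash]

/-- The action of `SL₂(Ẑ)` on the values of a family that is equivariant under `SL₂(ℤ)` is well
defined, and the family is equivariant for it: `δ` may be replaced by an element of `SL₂(ℤ)` that
is congruent to it modulo the level of the values and that of `φ`. -/
theorem isSLStar_iff {k : ℕ} {Z : LCc → ℍ → ℂ} (hZ : IsSLEquivariant k Z) {φ ψ : LCc}
    {δ : Matrix (Fin 2) (Fin 2) Adele} (hδ : ∀ i j, InZhat (δ i j)) (hdet : δ.det = 1)
    (h : IsPullback δ φ ψ) (c : ℚ) (f' : ℍ → ℂ) :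
    IsSLStar k δ (c • Z ψ) f' ↔ f' = c • Z φ := by
  have hcast : ∀ {N : ℕ}, 1 ≤ N → (N : ℚ) ≠ 0 := fun {N} hN => by
    exact_mod_cast (by omega : N ≠ 0)
  obtain ⟨M, hM, hlev⟩ := exists_level φ
  have hs : ∀ s : SL(2, ℤ), (∀ i j, MemMul M (δ i j - ratAdele (s i j : ℤ))) →
      (c • Z ψ) ∣[(k : ℤ)] s = c • Z φ := by
    intro s hs
    rw [smul_slash_SL, hZ s φ ψ fun x => ?_]
    rw [h x]
    exact hlev δ (intMatrix s) hδ hdet (intMatrix_integral s) (intMatrix_det s) hs x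
  constructor
  · rintro ⟨N, s, hN, hinv, hs', rfl⟩
    obtain ⟨s', hs''⟩ := exists_SL2_memMul hδ hdet (Nat.mul_pos hN hM)
    have h1 : ∀ i j, MemMul M (δ i j - ratAdele (s' i j : ℤ)) := fun i j => by
      refine MemMul.of_int_mul (n := N) (by exact_mod_cast (by omega : N ≠ 0)) ?_
      have := hs'' i j
      rwa [Nat.cast_mul, mul_comm] at this
    have h2 : ∀ i j, (N : ℤ) ∣ s i j - s' i j := fun i j => by
      rw [← memMul_natCast_iff hN]
      have h3 : MemMul N (δ i j - ratAdele (s' i j : ℤ)) := by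
        refine MemMul.of_int_mul (n := M) (by exact_mod_cast (by omega : M ≠ 0)) ?_
        have := hs'' i j
        rwa [Nat.cast_mul] at this
      have h4 := h3.sub ((memMul_sub_iff (hcast hN)).2 (hs' i j))
      rwa [sub_sub_sub_cancel_left, ← map_sub, ← Int.cast_sub] at h4
    have h5 : s * s'⁻¹ ∈ CongruenceSubgroup.Gamma N := by
      rw [CongruenceSubgroup.Gamma_mem', map_mul, map_inv, mul_inv_eq_one]
      ext i j
      rw [SL_reduction_mod_hom_val, SL_reduction_mod_hom_val,
        eq_comm, ZMod.intCast_eq_intCast_iff_dvd_sub]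
      exact h2 i j
    have h6 : s = (s * s'⁻¹) * s' := by group
    rw [h6, SlashAction.slash_mul, hinv _ h5]
    exact hs s' h1
  · rintro rfl
    obtain ⟨N, hN, hinv⟩ := hZ.exists_invariant ψ
    obtain ⟨s', hs''⟩ := exists_SL2_memMul hδ hdet (Nat.mul_pos hN hM)
    refine ⟨N, s', hN, fun γ hγ => by rw [smul_slash_SL, hinv γ hγ], fun i j => ?_,
      (hs s' fun i j => ?_).symm⟩
    · refine (memMul_sub_iff (hcast hN)).1 (MemMul.of_int_mul (n := M)
        (by exact_mod_cast (by omega : M ≠ 0)) ?_)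
      have := hs'' i j
      rwa [Nat.cast_mul] at this
    · refine MemMul.of_int_mul (n := N) (by exact_mod_cast (by omega : N ≠ 0)) ?_
      have := hs'' i j
      rwa [Nat.cast_mul, mul_comm] at this

theorem GalRel.rat_smul {σ : Qcycl ≃ₐ[ℚ] Qcycl} {f f' : ℍ → ℂ} (c : ℚ) (h : GalRel σ f f') :
    GalRel σ (c • f) (c • f') := by
  refine (h.const_mul (algebraMap ℚ Qcycl c)).congr (fun τ => ?_) fun τ => ?_
  · rw [Pi.smul_apply, Rat.smul_def]
    rfl
  · rw [AlgEquiv.commutes, Pi.smul_apply, Rat.smul_def]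
    rfl

/-- By uniqueness of `q`-expansions, the action of `(1, 0; 0, d)` on the values of a family that
is equivariant under these matrices is the one prescribed by equivariance. -/
theorem isGalStar_iff {Z : LCc → ℍ → ℂ} (hZ : IsGalEquivariant Z) {φ ψ : LCc} {d : Adele}
    (hd : IsUnitZhat d) (h : IsPullback !![1, 0; 0, d] φ ψ) (c : ℚ) (f' : ℍ → ℂ) :
    IsGalStar d (c • Z ψ) f' ↔ f' = c • Z φ := by
  constructor
  · rintro ⟨σ, N, a, hσ, hN, ha, ha'⟩
    exact ((hZ d σ hd hσ φ ψ h).rat_smul c).eq_of_hasQExp hN ha ha'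
  · rintro rfl
    obtain ⟨σ, hσ⟩ := exists_isCyclAut hd
    obtain ⟨N, a, hN, ha, ha'⟩ := (hZ d σ hd hσ φ ψ h).rat_smul c
    exact ⟨σ, N, a, hσ, hN, ha, ha'⟩

/-- The action of `γ` on a distribution that is equivariant under `SL₂(ℤ)` and under the
matrices `(1, 0; 0, d)` is determined by the action of the rational part of `γ`. -/
theorem act_eq_smul {k : ℕ} {μ : Dist k}
    (hSL : IsSLEquivariant k fun φ => (μ φ : ℍ → ℂ)) (hGal : IsGalEquivariant fun φ => (μ φ : ℍ → ℂ))
    (γ : GL (Fin 2) Adele) (φ : LCc) (c : ℚ)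
    (hrat : ∀ g δ d, IsDecomp (γ : Matrix (Fin 2) (Fin 2) Adele) g δ d → ∀ ψ ψ' : LCc,
      IsPullback (γ : Matrix (Fin 2) (Fin 2) Adele) φ ψ →
      IsPullback (δ * !![1, 0; 0, d]) φ ψ' →
      ratStar k (μ ψ) g = c • (μ ψ' : ℍ → ℂ)) :
    μ.act γ φ = c • μ φ := by
  have hγ : IsPullback (γ : Matrix (Fin 2) (Fin 2) Adele) φ (LCc.act φ γ⁻¹) := fun x => by
    rw [LCc.act_apply, inv_inv]
  have key : ∀ g δ d, IsDecomp (γ : Matrix (Fin 2) (Fin 2) Adele) g δ d → ∀ f' : ℍ → ℂ,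
      (∃ f₁, IsSLStar k δ (ratStar k (μ (LCc.act φ γ⁻¹)) g) f₁ ∧ IsGalStar d f₁ f') ↔
        f' = c • (μ φ : ℍ → ℂ) := by
    intro g δ d h f'
    obtain ⟨ψ, hψ⟩ := exists_isPullback (isUnit_det_diag h.isUnit) φ
    obtain ⟨ψ', hψ'⟩ := exists_isPullback (isUnit_det_of_eq_one h.det_eq_one) ψ
    rw [hrat g δ d h _ _ hγ (hψ.comp hψ')]
    simp only [isSLStar_iff hSL h.integral h.det_eq_one hψ']
    simp only [exists_eq_left]
    exact isGalStar_iff hGal h.isUnit hψ c f'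
  have hex : ∃ f' : Mcong k, IsStar k γ (μ (LCc.act φ γ⁻¹) : ℍ → ℂ) f' := by
    obtain ⟨g, δ, d, h⟩ := exists_isDecomp γ
    obtain ⟨f₁, h1, h2⟩ := (key g δ d h (c • (μ φ : ℍ → ℂ))).2 rfl
    exact ⟨c • μ φ, g, δ, d, f₁, h.det_pos, h.integral, h.det_eq_one, h.isUnit, h.eq, h1, h2⟩
  obtain ⟨g, δ, d, f₁, h1, h2, h3, h4, h5, h6, h7⟩ := Classical.epsilon_spec hex
  exact Subtype.ext ((key g δ d ⟨h1, h2, h3, h4, h5⟩ _).1 ⟨f₁, h6, h7⟩)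

/-! ### Eisenstein series attached to test functions -/

/-- The image of a rational vector in `X`. -/
def ratPt (v : ℚ × ℚ) : X := ![ratAdele v.1, ratAdele v.2]

/-- The point `xτ + y` of `ℂ`, for `v = (x, y)`. -/
def latQ (τ : ℍ) (v : ℚ × ℚ) : ℂ := v.1 * τ + v.2

/-- The general term of the theta series attached to `φ`. -/
def thetaTerm (k : ℕ) (τ : ℍ) (φ : LCc) (t : ℝ) (v : ℚ × ℚ) : ℂ :=
  (φ (ratPt v) : ℂ) * ((starRingEnd ℂ) (latQ τ v) ^ k *
    (Real.exp (-(Real.pi / τ.im * ‖latQ τ v‖ ^ 2) * t) : ℝ))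

/-- The theta series `∑ φ(x, y) conj(xτ + y)^k exp(-πt|xτ + y|²/Im τ)` over `(x, y) ∈ ℚ²`. -/
def thetaFun (k : ℕ) (τ : ℍ) (φ : LCc) (t : ℝ) : ℂ := ∑' v, thetaTerm k τ φ t v

/-- The value at `s` of the Eisenstein-Kronecker series attached to `φ`, as a Mellin transform. -/
def eisFun (k : ℕ) (s : ℕ) (φ : LCc) (τ : ℍ) : ℂ := normFac k τ * mellin (thetaFun k τ φ) s

/-- The rational points of the box `(a + rẐ) × (b + rẐ)`. -/
def boxPt (a b r : ℚ) (w : ℤ × ℤ) : ℚ × ℚ := (a + r * w.2, b + r * w.1)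

theorem boxPt_injective {a b r : ℚ} (hr : r ≠ 0) : Function.Injective (boxPt a b r) := by
  rintro ⟨m, n⟩ ⟨m', n'⟩ h
  simp only [boxPt, Prod.mk.injEq, add_right_inj, mul_right_inj' hr] at h
  exact Prod.ext (by exact_mod_cast h.2) (by exact_mod_cast h.1)

theorem mem_range_boxPt_iff {a b r : ℚ} (hr : r ≠ 0) (v : ℚ × ℚ) :
    v ∈ Set.range (boxPt a b r) ↔
      MemMul r (ratPt v 0 - ratAdele a) ∧ MemMul r (ratPt v 1 - ratAdele b) := by
  change _ ↔ MemMul r (ratAdele v.1 - ratAdele a) ∧ MemMul r (ratAdele v.2 - ratAdele b)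
  rw [← map_sub, ← map_sub, memMul_rat_iff hr, memMul_rat_iff hr]
  constructor
  · rintro ⟨w, rfl⟩
    exact ⟨⟨w.2, add_sub_cancel_left _ _⟩, w.1, add_sub_cancel_left _ _⟩
  · rintro ⟨⟨n, hn⟩, m, hm⟩
    exact ⟨(m, n), Prod.ext (by simp only [boxPt]; linarith) (by simp only [boxPt]; linarith)⟩

theorem latQ_boxPt (τ : ℍ) {a b r : ℚ} (hr : r ≠ 0) (w : ℤ × ℤ) :
    latQ τ (boxPt a b r w) = ((r : ℝ) : ℂ) * latPt τ (a / r : ℚ) (b / r : ℚ) w := by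
  have hrC : (r : ℂ) ≠ 0 := by exact_mod_cast hr
  rw [latQ, boxPt, latPt]
  push_cast
  field_simp
  ring

theorem thetaTerm_boxPt (k : ℕ) (τ : ℍ) {a b r : ℚ} (hr : r ≠ 0) (t : ℝ) (w : ℤ × ℤ) :
    thetaTerm k τ (boxIndicator a b r hr) t (boxPt a b r w) =
      (r : ℂ) ^ k * ((starRingEnd ℂ) (latPt τ (a / r : ℚ) (b / r : ℚ) w) ^ k *
        (Real.exp (-(Real.pi / τ.im * ‖latPt τ (a / r : ℚ) (b / r : ℚ) w‖ ^ 2) *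
          ((r : ℝ) ^ 2 * t)) : ℝ)) := by
  rw [thetaTerm, boxIndicator_apply, if_pos ((mem_range_boxPt_iff hr _).1 ⟨w, rfl⟩),
    latQ_boxPt τ hr, map_mul, Complex.conj_ofReal, norm_mul, Complex.norm_real, mul_pow, mul_pow,
    Real.norm_eq_abs, sq_abs, ← mul_assoc (Real.pi / τ.im), mul_comm (Real.pi / τ.im),
    mul_assoc ((r : ℝ) ^ 2), ← mul_neg, mul_comm ((r : ℝ) ^ 2), mul_assoc _ ((r : ℝ) ^ 2) t,
    Int.cast_one, one_mul, Complex.ofReal_ratCast, mul_assoc]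

theorem support_thetaTerm_box (k : ℕ) (τ : ℍ) {a b r : ℚ} (hr : r ≠ 0) (t : ℝ) :
    Function.support (thetaTerm k τ (boxIndicator a b r hr) t) ⊆ Set.range (boxPt a b r) := by
  intro v hv
  by_contra h
  rw [mem_range_boxPt_iff hr] at h
  refine hv ?_
  rw [thetaTerm, boxIndicator_apply, if_neg h]
  simp

theorem thetaFun_box (k : ℕ) (τ : ℍ) {a b r : ℚ} (hr : r ≠ 0) (t : ℝ) :
    thetaFun k τ (boxIndicator a b r hr) t =
      (r : ℂ) ^ k * thetaE k τ (a / r : ℚ) (b / r : ℚ) ((r : ℝ) ^ 2 * t) := by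
  rw [thetaFun, ← (boxPt_injective hr).tsum_eq (support_thetaTerm_box k τ hr t), thetaE,
    ← tsum_mul_left]
  exact tsum_congr fun w => thetaTerm_boxPt k τ hr t w

theorem thetaTerm_add (k : ℕ) (τ : ℍ) (φ ψ : LCc) (t : ℝ) (v : ℚ × ℚ) :
    thetaTerm k τ (φ + ψ) t v = thetaTerm k τ φ t v + thetaTerm k τ ψ t v := by
  rw [thetaTerm, LCc.add_apply, Int.cast_add, add_mul]; rfl

theorem thetaTerm_smul (k : ℕ) (τ : ℍ) (c : ℤ) (φ : LCc) (t : ℝ) (v : ℚ × ℚ) :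
    thetaTerm k τ (c • φ) t v = c * thetaTerm k τ φ t v := by
  rw [thetaTerm, LCc.smul_apply, Int.cast_mul, mul_assoc]; rfl

theorem thetaFun_smul (k : ℕ) (τ : ℍ) (c : ℤ) (φ : LCc) (t : ℝ) :
    thetaFun k τ (c • φ) t = (c : ℂ) • thetaFun k τ φ t := by
  simp only [thetaFun, thetaTerm_smul, tsum_mul_left, smul_eq_mul]

theorem summable_thetaTerm (k : ℕ) (τ : ℍ) (φ : LCc) {t : ℝ} (ht : 0 < t) :
    Summable (thetaTerm k τ φ t) := by
  refine LCc.induction_on (P := fun φ => Summable (thetaTerm k τ φ t)) φ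
    (fun a b r hr => ?_) (fun φ ψ hφ hψ => ?_) fun c φ hφ => ?_
  · rw [← (boxPt_injective hr).summable_iff fun v hv => ?_]
    · have hr' : 0 < (r : ℝ) ^ 2 * t :=
        mul_pos (by positivity) ht
      refine ((summable_thetaE k τ (a / r : ℚ) (b / r : ℚ) hr').mul_left ((r : ℂ) ^ k)).congr
        fun w => ?_
      exact (thetaTerm_boxPt k τ hr t w).symm
    · by_contra h
      exact hv (support_thetaTerm_box k τ hr t h)
  · exact (hφ.add hψ).congr fun v => (thetaTerm_add k τ φ ψ t v).symm
  · exact (hφ.mul_left (c : ℂ)).congr fun v => (thetaTerm_smul k τ c φ t v).symm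

theorem thetaFun_add (k : ℕ) (τ : ℍ) (φ ψ : LCc) {t : ℝ} (ht : 0 < t) :
    thetaFun k τ (φ + ψ) t = thetaFun k τ φ t + thetaFun k τ ψ t := by
  simp only [thetaFun, thetaTerm_add]
  exact (summable_thetaTerm k τ φ ht).tsum_add (summable_thetaTerm k τ ψ ht)

theorem mellinConvergent_congr {f g : ℝ → ℂ} {s : ℂ} (h : ∀ t, 0 < t → f t = g t)
    (hf : MellinConvergent f s) : MellinConvergent g s :=
  hf.congr_fun (fun t ht => by simp only [h t ht]) measurableSet_Ioi

theorem mellin_congr {f g : ℝ → ℂ} {s : ℂ} (h : ∀ t, 0 < t → f t = g t) :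
    mellin f s = mellin g s :=
  setIntegral_congr_fun measurableSet_Ioi fun t ht => by simp only [h t ht]

theorem mellinConvergent_thetaFun {k : ℕ} (hk : 1 ≤ k) (τ : ℍ) (φ : LCc) (s : ℂ) :
    MellinConvergent (thetaFun k τ φ) s := by
  refine LCc.induction_on (P := fun φ => MellinConvergent (thetaFun k τ φ) s) φ
    (fun a b r hr => ?_) (fun φ ψ hφ hψ => ?_) fun c φ hφ => ?_
  · have hr' : 0 < (r : ℝ) ^ 2 := by positivity
    have h := ((MellinConvergent.comp_mul_left hr').2
      (mellinConvergent_thetaE hk τ (a / r : ℚ) (b / r : ℚ) s)).const_smul ((r : ℂ) ^ k)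
    exact mellinConvergent_congr (fun t _ => (thetaFun_box k τ hr t).symm) h
  · exact mellinConvergent_congr (fun t ht => (thetaFun_add k τ φ ψ ht).symm)
      (hasMellin_add hφ hψ).1
  · exact mellinConvergent_congr (fun t _ => (thetaFun_smul k τ c φ t).symm)
      (hφ.const_smul (c : ℂ))

theorem eisFun_add {k : ℕ} (hk : 1 ≤ k) (s : ℕ) (φ ψ : LCc) :
    eisFun k s (φ + ψ) = eisFun k s φ + eisFun k s ψ := by
  funext τ
  rw [Pi.add_apply, eisFun, eisFun, eisFun, ← mul_add,
    mellin_congr fun t ht => thetaFun_add k τ φ ψ ht,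
    (hasMellin_add (mellinConvergent_thetaFun hk τ φ s) (mellinConvergent_thetaFun hk τ ψ s)).2]

theorem eisFun_smul (k s : ℕ) (c : ℤ) (φ : LCc) : eisFun k s (c • φ) = c • eisFun k s φ := by
  funext τ
  rw [Pi.smul_apply, eisFun, eisFun, mellin_congr fun t _ => thetaFun_smul k τ c φ t,
    mellin_const_smul, smul_eq_mul, zsmul_eq_mul]
  ring

theorem eisFun_box (k s : ℕ) {a b r : ℚ} (hr : r ≠ 0) (τ : ℍ) :
    eisFun k s (boxIndicator a b r hr) τ = (r : ℂ) ^ ((k : ℤ) - 2 * s) *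
      (normFac k τ * mellin (thetaE k τ (a / r : ℚ) (b / r : ℚ)) s) := by
  have hr' : 0 < (r : ℝ) ^ 2 := by positivity
  have hrC : (r : ℂ) ≠ 0 := by exact_mod_cast hr
  rw [eisFun, mellin_congr fun t _ => (thetaFun_box k τ hr t).trans (smul_eq_mul _ _).symm,
    mellin_const_smul, mellin_comp_mul_left _ _ hr', smul_eq_mul, smul_eq_mul,
    ← Nat.cast_two (R := ℤ),
    zpow_sub₀ hrC, zpow_natCast, ← Nat.cast_mul, zpow_natCast, Complex.cpow_neg,
    Complex.cpow_natCast, pow_mul]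
  push_cast
  field_simp

/-- At `s = k`, the function attached to a box is the series `E`. -/
theorem eisFun_box_E {k : ℕ} (hk : 1 ≤ k) {a b r : ℚ} (hr : r ≠ 0) :
    eisFun k k (boxIndicator a b r hr) = r ^ (-(k : ℤ)) • E k (a / r) (b / r) := by
  funext τ
  rw [eisFun_box, ← E_eq_mellin hk, Pi.smul_apply, Rat.smul_def]
  push_cast
  congr 2
  ring

/-- At `s = 1`, the function attached to a box is the series `F`. -/
theorem eisFun_box_F {k : ℕ} (hk : 1 ≤ k) {a b r : ℚ} (hr : r ≠ 0) :
    eisFun k 1 (boxIndicator a b r hr) = r ^ ((k : ℤ) - 2) • F k (a / r) (b / r) := by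
  funext τ
  have h : F k (a / r) (b / r) τ =
      normFac k τ * mellin (thetaE k τ (a / r : ℚ) (b / r : ℚ)) (1 : ℕ) := by
    rw [Nat.cast_one]; exact F_eq_mellin hk (a / r) (b / r) τ
  rw [eisFun_box, ← h, Pi.smul_apply, Rat.smul_def]
  push_cast
  rfl

/-- The substitution `v ↦ v g` in the sum over `v ∈ ℚ²`, for `g = (a, b; c, d)` and `τ' = gτ`. It
divides `xτ + y` by `cτ + d` and rescales the variable `t` of the Mellin transform by `det g`. -/
theorem eisFun_transform (k s : ℕ) {a b c d : ℚ} (hD : 0 < a * d - b * c) {φ ψ : LCc}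
    (h : ∀ v : ℚ × ℚ, ψ (ratPt v) = φ (ratPt (v.1 * a + v.2 * c, v.1 * b + v.2 * d)))
    {τ τ' : ℍ} (hJ : (c * τ + d : ℂ) ≠ 0) (hτ : (τ' : ℂ) = (a * τ + b) / (c * τ + d))
    (hτ' : τ'.im = ((a * d - b * c : ℚ) : ℝ) * τ.im / ‖(c * τ + d : ℂ)‖ ^ 2) :
    eisFun k s ψ τ' = ((a * d - b * c : ℚ) : ℂ) ^ ((s : ℤ) - k) * (c * τ + d : ℂ) ^ k *
      eisFun k s φ τ := by
  set D : ℚ := a * d - b * c with hDdef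
  set J : ℂ := c * τ + d with hJdef
  have hD' : (0 : ℝ) < D := by exact_mod_cast hD
  have hDC : (D : ℂ) ≠ 0 := by exact_mod_cast hD.ne'
  have hJn : 0 < ‖J‖ := norm_pos_iff.2 hJ
  have hJc : (starRingEnd ℂ) J ≠ 0 := by simpa using hJ
  -- the linear substitution of `ℚ²` given by the matrix
  let e : ℚ × ℚ ≃ ℚ × ℚ :=
    { toFun := fun v => (v.1 * a + v.2 * c, v.1 * b + v.2 * d)
      invFun := fun v => ((v.1 * d - v.2 * c) / D, (v.2 * a - v.1 * b) / D)
      left_inv := fun v => by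
        ext <;> simp only <;> rw [div_eq_iff hD.ne', hDdef] <;> ring
      right_inv := fun v => by
        ext <;> simp only <;> field_simp <;> rw [hDdef] <;> ring }
  have hlat : ∀ v, latQ τ' v = latQ τ (e v) / J := fun v => by
    change (v.1 : ℂ) * τ' + v.2 = (((v.1 * a + v.2 * c : ℚ) : ℂ) * τ +
      ((v.1 * b + v.2 * d : ℚ) : ℂ)) / J
    rw [hτ, eq_div_iff hJ, add_mul, mul_assoc, div_mul_cancel₀ _ hJ, hJdef]
    push_cast
    ring
  have hθ : ∀ t, thetaFun k τ' ψ t =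
      ((starRingEnd ℂ) J ^ k)⁻¹ • thetaFun k τ φ ((D : ℝ)⁻¹ * t) := by
    intro t
    rw [thetaFun, thetaFun, smul_eq_mul, ← tsum_mul_left, ← e.tsum_eq fun v =>
      ((starRingEnd ℂ) J ^ k)⁻¹ * thetaTerm k τ φ ((D : ℝ)⁻¹ * t) v]
    refine tsum_congr fun v => ?_
    have h1 : Real.pi / τ'.im * ‖latQ τ' v‖ ^ 2 =
        Real.pi / τ.im * ‖latQ τ (e v)‖ ^ 2 * (D : ℝ)⁻¹ := by
      have hy := τ.im_pos
      rw [hlat, norm_div, hτ']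
      field_simp
    rw [thetaTerm, thetaTerm, h1, hlat, h, map_div₀, div_pow]
    change ((φ (ratPt (e v)) : ℤ) : ℂ) * _ = _
    rw [← mul_assoc (-_ : ℝ) (D : ℝ)⁻¹ t, ← neg_mul]
    ring
  have hN : normFac k τ' = normFac k τ * ((D : ℂ) ^ k)⁻¹ * (J * (starRingEnd ℂ) J) ^ k := by
    rw [normFac, normFac, hτ', Complex.mul_conj, Complex.normSq_eq_norm_sq, ← mul_inv, ← mul_pow,
      ← inv_pow, ← inv_pow, ← mul_pow]
    congr 1
    have hy : (τ.im : ℂ) ≠ 0 := by exact_mod_cast τ.im_pos.ne'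
    have hJn' : ((‖J‖ : ℝ) : ℂ) ≠ 0 := by exact_mod_cast hJn.ne'
    push_cast
    field_simp
  have hM : mellin (thetaFun k τ' ψ) s = ((starRingEnd ℂ) J ^ k)⁻¹ * ((D : ℂ) ^ s *
      mellin (thetaFun k τ φ) s) := by
    rw [mellin_congr fun t _ => hθ t, mellin_const_smul,
      mellin_comp_mul_left _ _ (inv_pos.2 hD'), smul_eq_mul, smul_eq_mul, Complex.cpow_neg,
      Complex.cpow_natCast]
    push_cast
    rw [inv_pow, inv_inv]
  rw [eisFun, eisFun, hN, hM, zpow_sub₀ hDC, zpow_natCast, zpow_natCast, mul_pow]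
  field_simp

theorem IsPullback.ratPt {a b c d : ℚ} {φ ψ : LCc}
    (h : IsPullback ((!![a, b; c, d] : Matrix (Fin 2) (Fin 2) ℚ).map ratAdele) φ ψ) (v : ℚ × ℚ) :
    ψ (ratPt v) = φ (EisDist.ratPt (v.1 * a + v.2 * c, v.1 * b + v.2 * d)) := by
  rw [h]
  congr 1
  funext i
  rw [vecMul_two]
  fin_cases i
  · change ratAdele v.1 * ratAdele a + ratAdele v.2 * ratAdele c = ratAdele _
    rw [map_add, map_mul, map_mul]
  · change ratAdele v.1 * ratAdele b + ratAdele v.2 * ratAdele d = ratAdele _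
    rw [map_add, map_mul, map_mul]

theorem ratStar_apply (k : ℕ) (f : ℍ → ℂ) {g : GL (Fin 2) ℚ}
    (hg : 0 < (g : Matrix (Fin 2) (Fin 2) ℚ).det) (τ : ℍ) :
    ratStar k f g τ = f ((g.map (algebraMap ℚ ℝ) : GL (Fin 2) ℝ) • τ) *
      (((g : Matrix (Fin 2) (Fin 2) ℚ) 1 0 * τ + (g : Matrix (Fin 2) (Fin 2) ℚ) 1 1 : ℂ) ^ k)⁻¹ := by
  have hdet : ((g.map (algebraMap ℚ ℝ) : GL (Fin 2) ℝ).det : ℝ) =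
      ((g : Matrix (Fin 2) (Fin 2) ℚ).det : ℝ) := by
    change ((g : Matrix (Fin 2) (Fin 2) ℚ).map (algebraMap ℚ ℝ)).det = _
    exact (RingHom.map_det (algebraMap ℚ ℝ) _).symm
  have hpos : (0 : ℝ) < ((g : Matrix (Fin 2) (Fin 2) ℚ).det : ℝ) := by exact_mod_cast hg
  have hC : ((g : Matrix (Fin 2) (Fin 2) ℚ).det : ℂ) ≠ 0 := by exact_mod_cast hg.ne'
  rw [ratStar, Pi.smul_apply, ModularForm.slash_apply, hdet, UpperHalfPlane.σ, if_pos (by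
    rw [hdet]; exact hpos), abs_of_pos hpos, zpow_neg, zpow_natCast, smul_eq_mul]
  rw [show (1 - (k : ℤ)) = -((k : ℤ) - 1) by ring, zpow_neg]
  have hden : UpperHalfPlane.denom (g.map (algebraMap ℚ ℝ) : GL (Fin 2) ℝ) τ =
      (g : Matrix (Fin 2) (Fin 2) ℚ) 1 0 * τ + (g : Matrix (Fin 2) (Fin 2) ℚ) 1 1 := by
    rw [UpperHalfPlane.denom]
    simp
  rw [hden]
  rw [Rat.cast_inv, Rat.cast_zpow, Complex.ofReal_ratCast, ContinuousAlgEquiv.refl_apply]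
  field_simp

/-- The transformation of the Eisenstein series under rational matrices: the determinant occurs
with exponent `s - k`. -/
theorem ratStar_eisFun (k s : ℕ) {g : GL (Fin 2) ℚ} (hg : 0 < (g : Matrix (Fin 2) (Fin 2) ℚ).det)
    {φ ψ : LCc} (h : IsPullback ((g : Matrix (Fin 2) (Fin 2) ℚ).map ratAdele) φ ψ) :
    ratStar k (eisFun k s ψ) g =
      (g : Matrix (Fin 2) (Fin 2) ℚ).det ^ ((s : ℤ) - k) • eisFun k s φ := by
  funext τ
  have hdet : ((g.map (algebraMap ℚ ℝ) : GL (Fin 2) ℝ).det : ℝ) =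
      ((g : Matrix (Fin 2) (Fin 2) ℚ).det : ℝ) := by
    change ((g : Matrix (Fin 2) (Fin 2) ℚ).map (algebraMap ℚ ℝ)).det = _
    exact (RingHom.map_det (algebraMap ℚ ℝ) _).symm
  have hpos : (0 : ℝ) < ((g : Matrix (Fin 2) (Fin 2) ℚ).det : ℝ) := by exact_mod_cast hg
  have hden : UpperHalfPlane.denom (g.map (algebraMap ℚ ℝ) : GL (Fin 2) ℝ) τ =
      (g : Matrix (Fin 2) (Fin 2) ℚ) 1 0 * τ + (g : Matrix (Fin 2) (Fin 2) ℚ) 1 1 := by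
    rw [UpperHalfPlane.denom]
    simp
  have hnum : UpperHalfPlane.num (g.map (algebraMap ℚ ℝ) : GL (Fin 2) ℝ) τ =
      (g : Matrix (Fin 2) (Fin 2) ℚ) 0 0 * τ + (g : Matrix (Fin 2) (Fin 2) ℚ) 0 1 := by
    rw [UpperHalfPlane.num]
    simp
  have hJ := UpperHalfPlane.denom_ne_zero (g.map (algebraMap ℚ ℝ) : GL (Fin 2) ℝ) τ
  rw [hden] at hJ
  rw [ratStar_apply k _ hg, Pi.smul_apply, Rat.smul_def]
  rw [Matrix.eta_fin_two (g : Matrix (Fin 2) (Fin 2) ℚ)] at h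
  have hD := Matrix.det_fin_two (g : Matrix (Fin 2) (Fin 2) ℚ)
  rw [eisFun_transform k s (τ := τ) (by rw [← hD]; exact hg) h.ratPt hJ, ← hD]
  · push_cast
    field_simp
  · rw [UpperHalfPlane.coe_smul_of_det_pos (by rw [hdet]; exact hpos), hden, hnum]
  · rw [UpperHalfPlane.im_smul_eq_div_normSq, hdet, abs_of_pos hpos, hden, hD,
      Complex.normSq_eq_norm_sq]

theorem ratStar_mapGL (k : ℕ) (f : ℍ → ℂ) (s : SL(2, ℤ)) :
    ratStar k f (Matrix.SpecialLinearGroup.mapGL ℚ s) = f ∣[(k : ℤ)] s := by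
  have h1 : ((Matrix.SpecialLinearGroup.mapGL ℚ s : GL (Fin 2) ℚ) :
      Matrix (Fin 2) (Fin 2) ℚ).det = 1 :=
    (Matrix.SpecialLinearGroup.map (algebraMap ℤ ℚ) s).2
  rw [ratStar, h1, one_zpow, Rat.cast_one, one_smul, ModularForm.SL_slash]
  exact congrArg (fun g : GL (Fin 2) ℝ => f ∣[(k : ℤ)] g)
    (Matrix.SpecialLinearGroup.map_mapGL (R := ℤ) (S := ℚ) (T := ℝ) s)

theorem mapGL_map_ratAdele (s : SL(2, ℤ)) :
    ((Matrix.SpecialLinearGroup.mapGL ℚ s : GL (Fin 2) ℚ) :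
      Matrix (Fin 2) (Fin 2) ℚ).map ratAdele = intMatrix s := by
  ext i j : 1
  simp [intMatrix]

/-! ### The Haar measure -/

instance measurableSpaceX : MeasurableSpace X := borel X

instance borelSpaceX : BorelSpace X := ⟨rfl⟩

theorem haarIntegral_eq (φ : LCc) :
    haarIntegral φ = ∫ x : X, (φ x : ℝ) ∂(Measure.addHaar : Measure X) := rfl

theorem LCc.continuous_real (φ : LCc) : Continuous fun x : X => (φ x : ℝ) :=
  (φ.1.isLocallyConstant.comp fun n : ℤ => (n : ℝ)).continuous

theorem LCc.hasCompactSupport_real (φ : LCc) : HasCompactSupport fun x : X => (φ x : ℝ) :=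
  HasCompactSupport.comp_left (g := fun n : ℤ => (n : ℝ)) φ.2 Int.cast_zero

theorem LCc.integrable (φ : LCc) :
    Integrable (fun x : X => (φ x : ℝ)) (Measure.addHaar : Measure X) :=
  (LCc.continuous_real φ).integrable_of_hasCompactSupport (LCc.hasCompactSupport_real φ)

theorem haarIntegral_add (φ ψ : LCc) :
    haarIntegral (φ + ψ) = haarIntegral φ + haarIntegral ψ := by
  simp only [haarIntegral_eq, LCc.add_apply, Int.cast_add]
  exact integral_add (LCc.integrable φ) (LCc.integrable ψ)

theorem haarIntegral_smul (c : ℤ) (φ : LCc) : haarIntegral (c • φ) = c * haarIntegral φ := by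
  simp only [haarIntegral_eq, LCc.smul_apply, Int.cast_mul]
  exact integral_const_mul _ _

theorem haarIntegral_sum {ι : Type*} (s : Finset ι) (f : ι → LCc) :
    haarIntegral (∑ i ∈ s, f i) = ∑ i ∈ s, haarIntegral (f i) := by
  classical
  induction s using Finset.induction_on with
  | empty => simpa using haarIntegral_smul 0 0
  | insert i s hi ih => rw [Finset.sum_insert hi, Finset.sum_insert hi, haarIntegral_add, ih]

theorem haarIntegral_translate {φ ψ : LCc} (y : X) (h : ∀ x, ψ x = φ (x + y)) :
    haarIntegral ψ = haarIntegral φ := by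
  simp only [haarIntegral_eq, h]
  exact integral_add_right_eq_self (fun x => (φ x : ℝ)) y

/-- Linear substitutions multiply the Haar integral by a constant. -/
theorem exists_haarIntegral_isPullback {A : Matrix (Fin 2) (Fin 2) Adele} (hA : IsUnit A.det) :
    ∃ κ : ℝ, ∀ φ ψ : LCc, IsPullback A φ ψ → haarIntegral ψ = κ * haarIntegral φ := by
  obtain ⟨u, hu⟩ := (Matrix.isUnit_iff_isUnit_det A).2 hA
  let e : X ≃+ X := { (mulRight u).toEquiv with map_add' := fun x y => Matrix.add_vecMul _ x y }
  have he : ∀ x, e x = Matrix.vecMul x A := fun x => by rw [← hu]; rfl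
  have hcont : Continuous e := (mulRight u).continuous
  have hmap : Measure.IsAddHaarMeasure (Measure.map e (Measure.addHaar : Measure X)) :=
    e.isAddHaarMeasure_map _ hcont (mulRight u).symm.continuous
  refine ⟨Measure.addHaarScalarFactor (Measure.map e (Measure.addHaar : Measure X))
    Measure.addHaar, fun φ ψ h => ?_⟩
  have h1 : haarIntegral ψ = ∫ x, (φ x : ℝ) ∂(Measure.map e (Measure.addHaar : Measure X)) := by
    rw [integral_map hcont.aemeasurable ((LCc.continuous_real φ).stronglyMeasurable_of_hasCompactSupport
      (LCc.hasCompactSupport_real φ)).aestronglyMeasurable, haarIntegral_eq]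
    simp only [h _, he]
  rw [h1, Measure.integral_isAddLeftInvariant_eq_smul_of_hasCompactSupport _ Measure.addHaar
    (LCc.continuous_real φ) (LCc.hasCompactSupport_real φ), integral_smul_nnreal_measure]
  rfl

/-- The characteristic function of `Ẑ²`. -/
def unitBox : LCc := boxIndicator 0 0 1 one_ne_zero

theorem unitBox_apply_eq_one_iff (x : X) : unitBox x = 1 ↔ ∀ i, InZhat (x i) := by
  classical
  rw [unitBox, boxIndicator_apply, map_zero, sub_zero, sub_zero, memMul_one_iff, memMul_one_iff,
    Fin.forall_fin_two]
  split_ifs with h <;> simp [h]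

theorem haarIntegral_unitBox_pos : 0 < haarIntegral unitBox := by
  classical
  rw [haarIntegral_eq]
  refine (LCc.continuous_real unitBox).integral_pos_of_hasCompactSupport_nonneg_nonzero
    (LCc.hasCompactSupport_real unitBox) (fun x => ?_) (x := 0) ?_
  · rw [unitBox, boxIndicator_apply]
    split_ifs <;> simp
  · rw [(unitBox_apply_eq_one_iff 0).2 fun _ => inZhat_zero]
    simp

/-- The Haar integral, normalised so that `Ẑ²` has volume `1`. -/
def vol (φ : LCc) : ℝ := haarIntegral φ / haarIntegral unitBox

theorem vol_add (φ ψ : LCc) : vol (φ + ψ) = vol φ + vol ψ := by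
  rw [vol, haarIntegral_add, add_div]; rfl

theorem vol_smul (c : ℤ) (φ : LCc) : vol (c • φ) = c * vol φ := by
  rw [vol, haarIntegral_smul, mul_div_assoc]; rfl

theorem vol_unitBox : vol unitBox = 1 := div_self haarIntegral_unitBox_pos.ne'

/-- A linear substitution multiplies all volumes by that of the preimage of `Ẑ²`. -/
theorem vol_isPullback {A : Matrix (Fin 2) (Fin 2) Adele} (hA : IsUnit A.det) {φ ψ χ : LCc}
    (h : IsPullback A φ ψ) (hχ : IsPullback A unitBox χ) : vol ψ = vol χ * vol φ := by
  obtain ⟨κ, hκ⟩ := exists_haarIntegral_isPullback hA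
  have h0 := haarIntegral_unitBox_pos.ne'
  rw [vol, vol, vol, hκ φ ψ h, hκ _ χ hχ]
  field_simp

theorem vol_eq_zero_of_isPullback {A : Matrix (Fin 2) (Fin 2) Adele} (hA : IsUnit A.det)
    {φ ψ : LCc} (h : IsPullback A φ ψ) (h0 : haarIntegral φ = 0) : vol ψ = 0 := by
  obtain ⟨κ, hκ⟩ := exists_haarIntegral_isPullback hA
  rw [vol, hκ φ ψ h, h0, mul_zero, zero_div]

theorem vol_box_eq (a b : ℚ) {r : ℚ} (hr : r ≠ 0) :
    vol (boxIndicator a b r hr) = vol (boxIndicator 0 0 r hr) := by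
  classical
  rw [vol, vol, haarIntegral_translate ![-ratAdele a, -ratAdele b] fun x => ?_]
  rw [boxIndicator_apply, boxIndicator_apply, map_zero, sub_zero, sub_zero, sub_eq_add_neg,
    sub_eq_add_neg]
  rfl

open Classical in
/-- The group `rẐ` is the disjoint union of the cosets `ri + rnẐ` for `0 ≤ i < n`. -/
theorem ite_memMul_eq_sum {r : ℚ} (hr : r ≠ 0) {n : ℕ} (hn : 1 ≤ n) (x : Adele) :
    (if MemMul r x then 1 else 0 : ℤ) =
      ∑ i ∈ Finset.range n, if MemMul (r * n) (x - ratAdele (r * i)) then 1 else 0 := by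
  have hn0 : (n : ℚ) ≠ 0 := by exact_mod_cast (by omega : n ≠ 0)
  have key : ∀ i : ℕ, MemMul (r * n) (x - ratAdele (r * i)) ↔
      MemMul n (ratAdele r⁻¹ * x - ratAdele i) := fun i => by
    rw [← memMul_mul_iff hr (r := n), mul_sub, ← mul_assoc, ← map_mul, ← map_mul,
      mul_inv_cancel₀ hr, map_one, one_mul]
  have hI : ∀ n : ℕ, InZhat (ratAdele n) := fun n => by exact_mod_cast inZhat_int n
  simp only [key]
  by_cases hx : MemMul r x
  · obtain ⟨i, hi, h⟩ := InZhat.exists_nat hx hn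
    rw [if_pos hx, Finset.sum_eq_single i, if_pos h]
    · intro j hj hne
      refine if_neg fun hj' => hne ?_
      have h1 := h.sub hj'
      rw [sub_sub_sub_cancel_left, ← map_sub] at h1
      have h2 : MemMul n (ratAdele ((j - i : ℤ) : ℚ)) := by push_cast; exact h1
      have h3 := Int.eq_zero_of_abs_lt_dvd ((memMul_natCast_iff hn _).1 h2)
        (by rw [abs_lt]; have := Finset.mem_range.1 hj; constructor <;> omega)
      omega
    · intro h; exact absurd (Finset.mem_range.2 hi) h
  · rw [if_neg hx, Finset.sum_eq_zero]
    intro i _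
    refine if_neg fun h => hx ?_
    obtain ⟨t, ht, h'⟩ := (memMul_sub_iff hn0).1 h
    unfold MemMul
    rw [h']
    exact (hI i).add ((hI n).mul ht)

/-- Subdivision of a box into `n²` boxes. -/
theorem boxIndicator_eq_sum {r : ℚ} (hr : r ≠ 0) {n : ℕ} (hn : 1 ≤ n) (hrn : r * n ≠ 0) :
    boxIndicator 0 0 r hr = ∑ i ∈ Finset.range n, ∑ j ∈ Finset.range n,
      boxIndicator (r * i) (r * j) (r * n) hrn := by
  classical
  refine LCc.ext fun x => ?_
  have hite : ∀ p q : Prop, (if p ∧ q then 1 else 0 : ℤ) =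
      (if p then 1 else 0) * (if q then 1 else 0) := fun p q => by
    by_cases hp : p <;> by_cases hq : q <;> simp [hp, hq]
  simp only [LCc.sum_apply, boxIndicator_apply, hite, map_zero, sub_zero]
  rw [ite_memMul_eq_sum hr hn, ite_memMul_eq_sum hr hn (x 1), Finset.sum_mul_sum]

theorem vol_box_mul {r : ℚ} (hr : r ≠ 0) {n : ℕ} (hn : 1 ≤ n) (hrn : r * n ≠ 0) :
    vol (boxIndicator 0 0 r hr) = (n : ℝ) ^ 2 * vol (boxIndicator 0 0 (r * n) hrn) := by
  rw [vol, boxIndicator_eq_sum hr hn hrn]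
  simp only [haarIntegral_sum, Finset.sum_div]
  have h : ∀ i j : ℕ, haarIntegral (boxIndicator (r * i) (r * j) (r * n) hrn) /
      haarIntegral unitBox = vol (boxIndicator 0 0 (r * n) hrn) := fun i j => vol_box_eq _ _ hrn
  simp only [h, Finset.sum_const, Finset.card_range, nsmul_eq_mul]
  ring

/-- For `r > 0`, the box of side `1 / den r` is subdivided into boxes of side `1` and into boxes of
side `r`; comparing the two gives the volume. -/
theorem vol_box (a b : ℚ) {r : ℚ} (hr : r ≠ 0) :
    vol (boxIndicator a b r hr) = ((r : ℝ) ^ 2)⁻¹ := by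
  rw [vol_box_eq]
  have hpos : ∀ {r : ℚ} (hr : r ≠ 0), 0 < r →
      vol (boxIndicator 0 0 r hr) = ((r : ℝ) ^ 2)⁻¹ := by
    intro r hr hr0
    have hd : (r.den : ℚ) ≠ 0 := by exact_mod_cast r.den_nz
    have hn1 : 1 ≤ r.num.natAbs := by
      have := Rat.num_pos.2 hr0
      omega
    have hn : (r.num.natAbs : ℚ) = r.num := by
      rw [Nat.cast_natAbs, abs_of_pos (Rat.num_pos.2 hr0)]
    have e1 : (r.den : ℚ)⁻¹ * r.den = 1 := inv_mul_cancel₀ hd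
    have e2 : (r.den : ℚ)⁻¹ * r.num.natAbs = r := by
      rw [hn, mul_comm, ← div_eq_mul_inv, Rat.num_div_den]
    have h1 := vol_box_mul (inv_ne_zero hd) r.den_pos (by rw [e1]; exact one_ne_zero)
    have h2 := vol_box_mul (inv_ne_zero hd) hn1 (by rw [e2]; exact hr)
    simp only [e1, e2] at h1 h2
    have h3 : vol (boxIndicator 0 0 1 one_ne_zero) = 1 := vol_unitBox
    rw [h1, h3, mul_one] at h2
    have h4 : (r : ℝ) = r.num.natAbs / r.den := by
      have : (r : ℝ) = (((r.den : ℚ)⁻¹ * r.num.natAbs : ℚ) : ℝ) := by rw [e2]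
      rw [this]; push_cast; ring
    have h5 : (r.num.natAbs : ℝ) ≠ 0 := by exact_mod_cast (by omega : r.num.natAbs ≠ 0)
    have h6 : (r.den : ℝ) ≠ 0 := by exact_mod_cast r.den_nz
    rw [h4]
    field_simp
    linear_combination -h2
  rcases lt_or_gt_of_ne hr with h | h
  · have e : boxIndicator 0 0 r hr = boxIndicator 0 0 (-r) (neg_ne_zero.2 hr) := by
      classical
      refine LCc.ext fun x => ?_
      simp only [boxIndicator_apply, memMul_neg_left]
    rw [e, hpos _ (neg_pos.2 h)]
    push_cast
    rw [neg_sq]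
  · exact hpos hr h

/-! ### The two distributions -/

theorem one_eq_diag : (1 : Matrix (Fin 2) (Fin 2) Adele) = !![1, 0; 0, 1] := by
  rw [Matrix.one_fin_two]

theorem isUnitZhat_one : IsUnitZhat 1 := fun _ => norm_one

/-- An equivariant family of functions takes its values in modular forms. -/
theorem exists_dist {k : ℕ} (Z : LCc →ₗ[ℤ] (ℍ → ℂ)) (hSL : IsSLEquivariant k Z)
    (hGal : IsGalEquivariant Z) : ∃ μ : Dist k, ∀ φ, (μ φ : ℍ → ℂ) = Z φ := by
  have hq : ∀ φ, HasCyclCoeffs (Z φ) := fun φ => by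
    obtain ⟨σ, hσ⟩ := exists_isCyclAut isUnitZhat_one
    refine (hGal 1 σ isUnitZhat_one hσ φ φ fun x => ?_).hasCyclCoeffs
    rw [← one_eq_diag, Matrix.vecMul_one]
  have hmem : ∀ φ, Z φ ∈ Mcong k := fun φ => by
    obtain ⟨N, hN, hinv⟩ := hSL.exists_invariant φ
    refine ⟨isCongModularForm_of_slash hN hinv fun γ => ?_, hq φ⟩
    obtain ⟨ψ, hψ⟩ := exists_isPullback (isUnit_det_of_eq_one (intMatrix_det γ⁻¹)) φ
    have h1 := hSL γ⁻¹ φ ψ hψ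
    rw [← h1, ← SlashAction.slash_mul, inv_mul_cancel, SlashAction.slash_one]
    exact hq ψ
  exact ⟨{ toFun := fun φ => ⟨Z φ, hmem φ⟩
           map_add' := fun φ ψ => Subtype.ext (map_add Z φ ψ)
           map_smul' := fun c φ => Subtype.ext (map_smul Z c φ) }, fun φ => rfl⟩

theorem IsPullback.add {A : Matrix (Fin 2) (Fin 2) Adele} {φ φ' ψ ψ' : LCc}
    (h : IsPullback A φ ψ) (h' : IsPullback A φ' ψ') : IsPullback A (φ + φ') (ψ + ψ') := fun x => by
  rw [LCc.add_apply, LCc.add_apply, h, h']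

theorem IsPullback.smul {A : Matrix (Fin 2) (Fin 2) Adele} {φ ψ : LCc} (c : ℤ)
    (h : IsPullback A φ ψ) : IsPullback A (c • φ) (c • ψ) := fun x => by
  rw [LCc.smul_apply, LCc.smul_apply, h]

/-- By linearity, Galois equivariance may be checked on characteristic functions of boxes. -/
theorem isGalEquivariant_of_box (Z : LCc →ₗ[ℤ] (ℍ → ℂ))
    (h : ∀ (d : Adele) (σ : Qcycl ≃ₐ[ℚ] Qcycl), IsUnitZhat d → IsCyclAut d σ →
      ∀ (a b r : ℚ) (hr : r ≠ 0) (ψ : LCc),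
        IsPullback !![1, 0; 0, d] (boxIndicator a b r hr) ψ →
        GalRel σ (Z ψ) (Z (boxIndicator a b r hr))) : IsGalEquivariant Z := by
  intro d σ hd hσ φ
  have hu := isUnit_det_diag hd
  refine LCc.induction_on (P := fun φ => ∀ ψ, IsPullback !![1, 0; 0, d] φ ψ →
    GalRel σ (Z ψ) (Z φ)) φ (fun a b r hr ψ hψ => h d σ hd hσ a b r hr ψ hψ) ?_ ?_
  · intro φ φ' hφ hφ' ψ hψ
    obtain ⟨χ, hχ⟩ := exists_isPullback hu φ
    obtain ⟨χ', hχ'⟩ := exists_isPullback hu φ'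
    rw [hψ.unique (hχ.add hχ'), map_add, map_add]
    exact (hφ χ hχ).add (hφ' χ' hχ')
  · intro c φ hφ ψ hψ
    obtain ⟨χ, hχ⟩ := exists_isPullback hu φ
    rw [hψ.unique (hχ.smul c), map_smul, map_smul]
    have := (hφ χ hχ).rat_smul c
    simpa only [Int.cast_smul_eq_zsmul] using this

/-- The pullback of a box under `(1, 0; 0, d)` is a box `(a + rẐ) × (b' + rẐ)`, where
`b / r` is congruent to `d b' / r` modulo `Ẑ`. -/
theorem exists_isPullback_diag_box {d : Adele} (hd : IsUnitZhat d) (a b : ℚ) {r : ℚ}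
    (hr : r ≠ 0) {ψ : LCc} (h : IsPullback !![1, 0; 0, d] (boxIndicator a b r hr) ψ) :
    ∃ b' : ℚ, ψ = boxIndicator a b' r hr ∧ MemMul r (ratAdele b - d * ratAdele b') := by
  classical
  obtain ⟨d', hd', hdd⟩ := hd.exists_inv
  obtain ⟨b', hb'⟩ := exists_rat_memMul hr (d' * ratAdele b)
  have hb : MemMul r (ratAdele b - d * ratAdele b') := by
    have := hb'.mul hd.inZhat
    convert this using 1
    linear_combination (-ratAdele b) * hdd
  refine ⟨b', LCc.ext fun x => ?_, hb⟩
  rw [h, boxIndicator_apply, boxIndicator_apply]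
  have e0 : Matrix.vecMul x !![1, 0; 0, d] 0 = x 0 := by rw [vecMul_two]; simp
  have e1 : Matrix.vecMul x !![1, 0; 0, d] 1 = x 1 * d := by rw [vecMul_two]; simp
  rw [e0, e1]
  refine if_congr (and_congr Iff.rfl ⟨fun h => ?_, fun h => ?_⟩) rfl rfl
  · have := (h.mul hd'.inZhat).add hb'
    convert this using 1
    linear_combination (-x 1) * hdd
  · have := (h.mul hd.inZhat).sub hb
    convert this using 1
    ring

/-- Reduction of Galois equivariance on boxes to the functions attached to `N`-torsion points. -/
theorem galRel_box {G : ℚ → ℚ → ℍ → ℂ} (hper : ∀ (α β : ℚ) (m n : ℤ), G (α + n) (β + m) = G α β)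
    (hG : ∀ (σ : Qcycl ≃ₐ[ℚ] Qcycl) (N m : ℕ), 1 ≤ N → m.Coprime N →
      (∀ ζ : Qcycl, ζ ^ N = 1 → σ ζ = ζ ^ m) → ∀ a b : ℤ,
      GalRel σ (G (a / N) (b / N)) (G (a / N) (m * (b / N))))
    {Z : LCc →ₗ[ℤ] (ℍ → ℂ)} {e : ℤ}
    (hZ : ∀ (a b r : ℚ) (hr : r ≠ 0), Z (boxIndicator a b r hr) = r ^ e • G (a / r) (b / r)) :
    IsGalEquivariant Z := by
  refine isGalEquivariant_of_box Z fun d σ hd hσ a b r hr ψ hψ => ?_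
  obtain ⟨b', rfl, hb⟩ := exists_isPullback_diag_box hd a b hr hψ
  rw [hZ, hZ]
  refine GalRel.rat_smul _ ?_
  obtain ⟨N, A, B, hN, hA, hB⟩ := exists_common_denom (a / r) (b' / r)
  have hN0 : (N : ℚ) ≠ 0 := by exact_mod_cast (by omega : N ≠ 0)
  obtain ⟨m, -, hm⟩ := hd.inZhat.exists_nat hN
  have h1 : MemMul r (ratAdele (b - m * b')) := by
    obtain ⟨t, ht, hdm⟩ := (memMul_sub_iff hN0).1 hm
    have h2 : MemMul r (ratAdele (N * b') * t) := by
      refine MemMul.mul ((memMul_rat_iff hr _).2 ⟨B, ?_⟩) ht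
      rw [div_eq_div_iff hr hN0] at hB
      linear_combination hB
    have := hb.add h2
    convert this using 1
    rw [map_sub, map_mul, map_mul, hdm]
    ring
  obtain ⟨n, hn⟩ := (memMul_rat_iff hr _).1 h1
  have h3 : b / r = m * (B / N) + n := by
    rw [← hB, div_eq_iff hr]
    field_simp
    linear_combination hn
  have h4 := hG σ N m hN (hd.coprime hN hm)
    (fun ζ hζ => hσ N hN m ((memMul_sub_iff hN0).1 hm) ζ hζ) A B
  have h5 := hper (a / r) (m * (B / N)) n 0
  rw [Int.cast_zero, add_zero] at h5
  rw [h3, h5, hB, hA]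
  exact h4

/-- Elements of `GL₂(Ẑ)` preserve `Ẑ²`. -/
theorem unitBox_isPullback {A B : Matrix (Fin 2) (Fin 2) Adele} (hA : ∀ i j, InZhat (A i j))
    (hB : ∀ i j, InZhat (B i j)) (hAB : A * B = 1) : IsPullback A unitBox unitBox := by
  have key : ∀ (M : Matrix (Fin 2) (Fin 2) Adele), (∀ i j, InZhat (M i j)) → ∀ x : X,
      (∀ i, InZhat (x i)) → ∀ i, InZhat (Matrix.vecMul x M i) := by
    intro M hM x hx i
    rw [vecMul_two]
    exact ((hx 0).mul (hM 0 i)).add ((hx 1).mul (hM 1 i))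
  have hval : ∀ x y : X, ((∀ i, InZhat (x i)) ↔ ∀ i, InZhat (y i)) → unitBox x = unitBox y := by
    classical
    intro x y hxy
    rw [Fin.forall_fin_two, Fin.forall_fin_two] at hxy
    rw [unitBox, boxIndicator_apply, boxIndicator_apply, map_zero, sub_zero, sub_zero, sub_zero,
      sub_zero]
    simp only [memMul_one_iff]
    exact if_congr hxy rfl rfl
  intro x
  refine hval _ _ ⟨key A hA x, fun h => ?_⟩
  have := key B hB _ h
  rwa [Matrix.vecMul_vecMul, hAB, Matrix.vecMul_one] at this

theorem intMatrix_mul_inv (s : SL(2, ℤ)) : intMatrix s * intMatrix s⁻¹ = 1 := by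
  have h : ∀ s : SL(2, ℤ), intMatrix s =
      (s : Matrix (Fin 2) (Fin 2) ℤ).map (ratAdele.comp (Int.castRingHom ℚ)) := fun s => rfl
  rw [h, h, ← Matrix.map_mul, ← Matrix.SpecialLinearGroup.coe_mul, mul_inv_cancel,
    Matrix.SpecialLinearGroup.coe_one, Matrix.map_one _ (map_zero _) (map_one _)]

theorem unitBox_isPullback_intMatrix (s : SL(2, ℤ)) : IsPullback (intMatrix s) unitBox unitBox :=
  unitBox_isPullback (intMatrix_integral s) (intMatrix_integral s⁻¹) (intMatrix_mul_inv s)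

/-- For integral matrices of determinant `1` the factor in `ratStar_eisFun` is `1`. -/
theorem isSLEquivariant_eisFun (k j : ℕ) : IsSLEquivariant k (eisFun k j) := by
  intro s φ ψ h
  have h1 : ((Matrix.SpecialLinearGroup.mapGL ℚ s : GL (Fin 2) ℚ) :
      Matrix (Fin 2) (Fin 2) ℚ).det = 1 :=
    (Matrix.SpecialLinearGroup.map (algebraMap ℤ ℚ) s).2
  have h2 := ratStar_eisFun k j (g := Matrix.SpecialLinearGroup.mapGL ℚ s)
    (by rw [h1]; exact one_pos) (φ := φ) (ψ := ψ) (by rw [mapGL_map_ratAdele]; exact h)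
  rwa [ratStar_mapGL, h1, one_zpow, one_smul] at h2

/-- The distribution attached to the series `E`, corrected by the Haar measure in weight `2`. -/
def distE {k : ℕ} (hk : 1 ≤ k) : LCc →ₗ[ℤ] (ℍ → ℂ) where
  toFun φ := eisFun k k φ - if k = 2 then (vol φ : ℂ) • eisFun 2 2 unitBox else 0
  map_add' φ ψ := by
    rw [eisFun_add hk, vol_add, Complex.ofReal_add, add_smul]
    split_ifs
    · abel
    · simp
  map_smul' c φ := by
    rw [eisFun_smul, vol_smul, RingHom.id_apply, smul_sub]
    split_ifs
    · rw [Complex.ofReal_mul, mul_smul, Complex.ofReal_intCast, Int.cast_smul_eq_zsmul]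
    · simp

/-- The distribution attached to the series `F`, corrected at the origin in weight `2`. -/
def distF {k : ℕ} (hk : 1 ≤ k) : LCc →ₗ[ℤ] (ℍ → ℂ) where
  toFun φ := eisFun k 1 φ - if k = 2 then φ 0 • eisFun 2 1 unitBox else 0
  map_add' φ ψ := by
    rw [eisFun_add hk, LCc.add_apply, add_smul]
    split_ifs
    · abel
    · simp
  map_smul' c φ := by
    rw [eisFun_smul, LCc.smul_apply, RingHom.id_apply, smul_sub]
    split_ifs
    · rw [mul_smul]
    · simp

theorem distE_apply {k : ℕ} (hk : 1 ≤ k) (φ : LCc) : distE hk φ =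
    eisFun k k φ - if k = 2 then (vol φ : ℂ) • eisFun 2 2 unitBox else 0 := rfl

theorem distF_apply {k : ℕ} (hk : 1 ≤ k) (φ : LCc) : distF hk φ =
    eisFun k 1 φ - if k = 2 then φ 0 • eisFun 2 1 unitBox else 0 := rfl

theorem eisFun_unitBox_E : eisFun 2 2 unitBox = E 2 0 0 := by
  rw [unitBox, eisFun_box_E one_le_two]
  simp

theorem eisFun_unitBox_F : eisFun 2 1 unitBox = F 2 0 0 := by
  rw [unitBox, eisFun_box_F one_le_two]
  simp

theorem distE_box {k : ℕ} (hk : 1 ≤ k) (a b r : ℚ) (hr : r ≠ 0) :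
    distE hk (boxIndicator a b r hr) = r ^ (-(k : ℤ)) • regE k (a / r) (b / r) := by
  rw [distE_apply, eisFun_box_E hk, vol_box, eisFun_unitBox_E]
  funext τ
  by_cases h2 : k = 2
  · subst h2
    simp only [if_true, regE, Pi.sub_apply, Pi.smul_apply, Rat.smul_def, smul_eq_mul]
    push_cast
    rw [mul_sub, zpow_neg]
    norm_cast
  · simp only [if_neg h2, regE, sub_zero, Pi.smul_apply]

theorem zero_mem_box_iff {a b r : ℚ} (hr : r ≠ 0) :
    (MemMul r ((0 : X) 0 - ratAdele a) ∧ MemMul r ((0 : X) 1 - ratAdele b)) ↔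
      (∃ n : ℤ, a / r = n) ∧ ∃ n : ℤ, b / r = n := by
  have h : ∀ a : ℚ, MemMul r (0 - ratAdele a) ↔ ∃ n : ℤ, a / r = n := fun a => by
    rw [zero_sub]
    constructor
    · intro h
      obtain ⟨n, hn⟩ := (memMul_rat_iff hr a).1 (by simpa using h.neg)
      exact ⟨n, by rw [hn, mul_div_cancel_left₀ _ hr]⟩
    · rintro ⟨n, hn⟩
      exact ((memMul_rat_iff hr a).2 ⟨n, by rw [← hn, mul_div_cancel₀ _ hr]⟩).neg
  exact and_congr (h a) (h b)

theorem distF_box {k : ℕ} (hk : 1 ≤ k) (a b r : ℚ) (hr : r ≠ 0) :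
    distF hk (boxIndicator a b r hr) = r ^ ((k : ℤ) - 2) • regF k (a / r) (b / r) := by
  classical
  rw [distF_apply, eisFun_box_F hk, boxIndicator_apply, eisFun_unitBox_F]
  funext τ
  by_cases h2 : k = 2
  · subst h2
    simp only [if_true, regF, true_and, Pi.sub_apply, Pi.smul_apply, zero_mem_box_iff hr,
      Rat.smul_def]
    split_ifs <;> simp
  · simp only [regF, h2, false_and, if_false, sub_zero, Pi.smul_apply]

theorem isPullback_apply_zero {A : Matrix (Fin 2) (Fin 2) Adele} {φ ψ : LCc}
    (h : IsPullback A φ ψ) : ψ 0 = φ 0 := by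
  rw [h, Matrix.zero_vecMul]

theorem isSLEquivariant_distE {k : ℕ} (hk : 1 ≤ k) : IsSLEquivariant k (distE hk) := by
  intro s φ ψ h
  have hv : vol ψ = vol φ := by
    rw [vol_isPullback (isUnit_det_of_eq_one (intMatrix_det s)) h (unitBox_isPullback_intMatrix s),
      vol_unitBox, one_mul]
  rw [distE_apply, distE_apply, hv, sub_eq_add_neg, SlashAction.add_slash, SlashAction.neg_slash,
    isSLEquivariant_eisFun k k s φ ψ h, sub_eq_add_neg]
  split_ifs with h2
  · subst h2
    rw [ModularForm.SL_smul_slash,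
      isSLEquivariant_eisFun 2 2 s unitBox unitBox (unitBox_isPullback_intMatrix s)]
  · rw [SlashAction.zero_slash]

theorem isSLEquivariant_distF {k : ℕ} (hk : 1 ≤ k) : IsSLEquivariant k (distF hk) := by
  intro s φ ψ h
  rw [distF_apply, distF_apply, isPullback_apply_zero h, sub_eq_add_neg, SlashAction.add_slash,
    SlashAction.neg_slash, isSLEquivariant_eisFun k 1 s φ ψ h, sub_eq_add_neg]
  split_ifs with h2
  · subst h2
    rw [ModularForm.SL_smul_slash,
      isSLEquivariant_eisFun 2 1 s unitBox unitBox (unitBox_isPullback_intMatrix s)]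
  · rw [SlashAction.zero_slash]

theorem exists_eq_intCast_add_iff (α : ℚ) (n : ℤ) :
    (∃ m : ℤ, α + n = m) ↔ ∃ m : ℤ, α = m :=
  ⟨fun ⟨m, hm⟩ => ⟨m - n, by push_cast; linarith⟩, fun ⟨m, hm⟩ => ⟨m + n, by push_cast; linarith⟩⟩

theorem regF_add_int {k : ℕ} (hk : 1 ≤ k) (α β : ℚ) (m n : ℤ) :
    regF k (α + n) (β + m) = regF k α β := by
  funext τ
  unfold regF
  rw [F_add_int hk]
  have hc := and_congr (Iff.refl (k = 2)) (and_congr (exists_eq_intCast_add_iff α n)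
    (exists_eq_intCast_add_iff β m))
  split_ifs <;> first | rfl | exact absurd ‹_› (by tauto)

theorem isGalEquivariant_distE {k : ℕ} (hk : 1 ≤ k) : IsGalEquivariant (distE hk) :=
  galRel_box (fun α β m n => regE_add_int hk α β m n)
    (fun _ _ _ hN hm hσ a b => galRel_regE hk hN hm hσ a b) (distE_box hk)

theorem isGalEquivariant_distF {k : ℕ} (hk : 1 ≤ k) : IsGalEquivariant (distF hk) :=
  galRel_box (fun α β m n => regF_add_int hk α β m n)
    (fun _ _ _ hN hm hσ a b => galRel_regF hk hN hm hσ a b) (distF_box hk)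

/-! ### Invariance under the finite adelic group -/

theorem ratStar_sub_smul (k : ℕ) (f f' : ℍ → ℂ) (c : ℝ) {g : GL (Fin 2) ℚ}
    (hg : 0 < (g : Matrix (Fin 2) (Fin 2) ℚ).det) :
    ratStar k (f - (c : ℂ) • f') g = ratStar k f g - (c : ℂ) • ratStar k f' g := by
  funext τ
  simp only [ratStar_apply k _ hg, Pi.sub_apply, Pi.smul_apply, smul_eq_mul]
  ring

theorem IsDecomp.isUnit_det {γ : Matrix (Fin 2) (Fin 2) Adele} {g : GL (Fin 2) ℚ}
    {δ : Matrix (Fin 2) (Fin 2) Adele} {d : Adele} (h : IsDecomp γ g δ d) :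
    IsUnit (δ * !![1, 0; 0, d]).det := by
  rw [Matrix.det_mul, h.det_eq_one, one_mul]
  exact isUnit_det_diag h.isUnit

theorem isUnit_det_ratMatrix (g : GL (Fin 2) ℚ) :
    IsUnit (((g : Matrix (Fin 2) (Fin 2) ℚ).map ratAdele).det) := by
  have h : ((g : Matrix (Fin 2) (Fin 2) ℚ).map ratAdele).det =
      ratAdele (g : Matrix (Fin 2) (Fin 2) ℚ).det := (RingHom.map_det ratAdele _).symm
  rw [h]
  exact ((Matrix.isUnit_iff_isUnit_det _).1 g.isUnit).map ratAdele

theorem InZhat.matrix_mul {A B : Matrix (Fin 2) (Fin 2) Adele} (hA : ∀ i j, InZhat (A i j))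
    (hB : ∀ i j, InZhat (B i j)) (i j : Fin 2) : InZhat ((A * B) i j) := by
  rw [Matrix.mul_apply]
  exact InZhat.sum fun l _ => (hA i l).mul (hB l j)

/-- If `γ = c u` with `c ∈ ℚ^*` and `u ∈ GL₂(Ẑ)`, the rational part `g` of `γ` transforms
the characteristic function of `Ẑ²` into that of `c⁻¹Ẑ²`. -/
theorem IsScalarMulGLZhat.exists_isPullback {γ : GL (Fin 2) Adele} (hγ : IsScalarMulGLZhat γ) :
    ∃ (c : ℚ) (hc : c ≠ 0), ∀ g δ d, IsDecomp (γ : Matrix (Fin 2) (Fin 2) Adele) g δ d →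
      IsPullback ((g : Matrix (Fin 2) (Fin 2) ℚ).map ratAdele) unitBox
        (boxIndicator 0 0 c⁻¹ (inv_ne_zero hc)) := by
  classical
  obtain ⟨c, u, hc, hu, hu', hγu⟩ := hγ
  refine ⟨c, hc, fun g δ d h => ?_⟩
  obtain ⟨d', hd', hdd⟩ := h.isUnit.exists_inv
  have hd2 : ∀ x : Adele, InZhat x → ∀ i j, InZhat ((!![1, 0; 0, x] : Matrix _ _ Adele) i j) := by
    intro x hx i j
    fin_cases i <;> fin_cases j
    exacts [inZhat_one, inZhat_zero, inZhat_zero, hx]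
  -- the integral factor `V = δ (1, 0; 0, d)` and its integral inverse `W`
  set V : Matrix (Fin 2) (Fin 2) Adele := δ * !![1, 0; 0, d] with hV
  set W : Matrix (Fin 2) (Fin 2) Adele := !![1, 0; 0, d'] * δ.adjugate with hW
  have hVW : V * W = 1 := by
    have h1 : (!![1, 0; 0, d] : Matrix (Fin 2) (Fin 2) Adele) * !![1, 0; 0, d'] = 1 := by
      rw [Matrix.mul_fin_two, Matrix.one_fin_two]
      simp [hdd]
    rw [hV, hW, ← mul_assoc, mul_assoc δ, h1, mul_one, Matrix.mul_adjugate, h.det_eq_one, one_smul]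
  have hWV : W * V = 1 := mul_eq_one_comm.1 hVW
  have hVI : ∀ i j, InZhat (V i j) := InZhat.matrix_mul h.integral (hd2 d h.isUnit.inZhat)
  have hWI : ∀ i j, InZhat (W i j) := by
    refine InZhat.matrix_mul (hd2 d' hd'.inZhat) fun i j => ?_
    rw [Matrix.adjugate_fin_two]
    fin_cases i <;> fin_cases j
    exacts [h.integral 1 1, (h.integral 0 1).neg, (h.integral 1 0).neg, h.integral 0 0]
  set U : Matrix (Fin 2) (Fin 2) Adele := (u : Matrix (Fin 2) (Fin 2) Adele)
  set U' : Matrix (Fin 2) (Fin 2) Adele := ((u⁻¹ : GL (Fin 2) Adele) : Matrix (Fin 2) (Fin 2) Adele)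
  have hUU : U * U' = 1 := by rw [← Units.val_mul, mul_inv_cancel, Units.val_one]
  have hbox := unitBox_isPullback (InZhat.matrix_mul hu hWI) (InZhat.matrix_mul hVI hu')
    (by rw [mul_assoc, ← mul_assoc W, hWV, one_mul, hUU])
  have hg : (g : Matrix (Fin 2) (Fin 2) ℚ).map ratAdele = ratAdele c • (U * W) := by
    have h1 := h.eq
    rw [hγu, mul_assoc, ← hV] at h1
    rw [← Matrix.smul_mul, h1, mul_assoc, hVW, mul_one]
  intro x
  rw [hg, Matrix.vecMul_smul, ← Matrix.smul_vecMul, ← hbox, unitBox, boxIndicator_apply,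
    boxIndicator_apply]
  simp only [map_zero, sub_zero, memMul_one_iff]
  refine if_congr ?_ rfl rfl
  unfold MemMul
  rw [inv_inv]
  rfl

/-- The invariance of the distribution attached to the series `E`. -/
theorem ratStar_distE {k : ℕ} (hk : 1 ≤ k) {γ : GL (Fin 2) Adele} {φ : LCc}
    (hγ : k ≠ 2 ∨ haarIntegral φ = 0 ∨ IsScalarMulGLZhat γ) {g : GL (Fin 2) ℚ}
    {δ : Matrix (Fin 2) (Fin 2) Adele} {d : Adele}
    (h : IsDecomp (γ : Matrix (Fin 2) (Fin 2) Adele) g δ d) {ψ ψ' : LCc}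
    (hψ : IsPullback (γ : Matrix (Fin 2) (Fin 2) Adele) φ ψ)
    (hψ' : IsPullback (δ * !![1, 0; 0, d]) φ ψ') :
    ratStar k (distE hk ψ) g = distE hk ψ' := by
  have hg : IsPullback ((g : Matrix (Fin 2) (Fin 2) ℚ).map ratAdele) ψ' ψ := by
    obtain ⟨χ, hχ⟩ := exists_isPullback (isUnit_det_ratMatrix g) ψ'
    have h1 := hψ'.comp hχ
    rw [← mul_assoc, ← h.eq] at h1
    rwa [hψ.unique h1]
  have heis := ratStar_eisFun k k h.det_pos hg
  rw [sub_self, zpow_zero, one_smul] at heis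
  by_cases hk2 : k = 2
  · subst hk2
    rw [distE_apply, distE_apply, if_pos rfl, if_pos rfl, ratStar_sub_smul _ _ _ _ h.det_pos, heis]
    congr 1
    rcases hγ with hγ | hγ | hγ
    · exact absurd rfl hγ
    · rw [vol_eq_zero_of_isPullback ((Matrix.isUnit_iff_isUnit_det _).1 γ.isUnit) hψ hγ,
        vol_eq_zero_of_isPullback h.isUnit_det hψ' hγ]
      simp
    · obtain ⟨c, hc, hbox⟩ := hγ.exists_isPullback
      have hb := hbox g δ d h
      have hE := ratStar_eisFun 2 2 h.det_pos hb
      rw [sub_self, zpow_zero, one_smul, eisFun_box_E one_le_two (inv_ne_zero hc), zero_div] at hE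
      rw [vol_isPullback (isUnit_det_ratMatrix g) hg hb, vol_box]
      rw [eisFun_unitBox_E] at hE ⊢
      funext τ
      have hEτ := congrFun hE τ
      simp only [ratStar_apply _ _ h.det_pos, Pi.smul_apply, Rat.smul_def, smul_eq_mul] at hEτ ⊢
      rw [← hEτ]
      push_cast
      rw [zpow_neg, zpow_ofNat]
      ring
  · rw [distE_apply, distE_apply, if_neg hk2, if_neg hk2, sub_zero, sub_zero, heis]

/-- The transformation of the distribution attached to the series `F`. -/
theorem ratStar_distF {k : ℕ} (hk : 1 ≤ k) {γ : GL (Fin 2) Adele} {φ : LCc}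
    (hγ : k ≠ 2 ∨ φ 0 = 0 ∨ IsScalarMulGLZhat γ) {g : GL (Fin 2) ℚ}
    {δ : Matrix (Fin 2) (Fin 2) Adele} {d : Adele}
    (h : IsDecomp (γ : Matrix (Fin 2) (Fin 2) Adele) g δ d) {ψ ψ' : LCc}
    (hψ : IsPullback (γ : Matrix (Fin 2) (Fin 2) Adele) φ ψ)
    (hψ' : IsPullback (δ * !![1, 0; 0, d]) φ ψ') :
    ratStar k (distF hk ψ) g =
      absAdele (γ : Matrix (Fin 2) (Fin 2) Adele).det ^ (1 - (k : ℤ)) • distF hk ψ' := by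
  have hg : IsPullback ((g : Matrix (Fin 2) (Fin 2) ℚ).map ratAdele) ψ' ψ := by
    obtain ⟨χ, hχ⟩ := exists_isPullback (isUnit_det_ratMatrix g) ψ'
    have h1 := hψ'.comp hχ
    rw [← mul_assoc, ← h.eq] at h1
    rwa [hψ.unique h1]
  have heis := ratStar_eisFun k 1 h.det_pos hg
  rw [Nat.cast_one] at heis
  rw [h.absAdele_det]
  by_cases hk2 : k = 2
  · subst hk2
    have e : (ψ 0 • eisFun 2 1 unitBox : ℍ → ℂ) = (((ψ 0 : ℤ) : ℝ) : ℂ) • eisFun 2 1 unitBox := by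
      rw [Complex.ofReal_intCast, Int.cast_smul_eq_zsmul]
    rw [distF_apply, distF_apply, if_pos rfl, if_pos rfl, e, ratStar_sub_smul _ _ _ _ h.det_pos,
      heis, smul_sub, isPullback_apply_zero hψ, isPullback_apply_zero hψ']
    congr 1
    rcases hγ with hγ | hγ | hγ
    · exact absurd rfl hγ
    · rw [hγ]
      simp
    · obtain ⟨c, hc, hbox⟩ := hγ.exists_isPullback
      have hF := ratStar_eisFun 2 1 h.det_pos (hbox g δ d h)
      rw [eisFun_box_F one_le_two (inv_ne_zero hc), zero_div, Nat.cast_two, sub_self, zpow_zero,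
        one_smul, ← eisFun_unitBox_F, Nat.cast_one] at hF
      rw [hF, smul_comm, Complex.ofReal_intCast, Int.cast_smul_eq_zsmul, Nat.cast_two]
  · rw [distF_apply, distF_apply, if_neg hk2, if_neg hk2, sub_zero, sub_zero, heis]

end EisDist

end

theorem mainTheorem9 (k : ℕ) (hk : 1 ≤ k) :
    ∃ z z' : EisDist.Dist k,
      (∀ (r : ℚ) (hr : r ≠ 0) (a b : ℚ),
        (k ≠ 2 → (z (EisDist.boxIndicator a b r hr) : UpperHalfPlane → ℂ) =
          r ^ (-(k : ℤ)) • EisDist.E k (a / r) (b / r)) ∧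
        (k = 2 → (z (EisDist.boxIndicator a b r hr) : UpperHalfPlane → ℂ) =
          r ^ (-(k : ℤ)) • (EisDist.E k (a / r) (b / r) - EisDist.E k 0 0)) ∧
        ((k ≠ 2 ∨ ¬ ((∃ m : ℤ, a / r = m) ∧ (∃ n : ℤ, b / r = n))) →
          (z' (EisDist.boxIndicator a b r hr) : UpperHalfPlane → ℂ) =
            r ^ ((k : ℤ) - 2) • EisDist.F k (a / r) (b / r))) ∧
      (∀ (γ : GL (Fin 2) EisDist.Adele) (φ : EisDist.LCc),
        ((k ≠ 2 ∨ EisDist.haarIntegral φ = 0 ∨ EisDist.IsScalarMulGLZhat γ) →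
          z.act γ φ = z φ) ∧
        ((k ≠ 2 ∨ φ 0 = 0 ∨ EisDist.IsScalarMulGLZhat γ) →
          z'.act γ φ =
            EisDist.absAdele (γ : Matrix (Fin 2) (Fin 2) EisDist.Adele).det ^ (1 - (k : ℤ)) •
              z' φ)) := by
  obtain ⟨z, hz⟩ := EisDist.exists_dist (EisDist.distE hk) (EisDist.isSLEquivariant_distE hk)
    (EisDist.isGalEquivariant_distE hk)
  obtain ⟨z', hz'⟩ := EisDist.exists_dist (EisDist.distF hk) (EisDist.isSLEquivariant_distF hk)
    (EisDist.isGalEquivariant_distF hk)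
  refine ⟨z, z', fun r hr a b => ⟨fun h => ?_, fun h => ?_, fun h => ?_⟩,
    fun γ φ => ⟨fun h => ?_, fun h => ?_⟩⟩
  · rw [hz, EisDist.distE_box]
    congr 1
    funext τ
    rw [EisDist.regE, if_neg h, sub_zero]
  · subst h
    exact (hz _).trans (EisDist.distE_box hk a b r hr)
  · rw [hz', EisDist.distF_box]
    congr 1
    funext τ
    rw [EisDist.regF, if_neg, sub_zero]
    tauto
  · have key := EisDist.act_eq_smul (μ := z) (by simp only [hz]; exact EisDist.isSLEquivariant_distE hk)
      (by simp only [hz]; exact EisDist.isGalEquivariant_distE hk) γ φ 1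
      fun g δ d hd ψ ψ' hψ hψ' => by
        rw [hz, hz, one_smul]
        exact EisDist.ratStar_distE hk h hd hψ hψ'
    rwa [one_smul] at key
  · exact EisDist.act_eq_smul (μ := z') (by simp only [hz']; exact EisDist.isSLEquivariant_distF hk)
      (by simp only [hz']; exact EisDist.isGalEquivariant_distF hk) γ φ _
      fun g δ d hd ψ ψ' hψ hψ' => by
        rw [hz', hz']
        exact EisDist.ratStar_distF hk h hd hψ hψ'
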